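/- **Setting.** Let $\Delta$ be the unit disc, $b\Delta$ its boundary, $k\ge 1$ an integer, $0<\alpha<1$. Let $\mathcal C^{k,\alpha}$ be the space of real functions of class $C^{k,\alpha}$ on $b\Delta$ with its usual norm, and $\mathcal A^{k,\alpha}$ the space of continuous functions on $\overline\Delta$, holomorphic in $\Delta$, with boundary values in $\mathcal C^{k,\alpha}+i\,\mathcal C^{k,\alpha}$, with norm $\|\mathrm{Re}\,f\|+\|\mathrm{Im}\,f\|$. The space $(1-\zeta)\mathcal A^{k,\alpha}$ has the norm $\|(1-\zeta)u\|=\|u\|_{\mathcal A^{k,\alpha}}$, and $Y=\mathcal C^{k,\alpha}\times(1-\zeta)\mathcal A^{k,\alpha}\times(1-\zeta)\mathcal A^{k,\alpha}$ has the sum of the three norms; $\pi':Y\to(1-\zeta)\mathcal A^{k,\alpha}$, $(c,h,g)\mapsto h$. Let $d/2\le k_0\le d-1$ and let $P(z,\bar z)=\sum_{j=d-k_0}^{k_0}\alpha_jz^j\bar z^{d-j}$, $\alpha_j=\overline{\alpha_{d-j}}$, $\alpha_{k_0}\ne0$, be subharmonic with $P_{z\bar z}(z)\neq0$ for $z\ne0$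 (then $d$ is even). Put $\rho(z,w)=-\mathrm{Re}\,w+P(z,\bar z)$, $S=\{\rho=0\}$ and $\ell_0=k_0-d/2$. For a defining function $r$ on the bidisc $(\delta\Delta)^2$, let $\mathcal S^r_0$ be the set of $(c,h,g)\in Y$ such that $c$ has no zero on $b\Delta$, $(h,g)(b\Delta)\subset\{r=0\}\cap(\delta\Delta)^2$, and $\zeta^{k_0}c\,\frac{\partial r}{\partial z}(h,g)$ and $\zeta^{k_0}c\,\frac{\partial r}{\partial w}(h,g)$ extend to elements of $\mathcal A^{k,\alpha}$ (lifts of $k_0$-stationary discs attached to $\{r=0\}$ and tied to the origin). Fix $g_0\in(1-\zeta)\mathcal A^{k,\alpha}$ and $\delta>0$ such that $(1,f_0)=(1,1-\zeta,g_0)\in\mathcal S^\rho_0$ (in particular $f_0(b\Delta)\subset(\delta\Delta)^2$). Let $\Gamma\subset\mathbb R\times\mathbb C^{k_0}$ be the set of the vectors of Fourier coefficients of orders $0,\dots,k_0$ of the functions $(\bar b\bar\zeta+1+b\zeta)^{k_0}$, $b\in\mathbb C$, $|b|<1/2$. For $\eta>0$ let $\mathcal M^r_\eta$ be the set of $(c,h,g)\in\mathcal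 S^r_0$ with $\|(c,h,g)-(1,f_0)\|_Y<\eta$ whose $c$ has its Fourier coefficients of orders $0,\dots,k_0$ in $\Gamma$. Let $X$ be the set of real functions on $(\overline{\delta\Delta})^2$ of the form $$r=\rho+\sum_{i+j=d+1}z^i\bar z^jr_{ij0}(z)+\sum_{l=1}^{d-1}\sum_{i+j=d-l}z^i\bar z^j(\mathrm{Im}\,w)^lr_{ijl}(z,\mathrm{Im}\,w)+\theta_1(\mathrm{Im}\,w),$$ where $r_{ij0}$, $r_{ijl}$ are complex functions of class $C^{k+3}$ on $\overline{\delta\Delta}$, $\overline{\delta\Delta}\times[-\delta,\delta]$, and $\theta_1$ is real of class $C^{k+3}$ on $[-\delta,\delta]$ with $\theta_1(y)=O(y^2)$; the size of such a deformation, written $\|r-\rho\|_X$, is $\sup\|r_{ijl}\|_{C^{k+3}}+\|\theta_1\|_{C^{k+3}}$. **Proposition 4.4.** There is $\eta_0>0$ such that the following holds. (i) For every $0<\eta\le\eta_0$, $\pi'(\mathcal M^\rho_\eta)$ is a real $C^1$ submanifold of dimension $2\ell_0+4$ of $(1-\zeta)\mathcal A^{k,\alpha}$; the evaluation map $\varphi:\pi'(\mathcal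 M^\rho_\eta)\to\mathbb C^2$, $\varphi(h)=(h(0),g(0))$ for $(c,h,g)\in\mathcal M^\rho_\eta$, is well defined; and for every $\varepsilon>0$ there is $\theta\in\mathbb R$, $|\theta|<\varepsilon$, such that $h_\theta=(1-\zeta)e^{i\theta}$ belongs to $\pi'(\mathcal M^\rho_\eta)$, $\varphi$ is of class $C^1$ near $h_\theta$, and the (real) derivative of $\varphi$ at $h_\theta$, from the tangent space of $\pi'(\mathcal M^\rho_\eta)$ to $\mathbb C^2$, is surjective. In particular $\{(h(0),g(0)) : (c,h,g)\in\mathcal M^\rho_\eta\}$ contains a nonempty open subset of $\mathbb C^2$. (ii) If $k\ge\ell_0+2$, there is $\varepsilon>0$ such that, for all $r\in X$ with $\|r-\rho\|_X<\varepsilon$ and all $0<\eta\le\eta_0$, the restriction to $\pi'(\mathcal M^r_\eta)$ of the jet map $\mathfrak j_{\ell_0+2}(h)=(h'(1),h''(1),\dots,h^{(\ell_0+2)}(1))\in\mathbb C^{\ell_0+2}$ is a $C^1$ diffeomorphism of a $(2\ell_0+4)$-dimensional $C^1$ submanifold onto its image, which is a $C^1$ submanifold of $\mathbb C^{\ell_0+2}$.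 -/

import Mathlib

open Metric Complex

noncomputable section

namespace KStat

/-! ## Hölder spaces on the unit circle -/

/-- A function on the unit circle, read in the angular variable `t ↦ u (e^{it})`. -/
def angular {F : Type*} (u : Circle → F) (t : ℝ) : F := u (Circle.exp t)

/-- Real functions of class `C^{k,α}` on the unit circle: `k` times continuously differentiable
(with respect to the angle), the `k`-th derivative being Hölder continuous of exponent `α`. -/
def holderSubmodule (k : ℕ) (α : ℝ) : Submodule ℝ (Circle → ℝ) where
  carrier := {u | ContDiff ℝ k (angular u) ∧ ∃ C : ℝ, ∀ s t : ℝ,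
    |iteratedDeriv k (angular u) s - iteratedDeriv k (angular u) t|
      ≤ C * ‖(Circle.exp s : ℂ) - (Circle.exp t : ℂ)‖ ^ α}
  zero_mem' := by
    have h0 : angular (0 : Circle → ℝ) = fun _ => 0 := rfl
    refine ⟨by rw [h0]; exact contDiff_const, 0, fun s t => ?_⟩
    rw [h0]; simp
  add_mem' := by
    rintro u v ⟨hu, C, hC⟩ ⟨hv, D, hD⟩
    have hadd : angular (u + v) = angular u + angular v := rfl
    refine ⟨by rw [hadd]; exact hu.add hv, C + D, fun s t => ?_⟩
    rw [hadd, iteratedDeriv_add hu.contDiffAt hv.contDiffAt,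
      iteratedDeriv_add hu.contDiffAt hv.contDiffAt, add_mul]
    refine le_trans ?_ (add_le_add (hC s t) (hD s t))
    rw [add_sub_add_comm]
    exact abs_add_le _ _
  smul_mem' := by
    rintro a u ⟨hu, C, hC⟩
    have hsm : angular (a • u) = a • angular u := rfl
    refine ⟨by rw [hsm]; exact contDiff_const.smul hu, |a| * C, fun s t => ?_⟩
    rw [hsm, iteratedDeriv_const_smul_field, iteratedDeriv_const_smul_field, ← smul_sub,
      smul_eq_mul, abs_mul, mul_assoc]
    exact mul_le_mul_of_nonneg_left (hC s t) (abs_nonneg a)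

/-- The space `C^{k,α}(bΔ, ℝ)`. -/
def Hol (k : ℕ) (α : ℝ) : Type := holderSubmodule k α

variable {k : ℕ} {α : ℝ}

instance : AddCommGroup (Hol k α) := inferInstanceAs (AddCommGroup (holderSubmodule k α))

instance : Module ℝ (Hol k α) := inferInstanceAs (Module ℝ (holderSubmodule k α))

instance : CoeFun (Hol k α) (fun _ => Circle → ℝ) := ⟨fun u => u.1⟩

/-- The supremum over the circle of the absolute value of the `j`-th derivative. -/
def supDeriv (j : ℕ) (u : Circle → ℝ) : ℝ := ⨆ t : ℝ, |iteratedDeriv j (angular u) t|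

/-- The Hölder quotient of the `k`-th derivative between two points of the circle
(equal to `0` if the two points coincide). -/
def holderQuot (k : ℕ) (α : ℝ) (u : Circle → ℝ) (p : ℝ × ℝ) : ℝ :=
  |iteratedDeriv k (angular u) p.1 - iteratedDeriv k (angular u) p.2|
    / ‖(Circle.exp p.1 : ℂ) - (Circle.exp p.2 : ℂ)‖ ^ α

/-- The usual norm of `C^{k,α}`: the sum of the sup norms of the derivatives up to order `k` and of
the Hölder seminorm of the `k`-th derivative. -/
instance : Norm (Hol k α) :=
  ⟨fun u => ∑ j ∈ Finset.range (k + 1), supDeriv j u.1 + ⨆ p : ℝ × ℝ, holderQuot k α u.1 p⟩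

theorem norm_def (u : Hol k α) :
    ‖u‖ = ∑ j ∈ Finset.range (k + 1), supDeriv j u.1 + ⨆ p : ℝ × ℝ, holderQuot k α u.1 p := rfl

theorem angular_add (u v : Hol k α) : angular (u + v : Hol k α).1 = angular u.1 + angular v.1 := rfl

theorem angular_smul (a : ℝ) (u : Hol k α) : angular (a • u : Hol k α).1 = a • angular u.1 := rfl

theorem contDiffAt_angular (u : Hol k α) {j : ℕ} (hj : j ≤ k) (t : ℝ) :
    ContDiffAt ℝ j (angular u.1) t :=
  (u.2.1.of_le (by exact_mod_cast hj)).contDiffAt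

theorem bddAbove_deriv (u : Hol k α) {j : ℕ} (hj : j ≤ k) :
    BddAbove (Set.range fun t : ℝ => |iteratedDeriv j (angular u.1) t|) := by
  have hcont : Continuous (iteratedDeriv j (angular u.1)) :=
    u.2.1.continuous_iteratedDeriv j (by exact_mod_cast hj)
  have hper : Function.Periodic (iteratedDeriv j (angular u.1)) (2 * Real.pi) := by
    intro t
    have h1 : (fun z => angular u.1 (z + 2 * Real.pi)) = angular u.1 := by
      funext z; simp [angular]
    have h2 := congrFun (iteratedDeriv_comp_add_const j (angular u.1) (2 * Real.pi)) t
    rw [h1] at h2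
    exact h2.symm
  have hper' : Function.Periodic (fun t => |iteratedDeriv j (angular u.1) t|) (2 * Real.pi) :=
    fun t => by simp only [hper t]
  exact (hper'.compact_of_continuous (by positivity) hcont.abs).bddAbove

theorem bddAbove_holderQuot (u : Hol k α) : BddAbove (Set.range (holderQuot k α u.1)) := by
  obtain ⟨C, hC⟩ := u.2.2
  refine ⟨max C 0, ?_⟩
  rintro _ ⟨p, rfl⟩
  refine div_le_of_le_mul₀ (by positivity) (le_max_right _ _) ((hC p.1 p.2).trans ?_)
  exact mul_le_mul_of_nonneg_right (le_max_left _ _) (by positivity)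

theorem supDeriv_nonneg (j : ℕ) (u : Circle → ℝ) : 0 ≤ supDeriv j u :=
  Real.iSup_nonneg fun _ => abs_nonneg _

theorem holderQuot_nonneg (u : Circle → ℝ) (p : ℝ × ℝ) : 0 ≤ holderQuot k α u p := by
  unfold holderQuot; positivity

theorem normCore : NormedSpace.Core ℝ (Hol k α) where
  norm_nonneg u := by
    rw [norm_def]
    exact add_nonneg (Finset.sum_nonneg fun j _ => supDeriv_nonneg j _)
      (Real.iSup_nonneg fun p => holderQuot_nonneg _ p)
  norm_smul a u := by
    rw [norm_def, norm_def, mul_add, Finset.mul_sum, Real.mul_iSup_of_nonneg (norm_nonneg a)]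
    congr 1
    · refine Finset.sum_congr rfl fun j _ => ?_
      simp only [supDeriv, angular_smul, iteratedDeriv_const_smul_field, smul_eq_mul,
        abs_mul, Real.norm_eq_abs]
      rw [Real.mul_iSup_of_nonneg (abs_nonneg a)]
    · congr 1
      funext p
      simp only [holderQuot, angular_smul, iteratedDeriv_const_smul_field,
        smul_eq_mul, ← mul_sub, abs_mul, Real.norm_eq_abs, mul_div_assoc]
  norm_triangle u v := by
    rw [norm_def, norm_def, norm_def, add_add_add_comm, ← Finset.sum_add_distrib]
    refine add_le_add (Finset.sum_le_sum fun j hj => ?_) ?_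
    · have hj' : j ≤ k := by simpa [Nat.lt_succ_iff] using hj
      refine ciSup_le fun t => ?_
      rw [angular_add, iteratedDeriv_add (contDiffAt_angular u hj' t) (contDiffAt_angular v hj' t)]
      exact (abs_add_le _ _).trans (add_le_add (le_ciSup (bddAbove_deriv u hj') t)
        (le_ciSup (bddAbove_deriv v hj') t))
    · refine ciSup_le fun p => ?_
      refine le_trans ?_ (add_le_add (le_ciSup (bddAbove_holderQuot u) p)
        (le_ciSup (bddAbove_holderQuot v) p))
      unfold holderQuot
      rw [← add_div, angular_add]
      refine div_le_div_of_nonneg_right ?_ (by positivity)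
      rw [iteratedDeriv_add (contDiffAt_angular u le_rfl _) (contDiffAt_angular v le_rfl _),
        iteratedDeriv_add (contDiffAt_angular u le_rfl _) (contDiffAt_angular v le_rfl _),
        add_sub_add_comm]
      exact abs_add_le _ _
  norm_eq_zero_iff u := by
    constructor
    · intro h
      rw [norm_def] at h
      have h1 : ∑ j ∈ Finset.range (k + 1), supDeriv j u.1 = 0 := by
        have a1 := Finset.sum_nonneg (s := Finset.range (k + 1))
          fun j _ => supDeriv_nonneg j u.1
        have a2 : 0 ≤ ⨆ p : ℝ × ℝ, holderQuot k α u.1 p :=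
          Real.iSup_nonneg fun p => holderQuot_nonneg _ p
        linarith
      have h2 : supDeriv 0 u.1 = 0 :=
        (Finset.sum_eq_zero_iff_of_nonneg fun j _ => supDeriv_nonneg j u.1).1 h1 0 (by simp)
      apply Subtype.ext
      funext ζ
      obtain ⟨t, rfl⟩ : ∃ t : ℝ, Circle.exp t = ζ := ⟨_, Circle.exp_arg ζ⟩
      have h3 := le_ciSup (bddAbove_deriv u (Nat.zero_le k)) t
      have h4 : |u.1 (Circle.exp t)| ≤ 0 := by
        simpa [supDeriv, iteratedDeriv_zero, angular] using h3.trans h2.le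
      exact abs_nonpos_iff.1 h4
    · rintro rfl
      have := angular_smul (k := k) (α := α) 0 0
      rw [norm_def]
      have hz : angular (0 : Hol k α).1 = fun _ => (0 : ℝ) := rfl
      simp [supDeriv, holderQuot, hz]

instance : NormedAddCommGroup (Hol k α) := NormedAddCommGroup.ofCore normCore

instance : NormedSpace ℝ (Hol k α) := NormedSpace.ofCore normCore

/-- The constant function, as an element of `C^{k,α}`. -/
def Hol.const (x : ℝ) : Hol k α :=
  ⟨fun _ => x, by
    have h0 : angular (fun _ : Circle => x) = fun _ => x := rfl
    refine ⟨by rw [h0]; exact contDiff_const, 0, fun s t => ?_⟩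
    rw [h0]; simp [iteratedDeriv_const]⟩

/-- The complex function `u = a + i b` on the circle given by its real and imaginary parts. -/
def toComplex (u : Hol k α × Hol k α) (ζ : Circle) : ℂ := (u.1 ζ : ℂ) + (u.2 ζ : ℂ) * I

/-- `A^{k,α}`: the elements of `C^{k,α} + i C^{k,α}` which extend to the closed unit disc as
continuous functions, holomorphic in the open disc. It is normed as a subspace of
`C^{k,α} × C^{k,α}`. -/
def A (k : ℕ) (α : ℝ) : Submodule ℝ (Hol k α × Hol k α) where
  carrier := {u | ∃ F : ℂ → ℂ, DiffContOnCl ℂ F (ball 0 1) ∧ ∀ ζ : Circle, F ζ = toComplex u ζ}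
  zero_mem' := ⟨fun _ => 0, diffContOnCl_const, fun ζ => by
    have : (0 : Hol k α) ζ = 0 := rfl
    simp [toComplex, this]⟩
  add_mem' := by
    rintro u v ⟨F, hF, hu⟩ ⟨G, hG, hv⟩
    refine ⟨F + G, hF.add hG, fun ζ => ?_⟩
    have h1 : (u + v).1 ζ = u.1 ζ + v.1 ζ := rfl
    have h2 : (u + v).2 ζ = u.2 ζ + v.2 ζ := rfl
    rw [Pi.add_apply, hu, hv]
    simp only [toComplex, h1, h2]
    push_cast
    ring
  smul_mem' := by
    rintro a u ⟨F, hF, hu⟩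
    refine ⟨(a : ℂ) • F, hF.const_smul _, fun ζ => ?_⟩
    have h1 : (a • u).1 ζ = a * u.1 ζ := rfl
    have h2 : (a • u).2 ζ = a * u.2 ζ := rfl
    rw [Pi.smul_apply, hu]
    simp only [toComplex, h1, h2, smul_eq_mul]
    push_cast
    ring

/-- The boundary value of `u ∈ A^{k,α}`. -/
def bdVal (u : A k α) (ζ : Circle) : ℂ := toComplex u.1 ζ

/-- The extension of `u ∈ A^{k,α}` to the closed unit disc, continuous there and holomorphic
inside. Its values on the closed disc are determined by `u`. -/
def ext (u : A k α) : ℂ → ℂ := Classical.choose u.2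

theorem ext_spec (u : A k α) :
    DiffContOnCl ℂ (ext u) (ball 0 1) ∧ ∀ ζ : Circle, ext u ζ = bdVal u ζ :=
  Classical.choose_spec u.2

/-- The norm `‖Re u‖ + ‖Im u‖` of `C^{k,α} + i C^{k,α}` (equivalent to the one that `A k α` carries
as a subspace of a product). -/
def cnorm (u : A k α) : ℝ := ‖u.1.1‖ + ‖u.1.2‖

/-- The constant function, as an element of `A^{k,α}`. -/
def A.const (v : ℂ) : A k α :=
  ⟨(Hol.const v.re, Hol.const v.im), fun _ => v, diffContOnCl_const, fun _ => (re_add_im v).symm⟩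

/-! The space `(1-ζ) A^{k,α}` with the norm `‖(1-ζ) u‖ = ‖u‖` is isometric to `A^{k,α}` under
`u ↦ (1-ζ) u`. Its elements are represented by `u`. -/

/-- The boundary value of `(1-ζ) u`. -/
def discBd (u : A k α) (ζ : Circle) : ℂ := (1 - (ζ : ℂ)) * bdVal u ζ

/-- The values of `(1-ζ) u` on the closed unit disc. -/
def disc (u : A k α) (z : ℂ) : ℂ := (1 - z) * ext u z

/-- The space `Y = C^{k,α} × (1-ζ) A^{k,α} × (1-ζ) A^{k,α}`; the point `(c, u, v)` stands for
`(c, h, g) = (c, (1-ζ) u, (1-ζ) v)`. -/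
abbrev Y (k : ℕ) (α : ℝ) : Type := Hol k α × A k α × A k α

/-- The norm `‖c‖ + ‖h‖ + ‖g‖` on `Y`. -/
def normY (p : Y k α) : ℝ := ‖p.1‖ + cnorm p.2.1 + cnorm p.2.2

/-- The lift `(1, f₀)`, `f₀ = (1-ζ, (1-ζ) v)`. -/
def baseLift (v : A k α) : Y k α := (Hol.const 1, A.const 1, v)

/-- The pair `(h(0), g(0))` of the centres of `h` and `g`. -/
def centre (p : Y k α) : ℂ × ℂ := (disc p.2.1 0, disc p.2.2 0)

/-- The projection of `Y` to the factor `h`. -/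
def projH (p : Y k α) : A k α := p.2.1

/-- The `n`-jet map at `1`, `h ↦ (h'(1), …, h^{(n)}(1))` for `h = (1-ζ) u`; the derivatives are
complex derivatives in the closed disc. -/
def jetAtOne (n : ℕ) (u : A k α) : Fin n → ℂ :=
  fun i => iteratedDerivWithin (i + 1) (disc u) (closedBall 0 1) 1

/-! ## Model hypersurfaces and their deformations -/

/-- `∂f/∂z = (∂f/∂x - i ∂f/∂y) / 2`. -/
def dz (f : ℂ → ℂ) (z : ℂ) : ℂ := (fderiv ℝ f z 1 - I * fderiv ℝ f z I) / 2

/-- `∂f/∂z̄ = (∂f/∂x + i ∂f/∂y) / 2`. -/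
def dzbar (f : ℂ → ℂ) (z : ℂ) : ℂ := (fderiv ℝ f z 1 + I * fderiv ℝ f z I) / 2

/-- `P(z, z̄) = ∑_{j = d - k₀}^{k₀} a_j z^j z̄^{d-j}`. -/
def modelPoly (d k₀ : ℕ) (a : ℕ → ℂ) (z : ℂ) : ℂ :=
  ∑ j ∈ Finset.Icc (d - k₀) k₀, a j * z ^ j * (starRingEnd ℂ z) ^ (d - j)

/-- The conditions on the polynomial of a model hypersurface. -/
structure IsModel (d k₀ : ℕ) (a : ℕ → ℂ) : Prop where
  half_le : d ≤ 2 * k₀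
  lt : k₀ < d
  symm : ∀ j ∈ Finset.Icc (d - k₀) k₀, a j = starRingEnd ℂ (a (d - j))
  lead : a k₀ ≠ 0
  /-- `P` is subharmonic: its Laplacian `4 P_{z z̄}` is nonnegative. -/
  subharmonic : ∀ z : ℂ, 0 ≤ (dz (dzbar (modelPoly d k₀ a)) z).re
  /-- `P_{z z̄}` vanishes at most at the origin. -/
  nondegenerate : ∀ z : ℂ, z ≠ 0 → dz (dzbar (modelPoly d k₀ a)) z ≠ 0

/-- The defining function `ρ(z, w) = - Re w + P(z, z̄)` (`P` is real valued). -/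
def rho (d k₀ : ℕ) (a : ℕ → ℂ) (p : ℂ × ℂ) : ℝ := -p.2.re + (modelPoly d k₀ a p.1).re

/-- The function
`θ(z, y) = ∑_{i+j=d+1} z^i z̄^j r_{ij0}(z) + ∑_{l=1}^{d-1} ∑_{i+j=d-l} z^i z̄^j y^l r_{ijl}(z, y) + θ₁(y)`. -/
def thetaFun (d : ℕ) (r₀ : ℕ → ℕ → ℂ → ℂ) (r : ℕ → ℕ → ℕ → ℂ × ℝ → ℂ) (θ₁ : ℝ → ℝ)
    (z : ℂ) (y : ℝ) : ℂ :=
  ∑ p ∈ Finset.HasAntidiagonal.antidiagonal (d + 1), z ^ p.1 * (starRingEnd ℂ z) ^ p.2 * r₀ p.1 p.2 z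
    + ∑ l ∈ Finset.Icc 1 (d - 1), ∑ p ∈ Finset.HasAntidiagonal.antidiagonal (d - l),
        z ^ p.1 * (starRingEnd ℂ z) ^ p.2 * (y : ℂ) ^ l * r p.1 p.2 l (z, y)
    + (θ₁ y : ℂ)

/-- The `C^m` norm of a function on a compact set `K` with dense interior. -/
def cmNorm {E F : Type*} [NormedAddCommGroup E] [NormedSpace ℝ E] [NormedAddCommGroup F]
    [NormedSpace ℝ F] (m : ℕ) (K : Set E) (f : E → F) : ℝ :=
  ∑ j ∈ Finset.range (m + 1), ⨆ x : K, ‖iteratedFDerivWithin ℝ j f K x‖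

/-- The data of an element `r = ρ + θ(z, Im w)` of the space `X` of deformations of `ρ`. -/
structure Deformation (d k : ℕ) (δ : ℝ) where
  /-- the coefficients `r_{ij0}` -/
  r₀ : ℕ → ℕ → ℂ → ℂ
  /-- the coefficients `r_{ijl}`, `1 ≤ l ≤ d - 1` -/
  r : ℕ → ℕ → ℕ → ℂ × ℝ → ℂ
  /-- the function `θ₁` -/
  θ₁ : ℝ → ℝ
  contDiffOn_r₀ : ∀ i j, i + j = d + 1 → ContDiffOn ℝ (k + 3 : ℕ) (r₀ i j) (closedBall 0 δ)
  contDiffOn_r : ∀ i j l, 1 ≤ l → l ≤ d - 1 → i + j = d - l →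
    ContDiffOn ℝ (k + 3 : ℕ) (r i j l) (closedBall 0 δ ×ˢ Set.Icc (-δ) δ)
  contDiffOn_θ₁ : ContDiffOn ℝ (k + 3 : ℕ) θ₁ (Set.Icc (-δ) δ)
  θ₁_isBigO : ∃ C : ℝ, ∀ y ∈ Set.Icc (-δ) δ, |θ₁ y| ≤ C * y ^ 2
  real : ∀ z ∈ closedBall (0 : ℂ) δ, ∀ y ∈ Set.Icc (-δ) δ, (thetaFun d r₀ r θ₁ z y).im = 0

/-- The norm `sup ‖r_{ijl}‖ + ‖θ₁‖` of `r - ρ` in `X`. -/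
def Deformation.norm {d k : ℕ} {δ : ℝ} (D : Deformation d k δ) : ℝ :=
  max (⨆ p : Finset.HasAntidiagonal.antidiagonal (d + 1),
        cmNorm (k + 3) (closedBall 0 δ) (D.r₀ p.1.1 p.1.2))
      (⨆ l : Finset.Icc 1 (d - 1), ⨆ p : Finset.HasAntidiagonal.antidiagonal (d - l.1),
        cmNorm (k + 3) (closedBall 0 δ ×ˢ Set.Icc (-δ) δ) (D.r p.1.1 p.1.2 l.1))
    + cmNorm (k + 3) (Set.Icc (-δ) δ) D.θ₁

/-- The deformed defining function `r(z, w) = ρ(z, w) + θ(z, Im w)` (`θ` is real valued on the closed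
bidisc of radius `δ`). -/
def Deformation.fn {d k : ℕ} {δ : ℝ} (D : Deformation d k δ) (k₀ : ℕ) (a : ℕ → ℂ) (p : ℂ × ℂ) : ℝ :=
  rho d k₀ a p + (thetaFun d D.r₀ D.r D.θ₁ p.1 p.2.im).re

/-! ## `k₀`-stationary discs -/

/-- The lifts `(c, h, g) ∈ Y` of `k₀`-stationary discs tied to the origin and attached to the
hypersurface `{r = 0}` in the bidisc of radius `δ`: the function `c` has no zero, `(h, g)` maps the
unit circle to `{r = 0}`, and `ζ^{k₀} c ∂r(h, g)` extends as a map in `(A^{k,α})²`. -/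
def stationaryLifts (k : ℕ) (α : ℝ) (k₀ : ℕ) (δ : ℝ) (r : ℂ × ℂ → ℝ) : Set (Y k α) :=
  {p | (∀ ζ : Circle, p.1 ζ ≠ 0) ∧
    (∀ ζ : Circle, ‖discBd p.2.1 ζ‖ < δ ∧ ‖discBd p.2.2 ζ‖ < δ ∧
      r (discBd p.2.1 ζ, discBd p.2.2 ζ) = 0) ∧
    (∃ u : A k α, ∀ ζ : Circle, bdVal u ζ =
      (ζ : ℂ) ^ k₀ * (p.1 ζ : ℂ) * dz (fun z => (r (z, discBd p.2.2 ζ) : ℂ)) (discBd p.2.1 ζ)) ∧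
    (∃ u : A k α, ∀ ζ : Circle, bdVal u ζ =
      (ζ : ℂ) ^ k₀ * (p.1 ζ : ℂ) * dz (fun w => (r (discBd p.2.1 ζ, w) : ℂ)) (discBd p.2.2 ζ))}

/-- The `n`-th Fourier coefficient of a function on the circle. -/
def circleCoeff (u : Circle → ℂ) (n : ℕ) : ℂ :=
  (1 / (2 * Real.pi : ℝ) : ℂ) *
    ∫ t in (0 : ℝ)..(2 * Real.pi), u (Circle.exp t) * exp (-(n : ℂ) * t * I)

/-- The Fourier coefficients `(c_0, …, c_{k₀})` of `u`. -/
def coeffVec (k₀ : ℕ) (u : Circle → ℂ) : Fin (k₀ + 1) → ℂ := fun n => circleCoeff u n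

/-- The set `Γ` of the coefficient vectors of `(b̄ ζ̄ + 1 + b ζ)^{k₀}`, `|b| < 1/2`. -/
def Gam (k₀ : ℕ) : Set (Fin (k₀ + 1) → ℂ) :=
  {x | ∃ b : ℂ, ‖b‖ < 1 / 2 ∧ x = coeffVec k₀ fun ζ =>
    (starRingEnd ℂ b * starRingEnd ℂ (ζ : ℂ) + 1 + b * (ζ : ℂ)) ^ k₀}

/-- The set `M^r_η`: the lifts of stationary discs attached to `{r = 0}` and tied to the origin, at
distance less than `η` from `p₀`, such that the Fourier coefficients of `c` belong to `Γ`. -/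
def M (k₀ : ℕ) (δ : ℝ) (r : ℂ × ℂ → ℝ) (p₀ : Y k α) (η : ℝ) : Set (Y k α) :=
  {p | p ∈ stationaryLifts k α k₀ δ r ∧ normY (p - p₀) < η ∧
    coeffVec k₀ (fun ζ => (p.1 ζ : ℂ)) ∈ Gam k₀}

/-! ## Finite dimensional submanifolds of a normed space -/

section Manifold

variable {E F : Type*} [NormedAddCommGroup E] [NormedSpace ℝ E] [NormedAddCommGroup F]
  [NormedSpace ℝ F]

/-- `σ : Ω → N` is a local `C^1` parametrization of the set `N`: an injective immersion of class
`C^1` of an open set `Ω` of `ℝ^m`, which is a homeomorphism onto a relatively open subset of `N`. -/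
structure IsParam (m : ℕ) (N : Set E) (Ω : Set (Fin m → ℝ)) (σ : (Fin m → ℝ) → E) : Prop where
  isOpen : IsOpen Ω
  contDiffOn : ContDiffOn ℝ 1 σ Ω
  immersion : ∀ t ∈ Ω, Function.Injective (fderiv ℝ σ t)
  injOn : Set.InjOn σ Ω
  image_open : ∀ Ω' ⊆ Ω, IsOpen Ω' → ∃ O : Set E, IsOpen O ∧ σ '' Ω' = N ∩ O

/-- `N` is an embedded `m`-dimensional submanifold of class `C^1`. -/
def IsC1Submanifold (m : ℕ) (N : Set E) : Prop :=
  ∀ x ∈ N, ∃ Ω σ, IsParam m N Ω σ ∧ x ∈ σ '' Ω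

/-- The map `φ` is of class `C^1` on the `m`-dimensional submanifold `N` near `x ∈ N`, and its
derivative at `x`, defined on the tangent space of `N`, is surjective. -/
def SurjectiveDerivAt (m : ℕ) (N : Set E) (φ : E → F) (x : E) : Prop :=
  ∃ Ω σ, IsParam m N Ω σ ∧ ContDiffOn ℝ 1 (φ ∘ σ) Ω ∧
    ∃ t ∈ Ω, σ t = x ∧ Function.Surjective (fderiv ℝ (φ ∘ σ) t)

/-- The restriction of `φ` to `N` is a `C^1` diffeomorphism of the `m`-dimensional submanifold `N` onto
its image, which is a submanifold: `φ` is injective on `N`, and it maps suitable local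
parametrizations of `N` to local parametrizations of `φ(N)`. -/
def DiffeoOntoImage (m : ℕ) (N : Set E) (φ : E → F) : Prop :=
  Set.InjOn φ N ∧ ∀ x ∈ N, ∃ Ω σ, IsParam m N Ω σ ∧ x ∈ σ '' Ω ∧ IsParam m (φ '' N) Ω (φ ∘ σ)

end Manifold

end KStat

end

open KStat

/-! On the circle 1 - ζ̄ = -ζ̄ (1 - ζ). Hence, for h = (1-ζ)u and g = (1-ζ)v, each of h, h̄, Re g
and Im g is 1 - ζ times an explicit real linear expression in u or v. All monomials z^i z̄^j y^l in
P and in the sums defining a deformation satisfy i + j + l ≥ d, and θ₁(0) = 0. So r(h,g) is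
divisible by 1 - ζ and r_z(h,g) by (1-ζ)^(d-1), and the quotients depend on (u,v) in a C^1 way. The
normalization by Γ means that c = (b̄ζ̄ + 1 + bζ)^k₀ + 2 Re(ζ^(k₀+1) p) with b ∈ ℂ and p ∈ A^{k,α}.
Near the base lift, being a lift therefore becomes three equations for (b,p,u,v) in a Banach space.
The Szegő projection of r/(1-ζ) must vanish, which suffices because r is real; the negative Fourier
parts of ζ^k₀ c r_w and of ζ^k₀ c r_z/(1-ζ)^(d-1) must vanish (`Unk.toY_mem_stationaryLifts_iff`,
`exists_of_coeffVec_mem_Gam`, `M_eq_image`).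

A fourth component J(u) ∈ ℂ^(ℓ₀+2) makes the system square. Its linearization at h = 1 - ζ is
triangular: the second equation gives -p/2, the first gives -v/2 plus terms in u, and the third is,
up to terms in p, the negative part of B · conj(u + bζ). Here B is the Levi form of the model on the
circle (`leviPoly`), a self-reciprocal polynomial of degree at most 2ℓ₀. Since P_{zz̄} has no zero
off the origin, B has none on the circle, so B = κ ζ^ℓ₀ |Q|² there, with Q of degree ℓ₀ zero-free on
the closed disc (`exists_factor`). This Toeplitz operator is onto; its kernel consists of the pairs
(b,u) for which Qu is a polynomial of degree at most ℓ₀ + 1 and b is fixed by the top coefficient of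
Qu. The linearization is thus bijective as soon as J is injective on the quotients s/Q with deg s <
ℓ₀ + 2 (`toeplitz_bijective`). Both the first Taylor coefficients (`eq_zero_of_taylor`) and the jet
of (1-ζ)u at 1 (`eq_zero_of_jetAtOne`) have this property.

Superposition operators on Hölder spaces are C^1, with bounds linear in the size of the superposed
function, so a deformation perturbs the equations by a C^1-small term (`Coef.smallAt_pertEqs`). A
quantitative inverse function theorem (`exists_local_inverse`) then provides one ball valid for all
small deformations. Inside it the lifts are the preimages of the points (0,0,0,y), and y = J(u) can
be read off from h alone, so y parametrizes the projected set (`isParam_solSet`). With J the jet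
map, the jet in these coordinates is a linear isomorphism, which is (ii).

For (i), J is given by Taylor coefficients, and the centre map is differentiated at the rotated
discs h = (1-ζ)φ, |φ| = 1. The directions u = φ(l - bζ) are tangent; they move h(0) by φl and g(0)
by a term in l plus 2(bX(φ) + b̄Y(φ)), with X and Y trigonometric polynomials. The derivative is
onto whenever |X| ≠ |Y|. The top coefficients of |X|² and |Y|² differ by an inequality between
binomial coefficients (`choose_mul_choose_lt`), so arbitrarily small angles work.

The analytic foundation is the Szegő projection on C^{k,α}: it comes from the Hardy–Littlewood
criterion applied to a Cauchy integral (`exists_szego`), and its continuity from the closed graph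
theorem. -/

noncomputable section

namespace KStat

/-! ## Hölder spaces of vector valued functions on the circle -/

section CircleHolder

variable {F : Type} [NormedAddCommGroup F] [NormedSpace ℝ F]

/-- Functions of class `C^{k,α}` on the unit circle with values in `F`. -/
def circleHolder (F : Type) [NormedAddCommGroup F] [NormedSpace ℝ F] (k : ℕ) (α : ℝ) :
    Submodule ℝ (Circle → F) where
  carrier := {u | ContDiff ℝ k (angular u) ∧ ∃ C : ℝ, ∀ s t : ℝ,
    ‖iteratedDeriv k (angular u) s - iteratedDeriv k (angular u) t‖
      ≤ C * ‖(Circle.exp s : ℂ) - (Circle.exp t : ℂ)‖ ^ α}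
  zero_mem' := by
    have h0 : angular (0 : Circle → F) = fun _ => 0 := rfl
    refine ⟨by rw [h0]; exact contDiff_const, 0, fun s t => ?_⟩
    rw [h0]; simp
  add_mem' := by
    rintro u v ⟨hu, C, hC⟩ ⟨hv, D, hD⟩
    have hadd : angular (u + v) = angular u + angular v := rfl
    refine ⟨by rw [hadd]; exact hu.add hv, C + D, fun s t => ?_⟩
    rw [hadd, iteratedDeriv_add hu.contDiffAt hv.contDiffAt,
      iteratedDeriv_add hu.contDiffAt hv.contDiffAt, add_mul]
    refine le_trans ?_ (add_le_add (hC s t) (hD s t))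
    rw [add_sub_add_comm]
    exact norm_add_le _ _
  smul_mem' := by
    rintro a u ⟨hu, C, hC⟩
    have hsm : angular (a • u) = a • angular u := rfl
    refine ⟨by rw [hsm]; exact contDiff_const.smul hu, |a| * C, fun s t => ?_⟩
    rw [hsm, iteratedDeriv_const_smul_field, iteratedDeriv_const_smul_field, ← smul_sub,
      norm_smul, mul_assoc, Real.norm_eq_abs]
    exact mul_le_mul_of_nonneg_left (hC s t) (abs_nonneg a)

variable {k : ℕ} {α : ℝ}

/-- The space `C^{k,α}(bΔ, F)`. -/
structure CH (F : Type) [NormedAddCommGroup F] [NormedSpace ℝ F] (k : ℕ) (α : ℝ) : Type where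
  /-- the underlying function -/
  val : Circle → F
  property : val ∈ circleHolder F k α

/-- The elements of `C^{k,α}(bΔ, F)` as elements of a submodule. -/
def CH.equiv : CH F k α ≃ circleHolder F k α where
  toFun u := ⟨u.1, u.2⟩
  invFun u := ⟨u.1, u.2⟩

instance : AddCommGroup (CH F k α) := CH.equiv.addCommGroup

instance : Module ℝ (CH F k α) := CH.equiv.module ℝ

instance : CoeFun (CH F k α) (fun _ => Circle → F) := ⟨fun u => u.1⟩

namespace CH

@[ext] theorem ext {u v : CH F k α} (h : ∀ ζ, u ζ = v ζ) : u = v := by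
  cases u; cases v; simpa using funext h

@[simp] theorem add_apply (u v : CH F k α) (ζ : Circle) : (u + v) ζ = u ζ + v ζ := rfl
@[simp] theorem sub_apply (u v : CH F k α) (ζ : Circle) : (u - v) ζ = u ζ - v ζ := rfl
@[simp] theorem neg_apply (u : CH F k α) (ζ : Circle) : (-u) ζ = -u ζ := rfl
@[simp] theorem zero_apply (ζ : Circle) : (0 : CH F k α) ζ = 0 := rfl
@[simp] theorem smul_apply (a : ℝ) (u : CH F k α) (ζ : Circle) : (a • u) ζ = a • u ζ := rfl

/-- The supremum over the circle of the norm of the `j`-th derivative. -/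
def supD (j : ℕ) (u : Circle → F) : ℝ := ⨆ t : ℝ, ‖iteratedDeriv j (angular u) t‖

/-- The Hölder quotient of the `k`-th derivative. -/
def quot (k : ℕ) (α : ℝ) (u : Circle → F) (p : ℝ × ℝ) : ℝ :=
  ‖iteratedDeriv k (angular u) p.1 - iteratedDeriv k (angular u) p.2‖
    / ‖(Circle.exp p.1 : ℂ) - (Circle.exp p.2 : ℂ)‖ ^ α

/-- The formula is that of the real space with norms in place of absolute values, so that `holEquiv`
is isometric by definition. -/
instance : Norm (CH F k α) :=
  ⟨fun u => ∑ j ∈ Finset.range (k + 1), supD j u.1 + ⨆ p : ℝ × ℝ, quot k α u.1 p⟩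

theorem norm_def (u : CH F k α) :
    ‖u‖ = ∑ j ∈ Finset.range (k + 1), supD j u.1 + ⨆ p : ℝ × ℝ, quot k α u.1 p := rfl

theorem angular_add (u v : CH F k α) : angular (u + v : CH F k α).1 = angular u.1 + angular v.1 :=
  rfl

theorem angular_smul (a : ℝ) (u : CH F k α) : angular (a • u : CH F k α).1 = a • angular u.1 := rfl

theorem contDiffAt_angular (u : CH F k α) {j : ℕ} (hj : j ≤ k) (t : ℝ) :
    ContDiffAt ℝ j (angular u.1) t :=
  (u.2.1.of_le (by exact_mod_cast hj)).contDiffAt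

theorem periodic_angular {G : Type} (u : Circle → G) : Function.Periodic (angular u) (2 * Real.pi) := by
  intro t; simp [angular]

theorem periodic_iteratedDeriv (u : Circle → F) (j : ℕ) :
    Function.Periodic (iteratedDeriv j (angular u)) (2 * Real.pi) := by
  intro t
  have h2 := congrFun (iteratedDeriv_comp_add_const j (angular u) (2 * Real.pi)) t
  rw [funext (periodic_angular u)] at h2
  exact h2.symm

theorem bddAbove_deriv (u : CH F k α) {j : ℕ} (hj : j ≤ k) :
    BddAbove (Set.range fun t : ℝ => ‖iteratedDeriv j (angular u.1) t‖) := by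
  have hcont : Continuous (iteratedDeriv j (angular u.1)) :=
    u.2.1.continuous_iteratedDeriv j (by exact_mod_cast hj)
  have hper' : Function.Periodic (fun t => ‖iteratedDeriv j (angular u.1) t‖) (2 * Real.pi) :=
    fun t => by simp only [periodic_iteratedDeriv u.1 j t]
  exact (hper'.compact_of_continuous (by positivity) hcont.norm).bddAbove

theorem bddAbove_quot (u : CH F k α) : BddAbove (Set.range (quot k α u.1)) := by
  obtain ⟨C, hC⟩ := u.2.2
  refine ⟨max C 0, ?_⟩
  rintro _ ⟨p, rfl⟩
  refine div_le_of_le_mul₀ (by positivity) (le_max_right _ _) ((hC p.1 p.2).trans ?_)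
  exact mul_le_mul_of_nonneg_right (le_max_left _ _) (by positivity)

theorem supD_nonneg (j : ℕ) (u : Circle → F) : 0 ≤ supD j u :=
  Real.iSup_nonneg fun _ => norm_nonneg _

theorem quot_nonneg (u : Circle → F) (p : ℝ × ℝ) : 0 ≤ quot k α u p := by
  unfold quot; positivity

theorem supD_le_norm (u : CH F k α) {j : ℕ} (hj : j ≤ k) : supD j u.1 ≤ ‖u‖ := by
  rw [norm_def]
  have h1 := Finset.single_le_sum (f := fun j => supD j u.1) (s := Finset.range (k + 1))
    (fun j _ => supD_nonneg j u.1) (Finset.mem_range.2 (Nat.lt_succ_of_le hj))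
  have h2 : 0 ≤ ⨆ p : ℝ × ℝ, quot k α u.1 p := Real.iSup_nonneg fun p => quot_nonneg _ p
  linarith

theorem norm_apply_le' (u : CH F k α) (ζ : Circle) : ‖u ζ‖ ≤ ‖u‖ := by
  obtain ⟨t, rfl⟩ : ∃ t : ℝ, Circle.exp t = ζ := ⟨_, Circle.exp_arg ζ⟩
  refine le_trans ?_ (supD_le_norm u (Nat.zero_le k))
  exact le_ciSup (bddAbove_deriv u (Nat.zero_le k)) t

theorem normCore : NormedSpace.Core ℝ (CH F k α) where
  norm_nonneg u := by
    rw [norm_def]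
    exact add_nonneg (Finset.sum_nonneg fun j _ => supD_nonneg j _)
      (Real.iSup_nonneg fun p => quot_nonneg _ p)
  norm_smul a u := by
    rw [norm_def, norm_def, mul_add, Finset.mul_sum, Real.mul_iSup_of_nonneg (norm_nonneg a)]
    congr 1
    · refine Finset.sum_congr rfl fun j _ => ?_
      simp only [supD, angular_smul, iteratedDeriv_const_smul_field, norm_smul]
      rw [Real.mul_iSup_of_nonneg (norm_nonneg a)]
    · congr 1
      funext p
      simp only [quot, angular_smul, iteratedDeriv_const_smul_field, ← smul_sub, norm_smul,
        mul_div_assoc]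
  norm_triangle u v := by
    rw [norm_def, norm_def, norm_def, add_add_add_comm, ← Finset.sum_add_distrib]
    refine add_le_add (Finset.sum_le_sum fun j hj => ?_) ?_
    · have hj' : j ≤ k := by simpa [Nat.lt_succ_iff] using hj
      refine ciSup_le fun t => ?_
      rw [angular_add, iteratedDeriv_add (contDiffAt_angular u hj' t) (contDiffAt_angular v hj' t)]
      exact (norm_add_le _ _).trans (add_le_add (le_ciSup (bddAbove_deriv u hj') t)
        (le_ciSup (bddAbove_deriv v hj') t))
    · refine ciSup_le fun p => ?_
      refine le_trans ?_ (add_le_add (le_ciSup (bddAbove_quot u) p)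
        (le_ciSup (bddAbove_quot v) p))
      unfold quot
      rw [← add_div, angular_add]
      refine div_le_div_of_nonneg_right ?_ (by positivity)
      rw [iteratedDeriv_add (contDiffAt_angular u le_rfl _) (contDiffAt_angular v le_rfl _),
        iteratedDeriv_add (contDiffAt_angular u le_rfl _) (contDiffAt_angular v le_rfl _),
        add_sub_add_comm]
      exact norm_add_le _ _
  norm_eq_zero_iff u := by
    constructor
    · intro h
      ext ζ
      have := norm_apply_le' u ζ
      rw [h] at this
      simpa using this
    · rintro rfl
      rw [norm_def]
      have hz : angular (0 : CH F k α).1 = fun _ => (0 : F) := rfl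
      simp [supD, quot, hz]

instance : NormedAddCommGroup (CH F k α) := NormedAddCommGroup.ofCore normCore

instance : NormedSpace ℝ (CH F k α) := NormedSpace.ofCore normCore

theorem norm_apply_le (u : CH F k α) (ζ : Circle) : ‖u ζ‖ ≤ ‖u‖ := norm_apply_le' u ζ

theorem exists_exp (ζ : Circle) : ∃ t : ℝ, Circle.exp t = ζ := ⟨_, Circle.exp_arg ζ⟩

/-- Evaluation at a point of the circle. -/
def eval (ζ : Circle) : CH F k α →L[ℝ] F :=
  LinearMap.mkContinuous
    { toFun := fun u => u ζ, map_add' := fun _ _ => rfl, map_smul' := fun _ _ => rfl } 1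
    fun u => by rw [one_mul]; exact norm_apply_le u ζ

/-- The angular derivative of a function on the circle. -/
def cderiv (u : Circle → F) (ζ : Circle) : F := deriv (angular u) (arg ζ)

/-- `cderiv` differentiates at the principal argument; periodicity of the derivative makes the
choice of argument irrelevant. -/
theorem angular_cderiv (u : Circle → F) : angular (cderiv u) = deriv (angular u) := by
  funext t
  have h : Function.Periodic (deriv (angular u)) (2 * Real.pi) := by
    simpa only [iteratedDeriv_one] using periodic_iteratedDeriv u 1
  have h2 : Circle.exp (arg (Circle.exp t : ℂ)) = Circle.exp t := Circle.exp_arg _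
  obtain ⟨m, hm⟩ := Circle.exp_eq_exp.1 h2
  simp only [angular, cderiv]
  show deriv (angular u) _ = deriv (angular u) _
  rw [hm]
  exact h.int_mul m _

/-- The basis of the inductions on `k`: one differentiation lowers the order by one and leaves the
Hölder condition on the top derivative unchanged. `norm_succ` is the matching identity for norms. -/
theorem mem_succ_iff {u : Circle → F} : u ∈ circleHolder F (k + 1) α ↔
    Differentiable ℝ (angular u) ∧ cderiv u ∈ circleHolder F k α := by
  have h1 : ContDiff ℝ ((k + 1 : ℕ) : WithTop ℕ∞) (angular u) ↔
      Differentiable ℝ (angular u) ∧ ContDiff ℝ k (deriv (angular u)) := by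
    rw [show ((k + 1 : ℕ) : WithTop ℕ∞) = (k : WithTop ℕ∞) + 1 by norm_cast,
      contDiff_succ_iff_deriv]
    constructor
    · rintro ⟨h, _, h'⟩; exact ⟨h, h'⟩
    · rintro ⟨h, h'⟩; exact ⟨h, by simp, h'⟩
  show (ContDiff ℝ ((k + 1 : ℕ) : WithTop ℕ∞) (angular u) ∧ _) ↔
    _ ∧ (ContDiff ℝ k (angular (cderiv u)) ∧ _)
  rw [h1, angular_cderiv, iteratedDeriv_succ', and_assoc]

theorem differentiable_angular (u : CH F (k + 1) α) : Differentiable ℝ (angular u.1) :=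
  (mem_succ_iff.1 u.2).1

theorem continuous_angular (u : CH F k α) : Continuous (angular u.1) := u.2.1.continuous

/-- The angular derivative as an element of `C^{k,α}`. -/
def D (u : CH F (k + 1) α) : CH F k α := ⟨cderiv u.1, (mem_succ_iff.1 u.2).2⟩

theorem angular_D (u : CH F (k + 1) α) : angular (D u).1 = deriv (angular u.1) :=
  angular_cderiv _

theorem hasDerivAt_angular (u : CH F (k + 1) α) (t : ℝ) :
    HasDerivAt (angular u.1) (D u (Circle.exp t)) t := by
  have := (differentiable_angular u t).hasDerivAt
  rwa [← angular_D] at this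

theorem D_eq_of_hasDerivAt {u : CH F (k + 1) α} {w : CH F k α}
    (h : ∀ t, HasDerivAt (angular u.1) (w (Circle.exp t)) t) : D u = w := by
  ext ζ
  obtain ⟨t, rfl⟩ := exists_exp ζ
  exact (hasDerivAt_angular u t).unique (h t)

theorem mem_succ_of_hasDerivAt {u : Circle → F} {w : CH F k α}
    (h : ∀ t, HasDerivAt (angular u) (w (Circle.exp t)) t) : u ∈ circleHolder F (k + 1) α := by
  refine mem_succ_iff.2 ⟨fun t => (h t).differentiableAt, ?_⟩
  have : cderiv u = w.1 := by
    funext ζ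
    obtain ⟨t, rfl⟩ := exists_exp ζ
    exact (congrFun (angular_cderiv u) t).trans (h t).deriv
  rw [this]; exact w.2

theorem norm_succ (u : CH F (k + 1) α) : ‖u‖ = supD 0 u.1 + ‖D u‖ := by
  rw [norm_def, norm_def, Finset.sum_range_succ']
  have h1 : ∀ j, supD j (D u).1 = supD (j + 1) u.1 := fun j => by
    simp only [supD, angular_D, iteratedDeriv_succ']
  have h2 : ∀ p, quot k α (D u).1 p = quot (k + 1) α u.1 p := fun p => by
    simp only [quot, angular_D, iteratedDeriv_succ']
  simp only [h1, h2]
  ring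

theorem supD_zero_le {u : Circle → F} {C : ℝ} (h : ∀ ζ, ‖u ζ‖ ≤ C) : supD 0 u ≤ C :=
  ciSup_le fun t => by simpa [angular] using h (Circle.exp t)

theorem norm_succ_le {u : CH F (k + 1) α} {C : ℝ} (h : ∀ ζ, ‖u ζ‖ ≤ C) : ‖u‖ ≤ C + ‖D u‖ := by
  rw [norm_succ]; gcongr; exact supD_zero_le h

theorem norm_D_le (u : CH F (k + 1) α) : ‖D u‖ ≤ ‖u‖ := by
  rw [norm_succ]; linarith [supD_nonneg 0 u.1]

theorem norm_zero_le {u : CH F 0 α} {C C' : ℝ} (h : ∀ ζ, ‖u ζ‖ ≤ C) (hC' : 0 ≤ C')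
    (h' : ∀ ζ ξ : Circle, ‖u ζ - u ξ‖ ≤ C' * ‖(ζ : ℂ) - ξ‖ ^ α) : ‖u‖ ≤ C + C' := by
  rw [norm_def]
  simp only [zero_add, Finset.range_one, Finset.sum_singleton]
  refine add_le_add (supD_zero_le h) (ciSup_le fun p => ?_)
  refine div_le_of_le_mul₀ (by positivity) hC' ?_
  simpa [angular] using h' (Circle.exp p.1) (Circle.exp p.2)

theorem exists_holder (u : CH F 0 α) : ∃ C : ℝ, 0 ≤ C ∧
    ∀ ζ ξ : Circle, ‖u ζ - u ξ‖ ≤ C * ‖(ζ : ℂ) - ξ‖ ^ α := by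
  obtain ⟨C, hC⟩ := u.2.2
  refine ⟨max C 0, le_max_right _ _, fun ζ ξ => ?_⟩
  obtain ⟨t, rfl⟩ := exists_exp ζ
  obtain ⟨s, rfl⟩ := exists_exp ξ
  have := hC t s
  simp only [iteratedDeriv_zero, angular] at this
  exact this.trans (mul_le_mul_of_nonneg_right (le_max_left _ _) (by positivity))

theorem norm_sub_apply_le (hα : 0 < α) (u : CH F 0 α) (ζ ξ : Circle) :
    ‖u ζ - u ξ‖ ≤ ‖u‖ * ‖(ζ : ℂ) - ξ‖ ^ α := by
  obtain ⟨t, rfl⟩ := exists_exp ζ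
  obtain ⟨s, rfl⟩ := exists_exp ξ
  rcases eq_or_ne (Circle.exp t) (Circle.exp s) with h | h
  · rw [h]; simp [Real.zero_rpow hα.ne']
  have hpos : 0 < ‖(Circle.exp t : ℂ) - Circle.exp s‖ := by
    rw [norm_pos_iff, sub_ne_zero]; exact fun h' => h (Circle.ext h')
  have h1 := le_ciSup (bddAbove_quot u) (t, s)
  have h2 : quot 0 α u.1 (t, s) ≤ ‖u‖ := by
    rw [norm_def]; linarith [Finset.sum_nonneg (s := Finset.range (0 + 1)) fun j _ => supD_nonneg j u.1]
  rwa [quot, div_le_iff₀ (by positivity)] at h2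

theorem mem_zero {u : Circle → F} {C : ℝ} (hα : 0 < α)
    (h' : ∀ ζ ξ : Circle, ‖u ζ - u ξ‖ ≤ C * ‖(ζ : ℂ) - ξ‖ ^ α) : u ∈ circleHolder F 0 α := by
  refine ⟨?_, C, fun s t => by
    simp only [iteratedDeriv_zero]; exact h' _ _⟩
  rw [Nat.cast_zero, contDiff_zero, continuous_iff_continuousAt]
  intro t
  have hc : Filter.Tendsto (fun s : ℝ => C * ‖(Circle.exp s : ℂ) - Circle.exp t‖ ^ α)
      (nhds t) (nhds (C * ‖(Circle.exp t : ℂ) - Circle.exp t‖ ^ α)) := by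
    apply ContinuousAt.tendsto
    refine continuousAt_const.mul (ContinuousAt.rpow_const ?_ (Or.inr hα.le))
    fun_prop
  rw [sub_self, norm_zero, Real.zero_rpow hα.ne', mul_zero] at hc
  rw [ContinuousAt, tendsto_iff_norm_sub_tendsto_zero]
  exact squeeze_zero (fun _ => norm_nonneg _) (fun s => h' _ _) hc

end CH

end CircleHolder

end KStat

end

set_option linter.unusedSectionVars false

noncomputable section

namespace KStat

/-! ### Completeness of the Hölder spaces, inclusions, and bilinear operations -/

section Complete

variable {F : Type} [NormedAddCommGroup F] [NormedSpace ℝ F] {k : ℕ} {α : ℝ}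

namespace CH

open Filter Topology

/-- Evaluations are contractions, so a Cauchy sequence converges pointwise. The Cauchy estimates for
the sup norm and for the Hölder seminorm both pass to the pointwise limit. -/
theorem complete_zero [CompleteSpace F] (hα : 0 < α) : CompleteSpace (CH F 0 α) := by
  refine Metric.complete_of_cauchySeq_tendsto fun u hu => ?_
  have hpt : ∀ ζ, CauchySeq fun n => u n ζ := fun ζ =>
    hu.map (eval (F := F) (k := 0) (α := α) ζ).uniformContinuous
  choose φ hφ using fun ζ => cauchySeq_tendsto_of_complete (hpt ζ)
  have key : ∀ ε > 0, ∃ N, ∀ n ≥ N, (∀ ζ, ‖u n ζ - φ ζ‖ ≤ ε) ∧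
      ∀ ζ ξ : Circle, ‖(u n ζ - φ ζ) - (u n ξ - φ ξ)‖ ≤ ε * ‖(ζ : ℂ) - ξ‖ ^ α := by
    intro ε hε
    obtain ⟨N, hN⟩ := Metric.cauchySeq_iff.1 hu ε hε
    refine ⟨N, fun n hn => ⟨fun ζ => ?_, fun ζ ξ => ?_⟩⟩
    · refine le_of_tendsto (tendsto_const_nhds.sub (hφ ζ)).norm ?_
      filter_upwards [eventually_ge_atTop N] with m hm
      have := hN n hn m hm
      rw [dist_eq_norm] at this
      exact (norm_apply_le (u n - u m) ζ).trans this.le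
    · refine le_of_tendsto ((tendsto_const_nhds.sub (hφ ζ)).sub
        (tendsto_const_nhds.sub (hφ ξ))).norm ?_
      filter_upwards [eventually_ge_atTop N] with m hm
      have := hN n hn m hm
      rw [dist_eq_norm] at this
      exact (norm_sub_apply_le hα (u n - u m) ζ ξ).trans
        (mul_le_mul_of_nonneg_right this.le (by positivity))
  have hmem : φ ∈ circleHolder F 0 α := by
    obtain ⟨N, hN⟩ := key 1 one_pos
    refine mem_zero (C := ‖u N‖ + 1) hα fun ζ ξ => ?_
    have h1 := (hN N le_rfl).2 ζ ξ
    have h2 := norm_sub_apply_le hα (u N) ζ ξ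
    have h3 : φ ζ - φ ξ = (u N ζ - u N ξ) - ((u N ζ - φ ζ) - (u N ξ - φ ξ)) := by abel
    rw [h3, add_mul]
    exact (norm_sub_le _ _).trans (add_le_add h2 h1)
  refine ⟨⟨φ, hmem⟩, ?_⟩
  rw [tendsto_iff_norm_sub_tendsto_zero, Metric.tendsto_atTop]
  intro ε hε
  obtain ⟨N, hN⟩ := key (ε / 3) (by positivity)
  refine ⟨N, fun n hn => ?_⟩
  rw [dist_zero_right, norm_norm]
  have := norm_zero_le (u := u n - ⟨φ, hmem⟩) (hN n hn).1 (by positivity) (hN n hn).2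
  linarith

/-- The values converge pointwise and the derivatives converge in order `k`, hence uniformly. The
limit of the values is then differentiable, with the limit of the derivatives as derivative. -/
theorem complete_succ [CompleteSpace F] [CompleteSpace (CH F k α)] :
    CompleteSpace (CH F (k + 1) α) := by
  refine Metric.complete_of_cauchySeq_tendsto fun u hu => ?_
  have hpt : ∀ ζ, CauchySeq fun n => u n ζ := fun ζ =>
    hu.map (eval (F := F) (α := α) ζ).uniformContinuous
  choose φ hφ using fun ζ => cauchySeq_tendsto_of_complete (hpt ζ)
  have hD : CauchySeq fun n => D (u n) := by
    rw [Metric.cauchySeq_iff] at hu ⊢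
    intro ε hε
    obtain ⟨N, hN⟩ := hu ε hε
    refine ⟨N, fun m hm n hn => lt_of_le_of_lt ?_ (hN m hm n hn)⟩
    rw [dist_eq_norm, dist_eq_norm]
    have : D (u m) - D (u n) = D (u m - u n) := by
      symm
      refine D_eq_of_hasDerivAt fun t => ?_
      exact (hasDerivAt_angular (u m) t).sub (hasDerivAt_angular (u n) t)
    rw [this]; exact norm_D_le _
  obtain ⟨w, hw⟩ := cauchySeq_tendsto_of_complete hD
  have hunif : TendstoUniformly (fun n t => D (u n) (Circle.exp t)) (fun t => w (Circle.exp t))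
      atTop := by
    rw [Metric.tendstoUniformly_iff]
    intro ε hε
    filter_upwards [Metric.tendsto_nhds.1 hw ε hε] with n hn t
    rw [dist_comm]
    rw [dist_eq_norm] at hn ⊢
    exact (norm_apply_le (D (u n) - w) _).trans_lt hn
  have hder : ∀ t, HasDerivAt (angular φ) (w (Circle.exp t)) t := fun t =>
    hasDerivAt_of_tendstoUniformly hunif
      (Eventually.of_forall fun n t => hasDerivAt_angular (u n) t) (fun t => hφ (Circle.exp t)) t
  refine ⟨⟨φ, mem_succ_of_hasDerivAt hder⟩, ?_⟩
  set Φ : CH F (k + 1) α := ⟨φ, mem_succ_of_hasDerivAt hder⟩ with hΦ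
  have hDΦ : D Φ = w := D_eq_of_hasDerivAt hder
  rw [tendsto_iff_norm_sub_tendsto_zero, Metric.tendsto_atTop]
  intro ε hε
  obtain ⟨N, hN⟩ := Metric.cauchySeq_iff.1 hu (ε / 3) (by positivity)
  obtain ⟨N', hN'⟩ := Metric.tendsto_atTop.1 hw (ε / 3) (by positivity)
  refine ⟨max N N', fun n hn => ?_⟩
  rw [dist_zero_right, norm_norm]
  have h1 : ∀ ζ, ‖(u n - Φ) ζ‖ ≤ ε / 3 := fun ζ => by
    refine le_of_tendsto (tendsto_const_nhds.sub (hφ ζ)).norm ?_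
    filter_upwards [eventually_ge_atTop N] with m hm
    have := hN n (le_of_max_le_left hn) m hm
    rw [dist_eq_norm] at this
    exact (norm_apply_le (u n - u m) ζ).trans this.le
  have h2 : D (u n - Φ) = D (u n) - w := D_eq_of_hasDerivAt fun t =>
    (hasDerivAt_angular (u n) t).sub (hder t)
  have h3 := norm_succ_le h1
  have h4 := hN' n (le_of_max_le_right hn)
  rw [dist_eq_norm] at h4
  rw [h2] at h3
  linarith

end CH

/-- The Hölder exponents in `(0, 1)`. -/
class HolderExponent (α : ℝ) : Prop where
  pos : 0 < α
  lt_one : α < 1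

variable [HolderExponent α]

namespace CH

instance [CompleteSpace F] : CompleteSpace (CH F k α) := by
  induction k with
  | zero => exact complete_zero HolderExponent.pos
  | succ k ih => exact complete_succ

/-- A linear map into a complete Hölder space is continuous if all its evaluations are. -/
theorem continuous_of_eval [CompleteSpace F] {V : Type*} [NormedAddCommGroup V] [NormedSpace ℝ V]
    [CompleteSpace V] (T : V →ₗ[ℝ] CH F k α) (h : ∀ ζ, Continuous fun x => T x ζ) :
    Continuous T := by
  -- Evaluations are continuous and separate functions, so the graph is closed. This replaces norm
  -- estimates in most of the constructions of operators below.
  refine T.continuous_of_seq_closed_graph fun u x y hu hTu => ?_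
  ext ζ
  exact tendsto_nhds_unique (((eval ζ).continuous.tendsto y).comp hTu)
    (((h ζ).tendsto x).comp hu)

/-- A continuous linear map from a linear map all of whose evaluations are continuous. -/
def mkCLM [CompleteSpace F] {V : Type*} [NormedAddCommGroup V] [NormedSpace ℝ V]
    [CompleteSpace V] (T : V →ₗ[ℝ] CH F k α) (h : ∀ ζ, Continuous fun x => T x ζ) :
    V →L[ℝ] CH F k α := ⟨T, continuous_of_eval T h⟩

/-- An arc of length at most π is at most π/2 times its chord c, which makes `u` Lipschitz for the
chordal distance; and c ≤ 2 gives c ≤ 2 c^α. This starts the inclusions between the orders. -/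
theorem mem_zero_of_deriv_bound {u : Circle → F} {C : ℝ} (hd : Differentiable ℝ (angular u))
    (hC : ∀ t, ‖deriv (angular u) t‖ ≤ C) : u ∈ circleHolder F 0 α := by
  have hα : 0 < α := HolderExponent.pos
  have hα1 : α < 1 := HolderExponent.lt_one
  have hC0 : 0 ≤ C := (norm_nonneg _).trans (hC 0)
  refine mem_zero (C := C * Real.pi) hα fun ζ ξ => ?_
  obtain ⟨s, rfl⟩ := exists_exp ξ
  -- The angle of ζ is chosen at distance at most π from `s`, so that Jordan's inequality for the
  -- sine applies to half the difference.
  obtain ⟨t, ht, rfl⟩ : ∃ t : ℝ, |t - s| ≤ Real.pi ∧ Circle.exp t = ζ := by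
    refine ⟨s + arg ((ζ * (Circle.exp s)⁻¹ : Circle) : ℂ), ?_, ?_⟩
    · rw [add_sub_cancel_left]; exact abs_arg_le_pi _
    · rw [Circle.exp_add, Circle.exp_arg]; simp
  have h1 : ‖angular u t - angular u s‖ ≤ C * |t - s| := by
    have := Convex.norm_image_sub_le_of_norm_deriv_le (f := angular u) (s := Set.univ) (x := s)
      (y := t) (C := C) (fun x _ => hd x) (fun x _ => hC x) convex_univ trivial trivial
    simpa [Real.norm_eq_abs] using this
  have h2 : |t - s| ≤ Real.pi / 2 * ‖(Circle.exp t : ℂ) - Circle.exp s‖ := by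
    have h3 : ‖(Circle.exp t : ℂ) - Circle.exp s‖ = 2 * |Real.sin ((t - s) / 2)| := by
      have h4 : (Circle.exp t : ℂ) - Circle.exp s
          = Circle.exp s * (exp (I * ((t - s : ℝ) : ℂ)) - 1) := by
        simp only [Circle.coe_exp, mul_sub, ← Complex.exp_add, mul_one]
        congr 2
        push_cast; ring
      rw [h4, norm_mul, Circle.norm_coe, one_mul, Complex.norm_exp_I_mul_ofReal_sub_one,
        norm_mul]
      simp [Real.norm_eq_abs]
    rw [h3]
    have h5 : |(t - s) / 2| ≤ Real.pi / 2 := by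
      rw [abs_div, abs_two]; linarith
    have h6 := Real.mul_abs_le_abs_sin h5
    rw [abs_div, abs_two] at h6
    have hpi := Real.pi_pos
    calc |t - s| = Real.pi * (2 / Real.pi * (|t - s| / 2)) := by field_simp
      _ ≤ Real.pi * |Real.sin ((t - s) / 2)| := by gcongr
      _ = _ := by ring
  have h7 : ‖(Circle.exp t : ℂ) - Circle.exp s‖ ≤ 2 := by
    refine (norm_sub_le _ _).trans ?_
    rw [Circle.norm_coe, Circle.norm_coe]; norm_num
  set c := ‖(Circle.exp t : ℂ) - Circle.exp s‖ with hc
  have hc0 : 0 ≤ c := norm_nonneg _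
  have h8 : c ≤ 2 * c ^ α := by
    rcases hc0.eq_or_lt with h0 | h0
    · rw [← h0]; simp [Real.zero_rpow hα.ne']
    have : c = c ^ (1 - α) * c ^ α := by rw [← Real.rpow_add h0]; simp
    calc c = c ^ (1 - α) * c ^ α := this
      _ ≤ 2 ^ (1 - α) * c ^ α := by
          gcongr
      _ ≤ 2 * c ^ α := by
          gcongr
          calc (2 : ℝ) ^ (1 - α) ≤ 2 ^ (1 : ℝ) :=
                Real.rpow_le_rpow_of_exponent_le (by norm_num) (by linarith)
            _ = 2 := Real.rpow_one 2
  calc ‖u (Circle.exp t) - u (Circle.exp s)‖ ≤ C * |t - s| := h1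
    _ ≤ C * (Real.pi / 2 * (2 * c ^ α)) := by
        gcongr; exact h2.trans (by gcongr)
    _ = C * Real.pi * c ^ α := by ring

theorem mem_of_mem_succ {u : Circle → F} (hu : u ∈ circleHolder F (k + 1) α) :
    u ∈ circleHolder F k α := by
  induction k generalizing u with
  | zero =>
    obtain ⟨hd, h⟩ := mem_succ_iff.1 hu
    refine mem_zero_of_deriv_bound (C := ‖(⟨_, h⟩ : CH F 0 α)‖) hd fun t => ?_
    rw [← angular_cderiv]
    exact norm_apply_le (⟨_, h⟩ : CH F 0 α) (Circle.exp t)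
  | succ k ih =>
    obtain ⟨hd, h⟩ := mem_succ_iff.1 hu
    exact mem_succ_iff.2 ⟨hd, ih h⟩

/-- The inclusion of `C^{k+1,α}` in `C^{k,α}`. -/
def incl [CompleteSpace F] : CH F (k + 1) α →L[ℝ] CH F k α :=
  mkCLM { toFun := fun u => ⟨u.1, mem_of_mem_succ u.2⟩, map_add' := fun _ _ => rfl,
          map_smul' := fun _ _ => rfl } fun ζ => (eval ζ).continuous

/-- The angular derivative as a continuous linear map. -/
def DL : CH F (k + 1) α →L[ℝ] CH F k α :=
  LinearMap.mkContinuous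
    { toFun := D
      map_add' := fun u v => D_eq_of_hasDerivAt fun t =>
        (hasDerivAt_angular u t).add (hasDerivAt_angular v t)
      map_smul' := fun a u => D_eq_of_hasDerivAt fun t =>
        (hasDerivAt_angular u t).const_smul a } 1
    fun u => by rw [one_mul]; exact norm_D_le u

/-- The norm of order `k + 1` is at most the norm of the inclusion plus the norm of the derivative,
so continuity can be checked one order lower, even for nonlinear maps. -/
theorem continuous_of_incl_D [CompleteSpace F] {T : Type*} [TopologicalSpace T]
    {Φ : T → CH F (k + 1) α} (h1 : Continuous fun x => incl (Φ x))
    (h2 : Continuous fun x => D (Φ x)) : Continuous Φ := by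
  rw [continuous_iff_continuousAt]
  intro x
  rw [ContinuousAt, tendsto_iff_norm_sub_tendsto_zero]
  have e1 := tendsto_iff_norm_sub_tendsto_zero.1 (h1.tendsto x)
  have e2 := tendsto_iff_norm_sub_tendsto_zero.1 (h2.tendsto x)
  have e3 := e1.add e2
  rw [add_zero] at e3
  refine squeeze_zero (fun _ => norm_nonneg _) (fun y => ?_) e3
  have e4 : D (Φ y) - D (Φ x) = D (Φ y - Φ x) := (map_sub DL _ _).symm
  rw [e4]
  exact norm_succ_le fun ζ => norm_apply_le (incl (Φ y) - incl (Φ x)) ζ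

/-! ### Bilinear pairings -/

variable {G H : Type} [NormedAddCommGroup G] [NormedSpace ℝ G] [NormedAddCommGroup H]
  [NormedSpace ℝ H]

/-- At order zero, the increment of a product is split into one increment per factor; higher orders
follow from the Leibniz rule. -/
theorem mem_bilin (B : F →L[ℝ] G →L[ℝ] H) {u : Circle → F} {v : Circle → G}
    (hu : u ∈ circleHolder F k α) (hv : v ∈ circleHolder G k α) :
    (fun ζ => B (u ζ) (v ζ)) ∈ circleHolder H k α := by
  induction k generalizing u v with
  | zero =>
    have hα : 0 < α := HolderExponent.pos
    set U : CH F 0 α := ⟨u, hu⟩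
    set V : CH G 0 α := ⟨v, hv⟩
    refine mem_zero (C := 2 * (‖B‖ * ‖U‖ * ‖V‖)) hα fun ζ ξ => ?_
    have h1 : B (u ζ) (v ζ) - B (u ξ) (v ξ) = B (u ζ) (v ζ - v ξ) + B (u ζ - u ξ) (v ξ) := by
      simp
    rw [h1]
    have h2 : ‖B (u ζ) (v ζ - v ξ)‖ ≤ ‖B‖ * ‖U‖ * (‖V‖ * ‖(ζ : ℂ) - ξ‖ ^ α) := by
      refine (B.le_opNorm₂ _ _).trans ?_
      gcongr
      · exact norm_apply_le U ζ
      · exact norm_sub_apply_le hα V ζ ξ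
    have h3 : ‖B (u ζ - u ξ) (v ξ)‖ ≤ ‖B‖ * (‖U‖ * ‖(ζ : ℂ) - ξ‖ ^ α) * ‖V‖ := by
      refine (B.le_opNorm₂ _ _).trans ?_
      gcongr
      · exact norm_sub_apply_le hα U ζ ξ
      · exact norm_apply_le V ξ
    refine (norm_add_le _ _).trans ((add_le_add h2 h3).trans (le_of_eq ?_))
    ring
  | succ k ih =>
    obtain ⟨hu1, hu2⟩ := mem_succ_iff.1 hu
    obtain ⟨hv1, hv2⟩ := mem_succ_iff.1 hv
    have h := Submodule.add_mem _ (ih hu2 (mem_of_mem_succ hv)) (ih (mem_of_mem_succ hu) hv2)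
    refine mem_succ_of_hasDerivAt (w := ⟨_, h⟩) fun t => ?_
    exact (B.hasFDerivAt.comp_hasDerivAt t (hasDerivAt_angular ⟨u, hu⟩ t)).clm_apply
      (hasDerivAt_angular ⟨v, hv⟩ t)

variable [CompleteSpace F] [CompleteSpace G] [CompleteSpace H]

/-- The pairing of functions on the circle induced by a bilinear map of their values. -/
def bilin (B : F →L[ℝ] G →L[ℝ] H) : CH F k α →L[ℝ] CH G k α →L[ℝ] CH H k α :=
  let T (u : CH F k α) : CH G k α →L[ℝ] CH H k α :=
    mkCLM { toFun := fun v => ⟨fun ζ => B (u ζ) (v ζ), mem_bilin B u.2 v.2⟩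
            map_add' := fun v w => by ext ζ; simp
            map_smul' := fun a v => by ext ζ; simp }
      fun ζ => (B (u ζ)).continuous.comp (eval ζ).continuous
  let TL : CH F k α →ₗ[ℝ] CH G k α →L[ℝ] CH H k α :=
    { toFun := T
      map_add' := fun v w => by
        refine ContinuousLinearMap.ext fun x => ?_
        ext ζ
        show B (v ζ + w ζ) (x ζ) = B (v ζ) (x ζ) + B (w ζ) (x ζ)
        simp
      map_smul' := fun a v => by
        refine ContinuousLinearMap.ext fun x => ?_
        ext ζ
        show B (a • v ζ) (x ζ) = a • B (v ζ) (x ζ)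
        simp }
  ⟨TL, by
    -- Continuity in the first argument, for the operator norm, is again a closed graph argument:
    -- the functionals `S ↦ S v ζ` separate the operators `S`.
    refine TL.continuous_of_seq_closed_graph fun u x y hu hTu => ?_
    refine ContinuousLinearMap.ext fun v => ?_
    ext ζ
    have e1 : Filter.Tendsto (fun n => (TL (u n)) v ζ) Filter.atTop (nhds (y v ζ)) :=
      (((eval ζ).comp (ContinuousLinearMap.apply ℝ _ v)).continuous.tendsto y).comp hTu
    have e2 : Filter.Tendsto (fun n => (TL (u n)) v ζ) Filter.atTop (nhds (TL x v ζ)) :=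
      (((B.flip (v ζ)).comp (eval ζ)).continuous.tendsto x).comp hu
    exact tendsto_nhds_unique e1 e2⟩

theorem mem_const (x : F) : (fun _ => x) ∈ circleHolder F k α := by
  have h0 : angular (fun _ : Circle => x) = fun _ => x := rfl
  refine ⟨by rw [h0]; exact contDiff_const, 0, fun s t => ?_⟩
  rw [h0]; simp [iteratedDeriv_const]

/-- Constant functions. -/
def const : F →L[ℝ] CH F k α :=
  mkCLM { toFun := fun x => ⟨fun _ => x, mem_const x⟩, map_add' := fun _ _ => rfl,
          map_smul' := fun _ _ => rfl } fun _ => continuous_id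

@[simp] theorem const_apply (x : F) (ζ : Circle) : (const x : CH F k α) ζ = x := rfl

/-- Composition with a continuous linear map of the values. -/
def lmap (L : F →L[ℝ] G) : CH F k α →L[ℝ] CH G k α :=
  bilin (ContinuousLinearMap.apply ℝ G).flip (const L)

@[simp] theorem lmap_apply (L : F →L[ℝ] G) (u : CH F k α) (ζ : Circle) :
    lmap L u ζ = L (u ζ) := rfl

end CH

/-! ### The real Hölder space -/

/-- `C^{k,α}(bΔ)` is the space of real functions of class `C^{k,α}` with the norm of the general
vector valued case. -/
def holEquiv : Hol k α ≃ₗᵢ[ℝ] CH ℝ k α where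
  toFun u := ⟨u.1, u.2⟩
  invFun u := ⟨u.1, u.2⟩
  map_add' _ _ := rfl
  map_smul' _ _ := rfl
  norm_map' _ := rfl

@[simp] theorem holEquiv_apply (u : Hol k α) (ζ : Circle) : holEquiv u ζ = u ζ := rfl
@[simp] theorem holEquiv_symm_apply (u : CH ℝ k α) (ζ : Circle) : holEquiv.symm u ζ = u ζ := rfl

instance : CompleteSpace (Hol k α) :=
  (completeSpace_congr (e := (holEquiv (k := k) (α := α)).toEquiv)
    holEquiv.isometry.isUniformEmbedding).2 inferInstance

end Complete

end KStat

end

set_option linter.unusedSectionVars false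

noncomputable section

namespace KStat

/-! ## Integrals depending on a parameter -/

section Parametric

variable {E F : Type} [NormedAddCommGroup E] [NormedSpace ℝ E] [NormedAddCommGroup F]
  [NormedSpace ℝ F]

/-- `f` is of class `C^m`, and its derivatives up to order `m` are bounded by `ε` on `S`. -/
def DerivBound (m : ℕ) (S : Set E) (f : E → F) (ε : ℝ) : Prop :=
  ContDiff ℝ m f ∧ ∀ j ≤ m, ∀ x ∈ S, ‖iteratedFDeriv ℝ j f x‖ ≤ ε

theorem contDiff_nat_succ_iff {m : ℕ} {f : E → F} :
    ContDiff ℝ (m + 1 : ℕ) f ↔ Differentiable ℝ f ∧ ContDiff ℝ m (fderiv ℝ f) := by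
  rw [show ((m + 1 : ℕ) : WithTop ℕ∞) = (m : WithTop ℕ∞) + 1 by norm_cast,
    contDiff_succ_iff_fderiv]
  exact ⟨fun h => ⟨h.1, h.2.2⟩, fun h => ⟨h.1, by simp, h.2⟩⟩

theorem derivBound_zero_iff {S : Set E} {f : E → F} {ε : ℝ} :
    DerivBound 0 S f ε ↔ Continuous f ∧ ∀ x ∈ S, ‖f x‖ ≤ ε := by
  simp [DerivBound, contDiff_zero]

/-- One derivative is peeled off at the inner end, so inductions on `m` replace `f` by `fderiv ℝ f`.
The target space changes on the way, which is why it is quantified inside such inductions. -/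
theorem derivBound_succ_iff {m : ℕ} {S : Set E} {f : E → F} {ε : ℝ} :
    DerivBound (m + 1) S f ε ↔
      Differentiable ℝ f ∧ (∀ x ∈ S, ‖f x‖ ≤ ε) ∧ DerivBound m S (fderiv ℝ f) ε := by
  rw [DerivBound, contDiff_nat_succ_iff, DerivBound]
  constructor
  · rintro ⟨⟨h1, h2⟩, h3⟩
    refine ⟨h1, fun x hx => by simpa using h3 0 (by omega) x hx, h2, fun j hj x hx => ?_⟩
    rw [norm_iteratedFDeriv_fderiv]
    exact h3 (j + 1) (by omega) x hx
  · rintro ⟨h1, h2, h3, h4⟩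
    refine ⟨⟨h1, h3⟩, fun j hj x hx => ?_⟩
    rcases j with _ | j
    · simpa using h2 x hx
    · rw [← norm_iteratedFDeriv_fderiv]
      exact h4 j (by omega) x hx

theorem DerivBound.mono {m m' : ℕ} {S S' : Set E} {f : E → F} {ε ε' : ℝ}
    (h : DerivBound m S f ε) (hm : m' ≤ m) (hS : S' ⊆ S) (hε : ε ≤ ε') : DerivBound m' S' f ε' :=
  ⟨h.1.of_le (by exact_mod_cast hm), fun j hj x hx => (h.2 j (hj.trans hm) x (hS hx)).trans hε⟩

variable [FiniteDimensional ℝ E]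

theorem hasFDerivAt_integral {g : ℝ × E → F} (hg : ContDiff ℝ 1 g) (x : E) :
    HasFDerivAt (fun x => ∫ s in (0 : ℝ)..1, g (s, x))
      (∫ s in (0 : ℝ)..1, fderiv ℝ (fun y => g (s, y)) x) x := by
  have hd : ∀ s y, HasFDerivAt (fun y => g (s, y))
      ((fderiv ℝ g (s, y)).comp (ContinuousLinearMap.inr ℝ ℝ E)) y := fun s y =>
    ((hg.differentiable (by simp)).differentiableAt.hasFDerivAt).comp y (hasFDerivAt_prodMk_right s y)
  have hc : Continuous fun p : ℝ × E => (fderiv ℝ g p).comp (ContinuousLinearMap.inr ℝ ℝ E) :=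
    (hg.continuous_fderiv (by simp)).clm_comp continuous_const
  have hcomp : IsCompact (Set.Icc (0 : ℝ) 1 ×ˢ closedBall x 1) :=
    isCompact_Icc.prod (isCompact_closedBall x 1)
  obtain ⟨C, hC⟩ := hcomp.exists_bound_of_continuousOn hc.continuousOn
  refine intervalIntegral.hasFDerivAt_integral_of_dominated_of_fderiv_le
    (F' := fun y s => fderiv ℝ (fun y => g (s, y)) y) (bound := fun _ => C)
    (closedBall_mem_nhds x one_pos) ?_ ?_ ?_ ?_ ?_ ?_
  · exact Filter.Eventually.of_forall fun y =>
      (hg.continuous.comp (by fun_prop : Continuous fun s => (s, y))).aestronglyMeasurable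
  · exact (hg.continuous.comp (by fun_prop : Continuous fun s => (s, x))).intervalIntegrable _ _
  · simp only [fun s y => (hd s y).fderiv]
    exact (hc.comp (by fun_prop : Continuous fun s => (s, x))).aestronglyMeasurable
  · refine Filter.Eventually.of_forall fun s hs y hy => ?_
    rw [(hd s y).fderiv]
    rw [Set.uIoc_of_le zero_le_one] at hs
    exact hC (s, y) ⟨⟨hs.1.le, hs.2⟩, hy⟩
  · exact intervalIntegrable_const
  · exact Filter.Eventually.of_forall fun s _ y _ => (hd s y).differentiableAt.hasFDerivAt

theorem contDiff_fderiv_right {m : ℕ} {g : ℝ × E → F} (hg : ContDiff ℝ (m + 1 : ℕ) g) :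
    ContDiff ℝ m fun p : ℝ × E => fderiv ℝ (fun y => g (p.1, y)) p.2 := by
  have h1 : ∀ p : ℝ × E, fderiv ℝ (fun y => g (p.1, y)) p.2 =
      (fderiv ℝ g p).comp (ContinuousLinearMap.inr ℝ ℝ E) := fun p =>
    (((hg.differentiable (by simp)).differentiableAt.hasFDerivAt).comp p.2
      (hasFDerivAt_prodMk_right p.1 p.2)).fderiv
  simp only [h1]
  exact (contDiff_nat_succ_iff.1 hg).2.clm_comp contDiff_const

/-- Differentiation under the integral sign reduces order `m + 1` to order `m` for the derivative.
The bound is preserved without a constant because the interval of integration has length one. -/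
theorem derivBound_integral (m : ℕ) : ∀ {F : Type} [NormedAddCommGroup F] [NormedSpace ℝ F]
    {g : ℝ × E → F} {S : Set E} {ε : ℝ}, ContDiff ℝ m g →
    (∀ s ∈ Set.Icc (0 : ℝ) 1, ∀ j ≤ m, ∀ x ∈ S, ‖iteratedFDeriv ℝ j (fun y => g (s, y)) x‖ ≤ ε) →
    DerivBound m S (fun x => ∫ s in (0 : ℝ)..1, g (s, x)) ε := by
  have bd : ∀ {F : Type} [NormedAddCommGroup F] [NormedSpace ℝ F] {g : ℝ × E → F} {ε : ℝ} {x : E},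
      (∀ s ∈ Set.Icc (0 : ℝ) 1, ‖g (s, x)‖ ≤ ε) → ‖∫ s in (0 : ℝ)..1, g (s, x)‖ ≤ ε := by
    intro F _ _ g ε x h
    have := intervalIntegral.norm_integral_le_of_norm_le_const (a := (0 : ℝ)) (b := 1)
      (f := fun s => g (s, x)) (C := ε) fun s hs => by
        rw [Set.uIoc_of_le zero_le_one] at hs
        exact h s ⟨hs.1.le, hs.2⟩
    simpa using this
  induction m with
  | zero =>
    intro F _ _ g S ε hg h
    rw [Nat.cast_zero, contDiff_zero] at hg
    refine derivBound_zero_iff.2 ⟨?_, fun x hx => bd fun s hs => ?_⟩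
    · exact intervalIntegral.continuous_parametric_intervalIntegral_of_continuous'
        (f := fun x s => g (s, x)) (by fun_prop) 0 1
    · simpa using h s hs 0 le_rfl x hx
  | succ m ih =>
    intro F _ _ g S ε hg h
    have h1 : ContDiff ℝ 1 g := hg.of_le (by norm_cast; omega)
    refine derivBound_succ_iff.2 ⟨fun x => (hasFDerivAt_integral h1 x).differentiableAt,
      fun x hx => bd fun s hs => by simpa using h s hs 0 (by omega) x hx, ?_⟩
    rw [funext fun x => (hasFDerivAt_integral h1 x).fderiv]
    refine ih (g := fun p : ℝ × E => fderiv ℝ (fun y => g (p.1, y)) p.2)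
      (contDiff_fderiv_right hg) fun s hs j hj x hx => ?_
    show ‖iteratedFDeriv ℝ j (fderiv ℝ fun y => g (s, y)) x‖ ≤ ε
    rw [norm_iteratedFDeriv_fderiv]
    exact h s hs (j + 1) (by omega) x hx

theorem contDiff_integral {m : ℕ} {g : ℝ × E → F} (hg : ContDiff ℝ m g) :
    ContDiff ℝ m (fun x => ∫ s in (0 : ℝ)..1, g (s, x)) :=
  (derivBound_integral m (S := ∅) (ε := 0) hg (by simp)).1

/-- The mean value of the derivative on a segment: `f(y) - f(x) = H(x, y) (y - x)`. -/
def hadamard (f : E → F) (p : E × E) : E →L[ℝ] F :=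
  ∫ s in (0 : ℝ)..1, fderiv ℝ f (p.1 + s • (p.2 - p.1))

theorem contDiff_hadamard {m : ℕ} {f : E → F} (hf : ContDiff ℝ (m + 1 : ℕ) f) :
    ContDiff ℝ m (hadamard f) := by
  refine contDiff_integral
    (g := fun q : ℝ × E × E => fderiv ℝ f (q.2.1 + q.1 • (q.2.2 - q.2.1))) ?_
  exact (contDiff_nat_succ_iff.1 hf).2.comp (by fun_prop)

theorem hadamard_self [CompleteSpace F] (f : E → F) (x : E) : hadamard f (x, x) = fderiv ℝ f x := by
  simp [hadamard]

theorem hadamard_apply [CompleteSpace F] {f : E → F} (hf : ContDiff ℝ 1 f) (x y : E) :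
    hadamard f (x, y) (y - x) = f y - f x := by
  have hd : ∀ s ∈ Set.uIcc (0 : ℝ) 1, HasDerivAt (fun s : ℝ => f (x + s • (y - x)))
      (fderiv ℝ f (x + s • (y - x)) (y - x)) s := fun s _ => by
    have h1 : HasDerivAt (fun s : ℝ => x + s • (y - x)) (y - x) s := by
      simpa using ((hasDerivAt_id s).smul_const (y - x)).const_add x
    exact ((hf.differentiable (by simp)).differentiableAt.hasFDerivAt).comp_hasDerivAt s h1
  have hc : Continuous fun s : ℝ => fderiv ℝ f (x + s • (y - x)) :=
    (hf.continuous_fderiv (by simp)).comp (by fun_prop)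
  have h2 := intervalIntegral.integral_eq_sub_of_hasDerivAt hd
    ((hc.clm_apply continuous_const).intervalIntegrable _ _)
  simp only [one_smul, zero_smul, add_zero, add_sub_cancel] at h2
  rw [← h2, hadamard, ContinuousLinearMap.intervalIntegral_apply (hc.intervalIntegrable _ _)]

end Parametric

/-! ## Superposition operators on Hölder spaces -/

section Nemytskii

variable {E F : Type} [NormedAddCommGroup E] [NormedSpace ℝ E] [FiniteDimensional ℝ E]
  [NormedAddCommGroup F] [NormedSpace ℝ F] {k : ℕ} {α : ℝ} [HolderExponent α]

namespace CH

/-- One derivative beyond `k` is needed: at order zero, `g` has to be Lipschitz on a ball containing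
the values of `u`. The induction uses the chain rule and `mem_bilin`. -/
theorem mem_comp {g : E → F} (hg : ContDiff ℝ (k + 1 : ℕ) g) {u : Circle → E}
    (hu : u ∈ circleHolder E k α) : (fun ζ => g (u ζ)) ∈ circleHolder F k α := by
  induction k generalizing F with
  | zero =>
    have hα : 0 < α := HolderExponent.pos
    set U : CH E 0 α := ⟨u, hu⟩
    have hg1 : ContDiff ℝ 1 g := hg
    obtain ⟨C, hC⟩ := (isCompact_closedBall (0 : E) ‖U‖).exists_bound_of_continuousOn
      (hg1.continuous_fderiv (by simp)).continuousOn
    have hC0 : 0 ≤ C := (norm_nonneg _).trans (hC 0 (by simp))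
    refine mem_zero (C := C * ‖U‖) hα fun ζ ξ => ?_
    have hmem : ∀ ζ, u ζ ∈ closedBall (0 : E) ‖U‖ := fun ζ => by
      simpa using norm_apply_le U ζ
    refine ((convex_closedBall (0 : E) ‖U‖).norm_image_sub_le_of_norm_fderiv_le
      (fun x _ => hg1.differentiable (by simp) x) hC (hmem ξ) (hmem ζ)).trans ?_
    rw [mul_assoc]
    exact mul_le_mul_of_nonneg_left (norm_sub_apply_le hα U ζ ξ) hC0
  | succ k ih =>
    obtain ⟨hd, hg'⟩ := contDiff_nat_succ_iff.1 hg
    obtain ⟨hu1, hu2⟩ := mem_succ_iff.1 hu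
    have h := mem_bilin (ContinuousLinearMap.id ℝ (E →L[ℝ] F)) (ih hg' (mem_of_mem_succ hu)) hu2
    refine mem_succ_of_hasDerivAt (w := ⟨_, h⟩) fun t => ?_
    exact (hd _).hasFDerivAt.comp_hasDerivAt t (hasDerivAt_angular ⟨u, hu⟩ t)

/-- The superposition operator `u ↦ g ∘ u`. -/
def nem (g : E → F) (hg : ContDiff ℝ (k + 1 : ℕ) g) (u : CH E k α) : CH F k α :=
  ⟨fun ζ => g (u ζ), mem_comp hg u.2⟩

/-- The pairing of a function with values in linear maps and of a vector valued function. -/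
def app [CompleteSpace F] : CH (E →L[ℝ] F) k α →L[ℝ] CH E k α →L[ℝ] CH F k α :=
  bilin (ContinuousLinearMap.id ℝ (E →L[ℝ] F))

theorem D_nem [CompleteSpace F] {g : E → F} (hg : ContDiff ℝ (k + 1 + 1 : ℕ) g)
    (u : CH E (k + 1) α) :
    D (nem g hg u) = app (nem (fderiv ℝ g) (contDiff_nat_succ_iff.1 hg).2 (incl u)) (D u) :=
  D_eq_of_hasDerivAt fun t =>
    ((contDiff_nat_succ_iff.1 hg).1 _).hasFDerivAt.comp_hasDerivAt t (hasDerivAt_angular u t)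

/-- Continuity in the Hölder seminorm is subtler than in the sup norm. With H = `hadamard g`, the
increment of g∘u - g∘v between ξ and ζ is H(u ξ, u ζ) applied to the increment of u - v, plus H(u ξ,
u ζ) - H(v ξ, v ζ) applied to the increment of v. The first is small because u - v is, the second by
uniform continuity of H on a compact set. -/
theorem continuous_nem_zero [CompleteSpace F] {g : E → F} (hg : ContDiff ℝ (0 + 1 : ℕ) g) :
    Continuous (nem (α := α) g hg) := by
  have hα : 0 < α := HolderExponent.pos
  have hg1 : ContDiff ℝ 1 g := hg
  have hHc : Continuous (hadamard g) := (contDiff_hadamard hg).continuous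
  rw [Metric.continuous_iff]
  intro v ε hε
  set K : Set (E × E) := closedBall (0 : E) (‖v‖ + 1) ×ˢ closedBall (0 : E) (‖v‖ + 1)
  have hK : IsCompact K := (isCompact_closedBall _ _).prod (isCompact_closedBall _ _)
  obtain ⟨C, hC⟩ := hK.exists_bound_of_continuousOn hHc.continuousOn
  have h0K : (0 : E × E) ∈ K := by
    constructor <;> simp <;> positivity
  have hC0 : 0 ≤ C := (norm_nonneg _).trans (hC 0 h0K)
  have huc := hK.uniformContinuousOn_of_continuous hHc.continuousOn
  rw [Metric.uniformContinuousOn_iff] at huc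
  -- The final bound is 2C‖u - v‖ plus this number times ‖v‖. The second part is at most ε/2, and ‖u
  -- - v‖ < ε/(4(C+1)) keeps the first below ε/2.
  obtain ⟨η, hη, hη'⟩ := huc (ε / (2 * (‖v‖ + 1))) (by positivity)
  refine ⟨min (min η 1) (ε / (4 * (C + 1))), by positivity, fun u hu => ?_⟩
  rw [dist_eq_norm] at hu ⊢
  have hu1 : ‖u - v‖ < η := hu.trans_le ((min_le_left _ _).trans (min_le_left _ _))
  have hu2 : ‖u - v‖ < 1 := hu.trans_le ((min_le_left _ _).trans (min_le_right _ _))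
  have hu3 : ‖u - v‖ < ε / (4 * (C + 1)) := hu.trans_le (min_le_right _ _)
  have mv : ∀ ζ, v ζ ∈ closedBall (0 : E) (‖v‖ + 1) := fun ζ => by
    have := norm_apply_le v ζ
    simp only [mem_closedBall, dist_zero_right]; linarith
  have mu : ∀ ζ, u ζ ∈ closedBall (0 : E) (‖v‖ + 1) := fun ζ => by
    have h1 := norm_apply_le u ζ
    have h2 : ‖u‖ ≤ ‖v‖ + ‖u - v‖ := by
      simpa using norm_add_le v (u - v)
    simp only [mem_closedBall, dist_zero_right]; linarith
  have huv : ∀ ζ, ‖u ζ - v ζ‖ ≤ ‖u - v‖ := fun ζ => norm_apply_le (u - v) ζ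
  have b1 : ∀ ζ, ‖(nem g hg u - nem g hg v) ζ‖ ≤ C * ‖u - v‖ := fun ζ => by
    show ‖g (u ζ) - g (v ζ)‖ ≤ _
    rw [← hadamard_apply hg1]
    refine (ContinuousLinearMap.le_opNorm _ _).trans ?_
    gcongr
    · exact hC (v ζ, u ζ) ⟨mv ζ, mu ζ⟩
    · exact huv ζ
  have b2 : ∀ ζ ξ : Circle, ‖(nem g hg u - nem g hg v) ζ - (nem g hg u - nem g hg v) ξ‖ ≤
      (C * ‖u - v‖ + ε / (2 * (‖v‖ + 1)) * ‖v‖) * ‖(ζ : ℂ) - ξ‖ ^ α := fun ζ ξ => by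
    have e1 : (nem g hg u - nem g hg v) ζ - (nem g hg u - nem g hg v) ξ =
        hadamard g (u ξ, u ζ) ((u - v) ζ - (u - v) ξ) +
        (hadamard g (u ξ, u ζ) - hadamard g (v ξ, v ζ)) (v ζ - v ξ) := by
      show (g (u ζ) - g (v ζ)) - (g (u ξ) - g (v ξ)) = hadamard g (u ξ, u ζ)
        ((u ζ - v ζ) - (u ξ - v ξ)) + _
      have e2 := hadamard_apply hg1 (u ξ) (u ζ)
      have e3 := hadamard_apply hg1 (v ξ) (v ζ)
      rw [_root_.sub_apply, e3,
        show u ζ - v ζ - (u ξ - v ξ) = (u ζ - u ξ) - (v ζ - v ξ) by abel, map_sub, e2]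
      abel
    rw [e1, add_mul]
    refine (norm_add_le _ _).trans (add_le_add ?_ ?_)
    · refine (ContinuousLinearMap.le_opNorm _ _).trans ?_
      rw [mul_assoc]
      gcongr
      · exact hC (u ξ, u ζ) ⟨mu ξ, mu ζ⟩
      · exact norm_sub_apply_le hα (u - v) ζ ξ
    · refine (ContinuousLinearMap.le_opNorm _ _).trans ?_
      rw [mul_assoc]
      gcongr
      · have := hη' (u ξ, u ζ) ⟨mu ξ, mu ζ⟩ (v ξ, v ζ) ⟨mv ξ, mv ζ⟩ (by
          rw [Prod.dist_eq, max_lt_iff, dist_eq_norm, dist_eq_norm]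
          exact ⟨(huv ξ).trans_lt hu1, (huv ζ).trans_lt hu1⟩)
        rw [dist_eq_norm] at this
        exact this.le
      · exact norm_sub_apply_le hα v ζ ξ
  have b3 := norm_zero_le b1 (by positivity) b2
  have b4 : ε / (2 * (‖v‖ + 1)) * ‖v‖ ≤ ε / 2 := by
    rw [div_mul_eq_mul_div, div_le_div_iff₀ (by positivity) (by positivity)]
    nlinarith [norm_nonneg v]
  have b5 : C * ‖u - v‖ < ε / 4 := by
    rw [lt_div_iff₀ (by positivity)] at hu3
    nlinarith [norm_nonneg (u - v)]
  linarith

theorem continuous_nem [CompleteSpace F] {g : E → F} (hg : ContDiff ℝ (k + 1 : ℕ) g) :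
    Continuous (nem (α := α) g hg) := by
  induction k generalizing F with
  | zero => exact continuous_nem_zero hg
  | succ k ih =>
    have hg' := (contDiff_nat_succ_iff.1 hg).2
    refine continuous_of_incl_D ?_ ?_
    · exact (ih (hg.of_le (by norm_cast; omega))).comp (incl (F := E) (k := k) (α := α)).continuous
    · simp only [D_nem hg]
      have h1 := (ih hg').comp (incl (F := E) (k := k) (α := α)).continuous
      exact ((app.continuous.comp h1).clm_apply DL.continuous)

/-- The pairing of two functions. -/
def pair {G : Type} [NormedAddCommGroup G] [NormedSpace ℝ G] [CompleteSpace G] [CompleteSpace E]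
    (u : CH E k α) (v : CH G k α) : CH (E × G) k α :=
  lmap (ContinuousLinearMap.inl ℝ E G) u + lmap (ContinuousLinearMap.inr ℝ E G) v

/-- Hadamard's formula writes the increment of g∘v as the pairing of N(v) = `hadamard g` (u,v) with
v - u, and N(u) is the derivative of g along u. The remainder is the pairing of N(v) - N(u) with v -
u, which is o(‖v - u‖) because N is continuous. Since `hadamard g` has one derivative less than g,
the order k + 2 appears. -/
theorem hasFDerivAt_nem [CompleteSpace F] {g : E → F} (hg : ContDiff ℝ (k + 1 + 1 : ℕ) g)
    (u : CH E k α) :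
    HasFDerivAt (nem g (hg.of_le (by norm_cast; omega)))
      (app (nem (fderiv ℝ g) (contDiff_nat_succ_iff.1 hg).2 u)) u := by
  have : CompleteSpace E := FiniteDimensional.complete ℝ E
  have hg1 : ContDiff ℝ 1 g := hg.of_le (by norm_cast; omega)
  set N : CH E k α → CH (E →L[ℝ] F) k α := fun v =>
    nem (hadamard g) (contDiff_hadamard hg) (pair u v) with hN
  have hNc : Continuous N := (continuous_nem (contDiff_hadamard hg)).comp
    (continuous_const.add (lmap (ContinuousLinearMap.inr ℝ E E)).continuous)
  have hNu : N u = nem (fderiv ℝ g) (contDiff_nat_succ_iff.1 hg).2 u := by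
    ext ζ : 1
    have : (pair u u) ζ = (u ζ, u ζ) := by
      show (ContinuousLinearMap.inl ℝ E E (u ζ)) + (ContinuousLinearMap.inr ℝ E E (u ζ)) = _
      simp
    show hadamard g (pair u u ζ) = fderiv ℝ g (u ζ)
    rw [this, hadamard_self]
  rw [← hNu, hasFDerivAt_iff_isLittleO]
  have key : ∀ v, nem g (hg.of_le (by norm_cast; omega)) v
      - nem g (hg.of_le (by norm_cast; omega)) u - app (N u) (v - u) = app (N v - N u) (v - u) := by
    intro v
    have : app (N v) (v - u) = nem g (hg.of_le (by norm_cast; omega)) v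
      - nem g (hg.of_le (by norm_cast; omega)) u := by
      ext ζ
      have : (pair u v) ζ = (u ζ, v ζ) := by
        show (ContinuousLinearMap.inl ℝ E E (u ζ)) + (ContinuousLinearMap.inr ℝ E E (v ζ)) = _
        simp
      show hadamard g (pair u v ζ) (v ζ - u ζ) = g (v ζ) - g (u ζ)
      rw [this, hadamard_apply hg1]
    rw [map_sub app, _root_.sub_apply, this]
  simp only [key]
  have h1 : (fun v => N v - N u) =o[nhds u] fun _ => (1 : ℝ) := by
    rw [Asymptotics.isLittleO_one_iff]
    have := (hNc.tendsto u).sub_const (N u)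
    rwa [sub_self] at this
  have h2 := (app (E := E) (F := F) (k := k) (α := α)).isBoundedBilinearMap.isBigO_comp
    (l := nhds u) (g := fun v => N v - N u) (h := fun v => v - u)
  refine h2.trans_isLittleO ?_
  simpa using h1.norm_left.mul_isBigO (Asymptotics.isBigO_refl (fun v => ‖v - u‖) (nhds u))

theorem contDiff_nem [CompleteSpace F] {g : E → F} (hg : ContDiff ℝ (k + 1 + 1 : ℕ) g) :
    ContDiff ℝ 1 (nem (α := α) (k := k) g (hg.of_le (by norm_cast; omega))) :=
  contDiff_one_iff_hasFDerivAt.2 ⟨_, app.continuous.comp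
    (continuous_nem (contDiff_nat_succ_iff.1 hg).2), fun u => hasFDerivAt_nem hg u⟩

/-- The constant depends on `g` only through the target space, and the estimate is linear in the
bound of the derivatives of `g`. This makes the effect of a deformation uniformly proportional to
its size. -/
theorem exists_norm_nem_le (k : ℕ) (R : ℝ) : ∀ (F : Type) [NormedAddCommGroup F] [NormedSpace ℝ F]
    [CompleteSpace F], ∃ C : ℝ, ∀ (g : E → F) (hg : ContDiff ℝ (k + 1 : ℕ) g) (S : Set E) (ε : ℝ),
    Convex ℝ S → DerivBound (k + 1) S g ε → ∀ u : CH E k α, (∀ ζ, u ζ ∈ S) → ‖u‖ ≤ R →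
    ‖nem g hg u‖ ≤ C * ε := by
  have hα : 0 < α := HolderExponent.pos
  induction k generalizing R with
  | zero =>
    intro F _ _ _
    refine ⟨1 + R, fun g hg S ε hS hb u hu hR => ?_⟩
    obtain ⟨h1, h2, h3⟩ := derivBound_succ_iff.1 hb
    have hε : 0 ≤ ε := (norm_nonneg _).trans (h2 _ (hu 1))
    have hR0 : 0 ≤ R := (norm_nonneg _).trans hR
    have := norm_zero_le (u := nem g hg u) (C := ε) (C' := ε * R) (fun ζ => h2 _ (hu ζ))
      (by positivity) fun ζ ξ => by
        refine (hS.norm_image_sub_le_of_norm_fderiv_le (fun x _ => h1 x)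
          (derivBound_zero_iff.1 h3).2 (hu ξ) (hu ζ)).trans ?_
        rw [mul_assoc]
        exact mul_le_mul_of_nonneg_left ((norm_sub_apply_le hα u ζ ξ).trans (by gcongr)) hε
    linarith
  | succ k ih =>
    intro F _ _ _
    have : CompleteSpace E := FiniteDimensional.complete ℝ E
    set I : ℝ := ‖(incl : CH E (k + 1) α →L[ℝ] CH E k α)‖
    obtain ⟨C1, h1⟩ := ih (I * R) F
    obtain ⟨C2, h2⟩ := ih (I * R) (E →L[ℝ] F)
    set B : ℝ := ‖(app : CH (E →L[ℝ] F) k α →L[ℝ] CH E k α →L[ℝ] CH F k α)‖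
    refine ⟨C1 + B * C2 * R, fun g hg S ε hS hb u hu hR => ?_⟩
    have hb' := (derivBound_succ_iff.1 hb).2.2
    have hI : ‖incl u‖ ≤ I * R := (ContinuousLinearMap.le_opNorm _ _).trans (by gcongr)
    have e1 := h1 g (hg.of_le (by norm_cast; omega)) S ε hS (hb.mono (by omega) subset_rfl le_rfl)
      (incl u) hu hI
    have e2 := h2 (fderiv ℝ g) (contDiff_nat_succ_iff.1 hg).2 S ε hS hb' (incl u) hu hI
    have e3 : ‖D (nem g hg u)‖ ≤ B * (C2 * ε) * R := by
      rw [D_nem hg]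
      refine ((app (E := E) (F := F) (k := k) (α := α)).le_opNorm₂ _ _).trans ?_
      gcongr
      · exact mul_nonneg (norm_nonneg (app : CH (E →L[ℝ] F) k α →L[ℝ] _)) ((norm_nonneg _).trans e2)
      · exact (norm_D_le u).trans hR
    have e4 := norm_succ_le (u := nem g hg u) fun ζ =>
      norm_apply_le (nem g (hg.of_le (by norm_cast; omega)) (incl u)) ζ
    linarith

end CH

end Nemytskii

end KStat

end

set_option linter.unusedSectionVars false

noncomputable section

namespace KStat

/-! ## Fourier coefficients -/

/-- The Fourier coefficient of order `n ∈ ℤ` of a function on the circle. -/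
def fc (q : Circle → ℂ) (n : ℤ) : ℂ :=
  (2 * Real.pi : ℂ)⁻¹ * ∫ t in (0 : ℝ)..(2 * Real.pi), q (Circle.exp t) * (Circle.exp t : ℂ) ^ (-n)

theorem continuous_of_angular {G : Type} [TopologicalSpace G] {u : Circle → G}
    (h : Continuous (angular u)) : Continuous u := by
  have h1 : Continuous fun x : AddCircle (2 * Real.pi) => u (AddCircle.homeomorphCircle' x) := by
    refine (QuotientAddGroup.isQuotientMap_mk _).continuous_iff.2 ?_
    exact h
  have h2 := h1.comp AddCircle.homeomorphCircle'.symm.continuous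
  exact h2.congr fun x => congrArg u (AddCircle.homeomorphCircle'.apply_symm_apply x)

theorem CH.continuous {F : Type} [NormedAddCommGroup F] [NormedSpace ℝ F] {k : ℕ} {α : ℝ}
    (u : CH F k α) : Continuous u.1 := continuous_of_angular (CH.continuous_angular u)

theorem continuous_exp_zpow (n : ℤ) : Continuous fun t : ℝ => (Circle.exp t : ℂ) ^ n := by
  have : (fun t : ℝ => (Circle.exp t : ℂ) ^ n) = fun t : ℝ => ((Circle.exp t ^ n : Circle) : ℂ) := by
    funext t; simp
  rw [this]
  exact continuous_subtype_val.comp (Circle.exp.continuous.zpow n)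

theorem fc_integrable {q : Circle → ℂ} (hq : Continuous q) (n : ℤ) (a b : ℝ) :
    IntervalIntegrable (fun t : ℝ => q (Circle.exp t) * (Circle.exp t : ℂ) ^ (-n))
      MeasureTheory.volume a b :=
  ((hq.comp Circle.exp.continuous).mul (continuous_exp_zpow (-n))).intervalIntegrable _ _

theorem fc_add {p q : Circle → ℂ} (hp : Continuous p) (hq : Continuous q) (n : ℤ) :
    fc (fun ζ => p ζ + q ζ) n = fc p n + fc q n := by
  simp only [fc, add_mul]
  rw [intervalIntegral.integral_add (fc_integrable hp n _ _) (fc_integrable hq n _ _), mul_add]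

theorem fc_const_mul (c : ℂ) (q : Circle → ℂ) (n : ℤ) : fc (fun ζ => c * q ζ) n = c * fc q n := by
  simp only [fc, mul_assoc, intervalIntegral.integral_const_mul]
  ring

theorem fc_neg (q : Circle → ℂ) (n : ℤ) : fc (fun ζ => -q ζ) n = -fc q n := by
  have := fc_const_mul (-1) q n
  simpa using this

theorem fc_sub {p q : Circle → ℂ} (hp : Continuous p) (hq : Continuous q) (n : ℤ) :
    fc (fun ζ => p ζ - q ζ) n = fc p n - fc q n := by
  simp only [sub_eq_add_neg]
  rw [fc_add (q := fun ζ => -q ζ) hp hq.neg, fc_neg]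

theorem fc_zpow_mul (m : ℤ) (q : Circle → ℂ) (n : ℤ) :
    fc (fun ζ => (ζ : ℂ) ^ m * q ζ) n = fc q (n - m) := by
  simp only [fc]
  congr 2
  funext t
  rw [neg_sub, sub_eq_add_neg, zpow_add₀ (Circle.coe_ne_zero _)]
  ring

theorem fc_pow_mul (m : ℕ) (q : Circle → ℂ) (n : ℤ) :
    fc (fun ζ => (ζ : ℂ) ^ m * q ζ) n = fc q (n - m) := by
  simpa using fc_zpow_mul m q n

theorem fc_conj (q : Circle → ℂ) (n : ℤ) :
    fc (fun ζ => starRingEnd ℂ (q ζ)) n = starRingEnd ℂ (fc q (-n)) := by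
  simp only [fc, map_mul, map_inv₀, conj_ofReal, neg_neg]
  rw [← intervalIntegral.intervalIntegral_conj]
  congr 2
  · rw [map_ofNat]
  · funext t
    rw [map_mul, map_zpow₀, ← Circle.coe_inv_eq_conj, Circle.coe_inv, inv_zpow, zpow_neg]

theorem fc_zpow (m n : ℤ) : fc (fun ζ => (ζ : ℂ) ^ m) n = if n = m then 1 else 0 := by
  have h := fc_zpow_mul m (fun _ => 1) n
  simp only [mul_one] at h
  rw [h]
  have h2 : fc (fun _ => (1 : ℂ)) (n - m) = (2 * Real.pi : ℂ)⁻¹ *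
      ∫ t in (0 : ℝ)..(2 * Real.pi), exp (((-(n - m) : ℤ) : ℂ) * I * t) := by
    simp only [fc, one_mul]
    congr 2
    funext t
    rw [Circle.coe_exp, ← Complex.exp_int_mul]
    congr 1; push_cast; ring
  rw [h2]
  split_ifs with hnm
  · subst hnm
    simp only [sub_self, neg_zero, Int.cast_zero, zero_mul, exp_zero, intervalIntegral.integral_const,
      sub_zero]
    rw [real_smul]
    push_cast
    field_simp
  · have hne : (((-(n - m) : ℤ) : ℂ) * I) ≠ 0 := by
      refine mul_ne_zero (by exact_mod_cast (by omega : -(n - m) ≠ 0)) I_ne_zero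
    rw [integral_exp_mul_complex hne]
    have : exp (((-(n - m) : ℤ) : ℂ) * I * ((2 * Real.pi : ℝ) : ℂ)) = 1 := by
      rw [Complex.exp_eq_one_iff]
      exact ⟨-(n - m), by push_cast; ring⟩
    rw [this]; simp

theorem norm_fc_le {q : Circle → ℂ} {C : ℝ} (h : ∀ ζ, ‖q ζ‖ ≤ C) (n : ℤ) : ‖fc q n‖ ≤ C := by
  have h1 := intervalIntegral.norm_integral_le_of_norm_le_const (a := 0) (b := 2 * Real.pi)
    (f := fun t : ℝ => q (Circle.exp t) * (Circle.exp t : ℂ) ^ (-n)) (C := C) fun t _ => by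
      rw [norm_mul, norm_zpow, Circle.norm_coe, one_zpow, mul_one]; exact h _
  have hpi := Real.pi_pos
  rw [sub_zero, abs_of_pos (by positivity)] at h1
  rw [fc, norm_mul, norm_inv, norm_mul, Complex.norm_ofNat, norm_real, Real.norm_eq_abs,
    abs_of_pos hpi, inv_mul_le_iff₀ (by positivity)]
  linarith

/-- With all coefficients zero, the Fourier series is trivially summable, and a continuous function
with summable Fourier coefficients is the sum of its series. -/
theorem eq_zero_of_fc {q : Circle → ℂ} (hq : Continuous q) (h : ∀ n, fc q n = 0) : q = 0 := by
  have : Fact (0 < 2 * Real.pi) := ⟨by positivity⟩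
  set f : C(AddCircle (2 * Real.pi), ℂ) :=
    ⟨fun x => q (AddCircle.homeomorphCircle' x), hq.comp AddCircle.homeomorphCircle'.continuous⟩
    with hf
  have h1 : ∀ n, fourierCoeff f n = 0 := fun n => by
    rw [fourierCoeff_eq_intervalIntegral f n 0, zero_add]
    have h2 := h n
    rw [fc, mul_eq_zero] at h2
    have h3 := h2.resolve_left (by simp [Real.pi_ne_zero])
    rw [smul_eq_zero]
    right
    rw [← h3]
    congr 1
    funext t
    rw [smul_eq_mul, mul_comm, fourier_coe_apply]
    congr 1
    rw [Circle.coe_exp, ← Complex.exp_int_mul]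
    congr 1
    have := Real.pi_ne_zero
    push_cast
    field_simp
  have h4 := hasSum_fourier_series_of_summable (f := f) (by rw [funext h1]; exact summable_zero)
  simp only [h1, zero_smul] at h4
  have h5 : f = 0 := h4.unique hasSum_zero
  funext ζ
  have h6 := congrArg (fun g : C(AddCircle (2 * Real.pi), ℂ) =>
    g (AddCircle.homeomorphCircle'.symm ζ)) h5
  exact (congrArg q (AddCircle.homeomorphCircle'.apply_symm_apply ζ)).symm.trans h6

theorem eq_of_fc {p q : Circle → ℂ} (hp : Continuous p) (hq : Continuous q)
    (h : ∀ n, fc p n = fc q n) : p = q := by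
  have := eq_zero_of_fc (q := fun ζ => p ζ - q ζ) (hp.sub hq) fun n => by
    rw [fc_sub hp hq, h, sub_self]
  funext ζ
  exact sub_eq_zero.1 (congrFun this ζ)

theorem fc_of_hasDerivAt {q q' : Circle → ℂ} (hq' : Continuous q')
    (h : ∀ t, HasDerivAt (angular q) (q' (Circle.exp t)) t) (n : ℤ) : fc q' n = I * n * fc q n := by
  have hv : ∀ t : ℝ, HasDerivAt (fun t : ℝ => (Circle.exp t : ℂ) ^ (-n))
      (-(I * n) * (Circle.exp t : ℂ) ^ (-n)) t := fun t => by
    have e1 : (fun t : ℝ => (Circle.exp t : ℂ) ^ (-n)) = fun t : ℝ => exp (-(I * n) * (t : ℂ)) := by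
      funext t
      rw [Circle.coe_exp, ← Complex.exp_int_mul]
      congr 1; push_cast; ring
    have e2 := congrFun e1 t
    rw [e1]
    refine HasDerivAt.congr_deriv ?_ (congrArg (-(I * n) * ·) e2.symm)
    have e3 : HasDerivAt (fun z : ℂ => exp (-(I * n) * z))
        (exp (-(I * n) * (t : ℂ)) * (-(I * n))) (t : ℂ) := by
      simpa using ((hasDerivAt_id (t : ℂ)).const_mul (-(I * n))).cexp
    exact e3.comp_ofReal.congr_deriv (mul_comm _ _)
  have hc : Continuous (angular q) := continuous_iff_continuousAt.2 fun t => (h t).continuousAt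
  have e := intervalIntegral.integral_mul_deriv_eq_deriv_mul (a := 0) (b := 2 * Real.pi)
    (fun t _ => h t) (fun t _ => hv t) ((hq'.comp Circle.exp.continuous).intervalIntegrable _ _)
    ((continuous_const.mul (continuous_exp_zpow (-n))).intervalIntegrable _ _)
  have e4 : angular q (2 * Real.pi) = angular q 0 := by
    simpa using CH.periodic_angular q 0
  have e5 : (Circle.exp (2 * Real.pi) : ℂ) = Circle.exp 0 := by simp
  rw [e4, e5, sub_self, zero_sub] at e
  rw [fc, fc, ← neg_eq_iff_eq_neg.2 e]
  rw [show (fun t => angular q t * (-(I * n) * (Circle.exp t : ℂ) ^ (-n))) =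
    fun t => -(I * n) * (q (Circle.exp t) * (Circle.exp t : ℂ) ^ (-n)) from
      funext fun t => by simp only [angular]; ring]
  rw [intervalIntegral.integral_const_mul]
  ring

theorem circleIntegral_eq {f : ℂ → ℂ} {q : Circle → ℂ} (h : ∀ ζ : Circle, f ζ = q ζ) :
    (∮ z in C(0, 1), f z) = 2 * Real.pi * I * fc q (-1) := by
  rw [circleIntegral, fc, ← mul_assoc, show (2 * Real.pi * I * (2 * Real.pi : ℂ)⁻¹) = I by
    have := Real.pi_ne_zero
    field_simp, ← intervalIntegral.integral_const_mul]
  congr 1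
  funext t
  have : circleMap 0 1 t = Circle.exp t := by simp [circleMap]
  rw [deriv_circleMap, this, h, smul_eq_mul, neg_neg, zpow_one]
  ring

/-- The coefficient of order -1 - m is the Cauchy integral of z^m f, which vanishes. -/
theorem fc_neg_of_diffContOnCl {f : ℂ → ℂ} (hf : DiffContOnCl ℂ f (ball 0 1)) {q : Circle → ℂ}
    (h : ∀ ζ : Circle, f ζ = q ζ) {n : ℤ} (hn : n < 0) : fc q n = 0 := by
  obtain ⟨m, rfl⟩ : ∃ m : ℕ, n = -1 - m := ⟨(-1 - n).toNat, by omega⟩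
  have h1 : DiffContOnCl ℂ (fun z => z ^ m * f z) (ball 0 1) := by
    have : DiffContOnCl ℂ (fun z : ℂ => z ^ m) (ball 0 1) :=
      (differentiable_id.pow m).diffContOnCl
    simpa only [smul_eq_mul] using! this.smul hf
  have h2 := circleIntegral_eq (f := fun z => z ^ m * f z) (q := fun ζ => (ζ : ℂ) ^ m * q ζ)
    fun ζ => by rw [h]
  rw [h1.circleIntegral_eq_zero zero_le_one, fc_pow_mul] at h2
  have := Real.pi_ne_zero
  symm at h2
  simpa [this] using h2

/-- No holomorphy of `f` is involved. The identity is applied to an extension of an arbitrary Hölder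
function off the circle, and also to the holomorphic extension of its projection, in order to
compare their coefficients. -/
theorem fc_eq_of_hasFPowerSeries {f : ℂ → ℂ} {q : Circle → ℂ} (h : ∀ ζ : Circle, f ζ = q ζ)
    (n : ℕ) : cauchyPowerSeries f 0 1 n (fun _ => 1) = fc q n := by
  rw [cauchyPowerSeries_apply]
  have := circleIntegral_eq (f := fun z => (1 / (z - 0)) ^ n • (z - 0)⁻¹ • f z)
    (q := fun ζ => (ζ : ℂ) ^ (-(n : ℤ) - 1) * q ζ) fun ζ => by
      rw [h, smul_eq_mul, smul_eq_mul, sub_zero, zpow_sub₀ (Circle.coe_ne_zero _)]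
      simp [div_eq_mul_inv, mul_assoc]
  rw [this, fc_zpow_mul, smul_eq_mul, ← mul_assoc, inv_mul_cancel₀, one_mul]
  · congr 1; ring
  · simp [Real.pi_ne_zero]

theorem fc_zero_of_diffContOnCl {f : ℂ → ℂ} (hf : DiffContOnCl ℂ f (ball 0 1)) {q : Circle → ℂ}
    (h : ∀ ζ : Circle, f ζ = q ζ) : f 0 = fc q 0 := by
  have h1 := (hf.hasFPowerSeriesOnBall (R := 1) one_pos).coeff_zero (fun _ => 1)
  rw [← h1]
  exact fc_eq_of_hasFPowerSeries h 0

section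

variable {k : ℕ} {α : ℝ}

/-- The Fourier coefficient as a continuous linear map. -/
def fcL (n : ℤ) : CH ℂ k α →L[ℝ] ℂ :=
  LinearMap.mkContinuous
    { toFun := fun u => fc u.1 n
      map_add' := fun u v => fc_add u.continuous v.continuous n
      map_smul' := fun a u => by
        rw [RingHom.id_apply, real_smul, ← fc_const_mul]
        congr 1 } 1
    fun u => by rw [one_mul]; exact norm_fc_le (fun ζ => CH.norm_apply_le u ζ) n

@[simp] theorem fcL_apply (n : ℤ) (u : CH ℂ k α) : fcL n u = fc u.1 n := rfl

theorem CH.ext_fc {u v : CH ℂ k α} (h : ∀ n, fc u.1 n = fc v.1 n) : u = v :=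
  CH.ext fun ζ => congrFun (eq_of_fc u.continuous v.continuous h) ζ

end

end KStat

end

set_option linter.unusedSectionVars false

noncomputable section

namespace KStat

/-! ## The Szegő projection on Hölder spaces -/

open Filter Topology

section HardyLittlewood

variable {F : ℂ → ℂ} {K α : ℝ}

/-- The derivative bound is integrated along a radius, where K(1-s)^(α-1) has the primitive
-(K/α)(1-s)^α. The integrability of this singularity is what yields boundary values. -/
theorem norm_radial_sub_le (hα : 0 < α) (hα1 : α < 1) (hF : DifferentiableOn ℂ F (ball 0 1))
    (hK : ∀ w ∈ ball (0 : ℂ) 1, ‖deriv F w‖ ≤ K * (1 - ‖w‖) ^ (α - 1)) {z : ℂ} (hz : ‖z‖ ≤ 1)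
    {r r' : ℝ} (hr : 0 ≤ r) (hrr' : r ≤ r') (hr' : r' < 1) :
    ‖F (r' * z) - F (r * z)‖ ≤ K / α * (1 - r) ^ α := by
  have hK0 : 0 ≤ K := by
    have := (norm_nonneg _).trans (hK 0 (by simp))
    simpa using this
  have hmem : ∀ s ∈ Set.Icc r r', (s : ℂ) * z ∈ ball (0 : ℂ) 1 := fun s hs => by
    rw [mem_ball_zero_iff, norm_mul, norm_real, Real.norm_eq_abs, abs_of_nonneg (hr.trans hs.1)]
    have : s * ‖z‖ ≤ s * 1 := mul_le_mul_of_nonneg_left hz (hr.trans hs.1)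
    linarith [hs.2]
  have hd : ∀ s ∈ Set.Icc r r', HasDerivAt (fun s : ℝ => F (s * z) - F (r * z))
      (deriv F (s * z) * z) s := fun s hs => by
    have h1 := ((hF.differentiableAt (isOpen_ball.mem_nhds (hmem s hs))).hasDerivAt)
    have h2 : HasDerivAt (fun s : ℂ => s * z) z (s : ℂ) := by
      simpa using (hasDerivAt_id (s : ℂ)).mul_const z
    exact ((h1.comp (s : ℂ) h2).comp_ofReal).sub_const _
  have hB : ∀ s ∈ Set.Icc r r', HasDerivAt (fun s : ℝ => K / α * ((1 - r) ^ α - (1 - s) ^ α))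
      (K * (1 - s) ^ (α - 1)) s := fun s hs => by
    have h1 : HasDerivAt (fun s : ℝ => (1 - s) ^ α) (-1 * α * (1 - s) ^ (α - 1)) s :=
      ((hasDerivAt_id s).const_sub 1).rpow_const (Or.inl (by simp; linarith [hs.2]))
    refine ((h1.const_sub ((1 - r) ^ α)).const_mul (K / α)).congr_deriv ?_
    field_simp
  have h := image_norm_le_of_norm_deriv_right_le_deriv_boundary' (a := r) (b := r')
    (fun s hs => (hd s hs).continuousAt.continuousWithinAt)
    (fun s hs => (hd s (Set.Ico_subset_Icc_self hs)).hasDerivWithinAt)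
    (B := fun s : ℝ => K / α * ((1 - r) ^ α - (1 - s) ^ α)) (by simp)
    (fun s hs => (hB s hs).continuousAt.continuousWithinAt)
    (fun s hs => (hB s (Set.Ico_subset_Icc_self hs)).hasDerivWithinAt)
    (fun s hs => by
      have hs' := Set.Ico_subset_Icc_self hs
      rw [norm_mul]
      have h1 := hK _ (hmem s hs')
      have h2 : ‖(s : ℂ) * z‖ ≤ s := by
        rw [norm_mul, norm_real, Real.norm_eq_abs, abs_of_nonneg (hr.trans hs.1)]
        exact mul_le_of_le_one_right (hr.trans hs.1) hz
      have h3 : (1 - ‖(s : ℂ) * z‖) ^ (α - 1) ≤ (1 - s) ^ (α - 1) :=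
        Real.rpow_le_rpow_of_nonpos (by linarith [hs.2]) (by linarith) (by linarith)
      calc ‖deriv F (s * z)‖ * ‖z‖ ≤ ‖deriv F (s * z)‖ * 1 := by gcongr
        _ ≤ K * (1 - ‖(s : ℂ) * z‖) ^ (α - 1) := by rw [mul_one]; exact h1
        _ ≤ K * (1 - s) ^ (α - 1) := by gcongr)
    (Set.right_mem_Icc.2 hrr')
  refine h.trans ?_
  have h4 : 0 ≤ (1 - r') ^ α := Real.rpow_nonneg (by linarith) _
  gcongr
  linarith

theorem norm_disc_sub_le (hα1 : α < 1) (hF : DifferentiableOn ℂ F (ball 0 1))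
    (hK : ∀ w ∈ ball (0 : ℂ) 1, ‖deriv F w‖ ≤ K * (1 - ‖w‖) ^ (α - 1)) {r : ℝ} (hr : 0 ≤ r)
    (hr1 : r < 1) {z z' : ℂ} (hz : ‖z‖ ≤ 1) (hz' : ‖z'‖ ≤ 1) :
    ‖F (r * z) - F (r * z')‖ ≤ K * (1 - r) ^ (α - 1) * ‖z - z'‖ := by
  have hK0 : 0 ≤ K := by
    have := (norm_nonneg _).trans (hK 0 (by simp))
    simpa using this
  have hmem : ∀ z : ℂ, ‖z‖ ≤ 1 → (r : ℂ) * z ∈ closedBall (0 : ℂ) r := fun z hz => by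
    rw [mem_closedBall_zero_iff, norm_mul, norm_real, Real.norm_eq_abs, abs_of_nonneg hr]
    exact mul_le_of_le_one_right hr hz
  have hsub : closedBall (0 : ℂ) r ⊆ ball 0 1 := closedBall_subset_ball hr1
  have h := (convex_closedBall (0 : ℂ) r).norm_image_sub_le_of_norm_deriv_le (𝕜 := ℂ) (f := F)
    (C := K * (1 - r) ^ (α - 1))
    (fun w hw => hF.differentiableAt (isOpen_ball.mem_nhds (hsub hw)))
    (fun w hw => (hK w (hsub hw)).trans (by
      have : ‖w‖ ≤ r := by simpa using hw
      exact mul_le_mul_of_nonneg_left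
        (Real.rpow_le_rpow_of_nonpos (by linarith) (by linarith) (by linarith)) hK0))
    (hmem z' hz') (hmem z hz)
  refine h.trans ?_
  rw [← mul_sub, norm_mul, norm_real, Real.norm_eq_abs, abs_of_nonneg hr]
  have h5 : 0 ≤ K * (1 - r) ^ (α - 1) := mul_nonneg hK0 (Real.rpow_nonneg (by linarith) _)
  exact mul_le_mul_of_nonneg_left (mul_le_of_le_one_left (norm_nonneg _) hr1.le) h5

/-- **Hardy–Littlewood**: a holomorphic function whose derivative is `O((1-|w|)^{α-1})` extends
continuously to the closed disc, with Hölder continuous boundary values. -/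
theorem exists_extension_of_deriv_bound (hα : 0 < α) (hα1 : α < 1)
    (hF : DifferentiableOn ℂ F (ball 0 1))
    (hK : ∀ w ∈ ball (0 : ℂ) 1, ‖deriv F w‖ ≤ K * (1 - ‖w‖) ^ (α - 1)) :
    ∃ G : ℂ → ℂ, DiffContOnCl ℂ G (ball 0 1) ∧ (∀ z ∈ ball (0 : ℂ) 1, G z = F z) ∧
      ∃ C, ∀ ζ ξ : Circle, ‖G ζ - G ξ‖ ≤ C * ‖(ζ : ℂ) - ξ‖ ^ α := by
  have hK0 : 0 ≤ K := by
    have := (norm_nonneg _).trans (hK 0 (by simp))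
    simpa using this
  set ρ : ℕ → ℝ := fun n => 1 - 1 / ((n : ℝ) + 1) with hρ
  have hρ0 : ∀ n, 0 ≤ ρ n := fun n => by
    have : 1 / ((n : ℝ) + 1) ≤ 1 := by
      rw [div_le_one (by positivity)]; linarith [n.cast_nonneg (α := ℝ)]
    simp only [hρ]; linarith
  have hρ1 : ∀ n, ρ n < 1 := fun n => by
    have : 0 < 1 / ((n : ℝ) + 1) := by positivity
    simp only [hρ]; linarith
  have hmono : Monotone ρ := fun m n h => by
    have : 1 / ((n : ℝ) + 1) ≤ 1 / ((m : ℝ) + 1) := by gcongr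
    simp only [hρ]; linarith
  have hlim : Tendsto ρ atTop (𝓝 1) := by
    have h := (tendsto_one_div_add_atTop_nhds_zero_nat (𝕜 := ℝ)).const_sub 1
    rwa [sub_zero] at h
  have hlim2 : Tendsto (fun n => K / α * (1 - ρ n) ^ α) atTop (𝓝 0) := by
    have h1 : Tendsto (fun n => 1 - ρ n) atTop (𝓝 0) := by simpa using hlim.const_sub 1
    have h2 := (h1.rpow_const (Or.inr hα.le)).const_mul (K / α)
    simpa [Real.zero_rpow hα.ne'] using h2
  have hcauchy : UniformCauchySeqOn (fun n z => F (ρ n * z)) atTop (closedBall (0 : ℂ) 1) := by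
    rw [Metric.uniformCauchySeqOn_iff]
    intro ε hε
    obtain ⟨N, hN⟩ := (hlim2.eventually (gt_mem_nhds (half_pos hε))).exists
    have key : ∀ n ≥ N, ∀ z ∈ closedBall (0 : ℂ) 1, dist (F (ρ n * z)) (F (ρ N * z)) < ε / 2 := by
      intro n hn z hz
      rw [dist_eq_norm]
      exact (norm_radial_sub_le hα hα1 hF hK (by simpa using hz) (hρ0 N) (hmono hn) (hρ1 n)).trans_lt
        hN
    refine ⟨N, fun m hm n hn z hz => ?_⟩
    have := dist_triangle_right (F (ρ m * z)) (F (ρ n * z)) (F (ρ N * z))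
    linarith [key m hm z hz, key n hn z hz]
  have hex : ∀ z : ℂ, ∃ y, z ∈ closedBall (0 : ℂ) 1 → Tendsto (fun n => F (ρ n * z)) atTop (𝓝 y) := by
    intro z
    by_cases hz : z ∈ closedBall (0 : ℂ) 1
    · obtain ⟨y, hy⟩ := cauchySeq_tendsto_of_complete (hcauchy.cauchySeq hz)
      exact ⟨y, fun _ => hy⟩
    · exact ⟨0, fun h => absurd h hz⟩
  choose G hG using hex
  have hunif := hcauchy.tendstoUniformlyOn_of_tendsto hG
  have hGF : ∀ z ∈ ball (0 : ℂ) 1, G z = F z := fun z hz => by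
    refine tendsto_nhds_unique (hG z (ball_subset_closedBall hz)) ?_
    have h1 : Tendsto (fun n => (ρ n : ℂ) * z) atTop (𝓝 z) := by
      have := ((continuous_ofReal.tendsto 1).comp hlim).mul_const z
      simpa using this
    exact ((hF.differentiableAt (isOpen_ball.mem_nhds hz)).continuousAt.tendsto).comp h1
  have hGr : ∀ z ∈ closedBall (0 : ℂ) 1, ∀ r : ℝ, 0 ≤ r → r < 1 →
      ‖G z - F (r * z)‖ ≤ K / α * (1 - r) ^ α := fun z hz r hr hr1 => by
    refine le_of_tendsto ((hG z hz).sub_const _).norm ?_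
    filter_upwards [hlim.eventually (lt_mem_nhds hr1)] with n hn
    exact norm_radial_sub_le hα hα1 hF hK (by simpa using hz) hr hn.le (hρ1 n)
  refine ⟨G, ⟨hF.congr hGF, ?_⟩, hGF, 2 * (K / α) + K + 2 * (K / α), fun ζ ξ => ?_⟩
  · rw [closure_ball _ one_ne_zero]
    refine hunif.continuousOn (Frequently.of_forall fun n => ?_)
    refine hF.continuousOn.comp (by fun_prop) fun z hz => ?_
    rw [mem_ball_zero_iff, norm_mul, norm_real, Real.norm_eq_abs, abs_of_nonneg (hρ0 n)]
    have : ‖z‖ ≤ 1 := by simpa using hz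
    nlinarith [hρ0 n, hρ1 n]
  · have hζ : (ζ : ℂ) ∈ closedBall (0 : ℂ) 1 :=
      mem_closedBall_zero_iff.2 (Circle.norm_coe ζ).le
    have hξ : (ξ : ℂ) ∈ closedBall (0 : ℂ) 1 :=
      mem_closedBall_zero_iff.2 (Circle.norm_coe ξ).le
    set c := ‖(ζ : ℂ) - ξ‖ with hc
    have hKα : 0 ≤ K / α := by positivity
    -- Two boundary points are joined by moving radially inwards to radius `r`, then across, then
    -- radially outwards.
    have tri : ∀ r : ℝ, 0 ≤ r → r < 1 → ‖G ζ - G ξ‖ ≤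
        K / α * (1 - r) ^ α + K * (1 - r) ^ (α - 1) * c + K / α * (1 - r) ^ α := fun r hr hr1 => by
      have e1 := hGr ζ hζ r hr hr1
      have e2 := hGr ξ hξ r hr hr1
      have e3 := norm_disc_sub_le hα1 hF hK hr hr1 (z := (ζ : ℂ)) (z' := ξ)
        (Circle.norm_coe ζ).le (Circle.norm_coe ξ).le
      rw [norm_sub_rev] at e2
      have e4 : G ζ - G ξ = (G ζ - F (r * ζ)) + (F (r * ζ) - F (r * ξ)) + (F (r * ξ) - G ξ) := by
        ring
      rw [e4]
      exact (norm_add_le _ _).trans (add_le_add ((norm_add_le _ _).trans (add_le_add e1 e3)) e2)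
    rcases (norm_nonneg ((ζ : ℂ) - ξ)).eq_or_lt with h0 | h0
    · have : (ζ : ℂ) = ξ := by
        rw [← sub_eq_zero, ← norm_eq_zero]; exact h0.symm
      rw [this, sub_self, norm_zero]
      positivity
    · rw [← hc] at h0
      -- For c ≤ 1 the radius 1 - c balances the radial and the transversal terms, each becoming a
      -- multiple of c^α. For c > 1 the centre serves as intermediate point; there c ≤ 2 ≤ 2c^α and
      -- K ≤ K/α explain the second 2(K/α) in the constant.
      rcases le_or_gt c 1 with h1 | h1
      · have := tri (1 - c) (by linarith) (by linarith)
        rw [sub_sub_cancel] at this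
        have e5 : c ^ (α - 1) * c = c ^ α := by
          rw [← Real.rpow_add_one h0.ne']; simp
        refine this.trans (le_of_sub_nonneg ?_)
        have : 0 ≤ c ^ α := by positivity
        rw [mul_assoc, e5]
        nlinarith [mul_nonneg hKα this]
      · have := tri 0 le_rfl one_pos
        simp only [sub_zero, Real.one_rpow, mul_one] at this
        have e6 : 1 ≤ c ^ α := Real.one_le_rpow h1.le hα.le
        have e7 : c ≤ 2 := by
          refine (norm_sub_le _ _).trans ?_
          rw [Circle.norm_coe, Circle.norm_coe]; norm_num
        have e8 : c ≤ 2 * c ^ α := by linarith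
        have e9 : c ≤ c ^ α * 2 := by linarith
        refine this.trans ?_
        have f1 : K * c ≤ K * (2 * c ^ α) := by gcongr
        have f2 : K / α ≤ K / α * c ^ α := le_mul_of_one_le_right hKα e6
        have f3 : K ≤ K / α := by
          rw [le_div_iff₀ hα]; nlinarith
        have f4 : K * c ^ α ≤ K / α * c ^ α := by gcongr
        nlinarith

end HardyLittlewood

/-! ### The Cauchy integral of a Hölder function -/

section CauchyIntegral

variable {α : ℝ} [HolderExponent α]

theorem integral_rpow_kernel_le {α δ : ℝ} (hα1 : α < 1) (hδ : 0 < δ) :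
    ∫ s in (0 : ℝ)..Real.pi, (δ + s) ^ (α - 2) ≤ δ ^ (α - 1) / (1 - α) := by
  have hpi := Real.pi_pos
  rw [intervalIntegral.integral_comp_add_left (fun s => s ^ (α - 2)), add_zero, integral_rpow]
  · rw [show α - 2 + 1 = -(1 - α) by ring, div_neg, ← neg_div, neg_sub]
    have : 0 ≤ (δ + Real.pi) ^ (-(1 - α)) := by positivity
    rw [show α - 1 = -(1 - α) by ring]
    have h1 : 0 < 1 - α := by linarith
    gcongr
    linarith
  · right
    refine ⟨by linarith, ?_⟩
    rw [Set.uIcc_of_le (by linarith)]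
    intro h
    linarith [h.1]

theorem integral_even_le {f : ℝ → ℝ} {g : ℝ → ℝ} (hf : Continuous f)
    (hg : ContinuousOn g (Set.Icc 0 Real.pi))
    (h : ∀ s, |s| ≤ Real.pi → f s ≤ g |s|) :
    ∫ s in (-Real.pi)..Real.pi, f s ≤ 2 * ∫ s in (0 : ℝ)..Real.pi, g s := by
  have hpi := Real.pi_pos
  have hgi : IntervalIntegrable g MeasureTheory.volume 0 Real.pi := by
    apply ContinuousOn.intervalIntegrable
    rwa [Set.uIcc_of_le hpi.le]
  rw [← intervalIntegral.integral_add_adjacent_intervals (b := 0) (hf.intervalIntegrable _ _)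
    (hf.intervalIntegrable _ _)]
  have h1 : ∫ s in (-Real.pi)..0, f s = ∫ s in (0 : ℝ)..Real.pi, f (-s) := by
    rw [intervalIntegral.integral_comp_neg]; simp
  rw [h1, two_mul]
  refine add_le_add ?_ ?_
  · refine intervalIntegral.integral_mono_on hpi.le
      ((hf.comp continuous_neg).intervalIntegrable _ _) hgi fun s hs => ?_
    have := h (-s) (by rw [abs_neg, abs_of_nonneg hs.1]; exact hs.2)
    rwa [abs_neg, abs_of_nonneg hs.1] at this
  · refine intervalIntegral.integral_mono_on hpi.le (hf.intervalIntegrable _ _) hgi fun s hs => ?_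
    have := h s (by rw [abs_of_nonneg hs.1]; exact hs.2)
    rwa [abs_of_nonneg hs.1] at this

theorem norm_exp_sub_ge {φ s : ℝ} (hs : |s| ≤ Real.pi) :
    2 / Real.pi * |s| ≤ ‖(Circle.exp (φ + s) : ℂ) - Circle.exp φ‖ := by
  have h4 : (Circle.exp (φ + s) : ℂ) - Circle.exp φ = Circle.exp φ * (exp (I * (s : ℂ)) - 1) := by
    simp only [Circle.coe_exp, mul_sub, ← Complex.exp_add, mul_one]
    congr 2
    push_cast; ring
  rw [h4, norm_mul, Circle.norm_coe, one_mul, Complex.norm_exp_I_mul_ofReal_sub_one, norm_mul,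
    Real.norm_eq_abs, Real.norm_eq_abs, abs_two]
  have h6 := Real.mul_abs_le_abs_sin (x := s / 2) (by rw [abs_div, abs_two]; linarith)
  rw [abs_div, abs_two] at h6
  linarith


theorem circleMap_zero_one (t : ℝ) : circleMap 0 1 t = Circle.exp t := by simp [circleMap]

theorem circleExp_sub_ne_zero (t : ℝ) {w : ℂ} (hw : ‖w‖ < 1) : (Circle.exp t : ℂ) - w ≠ 0 := by
  intro h
  rw [sub_eq_zero] at h
  rw [← h, Circle.norm_coe] at hw
  exact lt_irrefl _ hw

/-- Let D be the distance from e^{i(φ+s)} to the point re^{iφ} and c the distance to e^{iφ}. Then D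
≥ 1 - r and D ≥ c/2 ≥ |s|/π, hence D ≥ ((1-r) + |s|)/(2π). The integrand M c^α/D² is thus dominated
by a constant times ((1-r) + |s|)^(α-2), whose integral is of order (1-r)^(α-1). -/
theorem norm_cauchy_kernel_integral_le {u : Circle → ℂ} (hu : Continuous u) {M : ℝ} (hM : 0 ≤ M)
    (hM' : ∀ ζ ξ : Circle, ‖u ζ - u ξ‖ ≤ M * ‖(ζ : ℂ) - ξ‖ ^ α) (φ : ℝ) {r : ℝ} (hr : 0 ≤ r)
    (hr1 : r < 1) :
    ∫ θ in (0 : ℝ)..(2 * Real.pi), ‖u (Circle.exp θ) - u (Circle.exp φ)‖ /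
      ‖(Circle.exp θ : ℂ) - r * Circle.exp φ‖ ^ 2 ≤
      4 * M * (2 * Real.pi) ^ (2 - α) / (1 - α) * (1 - r) ^ (α - 1) := by
  have hα : 0 < α := HolderExponent.pos
  have hα1 : α < 1 := HolderExponent.lt_one
  have hpi := Real.pi_pos
  have hw : ‖(r : ℂ) * Circle.exp φ‖ < 1 := by
    rw [norm_mul, Circle.norm_coe, norm_real, Real.norm_eq_abs, abs_of_nonneg hr, mul_one]
    exact hr1
  set g : ℝ → ℝ := fun θ => ‖u (Circle.exp θ) - u (Circle.exp φ)‖ /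
      ‖(Circle.exp θ : ℂ) - r * Circle.exp φ‖ ^ 2 with hg
  have hgc : Continuous g := by
    refine Continuous.div (by fun_prop) (by fun_prop) fun θ => ?_
    exact pow_ne_zero 2 (norm_ne_zero_iff.2 (circleExp_sub_ne_zero θ hw))
  have hper : Function.Periodic g (2 * Real.pi) := fun θ => by
    simp only [hg]
    rw [Circle.periodic_exp θ]
  have e1 : ∫ θ in (0 : ℝ)..(2 * Real.pi), g θ = ∫ s in (-Real.pi)..Real.pi, g (φ + s) := by
    rw [intervalIntegral.integral_comp_add_left g φ]
    have := hper.intervalIntegral_add_eq 0 (φ + -Real.pi)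
    rw [zero_add] at this
    rw [this]
    congr 1; ring
  have hδ : 0 < 1 - r := by linarith
  rw [e1]
  have e2 := integral_even_le (f := fun s => g (φ + s))
    (g := fun s => 2 * M * (2 * Real.pi) ^ (2 - α) * ((1 - r) + s) ^ (α - 2))
    (hgc.comp (by fun_prop)) ?_ ?_
  · refine e2.trans ?_
    rw [intervalIntegral.integral_const_mul]
    have e3 := integral_rpow_kernel_le hα1 hδ
    have e4 : 0 ≤ 2 * M * (2 * Real.pi) ^ (2 - α) := by positivity
    calc 2 * (2 * M * (2 * Real.pi) ^ (2 - α) * ∫ s in (0 : ℝ)..Real.pi, (1 - r + s) ^ (α - 2))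
        ≤ 2 * (2 * M * (2 * Real.pi) ^ (2 - α) * ((1 - r) ^ (α - 1) / (1 - α))) := by gcongr
      _ = _ := by ring
  · refine continuousOn_const.mul (ContinuousOn.rpow_const (by fun_prop) fun s hs => Or.inl ?_)
    have := hs.1
    linarith
  · intro s hs
    set D := ‖(Circle.exp (φ + s) : ℂ) - r * Circle.exp φ‖ with hD
    set c := ‖(Circle.exp (φ + s) : ℂ) - Circle.exp φ‖ with hc
    have d1 : 1 - r ≤ D := by
      have := norm_sub_norm_le (Circle.exp (φ + s) : ℂ) (r * Circle.exp φ)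
      rw [Circle.norm_coe, norm_mul, Circle.norm_coe, norm_real, Real.norm_eq_abs,
        abs_of_nonneg hr, mul_one] at this
      exact this
    have hDpos : 0 < D := hδ.trans_le d1
    have d2 : c ≤ 2 * D := by
      have h1 : (Circle.exp (φ + s) : ℂ) - Circle.exp φ =
          ((Circle.exp (φ + s) : ℂ) - r * Circle.exp φ) - (1 - r : ℝ) * Circle.exp φ := by
        push_cast; ring
      have h2 : ‖((1 - r : ℝ) : ℂ) * Circle.exp φ‖ = 1 - r := by
        rw [norm_mul, Circle.norm_coe, norm_real, Real.norm_eq_abs, abs_of_pos hδ, mul_one]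
      have h3 := norm_sub_le ((Circle.exp (φ + s) : ℂ) - r * Circle.exp φ)
        (((1 - r : ℝ) : ℂ) * Circle.exp φ)
      rw [← h1, h2] at h3
      linarith
    have d3 : ((1 - r) + |s|) / (2 * Real.pi) ≤ D := by
      have h1 := norm_exp_sub_ge (φ := φ) hs
      rw [← hc] at h1
      have h2 : |s| / Real.pi ≤ D := by
        have : 2 / Real.pi * |s| = 2 * (|s| / Real.pi) := by ring
        linarith
      have h3 : (1 - r) / Real.pi ≤ D := by
        refine le_trans ?_ d1
        exact div_le_self hδ.le (by linarith [Real.pi_gt_three])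
      have h4 : ((1 - r) + |s|) / (2 * Real.pi) = ((1 - r) / Real.pi + |s| / Real.pi) / 2 := by
        field_simp
      rw [h4]; linarith
    have hspos : 0 < (1 - r) + |s| := by positivity
    have e5 : c ^ α ≤ 2 * D ^ α := by
      calc c ^ α ≤ (2 * D) ^ α := Real.rpow_le_rpow (norm_nonneg _) d2 hα.le
        _ = 2 ^ α * D ^ α := Real.mul_rpow (by norm_num) hDpos.le
        _ ≤ 2 ^ (1 : ℝ) * D ^ α := by
            gcongr
            norm_num
        _ = 2 * D ^ α := by rw [Real.rpow_one]
    have e6 : D ^ (α - 2) ≤ (2 * Real.pi) ^ (2 - α) * ((1 - r) + |s|) ^ (α - 2) := by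
      calc D ^ (α - 2) ≤ (((1 - r) + |s|) / (2 * Real.pi)) ^ (α - 2) :=
            Real.rpow_le_rpow_of_nonpos (by positivity) d3 (by linarith)
        _ = _ := by
          rw [Real.div_rpow hspos.le (by positivity), show α - 2 = -(2 - α) by ring,
            Real.rpow_neg (x := 2 * Real.pi) (by positivity), div_inv_eq_mul, mul_comm]
    calc g (φ + s) = ‖u (Circle.exp (φ + s)) - u (Circle.exp φ)‖ / D ^ 2 := rfl
      _ ≤ M * c ^ α / D ^ 2 := by gcongr; exact hM' _ _
      _ ≤ M * (2 * D ^ α) / D ^ 2 := by gcongr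
      _ = 2 * M * D ^ (α - 2) := by
          rw [Real.rpow_sub hDpos, Real.rpow_two]; ring
      _ ≤ 2 * M * ((2 * Real.pi) ^ (2 - α) * ((1 - r) + |s|) ^ (α - 2)) := by gcongr
      _ = _ := by ring

/-- The projection is the boundary value of the Cauchy integral F of u. The kernel of F' has
integral zero, so the value of u at the radial projection of w may be subtracted under the integral;
the Hölder condition then gives F' = O((1-|w|)^(α-1)), and `exists_extension_of_deriv_bound`
applies. -/
theorem exists_szego_zero (u : CH ℂ 0 α) : ∃ φ : CH ℂ 0 α,
    (∃ G : ℂ → ℂ, DiffContOnCl ℂ G (ball 0 1) ∧ ∀ ζ : Circle, G ζ = φ ζ) ∧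
    ∀ n : ℕ, fc φ.1 n = fc u.1 n := by
  have hα : 0 < α := HolderExponent.pos
  have hα1 : α < 1 := HolderExponent.lt_one
  have hpi := Real.pi_pos
  have huc := u.continuous
  set f : ℂ → ℂ := fun z => u (Circle.exp (arg z)) with hf
  have hfu : ∀ ζ : Circle, f ζ = u ζ := fun ζ => by simp only [hf, Circle.exp_arg]
  have hint : CircleIntegrable f 0 1 := by
    have : (fun θ => f (circleMap 0 1 θ)) = fun θ => u (Circle.exp θ) := by
      funext θ; rw [circleMap_zero_one, hfu]
    rw [CircleIntegrable, this]
    exact (huc.comp Circle.exp.continuous).intervalIntegrable _ _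
  set F : ℂ → ℂ := fun w => (2 * Real.pi * I : ℂ)⁻¹ • ∮ z in C(0, 1), (z - w)⁻¹ • f z with hF
  have hFps : HasFPowerSeriesOnBall F (cauchyPowerSeries f 0 1) 0 1 := by
    have := hasFPowerSeriesOn_cauchy_integral (f := f) (c := 0) (R := 1)
      (by rw [NNReal.coe_one]; exact hint) one_pos
    simpa only [NNReal.coe_one, ENNReal.coe_one] using this
  have hFd : DifferentiableOn ℂ F (ball 0 1) := by
    have := hFps.differentiableOn
    rwa [← ENNReal.ofReal_one, Metric.eball_ofReal] at this
  set H : ℂ → ℂ := fun w => Real.circleAverage (fun ζ => herglotzRieszKernel 0 w ζ • f ζ) 0 1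
  have hcont : ∀ w : ℂ, ‖w‖ < 1 → ContinuousOn (fun z : ℂ => (z - w)⁻¹) (sphere 0 |1|) := by
    intro w hw
    refine ContinuousOn.inv₀ (by fun_prop) fun z hz h => ?_
    rw [sub_eq_zero] at h
    rw [← h] at hw
    simp at hz
    linarith
  -- The Cauchy kernel is half the sum of the Herglotz kernel and 1. This gives access to the
  -- derivative formula for the Herglotz integral.
  have hHF : ∀ w ∈ ball (0 : ℂ) 1, F w = (1 / 2 : ℂ) * (H w + fc u.1 0) := by
    intro w hw
    rw [mem_ball_zero_iff] at hw
    have i1 : CircleIntegrable (fun z => (z - w)⁻¹ • f z) 0 1 := hint.continuousOn_smul (hcont w hw)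
    have i2 : CircleIntegrable (fun z => (z - 0)⁻¹ • f z) 0 1 :=
      hint.continuousOn_smul (hcont 0 (by simp))
    have e1 : H w = (2 * Real.pi * I : ℂ)⁻¹ • ((2 : ℂ) • (∮ z in C(0, 1), (z - w)⁻¹ • f z)
        - ∮ z in C(0, 1), (z - 0)⁻¹ • f z) := by
      simp only [H]
      rw [Real.circleAverage_eq_circleIntegral one_ne_zero]
      congr 1
      rw [← circleIntegral.integral_smul, ← circleIntegral.integral_sub
        (f := fun z => (2 : ℂ) • ((z - w)⁻¹ • f z)) (i1.const_smul (a := (2 : ℂ))) i2]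
      refine circleIntegral.integral_congr zero_le_one fun z hz => ?_
      have hz1 : ‖z‖ = 1 := by simpa using hz
      have hz0 : z ≠ 0 := by rintro rfl; simp at hz1
      have hzw : z - w ≠ 0 := by
        intro h
        rw [sub_eq_zero] at h
        rw [← h, hz1] at hw
        exact lt_irrefl _ hw
      simp only [herglotzRieszKernel_def, smul_eq_mul, sub_zero]
      field_simp
      ring
    have e2 : fc u.1 0 = (2 * Real.pi * I : ℂ)⁻¹ • ∮ z in C(0, 1), (z - 0)⁻¹ • f z := by
      rw [circleIntegral_eq (q := fun ζ => (ζ : ℂ) ^ (-1 : ℤ) * u ζ)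
        (fun ζ => by rw [hfu, sub_zero, smul_eq_mul, zpow_neg_one]), fc_zpow_mul, smul_eq_mul,
        ← mul_assoc, inv_mul_cancel₀, one_mul]
      · congr 1
      · simp [Real.pi_ne_zero]
    rw [e1, e2, hF]
    simp only [smul_eq_mul]
    ring
  obtain ⟨M, hM, hM'⟩ := CH.exists_holder u
  set K : ℝ := (2 * Real.pi)⁻¹ * (4 * M * (2 * Real.pi) ^ (2 - α) / (1 - α)) with hK
  have hbound : ∀ w ∈ ball (0 : ℂ) 1, ‖deriv F w‖ ≤ K * (1 - ‖w‖) ^ (α - 1) := by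
    intro w hw
    have hw1 : ‖w‖ < 1 := by simpa using hw
    set a : ℂ := u (Circle.exp (arg w))
    have hwa : w = ‖w‖ * Circle.exp (arg w) := by
      rw [Circle.coe_exp]; exact (Complex.norm_mul_exp_arg_mul_I w).symm
    have hdH := hasDerivAt_circleAverage_herglotzRieszKernel_smul hint hw
    have hdF : HasDerivAt F ((1 / 2 : ℂ) *
        Real.circleAverage (fun ζ => (2 * ζ / (ζ - w) ^ 2) • f ζ) 0 1) w := by
      refine ((hdH.add_const (fc u.1 0)).const_mul (1 / 2 : ℂ)).congr_of_eventuallyEq ?_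
      filter_upwards [isOpen_ball.mem_nhds hw] with y hy using hHF y hy
    have hker : ∀ θ : ℝ, Circle.exp θ - w ≠ 0 := fun θ => circleExp_sub_ne_zero θ hw1
    have hkc : Continuous fun θ : ℝ => 2 * (Circle.exp θ : ℂ) / ((Circle.exp θ : ℂ) - w) ^ 2 :=
      Continuous.div (by fun_prop) (by fun_prop) fun θ => pow_ne_zero 2 (hker θ)
    -- The function (ζ - w)^(-2) has a primitive on the circle, so subtracting a constant from u
    -- leaves the derivative unchanged.
    have hzero : ∫ θ in (0 : ℝ)..(2 * Real.pi), 2 * (Circle.exp θ : ℂ) /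
        ((Circle.exp θ : ℂ) - w) ^ 2 = 0 := by
      have h1 := circleIntegral.integral_sub_zpow_of_ne (n := -2) (by norm_num) 0 w 1
      have h1 : (∮ z in C(0, 1), (z - w) ^ (-2 : ℤ)) = 0 :=
        circleIntegral.integral_sub_zpow_of_ne (by norm_num) 0 w 1
      rw [circleIntegral] at h1
      have h2 : ∀ θ : ℝ, deriv (circleMap 0 1) θ • (circleMap 0 1 θ - w) ^ (-2 : ℤ) =
          (I / 2) * (2 * (Circle.exp θ : ℂ) / ((Circle.exp θ : ℂ) - w) ^ 2) := fun θ => by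
        rw [deriv_circleMap, circleMap_zero_one, zpow_neg, smul_eq_mul, zpow_ofNat]
        ring
      simp only [h2] at h1
      rw [intervalIntegral.integral_const_mul] at h1
      simpa using h1
    have havg : Real.circleAverage (fun ζ => (2 * ζ / (ζ - w) ^ 2) • f ζ) 0 1 = (2 * Real.pi)⁻¹ •
        ∫ θ in (0 : ℝ)..(2 * Real.pi), (2 * (Circle.exp θ : ℂ) / ((Circle.exp θ : ℂ) - w) ^ 2) *
          (u (Circle.exp θ) - a) := by
      rw [Real.circleAverage_def]
      congr 1
      have h3 : ∀ θ : ℝ, (2 * (Circle.exp θ : ℂ) / ((Circle.exp θ : ℂ) - w) ^ 2) *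
          (u (Circle.exp θ) - a) = (2 * (Circle.exp θ : ℂ) / ((Circle.exp θ : ℂ) - w) ^ 2) *
          u (Circle.exp θ) - (2 * (Circle.exp θ : ℂ) / ((Circle.exp θ : ℂ) - w) ^ 2) * a :=
        fun θ => mul_sub _ _ _
      simp only [h3]
      rw [intervalIntegral.integral_sub (f := fun θ : ℝ => 2 * (Circle.exp θ : ℂ) /
          ((Circle.exp θ : ℂ) - w) ^ 2 * u (Circle.exp θ))
        (g := fun θ : ℝ => 2 * (Circle.exp θ : ℂ) / ((Circle.exp θ : ℂ) - w) ^ 2 * a)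
        ((hkc.mul (huc.comp Circle.exp.continuous)).intervalIntegrable _ _)
        ((hkc.mul continuous_const).intervalIntegrable _ _), intervalIntegral.integral_mul_const,
        hzero, zero_mul, sub_zero]
      congr 1
      funext θ
      rw [circleMap_zero_one, hfu, smul_eq_mul]
    rw [hdF.deriv, havg, norm_mul, norm_smul]
    have h4 : ‖∫ θ in (0 : ℝ)..(2 * Real.pi), (2 * (Circle.exp θ : ℂ) /
        ((Circle.exp θ : ℂ) - w) ^ 2) * (u (Circle.exp θ) - a)‖ ≤
        2 * ∫ θ in (0 : ℝ)..(2 * Real.pi), ‖u (Circle.exp θ) - a‖ / ‖(Circle.exp θ : ℂ) - w‖ ^ 2 := by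
      refine (intervalIntegral.norm_integral_le_integral_norm (by positivity)).trans ?_
      rw [← intervalIntegral.integral_const_mul]
      refine le_of_eq ?_
      congr 1
      funext θ
      rw [norm_mul, norm_div, norm_mul, norm_pow, Circle.norm_coe, Complex.norm_ofNat]
      ring
    have h5 := norm_cauchy_kernel_integral_le huc hM hM' (arg w) (norm_nonneg w) hw1
    rw [← hwa] at h5
    rw [Real.norm_eq_abs, abs_of_pos (by positivity : (0 : ℝ) < (2 * Real.pi)⁻¹)]
    calc ‖(1 / 2 : ℂ)‖ * ((2 * Real.pi)⁻¹ * _) ≤ ‖(1 / 2 : ℂ)‖ * ((2 * Real.pi)⁻¹ *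
          (2 * (4 * M * (2 * Real.pi) ^ (2 - α) / (1 - α) * (1 - ‖w‖) ^ (α - 1)))) := by
          gcongr
          exact h4.trans (by gcongr)
      _ = K * (1 - ‖w‖) ^ (α - 1) := by
          rw [norm_div, norm_one, Complex.norm_ofNat, hK]; ring
  obtain ⟨G, hG1, hG2, C, hC⟩ := exists_extension_of_deriv_bound hα hα1 hFd hbound
  refine ⟨⟨fun ζ => G ζ, CH.mem_zero hα hC⟩, ⟨G, hG1, fun _ => rfl⟩, fun n => ?_⟩
  have hGps := (hG1.hasFPowerSeriesOnBall (R := 1) one_pos).hasFPowerSeriesAt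
  -- G and F have the same power series at 0. Its coefficients are the Fourier coefficients of the
  -- boundary values of G on one side, and those of u on the other.
  have hFG : G =ᶠ[𝓝 0] F := by
    filter_upwards [isOpen_ball.mem_nhds (mem_ball_self one_pos)] with z hz using hG2 z hz
  have heq := (hGps.congr hFG).eq_formalMultilinearSeries hFps.hasFPowerSeriesAt
  rw [← fc_eq_of_hasFPowerSeries (f := f) hfu n, ← heq]
  exact (fc_eq_of_hasFPowerSeries (f := G) (fun _ => rfl) n).symm

/-- The projection commutes with the angular derivative. By induction there are projections φ of u
and ψ of its derivative, both of order k. Since ψ has mean zero, its primitive is periodic and of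
order k + 1; up to a constant it has the Fourier coefficients of φ, so φ gains one order. -/
theorem exists_szego (k : ℕ) (u : CH ℂ k α) : ∃ φ : CH ℂ k α,
    (∃ G : ℂ → ℂ, DiffContOnCl ℂ G (ball 0 1) ∧ ∀ ζ : Circle, G ζ = φ ζ) ∧
    ∀ n : ℕ, fc φ.1 n = fc u.1 n := by
  induction k with
  | zero => exact exists_szego_zero u
  | succ k ih =>
    obtain ⟨φ, ⟨G, hG, hGφ⟩, hφ⟩ := ih (CH.incl u)
    obtain ⟨ψ, ⟨G', hG', hGψ⟩, hψ⟩ := ih (CH.D u)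
    have hDu : ∀ n, fc (CH.D u).1 n = I * n * fc u.1 n := fun n =>
      fc_of_hasDerivAt (CH.D u).continuous (CH.hasDerivAt_angular u) n
    have hψc := ψ.continuous
    have hψe : Continuous fun t : ℝ => ψ (Circle.exp t) := hψc.comp Circle.exp.continuous
    -- a primitive of `ψ`
    have hper : Function.Periodic (fun t : ℝ => ∫ s in (0 : ℝ)..t, ψ (Circle.exp s))
        (2 * Real.pi) := by
      intro t
      have h0 : fc ψ.1 0 = 0 := by
        have := hψ 0
        rw [Nat.cast_zero] at this
        rw [this, hDu]; simp
      have h1 : ∫ s in (0 : ℝ)..(2 * Real.pi), ψ (Circle.exp s) = 0 := by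
        simpa [fc, Real.pi_ne_zero] using h0
      have h2 : Function.Periodic (fun s : ℝ => ψ (Circle.exp s)) (2 * Real.pi) := fun s => by simp
      simp only
      rw [← intervalIntegral.integral_add_adjacent_intervals (b := t)
        (hψe.intervalIntegrable _ _) (hψe.intervalIntegrable _ _),
        h2.intervalIntegral_add_eq t 0, zero_add, h1, add_zero]
    set χ : Circle → ℂ := fun ζ => ∫ s in (0 : ℝ)..(arg ζ), ψ (Circle.exp s) with hχ
    have hχa : angular χ = fun t : ℝ => ∫ s in (0 : ℝ)..t, ψ (Circle.exp s) := by
      funext t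
      have h2 : Circle.exp (arg (Circle.exp t : ℂ)) = Circle.exp t := Circle.exp_arg _
      obtain ⟨m, hm⟩ := Circle.exp_eq_exp.1 h2
      simp only [angular, hχ]
      rw [hm]
      exact hper.int_mul m t
    have hχd : ∀ t, HasDerivAt (angular χ) (ψ (Circle.exp t)) t := fun t => by
      rw [hχa]
      exact intervalIntegral.integral_hasDerivAt_right (hψe.intervalIntegrable _ _)
        (hψe.stronglyMeasurableAtFilter _ _) hψe.continuousAt
    set X : CH ℂ (k + 1) α := ⟨χ, CH.mem_succ_of_hasDerivAt hχd⟩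
    have hXn : ∀ n : ℤ, n ≠ 0 → fc X.1 n = fc φ.1 n := fun n hn => by
      have h1 := fc_of_hasDerivAt hψc hχd n
      have hIn : I * n ≠ 0 := mul_ne_zero I_ne_zero (by exact_mod_cast hn)
      apply mul_left_cancel₀ hIn
      rw [← h1]
      rcases lt_or_gt_of_ne hn with h | h
      · rw [fc_neg_of_diffContOnCl hG' hGψ h, fc_neg_of_diffContOnCl hG hGφ h, mul_zero]
      · obtain ⟨m, rfl⟩ : ∃ m : ℕ, n = m := ⟨n.toNat, by omega⟩
        rw [hψ, hDu, hφ]; rfl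
    set c : ℂ := fc φ.1 0 - fc X.1 0
    have hfin : CH.incl (X + CH.const c) = φ := by
      refine CH.ext_fc fun n => ?_
      have h1 : fc (CH.incl (X + CH.const c)).1 n = fc X.1 n + fc (fun _ => c) n :=
        fc_add X.continuous continuous_const n
      have h2 : fc (fun _ => c) n = if n = 0 then c else 0 := by
        have h3 := fc_const_mul c (fun ζ => (ζ : ℂ) ^ (0 : ℤ)) n
        rw [fc_zpow] at h3
        simpa using h3
      rw [h1, h2]
      split_ifs with hn
      · subst hn; simp [c]
      · rw [add_zero, hXn n hn]
    refine ⟨X + CH.const c, ⟨G, hG, fun ζ => ?_⟩, fun n => ?_⟩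
    · rw [hGφ, ← hfin]; rfl
    · have := hφ n
      rw [← hfin] at this
      exact this

end CauchyIntegral

end KStat

end

set_option linter.unusedSectionVars false

noncomputable section

namespace KStat

/-! ## The space `A^{k,α}` inside the complex Hölder space -/

open Filter Topology ComplexConjugate

section HolomorphicSpace

variable {F : Type} [NormedAddCommGroup F] [NormedSpace ℝ F] {k : ℕ} {α : ℝ} [HolderExponent α]

theorem CH.mem_of_contDiff {u : Circle → F} (hu : ContDiff ℝ (k + 1 : ℕ) (angular u)) :
    u ∈ circleHolder F k α := by
  induction k generalizing u with
  | zero =>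
    have hu1 : ContDiff ℝ 1 (angular u) := by exact_mod_cast hu
    have hc : Continuous (cderiv u) := by
      refine continuous_of_angular ?_
      rw [CH.angular_cderiv]
      exact hu1.continuous_deriv le_rfl
    obtain ⟨C, hC⟩ := (isCompact_range hc).isBounded.exists_norm_le
    refine CH.mem_zero_of_deriv_bound (C := C) (hu1.differentiable one_ne_zero) fun t => ?_
    rw [← CH.angular_cderiv]
    exact hC _ ⟨_, rfl⟩
  | succ k ih =>
    refine CH.mem_succ_iff.2 ⟨hu.differentiable (by simp), ih ?_⟩
    rw [CH.angular_cderiv]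
    have : ContDiff ℝ ((k + 1 : ℕ) + 1 : WithTop ℕ∞) (angular u) := by exact_mod_cast hu
    exact (contDiff_succ_iff_deriv.1 this).2.2

namespace CH

/-- The monomial `ζ ^ n` on the circle. -/
def zp (n : ℤ) : CH ℂ k α := ⟨fun ζ => (ζ : ℂ) ^ n, mem_of_contDiff <| by
  have : angular (fun ζ : Circle => (ζ : ℂ) ^ n) = fun t : ℝ => exp (n * (t * I)) := by
    funext t
    rw [angular, Circle.coe_exp, exp_int_mul]
  rw [this]
  exact (contDiff_const.mul (ofRealCLM.contDiff.mul contDiff_const)).cexp⟩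

@[simp] theorem zp_apply (n : ℤ) (ζ : Circle) : (zp n : CH ℂ k α) ζ = (ζ : ℂ) ^ n := rfl

/-- The pointwise product. -/
def mul : CH ℂ k α →L[ℝ] CH ℂ k α →L[ℝ] CH ℂ k α := bilin (ContinuousLinearMap.mul ℝ ℂ)

@[simp] theorem mul_apply (u v : CH ℂ k α) (ζ : Circle) : mul u v ζ = u ζ * v ζ := rfl

/-- The pointwise complex conjugate. -/
def cj : CH ℂ k α →L[ℝ] CH ℂ k α := lmap conjCLE.toContinuousLinearMap

@[simp] theorem cj_apply (u : CH ℂ k α) (ζ : Circle) : cj u ζ = conj (u ζ) := rfl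

/-- The boundary values of the holomorphic functions: the negative Fourier coefficients vanish. -/
def IsHol (u : CH ℂ k α) : Prop := ∀ n : ℤ, n < 0 → fc u.1 n = 0

/-- If the negative coefficients vanish, u has the same Fourier coefficients as its Szegő
projection, which extends holomorphically by construction. -/
theorem isHol_iff {u : CH ℂ k α} : IsHol u ↔
    ∃ G : ℂ → ℂ, DiffContOnCl ℂ G (ball 0 1) ∧ ∀ ζ : Circle, G ζ = u ζ := by
  constructor
  · intro h
    obtain ⟨φ, ⟨G, hG, hGφ⟩, hφ⟩ := exists_szego k u
    have : φ = u := by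
      refine CH.ext_fc fun n => ?_
      rcases lt_or_ge n 0 with hn | hn
      · rw [h n hn, fc_neg_of_diffContOnCl hG hGφ hn]
      · obtain ⟨m, rfl⟩ : ∃ m : ℕ, n = m := ⟨n.toNat, by omega⟩
        exact hφ m
    subst this
    exact ⟨G, hG, hGφ⟩
  · rintro ⟨G, hG, h⟩ n hn
    exact fc_neg_of_diffContOnCl hG h hn

theorem IsHol.mul {u v : CH ℂ k α} (hu : IsHol u) (hv : IsHol v) : IsHol (mul u v) := by
  obtain ⟨F, hF, hFu⟩ := isHol_iff.1 hu
  obtain ⟨G, hG, hGv⟩ := isHol_iff.1 hv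
  refine isHol_iff.2 ⟨fun z => F z * G z, ?_, fun ζ => ?_⟩
  swap
  · exact congrArg₂ (· * ·) (hFu ζ) (hGv ζ)
  simpa only [smul_eq_mul] using! hF.smul hG

theorem IsHol.add {u v : CH ℂ k α} (hu : IsHol u) (hv : IsHol v) : IsHol (u + v) := fun n hn => by
  have := map_add (fcL n) u v
  simpa [hu n hn, hv n hn] using this

theorem IsHol.neg {u : CH ℂ k α} (hu : IsHol u) : IsHol (-u) := fun n hn => by
  have := map_neg (fcL n) u
  simpa [hu n hn] using this

theorem isHol_zp (n : ℕ) : IsHol (zp n : CH ℂ k α) := fun m hm => by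
  show fc (fun ζ => (ζ : ℂ) ^ (n : ℤ)) m = 0
  rw [fc_zpow, if_neg (by omega)]

theorem isHol_const (c : ℂ) : IsHol (const c : CH ℂ k α) :=
  isHol_iff.2 ⟨fun _ => c, diffContOnCl_const, fun _ => rfl⟩

theorem isClosed_isHol : IsClosed {u : CH ℂ k α | IsHol u} := by
  have : {u : CH ℂ k α | IsHol u} = ⋂ (n : ℤ) (_ : n < 0), {u | fcL n u = 0} := by
    ext u; simp [IsHol]
  rw [this]
  exact isClosed_iInter fun n => isClosed_iInter fun _ =>
    isClosed_eq (fcL n).continuous continuous_const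

/-- A function whose nonnegative Fourier coefficients vanish still has this property after
multiplication by the conjugate of a holomorphic function. -/
theorem fc_mul_conj_eq_zero {q a : CH ℂ k α} (hq : ∀ n : ℕ, fc q.1 n = 0) (ha : IsHol a) (n : ℕ) :
    fc (mul q (cj a)).1 n = 0 := by
  -- Having only negative orders means that conj(ζq) is holomorphic, a property preserved by the
  -- product with `a`.
  have h1 : IsHol (cj (mul (zp 1) q)) := fun m hm => by
    have h2 : (cj (mul (zp 1) q)).1 = fun ζ : Circle => conj ((ζ : ℂ) ^ (1 : ℤ) * q ζ) := rfl
    obtain ⟨p, hp⟩ : ∃ p : ℕ, -m - 1 = p := ⟨(-m - 1).toNat, by omega⟩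
    rw [h2, fc_conj, fc_zpow_mul, hp, hq, map_zero]
  have h3 := h1.mul ha (-n - 1) (by omega)
  have h4 : (mul (cj (mul (zp 1) q)) a).1 =
      fun ζ : Circle => conj ((ζ : ℂ) ^ (1 : ℤ) * (mul q (cj a)).1 ζ) := by
    funext ζ
    show conj ((ζ : ℂ) ^ (1 : ℤ) * q ζ) * a ζ = conj ((ζ : ℂ) ^ (1 : ℤ) * (q ζ * conj (a ζ)))
    simp only [map_mul, conj_conj]
    ring
  rw [h4, fc_conj, fc_zpow_mul, map_eq_zero] at h3
  convert h3 using 2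
  ring

theorem fc_one_sub_mul (q : CH ℂ k α) {w : Circle → ℂ} (h : ∀ ζ : Circle, w ζ = (1 - (ζ : ℂ)) * q ζ)
    (n : ℤ) : fc w n = fc q.1 n - fc q.1 (n - 1) := by
  have h1 : w = fun ζ : Circle => q ζ - (ζ : ℂ) ^ (1 : ℤ) * q ζ := by
    funext ζ; rw [h, zpow_one]; ring
  rw [h1, fc_sub (q := fun ζ : Circle => (ζ : ℂ) ^ (1 : ℤ) * q ζ) q.continuous
    (mul (zp 1) q).continuous, fc_zpow_mul]

/-- Division by `1 - ζ` preserves holomorphy. -/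
theorem isHol_of_one_sub_mul {q : CH ℂ k α} {w : CH ℂ k α} (hw : IsHol w)
    (h : ∀ ζ : Circle, w ζ = (1 - (ζ : ℂ)) * q ζ) : IsHol q := by
  have hstep : ∀ n : ℤ, n < 0 → fc q.1 n = fc q.1 (n - 1) := fun n hn => by
    have h2 := hw n hn
    rw [fc_one_sub_mul q h] at h2
    exact sub_eq_zero.1 h2
  have hconst : ∀ m : ℕ, fc q.1 (-1 - m) = fc q.1 (-1) := fun m => by
    induction m with
    | zero => simp
    | succ m ih =>
      rw [← ih, hstep (-1 - m) (by omega)]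
      push_cast
      congr 1; ring
  -- The negative coefficients of q are all equal to one number, so the projection φ of conj(ζq) has
  -- constant coefficients and (1-ζ)φ is a constant. As φ is continuous, evaluation at ζ = 1 shows
  -- that this constant is zero.
  obtain ⟨φ, ⟨G, hG, hGφ⟩, hφ⟩ := exists_szego k (cj (mul (zp 1) q))
  have hφn : ∀ n : ℕ, fc φ.1 n = conj (fc q.1 (-1)) := fun n => by
    have h2 : (cj (mul (zp 1) q)).1 = fun ζ : Circle => conj ((ζ : ℂ) ^ (1 : ℤ) * q ζ) := rfl
    rw [hφ, h2, fc_conj, fc_zpow_mul, ← hconst n]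
    congr 2; ring
  have hneg : ∀ n : ℤ, n < 0 → fc φ.1 n = 0 := fun n hn => fc_neg_of_diffContOnCl hG hGφ hn
  have hφc : mul (const 1 - zp 1) φ = const (conj (fc q.1 (-1))) := by
    refine CH.ext_fc fun n => ?_
    have h3 : fc (const (conj (fc q.1 (-1))) : CH ℂ k α).1 n =
        if n = 0 then conj (fc q.1 (-1)) else 0 := by
      have h3 := fc_const_mul (conj (fc q.1 (-1))) (fun ζ : Circle => (ζ : ℂ) ^ (0 : ℤ)) n
      rw [fc_zpow] at h3
      simp only [zpow_zero, mul_one, mul_ite, mul_zero] at h3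
      exact h3
    rw [fc_one_sub_mul φ (fun ζ => by
      show (1 - (ζ : ℂ) ^ (1 : ℤ)) * φ ζ = _
      rw [zpow_one]), h3]
    rcases lt_trichotomy n 0 with hn | rfl | hn
    · rw [hneg n hn, hneg (n - 1) (by omega), if_neg hn.ne, sub_zero]
    · rw [hneg (0 - 1) (by omega), if_pos rfl, sub_zero]
      exact hφn 0
    · obtain ⟨m, rfl⟩ : ∃ m : ℕ, n = m + 1 := ⟨(n - 1).toNat, by omega⟩
      have := hφn (m + 1)
      push_cast at this
      rw [this, add_sub_cancel_right, hφn, if_neg hn.ne', sub_self]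
  have h0 : fc q.1 (-1) = 0 := by
    have h4 := congrArg (fun w : CH ℂ k α => w 1) hφc
    have h5 : (1 - ((1 : Circle) : ℂ) ^ (1 : ℤ)) * φ 1 = conj (fc q.1 (-1)) := h4
    rw [Circle.coe_one, one_zpow, sub_self, zero_mul] at h5
    exact (map_eq_zero _).1 h5.symm
  intro n hn
  have := hconst (-1 - n).toNat
  rw [h0] at this
  rw [← this]
  congr 1; omega

end CH

open CH

/-- The complex function with given real and imaginary parts, in the complex Hölder space. -/
def toCH : Hol k α × Hol k α →L[ℝ] CH ℂ k α :=
  ((lmap ofRealCLM).comp (holEquiv (k := k) (α := α)).toContinuousLinearEquiv.toContinuousLinearMap).comp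
    (ContinuousLinearMap.fst ℝ _ _) +
  ((lmap (ofRealCLM.smulRight I)).comp
    (holEquiv (k := k) (α := α)).toContinuousLinearEquiv.toContinuousLinearMap).comp
    (ContinuousLinearMap.snd ℝ _ _)

@[simp] theorem toCH_apply (u : Hol k α × Hol k α) (ζ : Circle) : toCH u ζ = toComplex u ζ := rfl

/-- The real and imaginary parts of an element of the complex Hölder space. -/
def ofCH : CH ℂ k α →L[ℝ] Hol k α × Hol k α :=
  ((holEquiv (k := k) (α := α)).symm.toContinuousLinearEquiv.toContinuousLinearMap.comp
    (lmap reCLM)).prod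
  ((holEquiv (k := k) (α := α)).symm.toContinuousLinearEquiv.toContinuousLinearMap.comp
    (lmap imCLM))

theorem toComplex_ofCH (q : CH ℂ k α) (ζ : Circle) : toComplex (ofCH q) ζ = q ζ :=
  re_add_im (q ζ)

theorem mem_A_iff {u : Hol k α × Hol k α} : u ∈ A k α ↔ IsHol (toCH u) :=
  (isHol_iff (u := toCH u)).symm

instance : CompleteSpace (A k α) := by
  have : IsClosed (A k α : Set (Hol k α × Hol k α)) := by
    have h : (A k α : Set (Hol k α × Hol k α)) = toCH ⁻¹' {u | IsHol u} := by
      ext u; exact mem_A_iff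
    rw [h]
    exact isClosed_isHol.preimage toCH.continuous
  exact this.completeSpace_coe

/-- The boundary values of the elements of `A^{k,α}`. -/
def bd : A k α →L[ℝ] CH ℂ k α := toCH.comp (A k α).subtypeL

@[simp] theorem bd_apply (u : A k α) (ζ : Circle) : bd u ζ = bdVal u ζ := rfl

theorem isHol_bd (u : A k α) : IsHol (bd u) := mem_A_iff.1 u.2

theorem bd_injective : Function.Injective (bd : A k α → CH ℂ k α) := fun u v h => by
  have h1 : ∀ ζ, toComplex u.1 ζ = toComplex v.1 ζ := fun ζ => congrArg (fun w : CH ℂ k α => w ζ) h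
  refine Subtype.ext (Prod.ext (Subtype.ext (funext fun ζ => ?_)) (Subtype.ext (funext fun ζ => ?_)))
  · simpa [toComplex] using congrArg re (h1 ζ)
  · simpa [toComplex] using congrArg im (h1 ζ)

/-- The element of `A^{k,α}` with given boundary values. -/
def ofBd (q : CH ℂ k α) (hq : IsHol q) : A k α := ⟨ofCH q, by
  rw [mem_A_iff]
  convert hq
  ext ζ
  exact toComplex_ofCH q ζ⟩

@[simp] theorem bd_ofBd (q : CH ℂ k α) (hq : IsHol q) : bd (ofBd q hq) = q := by
  ext ζ
  exact toComplex_ofCH q ζ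

theorem ext_eq_of_diffContOnCl (u : A k α) {G : ℂ → ℂ} (hG : DiffContOnCl ℂ G (ball 0 1))
    (h : ∀ ζ : Circle, G ζ = bdVal u ζ) : Set.EqOn (ext u) G (closedBall 0 1) := by
  have h1 : Set.EqOn (ext u) G (closure (ball 0 1)) := by
    refine Complex.eqOn_closure_of_eqOn_frontier isBounded_ball (ext_spec u).1 hG ?_
    rw [frontier_ball _ one_ne_zero]
    intro z hz
    have hz1 : ‖z‖ = 1 := by simpa using hz
    have := (ext_spec u).2 ⟨z, mem_sphere_zero_iff_norm.2 hz1⟩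
    exact this.trans (h ⟨z, mem_sphere_zero_iff_norm.2 hz1⟩).symm
  rwa [closure_ball _ one_ne_zero] at h1

theorem ext_zero (u : A k α) : ext u 0 = fc (bd u).1 0 :=
  fc_zero_of_diffContOnCl (ext_spec u).1 (ext_spec u).2

/-- The Szegő projection of `C^{k,α} + i C^{k,α}` to `A^{k,α}`. -/
def szego : CH ℂ k α →L[ℝ] A k α :=
  let S (q : CH ℂ k α) : A k α := ofBd _ (isHol_iff.2 (exists_szego k q).choose_spec.1)
  have hS : ∀ (q : CH ℂ k α) (n : ℕ), fc (bd (S q)).1 n = fc q.1 n := fun q n => by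
    simp only [S, bd_ofBd]
    exact (exists_szego k q).choose_spec.2 n
  have huniq : ∀ u v : A k α, (∀ n : ℕ, fc (bd u).1 n = fc (bd v).1 n) → u = v := fun u v h => by
    refine bd_injective (CH.ext_fc fun n => ?_)
    rcases lt_or_ge n 0 with hn | hn
    · rw [isHol_bd u n hn, isHol_bd v n hn]
    · obtain ⟨m, rfl⟩ : ∃ m : ℕ, n = m := ⟨n.toNat, by omega⟩
      exact h m
  let T : CH ℂ k α →ₗ[ℝ] A k α :=
    { toFun := S
      map_add' := fun p q => huniq _ _ fun n => by
        have h1 := map_add (fcL (k := k) (α := α) n) p q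
        have h2 := map_add (fcL (k := k) (α := α) n) (bd (S p)) (bd (S q))
        simp only [fcL_apply] at h1 h2
        rw [hS, h1, map_add, h2, hS, hS]
      map_smul' := fun a q => huniq _ _ fun n => by
        have h1 := map_smul (fcL (k := k) (α := α) n) a q
        have h2 := map_smul (fcL (k := k) (α := α) n) a (bd (S q))
        simp only [fcL_apply] at h1 h2
        rw [hS, h1, map_smul, RingHom.id_apply, h2, hS] }
  -- Boundedness of the projection requires no further estimate: Fourier coefficients are continuous
  -- and separate the elements of `A k α`, so the graph is closed.
  ⟨T, T.continuous_of_seq_closed_graph fun q p y hq hy => huniq _ _ fun n => by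
    have e1 := ((fcL (k := k) (α := α) n).continuous.tendsto p).comp hq
    have e2 := (((fcL (k := k) (α := α) n).comp bd).continuous.tendsto y).comp hy
    have e3 : (⇑((fcL n).comp bd) ∘ ⇑T ∘ q) = ⇑(fcL (k := k) (α := α) n) ∘ q :=
      funext fun i => hS (q i) n
    rw [e3] at e2
    exact (tendsto_nhds_unique e2 e1).trans (hS p n).symm⟩

theorem fc_szego (q : CH ℂ k α) (n : ℕ) : fc (bd (szego q)).1 n = fc q.1 n := by
  show fc (bd (ofBd _ (isHol_iff.2 (exists_szego k q).choose_spec.1))).1 n = _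
  rw [bd_ofBd]
  exact (exists_szego k q).choose_spec.2 n

theorem A_ext {u v : A k α} (h : ∀ n : ℕ, fc (bd u).1 n = fc (bd v).1 n) : u = v := by
  refine bd_injective (CH.ext_fc fun n => ?_)
  rcases lt_or_ge n 0 with hn | hn
  · rw [isHol_bd u n hn, isHol_bd v n hn]
  · obtain ⟨m, rfl⟩ : ∃ m : ℕ, n = m := ⟨n.toNat, by omega⟩
    exact h m

theorem szego_bd (u : A k α) : szego (bd u) = u := A_ext fun n => fc_szego _ n

theorem szego_eq_iff {q : CH ℂ k α} {u : A k α} : szego q = u ↔ ∀ n : ℕ, fc q.1 n = fc (bd u).1 n := by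
  constructor
  · rintro rfl n
    exact (fc_szego q n).symm
  · intro h
    exact A_ext fun n => by rw [fc_szego, h]

theorem szego_eq_zero_iff {q : CH ℂ k α} : szego q = 0 ↔ ∀ n : ℕ, fc q.1 n = 0 := by
  rw [szego_eq_iff]
  have : ∀ n : ℕ, fc (bd (0 : A k α)).1 n = 0 := fun n => by
    have := map_zero ((fcL (k := k) (α := α) n).comp bd)
    exact this
  simp only [this]

/-- The negative part of `q`, as the element of `A^{k,α}` with the coefficients
`conj (q^(-n-1))`. -/
def negPart : CH ℂ k α →L[ℝ] A k α := szego.comp (cj.comp (mul (zp 1)))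

theorem fc_cj_zp_mul (q : CH ℂ k α) (m n : ℤ) :
    fc (cj (mul (zp m) q)).1 n = conj (fc q.1 (-n - m)) := by
  have h2 : (cj (mul (zp m) q)).1 = fun ζ : Circle => conj ((ζ : ℂ) ^ m * q ζ) := rfl
  rw [h2, fc_conj, fc_zpow_mul]

theorem negPart_eq_zero_iff {q : CH ℂ k α} : negPart q = 0 ↔ IsHol q := by
  refine (szego_eq_zero_iff (q := cj (mul (zp 1) q))).trans ⟨fun h n hn => ?_, fun h n => ?_⟩
  · have := h (-1 - n).toNat
    rw [fc_cj_zp_mul, map_eq_zero] at this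
    rw [← this]
    congr 1; omega
  · rw [fc_cj_zp_mul, h _ (by omega), map_zero]

theorem isHol_iff_exists {q : CH ℂ k α} : IsHol q ↔ ∃ u : A k α, bd u = q :=
  ⟨fun h => ⟨ofBd q h, bd_ofBd q h⟩, by rintro ⟨u, rfl⟩; exact isHol_bd u⟩

end HolomorphicSpace

end KStat

end

set_option linter.unusedSectionVars false

noncomputable section

namespace KStat

/-! ## Derivatives of the functions of class `A^{k,α}` in the closed disc -/

open Filter Topology ComplexConjugate CH

section Jets

variable {k : ℕ} {α : ℝ} [HolderExponent α]

/-- The real derivative in the open disc has a limit at the boundary point, so on the convex disc it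
extends to a derivative within the closure. The limit is multiplication by G(z), hence complex
linear. -/
theorem hasDerivWithinAt_closedBall {H G : ℂ → ℂ} (hH : DiffContOnCl ℂ H (ball 0 1))
    (hG : ContinuousOn G (closedBall 0 1)) (h : ∀ z ∈ ball (0 : ℂ) 1, HasDerivAt H (G z) z)
    {z : ℂ} (hz : z ∈ closedBall (0 : ℂ) 1) : HasDerivWithinAt H (G z) (closedBall 0 1) z := by
  have hcl : closure (ball (0 : ℂ) 1) = closedBall 0 1 := closure_ball _ one_ne_zero
  have hreal : ∀ y ∈ ball (0 : ℂ) 1, HasFDerivAt H (ContinuousLinearMap.mul ℝ ℂ (G y)) y :=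
    fun y hy => by
      refine ((h y hy).hasFDerivAt.restrictScalars ℝ).congr_fderiv ?_
      refine ContinuousLinearMap.ext fun x => ?_
      simp [mul_comm]
  have h1 : HasFDerivWithinAt H (ContinuousLinearMap.mul ℝ ℂ (G z)) (closure (ball 0 1)) z := by
    refine hasFDerivWithinAt_closure_of_tendsto_fderiv
      (fun y hy => (hreal y hy).differentiableAt.differentiableWithinAt) (convex_ball _ _) isOpen_ball
      (fun y hy => (hH.continuousOn y hy).mono subset_closure) ?_
    have h2 : Tendsto (fun y => ContinuousLinearMap.mul ℝ ℂ (G y)) (𝓝[ball 0 1] z)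
        (𝓝 (ContinuousLinearMap.mul ℝ ℂ (G z))) :=
      ((ContinuousLinearMap.mul ℝ ℂ).continuous.tendsto _).comp
        ((hG z hz).mono_left (nhdsWithin_mono _ ball_subset_closedBall))
    refine h2.congr' ?_
    filter_upwards [self_mem_nhdsWithin] with y hy using (hreal y hy).fderiv.symm
  rw [hcl] at h1
  have h3 : HasFDerivWithinAt H (ContinuousLinearMap.toSpanSingleton ℂ (G z)) (closedBall 0 1) z :=
    HasFDerivWithinAt.of_restrictScalars ℝ h1 (ContinuousLinearMap.ext fun x => by simp [mul_comm])
  exact h3.hasDerivWithinAt.congr_deriv (by simp)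

theorem uniqueDiffOn_closedBall : UniqueDiffOn ℂ (closedBall (0 : ℂ) 1) :=
  uniqueDiffOn_convex_of_isRCLikeNormedField (convex_closedBall 0 1) (by
    rw [interior_closedBall _ one_ne_zero]
    exact ⟨0, mem_ball_self one_pos⟩)

/-- The complex derivative of the functions of class `A^{k+1,α}`. -/
def derivA : A (k + 1) α →L[ℝ] A k α :=
  szego.comp ((mul (mul (const (-I)) (zp (-1)))).comp (DL.comp bd))

/-- Since the angular derivative is iζu', the boundary value of u' is -iζ^(-1)Du. Its coefficient of
order n is (n+1) times the coefficient of u of order n + 1, which vanishes for all n < 0, including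
n = -1. The projection in `derivA` therefore changes nothing. -/
theorem bd_derivA (u : A (k + 1) α) :
    bd (derivA u) = mul (mul (const (-I)) (zp (-1))) (D (bd u)) := by
  have hol : IsHol (mul (mul (const (-I)) (zp (-1))) (D (bd u))) := fun n hn => by
    have h1 : (mul (mul (const (-I)) (zp (-1))) (D (bd u))).1 =
        fun ζ : Circle => -I * ((ζ : ℂ) ^ (-1 : ℤ) * D (bd u) ζ) := funext fun ζ => mul_assoc _ _ _
    rw [h1, fc_const_mul, fc_zpow_mul, fc_of_hasDerivAt (D (bd u)).continuous
      (hasDerivAt_angular (bd u))]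
    rcases eq_or_ne n (-1) with rfl | h
    · simp
    · rw [isHol_bd u _ (by omega)]; simp
  obtain ⟨w, hw⟩ := isHol_iff_exists.1 hol
  rw [← hw]
  show bd (szego (mul (mul (const (-I)) (zp (-1))) (D (bd u)))) = _
  rw [← hw, szego_bd]

/-- A primitive of the extension of `derivA u` has bounded derivative, hence extends continuously to
the closed disc. On the circle its angular derivative is that of u, so the two differ by a constant
there, and then in the whole disc. -/
theorem hasDerivWithinAt_ext (u : A (k + 1) α) {z : ℂ} (hz : z ∈ closedBall (0 : ℂ) 1) :
    HasDerivWithinAt (ext u) (ext (derivA u) z) (closedBall 0 1) z := by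
  have hα : 0 < α := HolderExponent.pos
  have hα1 : α < 1 := HolderExponent.lt_one
  have hcl : closure (ball (0 : ℂ) 1) = closedBall 0 1 := closure_ball _ one_ne_zero
  set G := ext (derivA u) with hGdef
  have hG := ext_spec (derivA u)
  have hGc : ContinuousOn G (closedBall 0 1) := hcl ▸ hG.1.continuousOn
  obtain ⟨K, hK⟩ := (isCompact_closedBall (0 : ℂ) 1).exists_bound_of_continuousOn hGc
  obtain ⟨H₀, hH₀⟩ := hG.1.differentiableOn.isExactOn_ball
  have hbound : ∀ w ∈ ball (0 : ℂ) 1, ‖deriv H₀ w‖ ≤ K * (1 - ‖w‖) ^ (α - 1) := fun w hw => by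
    rw [(hH₀ w hw).deriv]
    have hw1 : ‖w‖ < 1 := by simpa using hw
    have hK0 : 0 ≤ K := (norm_nonneg _).trans (hK w (ball_subset_closedBall hw))
    refine (hK w (ball_subset_closedBall hw)).trans (le_mul_of_one_le_right hK0 ?_)
    exact Real.one_le_rpow_of_pos_of_le_one_of_nonpos (by linarith) (by linarith [norm_nonneg w])
      (by linarith)
  obtain ⟨H, hH, hHH₀, -⟩ := exists_extension_of_deriv_bound hα hα1
    (fun w hw => (hH₀ w hw).differentiableAt.differentiableWithinAt) hbound
  have hHd : ∀ w ∈ closedBall (0 : ℂ) 1, HasDerivWithinAt H (G w) (closedBall 0 1) w := fun w hw =>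
    hasDerivWithinAt_closedBall hH hGc (fun y hy => (hH₀ y hy).congr_of_eventuallyEq <| by
      filter_upwards [isOpen_ball.mem_nhds hy] with x hx using hHH₀ x hx) hw
  have hcirc : ∀ ζ : Circle, (ζ : ℂ) ∈ closedBall (0 : ℂ) 1 := fun ζ => by
    rw [mem_closedBall_zero_iff, Circle.norm_coe]
  have hang : ∀ t : ℝ, HasDerivAt (fun t : ℝ => H (Circle.exp t) - angular (bd u).1 t) 0 t := by
    intro t
    have h1 : HasDerivAt (fun t : ℝ => (Circle.exp t : ℂ)) (Circle.exp t * I) t := by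
      simp only [Circle.coe_exp]
      have := ((hasDerivAt_id t).ofReal_comp.mul_const I).cexp
      simpa using this
    have h2 : HasDerivAt (fun t : ℝ => H (Circle.exp t)) (Circle.exp t * I * G (Circle.exp t)) t := by
      have := (hHd _ (hcirc (Circle.exp t))).scomp_hasDerivAt t h1 fun s => hcirc (Circle.exp s)
      simpa only [smul_eq_mul] using! this
    have h3 := h2.sub (hasDerivAt_angular (bd u) t)
    have h4 : G (Circle.exp t) = -I * (Circle.exp t : ℂ) ^ (-1 : ℤ) * D (bd u) (Circle.exp t) := by
      refine (hG.2 _).trans ?_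
      rw [← bd_apply, bd_derivA]; rfl
    refine h3.congr_deriv ?_
    rw [h4, zpow_neg_one]
    have h5 := Circle.coe_ne_zero (Circle.exp t)
    field_simp
    rw [I_sq]
    ring
  obtain ⟨c, hc⟩ : ∃ c, ∀ ζ : Circle, H ζ - bd u ζ = c := by
    refine ⟨H (Circle.exp 0) - angular (bd u).1 0, fun ζ => ?_⟩
    obtain ⟨t, rfl⟩ := exists_exp ζ
    exact is_const_of_deriv_eq_zero (fun t => (hang t).differentiableAt)
      (fun t => (hang t).deriv) t 0
  have hE : Set.EqOn (ext u) (fun z => H z - c) (closedBall 0 1) :=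
    ext_eq_of_diffContOnCl u (hH.sub_const c) fun ζ => by
      rw [← hc ζ, sub_sub_cancel, bd_apply]
  exact ((hHd z hz).sub_const c).congr_of_eventuallyEq
    (hE.eventuallyEq_nhdsWithin) (hE hz)

/-- Each complex derivative uses up one order of regularity; this is where the jet map needs ℓ₀ + 2
≤ k. -/
theorem exists_iteratedDerivWithin_eq {n k : ℕ} (hnk : n ≤ k) : ∃ L : A k α →L[ℝ] ℂ,
    ∀ u : A k α, iteratedDerivWithin n (ext u) (closedBall 0 1) 1 = L u := by
  induction n generalizing k with
  | zero =>
    refine ⟨(CH.eval 1).comp bd, fun u => ?_⟩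
    rw [iteratedDerivWithin_zero]
    have := (ext_spec u).2 1
    rwa [Circle.coe_one] at this
  | succ n ih =>
    obtain ⟨k, rfl⟩ : ∃ m, k = m + 1 := ⟨k - 1, by omega⟩
    obtain ⟨L, hL⟩ := ih (k := k) (by omega)
    refine ⟨L.comp derivA, fun u => ?_⟩
    rw [iteratedDerivWithin_succ', ContinuousLinearMap.comp_apply, ← hL]
    have h1 : (1 : ℂ) ∈ closedBall (0 : ℂ) 1 := by simp
    refine iteratedDerivWithin_congr (fun z hz => ?_) h1
    refine (hasDerivWithinAt_ext u hz).derivWithin ?_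
    exact uniqueDiffOn_closedBall z hz

/-- Multiplication by `1 - ζ`. -/
def oneSub : A k α →L[ℝ] A k α := szego.comp ((mul (const 1 - zp 1)).comp bd)

theorem isHol_one_sub : IsHol (const 1 - zp 1 : CH ℂ k α) := by
  rw [sub_eq_add_neg]
  exact (isHol_const 1).add (isHol_zp 1).neg

theorem bd_oneSub (u : A k α) : bd (oneSub u) = mul (const 1 - zp 1) (bd u) := by
  obtain ⟨w, hw⟩ := isHol_iff_exists.1 (isHol_one_sub.mul (isHol_bd u))
  rw [← hw]
  show bd (szego (mul (const 1 - zp 1) (bd u))) = _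
  rw [← hw, szego_bd]

theorem eqOn_ext_oneSub (u : A k α) : Set.EqOn (ext (oneSub u)) (disc u) (closedBall 0 1) := by
  refine ext_eq_of_diffContOnCl _ ?_ fun ζ => ?_
  · have h1 : DiffContOnCl ℂ (fun z : ℂ => 1 - z) (ball 0 1) :=
      ((differentiable_const 1).sub differentiable_id).diffContOnCl
    simpa only [smul_eq_mul] using! h1.smul (ext_spec u).1
  · rw [← bd_apply, bd_oneSub]
    show _ = (1 - (ζ : ℂ) ^ (1 : ℤ)) * bdVal u ζ
    rw [zpow_one, disc, (ext_spec u).2]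

/-- The jet map at `1` is continuous and linear on `A^{k,α}` if `n ≤ k`. -/
theorem exists_jetAtOne_eq {n : ℕ} (hnk : n ≤ k) : ∃ J : A k α →L[ℝ] (Fin n → ℂ),
    ∀ u, jetAtOne n u = J u := by
  have h : ∀ i : Fin n, ∃ L : A k α →L[ℝ] ℂ,
      ∀ u, iteratedDerivWithin (i + 1) (disc u) (closedBall 0 1) 1 = L u := fun i => by
    obtain ⟨L, hL⟩ := exists_iteratedDerivWithin_eq (α := α) (n := i + 1) (k := k) (by omega)
    refine ⟨L.comp oneSub, fun u => ?_⟩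
    rw [ContinuousLinearMap.comp_apply, ← hL]
    exact iteratedDerivWithin_congr (eqOn_ext_oneSub u).symm (by simp)
  choose L hL using h
  exact ⟨ContinuousLinearMap.pi L, fun u => funext fun i => hL i u⟩

end Jets

end KStat

end

set_option linter.unusedSectionVars false

noncomputable section

namespace KStat

/-! ## Wirtinger derivatives and the Levi form of the model -/

open ComplexConjugate

/-- The real linear map `v ↦ a v + b v̄`. -/
def wirt (a b : ℂ) : ℂ →L[ℝ] ℂ :=
  ContinuousLinearMap.mul ℝ ℂ a + (ContinuousLinearMap.mul ℝ ℂ b).comp conjCLE.toContinuousLinearMap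

@[simp] theorem wirt_apply (a b v : ℂ) : wirt a b v = a * v + b * conj v := rfl

theorem dz_eq {f : ℂ → ℂ} {a b z : ℂ} (h : HasFDerivAt f (wirt a b) z) : dz f z = a := by
  rw [dz, h.fderiv]
  simp only [wirt_apply, map_one, conj_I, mul_one]
  linear_combination (-(a - b) / 2) * I_sq

theorem dzbar_eq {f : ℂ → ℂ} {a b z : ℂ} (h : HasFDerivAt f (wirt a b) z) : dzbar f z = b := by
  rw [dzbar, h.fderiv]
  simp only [wirt_apply, map_one, conj_I, mul_one]
  linear_combination ((a - b) / 2) * I_sq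

theorem hasFDerivAt_monomial (c : ℂ) (i j : ℕ) (z : ℂ) :
    HasFDerivAt (fun z => c * z ^ i * conj z ^ j)
      (wirt (c * (i * z ^ (i - 1)) * conj z ^ j) (c * z ^ i * (j * conj z ^ (j - 1)))) z := by
  have h1 := (hasDerivAt_pow i z).hasFDerivAt.restrictScalars ℝ
  have h2 : HasFDerivAt (fun z : ℂ => conj z) conjCLE.toContinuousLinearMap z :=
    conjCLE.hasFDerivAt
  have h3 := ((hasDerivAt_pow j (conj z)).hasFDerivAt.restrictScalars ℝ).comp z h2
  refine ((h1.const_mul c).mul h3).congr_fderiv ?_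
  refine ContinuousLinearMap.ext fun v => ?_
  simp
  ring

theorem HasFDerivAt.sum_wirt {ι : Type*} {s : Finset ι} {f : ι → ℂ → ℂ} {a b : ι → ℂ} {z : ℂ}
    (h : ∀ i ∈ s, HasFDerivAt (f i) (wirt (a i) (b i)) z) :
    HasFDerivAt (fun z => ∑ i ∈ s, f i z) (wirt (∑ i ∈ s, a i) (∑ i ∈ s, b i)) z := by
  refine (HasFDerivAt.fun_sum h).congr_fderiv ?_
  refine ContinuousLinearMap.ext fun v => ?_
  simp [Finset.sum_mul, Finset.sum_add_distrib]

/-- The derivative `P_z` of the model polynomial. -/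
def modelDz (d k₀ : ℕ) (a : ℕ → ℂ) (z : ℂ) : ℂ :=
  ∑ j ∈ Finset.Icc (d - k₀) k₀, a j * (j * z ^ (j - 1)) * conj z ^ (d - j)

/-- The derivative `P_z̄` of the model polynomial. -/
def modelDzbar (d k₀ : ℕ) (a : ℕ → ℂ) (z : ℂ) : ℂ :=
  ∑ j ∈ Finset.Icc (d - k₀) k₀, a j * z ^ j * ((d - j : ℕ) * conj z ^ (d - j - 1))

theorem hasFDerivAt_modelPoly (d k₀ : ℕ) (a : ℕ → ℂ) (z : ℂ) :
    HasFDerivAt (modelPoly d k₀ a) (wirt (modelDz d k₀ a z) (modelDzbar d k₀ a z)) z :=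
  HasFDerivAt.sum_wirt fun _ _ => hasFDerivAt_monomial _ _ _ z

theorem dz_dzbar_modelPoly (d k₀ : ℕ) (a : ℕ → ℂ) (z : ℂ) :
    dz (dzbar (modelPoly d k₀ a)) z = ∑ j ∈ Finset.Icc (d - k₀) k₀,
      a j * (d - j : ℕ) * (j * z ^ (j - 1)) * conj z ^ (d - j - 1) := by
  have h1 : dzbar (modelPoly d k₀ a) = fun z => ∑ j ∈ Finset.Icc (d - k₀) k₀,
      (a j * (d - j : ℕ)) * z ^ j * conj z ^ (d - j - 1) := by
    funext z
    rw [dzbar_eq (hasFDerivAt_modelPoly d k₀ a z), modelDzbar]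
    exact Finset.sum_congr rfl fun j _ => by ring
  rw [h1]
  exact dz_eq (HasFDerivAt.sum_wirt fun _ _ => hasFDerivAt_monomial _ _ _ z)

section Model

variable {d k₀ : ℕ} {a : ℕ → ℂ}

namespace IsModel

variable (ha : IsModel d k₀ a)
include ha

/-- Conjugation is absorbed by the reindexing j ↔ d - j, under which the range of summation is
symmetric. -/
theorem conj_sum {f g : ℕ → ℂ} (h : ∀ j ∈ Finset.Icc (d - k₀) k₀, conj (f (d - j)) = g j) :
    conj (∑ j ∈ Finset.Icc (d - k₀) k₀, f j) = ∑ j ∈ Finset.Icc (d - k₀) k₀, g j := by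
  have := ha.lt
  rw [map_sum]
  refine Finset.sum_bij' (fun j _ => d - j) (fun j _ => d - j) ?_ ?_ ?_ ?_ ?_
  all_goals intro j hj; rw [Finset.mem_Icc] at hj
  · rw [Finset.mem_Icc]; omega
  · rw [Finset.mem_Icc]; omega
  · omega
  · omega
  · rw [← h (d - j) (by rw [Finset.mem_Icc]; omega), show d - (d - j) = j by omega]

theorem conj_coeff {j : ℕ} (hj : j ∈ Finset.Icc (d - k₀) k₀) : conj (a (d - j)) = a j :=
  (ha.symm j hj).symm

theorem modelPoly_im (z : ℂ) : (modelPoly d k₀ a z).im = 0 := by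
  rw [← conj_eq_iff_im]
  have := ha.lt
  refine ha.conj_sum fun j hj => ?_
  have h2 := Finset.mem_Icc.1 hj
  rw [map_mul, map_mul, map_pow, map_pow, conj_conj, ha.conj_coeff hj, show d - (d - j) = j by omega]
  ring

/-- For odd d the real function P_{zz̄} is homogeneous of odd degree d - 2. Being nonnegative at 1
and at -1, it would vanish at 1. -/
theorem even : Even d := by
  by_contra hd
  rw [Nat.not_even_iff_odd] at hd
  have hlt := ha.lt
  have hreal : (dz (dzbar (modelPoly d k₀ a)) 1).im = 0 := by
    rw [← conj_eq_iff_im, dz_dzbar_modelPoly]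
    refine ha.conj_sum fun j hj => ?_
    have h2 := Finset.mem_Icc.1 hj
    simp only [map_mul, map_one, ha.conj_coeff hj, one_pow, map_natCast,
      show d - (d - j) = j by omega]
    ring
  have hneg : dz (dzbar (modelPoly d k₀ a)) (-1) = -dz (dzbar (modelPoly d k₀ a)) 1 := by
    rw [dz_dzbar_modelPoly, dz_dzbar_modelPoly, ← Finset.sum_neg_distrib]
    refine Finset.sum_congr rfl fun j hj => ?_
    have h2 := Finset.mem_Icc.1 hj
    rw [map_neg, map_one, one_pow, one_pow]
    have h3 : (-1 : ℂ) ^ (j - 1) * (-1) ^ (d - j - 1) = -1 := by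
      rw [← pow_add]
      refine Odd.neg_one_pow ?_
      obtain ⟨m, hm⟩ := hd
      exact ⟨m - 1, by omega⟩
    linear_combination (a j * (d - j : ℕ) * j) * h3
  have h1 := ha.subharmonic 1
  have h2 := ha.subharmonic (-1)
  rw [hneg, neg_re] at h2
  exact ha.nondegenerate 1 one_ne_zero (Complex.ext (by rw [zero_re]; linarith) hreal)

theorem two_mul_half : 2 * (d / 2) = d := Nat.two_mul_div_two_of_even ha.even

theorem d_pos : 0 < d := (Nat.zero_le _).trans_lt ha.lt

theorem k₀_pos : 0 < k₀ := by
  have := ha.half_le; have := ha.d_pos; omega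

end IsModel

open Polynomial in
/-- The self-reciprocal polynomial `B(ζ) = ∑ j (d-j) a_j (-1)^{d-j} ζ^{k₀-d+j}`: the restriction of
the Levi form of the model to the unit circle, up to a power of `ζ`. -/
def leviPoly (d k₀ : ℕ) (a : ℕ → ℂ) : Polynomial ℂ :=
  ∑ j ∈ Finset.Icc (d - k₀) k₀, C (a j * (j * (d - j : ℕ)) * (-1) ^ (d - j)) * X ^ (k₀ + j - d)

theorem eval_leviPoly (z : ℂ) : (leviPoly d k₀ a).eval z =
    ∑ j ∈ Finset.Icc (d - k₀) k₀, a j * (j * (d - j : ℕ)) * (-1) ^ (d - j) * z ^ (k₀ + j - d) := by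
  simp only [leviPoly, Polynomial.eval_finsetSum, Polynomial.eval_mul, Polynomial.eval_C,
    Polynomial.eval_pow, Polynomial.eval_X]

namespace IsModel

variable (ha : IsModel d k₀ a)
include ha

theorem natDegree_leviPoly : (leviPoly d k₀ a).natDegree ≤ 2 * (k₀ - d / 2) := by
  have := ha.two_mul_half
  refine Polynomial.natDegree_sum_le_of_forall_le _ _ fun j hj => ?_
  have := Finset.mem_Icc.1 hj
  exact (Polynomial.natDegree_C_mul_X_pow_le _ _).trans (by omega)

/-- This combines the reality of P with the evenness of d, which gives (-1)^j = (-1)^(d-j). -/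
theorem reflect_leviPoly :
    ((leviPoly d k₀ a).map (starRingEnd ℂ)).reflect (2 * (k₀ - d / 2)) = leviPoly d k₀ a := by
  have h1 := ha.two_mul_half
  have h0 := ha.lt
  have h2 : ∀ n, ((leviPoly d k₀ a).map (starRingEnd ℂ)).coeff n = conj ((leviPoly d k₀ a).coeff n) :=
    fun n => Polynomial.coeff_map _ _
  ext n
  rw [Polynomial.coeff_reflect, h2]
  simp only [leviPoly, Polynomial.finsetSum_coeff, Polynomial.coeff_C_mul_X_pow]
  refine ha.conj_sum fun j hj => ?_
  have hj' := Finset.mem_Icc.1 hj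
  have h3 : ((Polynomial.revAt (2 * (k₀ - d / 2))) n = k₀ + (d - j) - d) ↔ n = k₀ + j - d := by
    rcases le_or_gt n (2 * (k₀ - d / 2)) with h | h
    · rw [Polynomial.revAt_le h]; omega
    · rw [Polynomial.revAt_eq_self_of_lt h]; omega
  simp only [h3]
  split_ifs
  · have h4 : (-1 : ℂ) ^ j = (-1) ^ (d - j) := by
      rw [neg_one_pow_eq_pow_mod_two, neg_one_pow_eq_pow_mod_two (n := d - j)]
      congr 1; omega
    simp only [map_mul, map_pow, map_neg, map_one, map_natCast, ha.conj_coeff hj,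
      show d - (d - j) = j by omega, h4]
    ring
  · rw [map_zero]

theorem leviPoly_coeff_zero : (leviPoly d k₀ a).coeff 0 =
    a (d - k₀) * ((d - k₀ : ℕ) * k₀) * (-1) ^ k₀ := by
  have h0 := ha.lt
  have h1 := ha.half_le
  simp only [leviPoly, Polynomial.finsetSum_coeff, Polynomial.coeff_C_mul_X_pow]
  rw [Finset.sum_eq_single (d - k₀)]
  · rw [if_pos (by omega), show d - (d - k₀) = k₀ by omega]
  · intro j hj hne
    have := Finset.mem_Icc.1 hj
    rw [if_neg (by omega)]
  · intro h
    exact absurd (Finset.mem_Icc.2 ⟨le_rfl, by omega⟩) h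

theorem lead' : a (d - k₀) ≠ 0 := by
  have h0 := ha.lt
  have h1 := ha.half_le
  have := ha.symm k₀ (Finset.mem_Icc.2 ⟨by omega, le_rfl⟩)
  intro h
  rw [h, map_zero] at this
  exact ha.lead this

theorem leviPoly_coeff_zero_ne : (leviPoly d k₀ a).coeff 0 ≠ 0 := by
  rw [ha.leviPoly_coeff_zero]
  have h0 := ha.lt
  have h2 := ha.k₀_pos
  refine mul_ne_zero (mul_ne_zero ha.lead' (mul_ne_zero ?_ ?_)) (pow_ne_zero _ (by norm_num))
  · exact_mod_cast (by omega : d - k₀ ≠ 0)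
  · exact_mod_cast h2.ne'

/-- Writing ζ = -z² with |z| = 1 turns the value of the polynomial into a unimodular multiple of
P_{zz̄}(z). The sign matches h̄/h = -ζ̄ for h = 1 - ζ. -/
theorem leviPoly_eval_ne {ζ : ℂ} (hζ : ‖ζ‖ = 1) : (leviPoly d k₀ a).eval ζ ≠ 0 := by
  have h0 := ha.lt
  have h1 := ha.half_le
  obtain ⟨z, hz⟩ := IsAlgClosed.exists_pow_nat_eq (-ζ) zero_lt_two
  have hz1 : ‖z‖ = 1 := by
    have := congrArg norm hz
    rw [norm_pow, norm_neg, hζ] at this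
    exact (pow_eq_one_iff_of_nonneg (norm_nonneg _) two_ne_zero).1 this
  have hz0 : z ≠ 0 := by rintro rfl; simp at hz1
  have hzc : z * conj z = 1 := by rw [mul_conj, normSq_eq_norm_sq, hz1]; simp
  have hζz : ζ = -z ^ 2 := by rw [hz, neg_neg]
  have key : (leviPoly d k₀ a).eval ζ =
      (-1) ^ k₀ * z ^ (2 * k₀ - d) * dz (dzbar (modelPoly d k₀ a)) z := by
    rw [eval_leviPoly, dz_dzbar_modelPoly, Finset.mul_sum]
    refine Finset.sum_congr rfl fun j hj => ?_
    have hj' := Finset.mem_Icc.1 hj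
    have e1 : (-1 : ℂ) ^ (d - j) * ζ ^ (k₀ + j - d) = (-1) ^ k₀ * z ^ (2 * (k₀ + j - d)) := by
      rw [hζz, neg_pow (z ^ 2), ← mul_assoc, ← pow_add, show d - j + (k₀ + j - d) = k₀ by omega,
        pow_mul]
    have e2 : z ^ (2 * k₀ - d) * z ^ (j - 1) * conj z ^ (d - j - 1) = z ^ (2 * (k₀ + j - d)) := by
      rw [← pow_add, show 2 * k₀ - d + (j - 1) = 2 * (k₀ + j - d) + (d - j - 1) by omega, pow_add,
        mul_assoc, ← mul_pow, hzc, one_pow, mul_one]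
    linear_combination (a j * (j * (d - j : ℕ))) * e1 - (a j * (j * (d - j : ℕ)) * (-1) ^ k₀) * e2
  rw [key]
  exact mul_ne_zero (mul_ne_zero (pow_ne_zero _ (by norm_num)) (pow_ne_zero _ hz0))
    (ha.nondegenerate z hz0)

end IsModel

end Model

end KStat

end

set_option linter.unusedSectionVars false

noncomputable section

namespace KStat

/-! ## Self-reciprocal polynomials and Toeplitz operators -/

open ComplexConjugate

section SelfReciprocal

open Polynomial

/-- `(X - z)(1 - z̄ X)`. -/
def blaschkePoly (z : ℂ) : ℂ[X] := (X - C z) * (1 - C (conj z) * X)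

theorem natDegree_one_sub_C_mul_X {z : ℂ} (hz : z ≠ 0) : (1 - C z * X : ℂ[X]).natDegree = 1 := by
  rw [show (1 - C z * X : ℂ[X]) = C (-z) * X + C 1 by rw [C_neg, C_1]; ring]
  exact natDegree_linear (neg_ne_zero.2 hz)

theorem natDegree_blaschkePoly {z : ℂ} (hz : z ≠ 0) : (blaschkePoly z).natDegree = 2 := by
  have hz' : conj z ≠ 0 := by simpa using hz
  have h1 := natDegree_one_sub_C_mul_X hz'
  rw [blaschkePoly, natDegree_mul (X_sub_C_ne_zero z), h1, natDegree_X_sub_C]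
  intro h
  rw [h, natDegree_zero] at h1
  exact zero_ne_one h1

theorem reflect_blaschkePoly (z : ℂ) :
    ((blaschkePoly z).map (starRingEnd ℂ)).reflect 2 = blaschkePoly z := by
  have h1 : (blaschkePoly z).map (starRingEnd ℂ) =
      C (-conj z) * X ^ 0 + C (1 + z * conj z) * X ^ 1 + C (-z) * X ^ 2 := by
    simp only [blaschkePoly, Polynomial.map_mul, Polynomial.map_sub, map_X, map_C, Polynomial.map_one,
      conj_conj, C_neg, C_add, C_mul, C_1]
    ring
  rw [h1, reflect_add, reflect_add, reflect_C_mul_X_pow, reflect_C_mul_X_pow, reflect_C_mul_X_pow,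
    revAt_le (by norm_num), revAt_le (by norm_num), revAt_le le_rfl]
  simp only [blaschkePoly, C_neg, C_add, C_mul, C_1]
  ring

/-- A self-reciprocal polynomial without zeros on the unit circle is `κ ζ^n |Q(ζ)|²` on the circle,
for a polynomial `Q` of degree `n` without zeros in the closed disc. -/
theorem exists_factor (n : ℕ) (p : ℂ[X]) (hdeg : p.natDegree ≤ 2 * n)
    (hself : (p.map (starRingEnd ℂ)).reflect (2 * n) = p) (h0 : p.coeff 0 ≠ 0)
    (hroot : ∀ z : ℂ, ‖z‖ = 1 → p.eval z ≠ 0) :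
    ∃ κ : ℂ, κ ≠ 0 ∧ ∃ Q : ℂ[X], Q.natDegree = n ∧ (∀ z : ℂ, ‖z‖ ≤ 1 → Q.eval z ≠ 0) ∧
      ∀ ζ : Circle, p.eval (ζ : ℂ) = κ * (ζ : ℂ) ^ n * (Q.eval (ζ : ℂ) * conj (Q.eval (ζ : ℂ))) := by
  induction n generalizing p with
  | zero =>
    obtain ⟨c, rfl⟩ : ∃ c, C c = p := ⟨_, (eq_C_of_natDegree_le_zero (by omega)).symm⟩
    rw [coeff_C_zero] at h0
    exact ⟨c, h0, 1, natDegree_one, fun z _ => by simp, fun ζ => by simp⟩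
  | succ n ih =>
    have hlead : p.natDegree = 2 * (n + 1) := by
      refine le_antisymm hdeg (le_natDegree_of_ne_zero ?_)
      rw [← hself, coeff_reflect, revAt_le le_rfl, Nat.sub_self, coeff_map]
      simpa using h0
    have hp0 : p ≠ 0 := by rintro rfl; simp at h0
    -- a root in the open disc
    obtain ⟨z, hz, hz1⟩ : ∃ z, p.IsRoot z ∧ ‖z‖ < 1 := by
      obtain ⟨z, hz⟩ := IsAlgClosed.exists_root p (by
        rw [degree_eq_natDegree hp0, hlead]
        exact_mod_cast (by omega : 2 * (n + 1) ≠ 0))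
      have hz0 : z ≠ 0 := by
        rintro rfl
        rw [IsRoot.def, ← coeff_zero_eq_eval_zero] at hz
        exact h0 hz
      rcases lt_trichotomy ‖z‖ 1 with h | h | h
      · exact ⟨z, hz, h⟩
      · exact absurd hz (hroot z h)
      · refine ⟨(conj z)⁻¹, ?_, ?_⟩
        · have hcz : conj z ≠ 0 := by simpa using hz0
          have : Invertible (conj z) := invertibleOfNonzero hcz
          have e := eval₂_reflect_eq_zero_iff (RingHom.id ℂ) (conj z) (2 * (n + 1))
            (p.map (starRingEnd ℂ)) (by rw [natDegree_map]; exact hdeg)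
          rw [hself, invOf_eq_inv] at e
          refine e.2 ?_
          show eval (conj z) (p.map (starRingEnd ℂ)) = 0
          rw [eval_map, eval₂_at_apply, hz.eq_zero, map_zero]
        · rw [norm_inv, RCLike.norm_conj]
          exact inv_lt_one_of_one_lt₀ h
    have hz0 : z ≠ 0 := by
      rintro rfl
      rw [IsRoot.def, ← coeff_zero_eq_eval_zero] at hz
      exact h0 hz
    have hcz : conj z ≠ 0 := by simpa using hz0
    -- Self-reciprocity reflects the roots in the unit circle, so 1/z̄ is a root as well; the
    -- quotient by the pair of linear factors is again self-reciprocal.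
    have hroot2 : p.eval (conj z)⁻¹ = 0 := by
      have : Invertible (conj z) := invertibleOfNonzero hcz
      have e := eval₂_reflect_eq_zero_iff (RingHom.id ℂ) (conj z) (2 * (n + 1))
        (p.map (starRingEnd ℂ)) (by rw [natDegree_map]; exact hdeg)
      rw [hself, invOf_eq_inv] at e
      refine e.2 ?_
      show eval (conj z) (p.map (starRingEnd ℂ)) = 0
      rw [eval_map, eval₂_at_apply, hz.eq_zero, map_zero]
    obtain ⟨p₁, hp₁⟩ := dvd_iff_isRoot.2 hz
    have hne : (conj z)⁻¹ - z ≠ 0 := by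
      intro h
      rw [sub_eq_zero] at h
      have := congrArg norm h
      rw [norm_inv, RCLike.norm_conj] at this
      have h3 : 1 < ‖z‖⁻¹ := (one_lt_inv₀ (norm_pos_iff.2 hz0)).2 hz1
      linarith
    obtain ⟨p₂, hp₂⟩ : X - C (conj z)⁻¹ ∣ p₁ := by
      refine dvd_iff_isRoot.2 ?_
      rw [hp₁, eval_mul, eval_sub, eval_X, eval_C] at hroot2
      exact (mul_eq_zero.1 hroot2).resolve_left hne
    obtain ⟨q, hq⟩ : ∃ q, p = blaschkePoly z * q := by
      refine ⟨C (-(conj z)⁻¹) * p₂, ?_⟩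
      have : (C (conj z) * C (conj z)⁻¹ : ℂ[X]) = 1 := by
        rw [← C_mul, mul_inv_cancel₀ hcz, C_1]
      rw [hp₁, hp₂, blaschkePoly, C_neg]
      linear_combination (-(X - C z) * X * p₂) * this
    have hq0 : q ≠ 0 := by rintro rfl; exact hp0 (by rw [hq, mul_zero])
    have hs0 : blaschkePoly z ≠ 0 := by intro h; exact hp0 (by rw [hq, h, zero_mul])
    have hqd : q.natDegree ≤ 2 * n := by
      have := natDegree_mul hs0 hq0
      rw [← hq, hlead, natDegree_blaschkePoly hz0] at this
      omega
    have hqself : (q.map (starRingEnd ℂ)).reflect (2 * n) = q := by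
      have e := hself
      rw [hq, Polynomial.map_mul, show 2 * (n + 1) = 2 + 2 * n by ring,
        reflect_mul _ _ (by rw [natDegree_map, natDegree_blaschkePoly hz0])
          (by rw [natDegree_map]; exact hqd), reflect_blaschkePoly] at e
      exact mul_left_cancel₀ hs0 e
    obtain ⟨κ, hκ, Q, hQd, hQ, hQe⟩ := ih q hqd hqself
      (fun h => h0 (by rw [hq, mul_coeff_zero, h, mul_zero]))
      (fun w hw h => hroot w hw (by rw [hq, eval_mul, h, mul_zero]))
    have h1 := natDegree_one_sub_C_mul_X hcz
    -- On the circle (ζ - z)(1 - z̄ζ) = ζ|1 - z̄ζ|². The factor 1 - z̄ζ is the one without zeros in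
    -- the closed disc.
    refine ⟨κ, hκ, (1 - C (conj z) * X) * Q, ?_, fun w hw => ?_, fun ζ => ?_⟩
    · rw [natDegree_mul (by intro h; rw [h, natDegree_zero] at h1; exact zero_ne_one h1)
        (by rintro rfl; exact hQ 0 (by simp) (by simp)), h1, hQd, add_comm]
    · rw [eval_mul]
      refine mul_ne_zero ?_ (hQ w hw)
      simp only [eval_sub, eval_one, eval_mul, eval_C, eval_X]
      intro h
      have h3 : ‖conj z * w‖ = 1 := by rw [← sub_eq_zero.1 h, norm_one]
      rw [norm_mul, RCLike.norm_conj] at h3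
      nlinarith [norm_nonneg z, norm_nonneg w]
    · have hζ : (ζ : ℂ) * conj (ζ : ℂ) = 1 := by
        rw [mul_conj, normSq_eq_norm_sq, Circle.norm_coe]; simp
      rw [hq, eval_mul, hQe, blaschkePoly]
      simp only [eval_mul, eval_sub, eval_one, eval_C, eval_X, map_mul, map_sub, map_one, conj_conj]
      linear_combination (κ * (ζ : ℂ) ^ n * (Q.eval (ζ : ℂ) * conj (Q.eval (ζ : ℂ))) * z *
        (1 - conj z * ζ)) * hζ

end SelfReciprocal

section Toeplitz

open CH

variable {k : ℕ} {α : ℝ} [HolderExponent α]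

namespace CH

/-- The restriction of a polynomial to the circle. -/
def poly (Q : Polynomial ℂ) : CH ℂ k α := ⟨fun ζ => Q.eval (ζ : ℂ), mem_of_contDiff <| by
  have h1 : ContDiff ℝ (k + 1 : ℕ) fun t : ℝ => (Circle.exp t : ℂ) := by
    simp only [Circle.coe_exp]
    exact (ofRealCLM.contDiff.mul contDiff_const).cexp
  exact ((Q.contDiff_aeval (𝕜 := ℂ) _).restrict_scalars ℝ).comp h1⟩

@[simp] theorem poly_apply (Q : Polynomial ℂ) (ζ : Circle) :
    (poly Q : CH ℂ k α) ζ = Q.eval (ζ : ℂ) := rfl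

theorem isHol_poly (Q : Polynomial ℂ) : IsHol (poly Q : CH ℂ k α) :=
  isHol_iff.2 ⟨fun z => Q.eval z, Q.differentiable.diffContOnCl, fun _ => rfl⟩

theorem fc_poly (Q : Polynomial ℂ) (n : ℕ) : fc (poly Q : CH ℂ k α).1 n = Q.coeff n := by
  induction Q using Polynomial.induction_on' with
  | add p q hp hq =>
    have h1 : (poly (p + q) : CH ℂ k α) = poly p + poly q := by ext ζ; exact Polynomial.eval_add
    have h2 := map_add (fcL (k := k) (α := α) n) (poly p) (poly q)
    rw [h1, Polynomial.coeff_add, ← hp, ← hq]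
    exact h2
  | monomial m c =>
    have h1 : (poly (Polynomial.monomial m c) : CH ℂ k α).1 =
        fun ζ : Circle => c * (ζ : ℂ) ^ (m : ℤ) := by
      funext ζ
      exact (Polynomial.eval_monomial).trans (by rw [zpow_natCast])
    rw [h1, fc_const_mul, fc_zpow, Polynomial.coeff_monomial]
    simp [eq_comm]

/-- The inverse of a polynomial without zeros in the closed disc, on the circle. -/
def polyInv (Q : Polynomial ℂ) (hQ : ∀ z : ℂ, ‖z‖ ≤ 1 → Q.eval z ≠ 0) : CH ℂ k α :=
  ⟨fun ζ => (Q.eval (ζ : ℂ))⁻¹, mem_of_contDiff <| by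
    have h1 : ContDiff ℝ (k + 1 : ℕ) fun t : ℝ => (Circle.exp t : ℂ) := by
      simp only [Circle.coe_exp]
      exact (ofRealCLM.contDiff.mul contDiff_const).cexp
    exact (((Q.contDiff_aeval (𝕜 := ℂ) _).restrict_scalars ℝ).comp h1).inv
      fun t => hQ _ (Circle.norm_coe _).le⟩

theorem polyInv_apply (Q : Polynomial ℂ) (hQ : ∀ z : ℂ, ‖z‖ ≤ 1 → Q.eval z ≠ 0) (ζ : Circle) :
    (polyInv Q hQ : CH ℂ k α) ζ = (Q.eval (ζ : ℂ))⁻¹ := rfl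

theorem isHol_polyInv (Q : Polynomial ℂ) (hQ : ∀ z : ℂ, ‖z‖ ≤ 1 → Q.eval z ≠ 0) :
    IsHol (polyInv Q hQ : CH ℂ k α) :=
  isHol_iff.2 ⟨fun z => (Q.eval z)⁻¹, (Q.differentiable.diffContOnCl).inv fun z hz => hQ z (by
    rw [closure_ball _ one_ne_zero] at hz
    simpa using hz), fun _ => rfl⟩

theorem exists_poly_of_fc {q : CH ℂ k α} (hq : IsHol q) {n : ℕ} (h : ∀ m : ℕ, fc q.1 (m + n) = 0) :
    ∃ s : Polynomial ℂ, s.degree < n ∧ q = poly s := by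
  refine ⟨∑ i ∈ Finset.range n, Polynomial.monomial i (fc q.1 i), ?_, CH.ext_fc fun m => ?_⟩
  · refine (Polynomial.degree_sum_le _ _).trans_lt ((Finset.sup_lt_iff (WithBot.bot_lt_coe n)).2 ?_)
    intro i hi
    refine (Polynomial.degree_monomial_le _ _).trans_lt ?_
    exact WithBot.coe_lt_coe.2 (Finset.mem_range.1 hi)
  · rcases lt_or_ge m 0 with hm | hm
    · rw [hq m hm, isHol_poly _ m hm]
    · obtain ⟨i, rfl⟩ : ∃ i : ℕ, m = i := ⟨m.toNat, by omega⟩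
      rw [fc_poly]
      simp only [Polynomial.finsetSum_coeff, Polynomial.coeff_monomial]
      rw [Finset.sum_ite_eq' (Finset.range n) i]
      split_ifs with hi
      · rfl
      · obtain ⟨j, rfl⟩ : ∃ j, i = j + n := ⟨i - n, by rw [Finset.mem_range] at hi; omega⟩
        have := h j
        push_cast
        exact this

end CH

variable {n : ℕ} {κ : ℂ} {B Q : Polynomial ℂ}

theorem negPart_apply (q : CH ℂ k α) : negPart q = szego (cj (mul (zp 1) q)) := rfl

theorem negPart_eq_zero_iff' {q : CH ℂ k α} :
    negPart q = 0 ↔ ∀ m : ℕ, fc (cj (mul (zp 1) q)).1 m = 0 := by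
  rw [negPart_apply, szego_eq_zero_iff]

/-- On the circle conj(ζ B w̄) = κ̄ ζ^(-(n+1)) Q̄ Q w. The negative part of B w̄ thus reads the
coefficients of Q̄(Qw) of order greater than n. -/
theorem fc_toeplitz (hB : ∀ ζ : Circle, B.eval (ζ : ℂ) =
      κ * (ζ : ℂ) ^ n * (Q.eval (ζ : ℂ) * conj (Q.eval (ζ : ℂ)))) (w : CH ℂ k α) (m : ℤ) :
    fc (cj (mul (zp 1) (mul (poly B) (cj w)))).1 m = conj κ *
      fc (mul (cj (poly Q)) (mul (poly Q) w)).1 (m + (n + 1)) := by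
  have h1 : (cj (mul (zp 1) (mul (poly B) (cj w)))).1 =
      fun ζ : Circle => conj κ * ((ζ : ℂ) ^ (-(n + 1) : ℤ) *
        mul (cj (poly Q)) (mul (poly Q) w) ζ) := by
    funext ζ
    show conj ((ζ : ℂ) ^ (1 : ℤ) * (B.eval (ζ : ℂ) * conj (w ζ))) = _
    have hζ : conj (ζ : ℂ) = (ζ : ℂ)⁻¹ := (Circle.coe_inv_eq_conj ζ).symm
    rw [hB]
    simp only [mul_apply, cj_apply, poly_apply, map_mul, map_pow, conj_conj, hζ, zpow_one, zpow_neg]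
    rw [show (ζ : ℂ) ^ ((n : ℤ) + 1) = (ζ : ℂ) ^ n * ζ by
      rw [zpow_add₀ (Circle.coe_ne_zero ζ), zpow_natCast, zpow_one], mul_inv, inv_pow]
    ring
  rw [h1, fc_const_mul, fc_zpow_mul]
  congr 2

/-- The equation says that ζ^(-(n+1)) Q̄ Q w has only negative orders. Multiplication by the
antiholomorphic function conj(1/Q) preserves this and leaves ζ^(-(n+1)) Qw. The argument is
reversible, which gives `negPart_toeplitz_poly`. -/
theorem exists_poly_of_toeplitz_eq_zero (hκ : κ ≠ 0) (hQ : ∀ z : ℂ, ‖z‖ ≤ 1 → Q.eval z ≠ 0)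
    (hB : ∀ ζ : Circle, B.eval (ζ : ℂ) =
      κ * (ζ : ℂ) ^ n * (Q.eval (ζ : ℂ) * conj (Q.eval (ζ : ℂ)))) {w : CH ℂ k α} (hw : IsHol w)
    (h : negPart (mul (poly B) (cj w)) = 0) :
    ∃ s : Polynomial ℂ, s.degree < (n + 1 : ℕ) ∧ mul (poly Q) w = poly s := by
  refine exists_poly_of_fc ((isHol_poly Q).mul hw) fun m => ?_
  have hκ' : conj κ ≠ 0 := by simpa using hκ
  set v : CH ℂ k α := mul (cj (poly Q)) (mul (poly Q) w)
  have h1 : ∀ m : ℕ, fc (mul (zp (-(n + 1) : ℤ)) v).1 m = 0 := fun m => by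
    have h2 := negPart_eq_zero_iff'.1 h m
    have h3 := fc_toeplitz hB w m
    have h4 := h3.symm.trans h2
    have h5 := (mul_eq_zero.1 h4).resolve_left hκ'
    have h6 := fc_zpow_mul (-(n + 1) : ℤ) v.1 m
    refine h6.trans ?_
    rw [← h5]
    congr 1
  have h2 := fc_mul_conj_eq_zero h1 (isHol_polyInv Q hQ) m
  have h3 : (mul (mul (zp (-(n + 1) : ℤ)) v) (cj (polyInv Q hQ))).1 =
      fun ζ : Circle => (ζ : ℂ) ^ (-(n + 1) : ℤ) * (mul (poly Q) w) ζ := by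
    funext ζ
    show (ζ : ℂ) ^ (-(n + 1) : ℤ) * (conj (Q.eval (ζ : ℂ)) * (Q.eval (ζ : ℂ) * w ζ)) *
      conj ((Q.eval (ζ : ℂ))⁻¹) = (ζ : ℂ) ^ (-(n + 1) : ℤ) * (Q.eval (ζ : ℂ) * w ζ)
    have h4 : conj (Q.eval (ζ : ℂ)) ≠ 0 := by
      rw [Ne, map_eq_zero]
      exact hQ _ (Circle.norm_coe ζ).le
    rw [map_inv₀]
    field_simp
  rw [h3, fc_zpow_mul] at h2
  rw [← h2]
  congr 1

theorem negPart_toeplitz_poly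
    (hB : ∀ ζ : Circle, B.eval (ζ : ℂ) =
      κ * (ζ : ℂ) ^ n * (Q.eval (ζ : ℂ) * conj (Q.eval (ζ : ℂ)))) {w : CH ℂ k α}
    {s : Polynomial ℂ} (hs : s.degree < (n + 1 : ℕ)) (hw : mul (poly Q) w = poly s) :
    negPart (mul (poly B) (cj w)) = 0 := by
  refine negPart_eq_zero_iff'.2 fun m => ?_
  rw [fc_toeplitz hB w m]
  have h1 : ∀ m : ℕ, fc (mul (zp (-(n + 1) : ℤ)) (poly s) : CH ℂ k α).1 m = 0 := fun m => by
    refine (fc_zpow_mul (-(n + 1) : ℤ) (poly s : CH ℂ k α).1 m).trans ?_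
    rw [show (m : ℤ) - -(n + 1) = ((m + n + 1 : ℕ) : ℤ) by push_cast; ring, fc_poly]
    exact Polynomial.coeff_eq_zero_of_degree_lt (hs.trans_le (by exact_mod_cast (by omega)))
  have h2 := fc_mul_conj_eq_zero h1 (isHol_poly Q) m
  have h3 : (mul (mul (zp (-(n + 1) : ℤ)) (poly s)) (cj (poly Q)) : CH ℂ k α).1 =
      fun ζ : Circle => (ζ : ℂ) ^ (-(n + 1) : ℤ) * (mul (cj (poly Q)) (mul (poly Q) w)) ζ := by
    rw [hw]
    funext ζ
    show (ζ : ℂ) ^ (-(n + 1) : ℤ) * s.eval (ζ : ℂ) * conj (Q.eval (ζ : ℂ)) =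
      (ζ : ℂ) ^ (-(n + 1) : ℤ) * (conj (Q.eval (ζ : ℂ)) * s.eval (ζ : ℂ))
    ring
  rw [h3, fc_zpow_mul] at h2
  rw [show (m : ℤ) + (n + 1) = m - -(n + 1) by ring, h2, mul_zero]

/-- There is an explicit Wiener–Hopf right inverse u = κ̄^(-1) Q^(-1) ζ^(n+1) s, where s is the
projection of q/Q̄. The error s - q/Q̄ has only negative orders and keeps this property after
multiplication by Q̄. -/
theorem exists_toeplitz_eq (hκ : κ ≠ 0) (hQ : ∀ z : ℂ, ‖z‖ ≤ 1 → Q.eval z ≠ 0)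
    (hB : ∀ ζ : Circle, B.eval (ζ : ℂ) =
      κ * (ζ : ℂ) ^ n * (Q.eval (ζ : ℂ) * conj (Q.eval (ζ : ℂ)))) (q : A k α) :
    ∃ u : A k α, negPart (mul (poly B) (cj (bd u))) = q := by
  have hκ' : conj κ ≠ 0 := by simpa using hκ
  set p : CH ℂ k α := mul (cj (polyInv Q hQ)) (bd q)
  set s : CH ℂ k α := bd (szego p)
  obtain ⟨u, hu⟩ := isHol_iff_exists.1 (((isHol_const (conj κ)⁻¹).mul (isHol_polyInv Q hQ)).mul
    ((isHol_zp (n + 1)).mul (isHol_bd (szego p))))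
  have huv : ∀ ζ : Circle, bd u ζ = (conj κ)⁻¹ * (Q.eval (ζ : ℂ))⁻¹ * ((ζ : ℂ) ^ (n + 1) * s ζ) :=
    fun ζ => by
      rw [hu]
      show (conj κ)⁻¹ * (Q.eval (ζ : ℂ))⁻¹ * ((ζ : ℂ) ^ ((n + 1 : ℕ) : ℤ) * s ζ) = _
      rw [zpow_natCast]
  refine ⟨u, ?_⟩
  rw [negPart_apply, szego_eq_iff]
  intro m
  rw [fc_toeplitz hB (bd u) m]
  have h1 : (mul (cj (poly Q)) (mul (poly Q) (bd u)) : CH ℂ k α).1 =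
      fun ζ : Circle => (conj κ)⁻¹ * ((ζ : ℂ) ^ ((n + 1 : ℕ) : ℤ) * mul s (cj (poly Q)) ζ) := by
    funext ζ
    show conj (Q.eval (ζ : ℂ)) * (Q.eval (ζ : ℂ) * bd u ζ) =
      (conj κ)⁻¹ * ((ζ : ℂ) ^ ((n + 1 : ℕ) : ℤ) * (s ζ * conj (Q.eval (ζ : ℂ))))
    rw [huv, zpow_natCast]
    have h4 := hQ _ (Circle.norm_coe ζ).le
    field_simp
  rw [h1, fc_const_mul, fc_zpow_mul, ← mul_assoc, mul_inv_cancel₀ hκ', one_mul]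
  have h2 : ∀ m : ℕ, fc (s - p).1 m = 0 := fun m => by
    have := map_sub (fcL (k := k) (α := α) m) s p
    simp only [fcL_apply] at this
    rw [this, fc_szego, sub_self]
  have h3 := fc_mul_conj_eq_zero h2 (isHol_poly Q) m
  have h5 : mul (s - p) (cj (poly Q)) = mul s (cj (poly Q)) - bd q := by
    ext ζ
    show (s ζ - conj ((Q.eval (ζ : ℂ))⁻¹) * bd q ζ) * conj (Q.eval (ζ : ℂ)) =
      s ζ * conj (Q.eval (ζ : ℂ)) - bd q ζ
    have h4 : conj (Q.eval (ζ : ℂ)) ≠ 0 := by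
      rw [Ne, map_eq_zero]
      exact hQ _ (Circle.norm_coe ζ).le
    rw [map_inv₀]
    field_simp
  rw [h5] at h3
  have h6 := map_sub (fcL (k := k) (α := α) m) (mul s (cj (poly Q))) (bd q)
  simp only [fcL_apply] at h6
  rw [h6, sub_eq_zero] at h3
  rw [← h3]
  congr 1; push_cast; ring

/-- The Toeplitz equation with prescribed finite dimensional data. -/
theorem toeplitz_bijective (hκ : κ ≠ 0) (hQ : ∀ z : ℂ, ‖z‖ ≤ 1 → Q.eval z ≠ 0)
    (hQn : Q.natDegree = n) (hB : ∀ ζ : Circle, B.eval (ζ : ℂ) =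
      κ * (ζ : ℂ) ^ n * (Q.eval (ζ : ℂ) * conj (Q.eval (ζ : ℂ))))
    (J : A k α →L[ℝ] (Fin (n + 2) → ℂ))
    (hJ : ∀ (u : A k α) (s : Polynomial ℂ), s.degree < (n + 2 : ℕ) → mul (poly Q) (bd u) = poly s →
      J u = 0 → s = 0) :
    (∀ (b : ℂ) (u : A k α), negPart (mul (poly B) (cj (bd u + mul (const b) (zp 1)))) = 0 →
      J u = 0 → b = 0 ∧ u = 0) ∧
    ∀ (q : A k α) (y : Fin (n + 2) → ℂ), ∃ (b : ℂ) (u : A k α),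
      negPart (mul (poly B) (cj (bd u + mul (const b) (zp 1)))) = q ∧ J u = y := by
  have hQ0 : Q ≠ 0 := by rintro rfl; exact hQ 0 (by simp) (by simp)
  have hQζ : ∀ ζ : Circle, Q.eval (ζ : ℂ) ≠ 0 := fun ζ => hQ _ (Circle.norm_coe ζ).le
  refine ⟨fun b u h hu => ?_, fun q y => ?_⟩
  · have hol : IsHol (bd u + mul (const b) (zp 1)) :=
      (isHol_bd u).add ((isHol_const b).mul (isHol_zp 1))
    obtain ⟨s, hs, hw⟩ := exists_poly_of_toeplitz_eq_zero hκ hQ hB hol h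
    -- With w = u + bζ in the kernel, Qu is a polynomial of degree at most n + 1, one more than Qw.
    -- This is why n + 2 complex data are needed.
    have hQu : mul (poly Q) (bd u) = poly (s - Polynomial.C b * (Q * Polynomial.X)) := by
      ext ζ
      have h1 := congrArg (fun w : CH ℂ k α => w ζ) hw
      have h2 : Q.eval (ζ : ℂ) * (bd u ζ + b * (ζ : ℂ) ^ (1 : ℤ)) = s.eval (ζ : ℂ) := h1
      show Q.eval (ζ : ℂ) * bd u ζ = (s - Polynomial.C b * (Q * Polynomial.X)).eval (ζ : ℂ)
      simp only [Polynomial.eval_sub, Polynomial.eval_mul, Polynomial.eval_C, Polynomial.eval_X]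
      rw [← h2, zpow_one]
      ring
    have hdX : (Q * Polynomial.X).degree = ((n + 1 : ℕ) : WithBot ℕ) := by
      rw [Polynomial.degree_mul_X, Polynomial.degree_eq_natDegree hQ0, hQn]; rfl
    have hdb : (Polynomial.C b * (Q * Polynomial.X)).degree ≤ ((n + 1 : ℕ) : WithBot ℕ) := by
      rw [← hdX, ← Polynomial.smul_eq_C_mul]; exact Polynomial.degree_smul_le _ _
    have hz := hJ u _ ((Polynomial.degree_sub_le _ _).trans_lt (max_lt
      (hs.trans (WithBot.coe_lt_coe.2 (by simp))) (hdb.trans_lt (WithBot.coe_lt_coe.2 (by simp)))))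
      hQu hu
    -- Otherwise s = bQX would have degree n + 1, against deg s ≤ n.
    have hb : b = 0 := by
      by_contra hb
      rw [sub_eq_zero] at hz
      rw [hz, Polynomial.degree_C_mul hb, hdX] at hs
      exact lt_irrefl _ hs
    refine ⟨hb, bd_injective ?_⟩
    rw [map_zero]
    ext ζ
    have h1 := congrArg (fun w : CH ℂ k α => w ζ) hQu
    rw [hz] at h1
    have h2 : Q.eval (ζ : ℂ) * bd u ζ = (0 : Polynomial ℂ).eval (ζ : ℂ) := h1
    rw [Polynomial.eval_zero] at h2
    exact (mul_eq_zero.1 h2).resolve_left (hQζ ζ)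
  · obtain ⟨u₁, hu₁⟩ := exists_toeplitz_eq (k := k) (α := α) hκ hQ hB q
    let pc (c : Fin (n + 2) → ℂ) : Polynomial ℂ := ((Polynomial.degreeLTEquiv ℂ (n + 2)).symm c).1
    have pc_add : ∀ c e, pc (c + e) = pc c + pc e := fun c e => by simp only [pc, map_add]; rfl
    have pc_smul : ∀ (x : ℝ) c, pc (x • c) = Polynomial.C (x : ℂ) * pc c := fun x c => by
      have : x • c = (x : ℂ) • c := by ext i; simp
      rw [this, ← Polynomial.smul_eq_C_mul]
      simp only [pc, map_smul]; rfl
    have pc_lt : ∀ c, (pc c).degree < (n + 2 : ℕ) := fun c =>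
      Polynomial.mem_degreeLT.1 ((Polynomial.degreeLTEquiv ℂ (n + 2)).symm c).2
    have pc_zero : ∀ c, pc c = 0 → c = 0 := fun c h =>
      (Polynomial.degreeLTEquiv ℂ (n + 2)).symm.map_eq_zero_iff.1 (Subtype.ext h)
    let U (c : Fin (n + 2) → ℂ) : A k α := szego (mul (polyInv Q hQ) (poly (pc c)))
    have hU : ∀ c, mul (poly Q) (bd (U c)) = poly (pc c) := fun c => by
      obtain ⟨w, hw⟩ := isHol_iff_exists.1 ((isHol_polyInv (k := k) (α := α) Q hQ).mul
        (isHol_poly (pc c)))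
      have : U c = w := by simp only [U]; rw [← hw, szego_bd]
      rw [this, hw]
      ext ζ
      simp only [mul_apply, poly_apply, polyInv_apply]
      rw [mul_inv_cancel_left₀ (hQζ ζ)]
    -- The data of pc(c)/Q define an injective real linear endomorphism of ℂ^(n+2), hence a
    -- surjective one. It corrects the data of the particular solution u₁.
    let Λ : (Fin (n + 2) → ℂ) →ₗ[ℝ] (Fin (n + 2) → ℂ) :=
      { toFun := fun c => J (U c)
        map_add' := fun c e => by
          have : (poly (pc (c + e)) : CH ℂ k α) = poly (pc c) + poly (pc e) := by
            ext ζ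
            rw [pc_add]
            exact Polynomial.eval_add
          simp only [U]
          rw [this, map_add, map_add, map_add]
        map_smul' := fun x c => by
          have : (poly (pc (x • c)) : CH ℂ k α) = x • poly (pc c) := by
            ext ζ
            rw [pc_smul]
            show Polynomial.eval (ζ : ℂ) _ = x • Polynomial.eval (ζ : ℂ) _
            rw [Polynomial.eval_C_mul, real_smul]
          simp only [U]
          rw [this, map_smul, map_smul, map_smul, RingHom.id_apply] }
    have hinj : Function.Injective Λ := by
      rw [injective_iff_map_eq_zero]
      intro c hc
      exact pc_zero c (hJ (U c) (pc c) (pc_lt c) (hU c) hc)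
    obtain ⟨c, hc⟩ := LinearMap.injective_iff_surjective.1 hinj (y - J u₁)
    have hc' : J (U c) = y - J u₁ := hc
    -- This value cancels the coefficient of order n + 1 of pc(c) + bQX, which puts the corrected
    -- pair in the kernel of the Toeplitz operator.
    set b : ℂ := -(pc c).coeff (n + 1) / Q.coeff n
    have hQc : Q.coeff n ≠ 0 := by
      rw [← hQn]; exact Polynomial.leadingCoeff_ne_zero.2 hQ0
    refine ⟨b, u₁ + U c, ?_, by rw [map_add, hc', add_sub_cancel]⟩
    have h1 : negPart (mul (poly B) (cj (bd (U c) + mul (const b) (zp 1)))) = 0 := by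
      refine negPart_toeplitz_poly (s := pc c + Polynomial.C b * (Q * Polynomial.X)) hB ?_ ?_
      · rw [Polynomial.degree_lt_iff_coeff_zero]
        intro m hm
        rw [Polynomial.coeff_add, Polynomial.coeff_C_mul]
        rcases hm.eq_or_lt with rfl | hm
        · rw [Polynomial.coeff_mul_X, div_mul_cancel₀ _ hQc, add_neg_cancel]
        · obtain ⟨m, rfl⟩ : ∃ j, m = j + 1 := ⟨m - 1, by omega⟩
          rw [Polynomial.coeff_mul_X, Polynomial.coeff_eq_zero_of_natDegree_lt (by omega : _ < m),
            Polynomial.coeff_eq_zero_of_degree_lt ((pc_lt c).trans_le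
              (WithBot.coe_le_coe.2 (by simp; omega)))]
          simp
      · ext ζ
        have h2 : Q.eval (ζ : ℂ) * bd (U c) ζ = (pc c).eval (ζ : ℂ) :=
          congrArg (fun w : CH ℂ k α => w ζ) (hU c)
        show Q.eval (ζ : ℂ) * (bd (U c) ζ + b * (ζ : ℂ) ^ (1 : ℤ)) = Polynomial.eval (ζ : ℂ) _
        simp only [Polynomial.eval_add, Polynomial.eval_mul, Polynomial.eval_C, Polynomial.eval_X]
        rw [← h2, zpow_one]
        ring
    rw [map_add bd, add_assoc, map_add cj, map_add (mul (poly B)), map_add negPart, hu₁, h1, add_zero]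

end Toeplitz

end KStat

end

set_option linter.unusedSectionVars false

noncomputable section

namespace KStat

/-! ## Finite dimensional data determining the kernel of the Toeplitz operator -/

open ComplexConjugate CH

section Data

variable {k : ℕ} {α : ℝ} [HolderExponent α]

theorem iteratedDeriv_eval (p : Polynomial ℂ) (i : ℕ) (z : ℂ) :
    iteratedDeriv i (fun z => p.eval z) z = (Polynomial.derivative^[i] p).eval z := by
  induction i generalizing z with
  | zero => simp
  | succ i ih =>
    rw [iteratedDeriv_succ, funext ih, Polynomial.deriv, Function.iterate_succ_apply']

/-- Near z, s = QH inherits a zero of order n from H, too many for a nonzero polynomial of degree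
less than n. -/
theorem eq_zero_of_iteratedDeriv_mul {s Q : Polynomial ℂ} {n : ℕ} (hs : s.degree < n) {H : ℂ → ℂ}
    {z : ℂ} (hH : AnalyticAt ℂ H z) (hHs : ∀ᶠ w in nhds z, Q.eval w * H w = s.eval w)
    (hz : ∀ i < n, iteratedDeriv i H z = 0) : s = 0 := by
  have hQ : AnalyticAt ℂ (fun w => Q.eval w) z := Q.differentiable.analyticAt z
  have hsA : AnalyticAt ℂ (fun w => s.eval w) z := s.differentiable.analyticAt z
  have h1 := (natCast_le_analyticOrderAt_iff_iteratedDeriv_eq_zero hH).2 hz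
  have h2 : (n : ℕ∞) ≤ analyticOrderAt (fun w => s.eval w) z := by
    rw [← analyticOrderAt_congr hHs]
    have := analyticOrderAt_mul hQ hH
    refine h1.trans ?_
    calc analyticOrderAt H z ≤ analyticOrderAt (fun w => Q.eval w) z + analyticOrderAt H z :=
          le_add_self
      _ = _ := this.symm
  have h3 := (natCast_le_analyticOrderAt_iff_iteratedDeriv_eq_zero hsA).1 h2
  by_contra hs0
  have hn : 0 < n := by
    rcases Nat.eq_zero_or_pos n with rfl | h
    · exact absurd hs (not_lt.2 (Polynomial.zero_le_degree_iff.2 hs0))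
    · exact h
  have h4 : n - 1 < s.rootMultiplicity z := by
    rw [Polynomial.lt_rootMultiplicity_iff_isRoot_iterate_derivative hs0]
    intro m hm
    rw [Polynomial.IsRoot.def, ← iteratedDeriv_eval]
    exact h3 m (by omega)
  have h5 : s.rootMultiplicity z ≤ s.natDegree := by
    rw [← Polynomial.count_roots]
    exact (Multiset.count_le_card _ _).trans (Polynomial.card_roots' s)
  have h6 := (Polynomial.natDegree_lt_iff_degree_lt hs0).2 hs
  omega

/-- The disc is H = (1-z)s/Q, and H(1) = 0 comes for free. With the jet it has a zero of order n + 1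
at 1, while (1-z)s has degree less than n + 1. -/
theorem eq_zero_of_jetAtOne {Q s : Polynomial ℂ} (hQ : ∀ z : ℂ, ‖z‖ ≤ 1 → Q.eval z ≠ 0) {n : ℕ}
    (hs : s.degree < n) {u : A k α} (hu : mul (poly Q) (bd u) = poly s) (hJ : jetAtOne n u = 0) :
    s = 0 := by
  set H : ℂ → ℂ := fun z => (1 - z) * (s.eval z / Q.eval z) with hH
  have hext : Set.EqOn (ext u) (fun z => s.eval z / Q.eval z) (closedBall 0 1) := by
    refine ext_eq_of_diffContOnCl u ?_ fun ζ => ?_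
    · simp only [div_eq_mul_inv]
      have h1 : DiffContOnCl ℂ (fun z => (Q.eval z)⁻¹) (ball 0 1) :=
        (Q.differentiable.diffContOnCl).inv fun z hz => hQ z (by
          rw [closure_ball _ one_ne_zero] at hz
          simpa using hz)
      simpa only [smul_eq_mul] using! (s.differentiable.diffContOnCl).smul h1
    · have h1 : Q.eval (ζ : ℂ) * bd u ζ = s.eval (ζ : ℂ) := congrArg (fun w : CH ℂ k α => w ζ) hu
      have h2 := hQ _ (Circle.norm_coe ζ).le
      rw [← h1, mul_div_cancel_left₀ _ h2, bd_apply]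
  have hdisc : Set.EqOn (disc u) H (closedBall 0 1) := fun z hz => by
    rw [disc, hext hz]
  have h1m : (1 : ℂ) ∈ closedBall (0 : ℂ) 1 := by simp
  have hHa : AnalyticAt ℂ H 1 :=
    (analyticAt_const.sub analyticAt_id).mul ((s.differentiable.analyticAt 1).div
      (Q.differentiable.analyticAt 1) (hQ 1 (by simp)))
  have hder : ∀ i < n + 1, iteratedDeriv i H 1 = 0 := fun i hi => by
    rcases i with _ | i
    · simp [hH]
    · have h2 := congrFun hJ ⟨i, by omega⟩
      rw [← iteratedDerivWithin_eq_iteratedDeriv uniqueDiffOn_closedBall hHa.contDiffAt h1m,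
        ← iteratedDerivWithin_congr hdisc h1m]
      exact h2
  have h3 := eq_zero_of_iteratedDeriv_mul (s := (1 - Polynomial.X) * s) (Q := Q) (n := n + 1) ?_ hHa
    ?_ hder
  · refine (mul_eq_zero.1 h3).resolve_left fun h => ?_
    have := congrArg (Polynomial.eval 0) h
    simp at this
  · rcases eq_or_ne s 0 with rfl | hs0
    · rw [mul_zero, Polynomial.degree_zero]
      exact WithBot.bot_lt_coe _
    · rw [← Polynomial.natDegree_lt_iff_degree_lt (mul_ne_zero ?_ hs0)]
      · have h4 := (Polynomial.natDegree_lt_iff_degree_lt hs0).2 hs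
        refine Polynomial.natDegree_mul_le.trans_lt ?_
        have : (1 - Polynomial.X : Polynomial ℂ).natDegree ≤ 1 :=
          (Polynomial.natDegree_sub_le _ _).trans (by simp)
        omega
      · intro h
        have := congrArg (Polynomial.eval 0) h
        simp at this
  · have : ∀ᶠ w in nhds (1 : ℂ), Q.eval w ≠ 0 :=
      Q.continuous.continuousAt.eventually_ne (hQ 1 (by simp))
    filter_upwards [this] with w hw
    simp only [hH, Polynomial.eval_mul, Polynomial.eval_sub, Polynomial.eval_one, Polynomial.eval_X]
    field_simp

/-- The first `n` Fourier coefficients of an element of `A^{k,α}`. -/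
def taylor (n : ℕ) : A k α →L[ℝ] (Fin n → ℂ) :=
  ContinuousLinearMap.pi fun i => (fcL (i : ℕ)).comp bd

/-- If the first n coefficients of u vanish, ζ^(-n)u is still holomorphic, hence so is ζ^(-n)s = Q
ζ^(-n)u. All coefficients of s of order below n are then zero. -/
theorem eq_zero_of_taylor {Q s : Polynomial ℂ} {n : ℕ} (hs : s.degree < n) {u : A k α}
    (hu : mul (poly Q) (bd u) = poly s) (hJ : taylor n u = 0) : s = 0 := by
  have h1 : IsHol (mul (zp (-n : ℤ)) (bd u)) := fun m hm => by
    refine (fc_zpow_mul (-n : ℤ) (bd u).1 m).trans ?_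
    rcases lt_or_ge (m - -(n : ℤ)) 0 with h | h
    · exact isHol_bd u _ h
    · obtain ⟨i, hi⟩ : ∃ i : ℕ, m - -(n : ℤ) = i := ⟨(m - -(n : ℤ)).toNat, by omega⟩
      rw [hi]
      exact congrFun hJ ⟨i, by omega⟩
  have h2 := (isHol_poly (k := k) (α := α) Q).mul h1
  ext m
  rw [Polynomial.coeff_zero]
  rcases lt_or_ge m n with hm | hm
  · have h3 := h2 (m - n) (by omega)
    have h4 : (mul (poly Q) (mul (zp (-n : ℤ)) (bd u))).1 =
        fun ζ : Circle => (ζ : ℂ) ^ (-n : ℤ) * (poly s : CH ℂ k α) ζ := by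
      rw [← hu]
      funext ζ
      simp only [mul_apply, zp_apply, poly_apply]
      ring
    rw [h4, fc_zpow_mul] at h3
    rw [← fc_poly (k := k) (α := α), ← h3]
    congr 1; ring
  · exact Polynomial.coeff_eq_zero_of_degree_lt (hs.trans_le (WithBot.coe_le_coe.2 hm))

end Data

end KStat

end

set_option linter.unusedSectionVars false

noncomputable section

namespace KStat

/-! ## Small perturbations of class `C^1` -/

open Filter Topology ComplexConjugate CH

section Small

variable {V W W' : Type*} [NormedAddCommGroup V] [NormedSpace ℝ V] [NormedAddCommGroup W]
  [NormedSpace ℝ W] [NormedAddCommGroup W'] [NormedSpace ℝ W'] {𝒟 : Type*} {size : 𝒟 → ℝ} {x₀ : V}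

/-- A family of maps of class `C^1` which, together with their derivatives, are bounded near `x₀`
by a multiple of the size of the parameter. -/
def SmallAt (size : 𝒟 → ℝ) (x₀ : V) (F : 𝒟 → V → W) : Prop :=
  (∀ D, ContDiff ℝ 1 (F D)) ∧ ∃ C : ℝ, 0 ≤ C ∧ ∀ᶠ x in 𝓝 x₀, ∀ D, ‖F D x‖ ≤ C * size D ∧
    ‖fderiv ℝ (F D) x‖ ≤ C * size D

theorem SmallAt.add {F G : 𝒟 → V → W} (hF : SmallAt size x₀ F) (hG : SmallAt size x₀ G) :
    SmallAt size x₀ fun D x => F D x + G D x := by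
  obtain ⟨hF1, C, hC0, hC⟩ := hF
  obtain ⟨hG1, C', hC0', hC'⟩ := hG
  refine ⟨fun D => (hF1 D).add (hG1 D), C + C', add_nonneg hC0 hC0', ?_⟩
  filter_upwards [hC, hC'] with x h1 h2 D
  rw [fderiv_fun_add ((hF1 D).differentiable one_ne_zero x) ((hG1 D).differentiable one_ne_zero x),
    add_mul]
  exact ⟨(norm_add_le _ _).trans (add_le_add (h1 D).1 (h2 D).1),
    (norm_add_le _ _).trans (add_le_add (h1 D).2 (h2 D).2)⟩

theorem smallAt_zero : SmallAt size x₀ fun (_ : 𝒟) (_ : V) => (0 : W) :=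
  ⟨fun _ => contDiff_const, 0, le_rfl, Eventually.of_forall fun x D => by simp⟩

theorem SmallAt.sum {ι : Type*} {s : Finset ι} {F : ι → 𝒟 → V → W}
    (hF : ∀ i ∈ s, SmallAt size x₀ (F i)) : SmallAt size x₀ fun D x => ∑ i ∈ s, F i D x := by
  classical
  induction s using Finset.induction_on with
  | empty => simpa using smallAt_zero
  | insert i s hi ih =>
    simp only [Finset.sum_insert hi]
    exact (hF i (Finset.mem_insert_self i s)).add
      (ih fun j hj => hF j (Finset.mem_insert_of_mem hj))

theorem SmallAt.clm {F : 𝒟 → V → W} (hF : SmallAt size x₀ F) (L : W →L[ℝ] W') :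
    SmallAt size x₀ fun D x => L (F D x) := by
  obtain ⟨hF1, C, hC0, hC⟩ := hF
  refine ⟨fun D => L.contDiff.comp (hF1 D), ‖L‖ * C, by positivity, ?_⟩
  filter_upwards [hC] with x h1 D
  have h2 : fderiv ℝ (fun x => L (F D x)) x = L.comp (fderiv ℝ (F D) x) :=
    (L.hasFDerivAt.comp x ((hF1 D).differentiable one_ne_zero x).hasFDerivAt).fderiv
  rw [h2, mul_assoc]
  exact ⟨(L.le_opNorm _).trans (mul_le_mul_of_nonneg_left (h1 D).1 (norm_nonneg _)),
    (L.opNorm_comp_le _).trans (mul_le_mul_of_nonneg_left (h1 D).2 (norm_nonneg _))⟩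

/-- The fixed factor and its derivative are continuous, hence bounded near `x₀`; the product rule
does the rest. Smallness of value and derivative together is the form stable under such products. -/
theorem SmallAt.bilin {W'' : Type*} [NormedAddCommGroup W''] [NormedSpace ℝ W'']
    (B : W' →L[ℝ] W →L[ℝ] W'') {f : V → W'} (hf : ContDiff ℝ 1 f) {F : 𝒟 → V → W}
    (hF : SmallAt size x₀ F) : SmallAt size x₀ fun D x => B (f x) (F D x) := by
  obtain ⟨hF1, C, hC0, hC⟩ := hF
  have h1 : ∀ᶠ x in 𝓝 x₀, ‖f x‖ < ‖f x₀‖ + 1 :=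
    hf.continuous.norm.continuousAt.eventually_lt continuousAt_const (lt_add_one _)
  have h2 : ∀ᶠ x in 𝓝 x₀, ‖fderiv ℝ f x‖ < ‖fderiv ℝ f x₀‖ + 1 :=
    (hf.continuous_fderiv one_ne_zero).norm.continuousAt.eventually_lt continuousAt_const
      (lt_add_one _)
  set M := ‖f x₀‖ + 1 with hM
  set M' := ‖fderiv ℝ f x₀‖ + 1 with hM'
  have hM0 : 0 ≤ M := by positivity
  have hM0' : 0 ≤ M' := by positivity
  refine ⟨fun D => (B.contDiff.comp hf).clm_apply (hF1 D), ‖B‖ * M * C + ‖B‖ * M' * C,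
    by positivity, ?_⟩
  filter_upwards [hC, h1, h2] with x hx h1x h2x D
  obtain ⟨e1, e2⟩ := hx D
  have hs : 0 ≤ C * size D := (norm_nonneg _).trans e1
  have p1 : ‖B‖ * ‖f x‖ * ‖F D x‖ ≤ ‖B‖ * M * (C * size D) := by gcongr
  have p2 : ‖B‖ * ‖f x‖ * ‖fderiv ℝ (F D) x‖ ≤ ‖B‖ * M * (C * size D) := by gcongr
  have p3 : ‖B‖ * ‖fderiv ℝ f x‖ * ‖F D x‖ ≤ ‖B‖ * M' * (C * size D) := by gcongr
  have p4 : 0 ≤ ‖B‖ * M' * (C * size D) := by positivity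
  constructor
  · refine (B.le_opNorm₂ _ _).trans ?_
    linarith
  · have hd := (B.hasFDerivAt_of_bilinear (hf.differentiable one_ne_zero x).hasFDerivAt
      ((hF1 D).differentiable one_ne_zero x).hasFDerivAt).fderiv
    rw [hd]
    refine (norm_add_le _ _).trans ?_
    have q1 : ‖B.precompR V (f x) (fderiv ℝ (F D) x)‖ ≤ ‖B‖ * ‖f x‖ * ‖fderiv ℝ (F D) x‖ := by
      refine ContinuousLinearMap.opNorm_le_bound _ (by positivity) fun v => ?_
      rw [ContinuousLinearMap.precompR_apply]
      refine (B.le_opNorm₂ _ _).trans ?_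
      calc ‖B‖ * ‖f x‖ * ‖fderiv ℝ (F D) x v‖ ≤ ‖B‖ * ‖f x‖ * (‖fderiv ℝ (F D) x‖ * ‖v‖) := by
            gcongr; exact (fderiv ℝ (F D) x).le_opNorm v
        _ = _ := by ring
    have q2 : ‖B.precompL V (fderiv ℝ f x) (F D x)‖ ≤ ‖B‖ * ‖fderiv ℝ f x‖ * ‖F D x‖ := by
      refine ContinuousLinearMap.opNorm_le_bound _ (by positivity) fun v => ?_
      rw [ContinuousLinearMap.precompL_apply]
      refine (B.le_opNorm₂ _ _).trans ?_
      calc ‖B‖ * ‖fderiv ℝ f x v‖ * ‖F D x‖ ≤ ‖B‖ * (‖fderiv ℝ f x‖ * ‖v‖) * ‖F D x‖ := by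
            gcongr; exact (fderiv ℝ f x).le_opNorm v
        _ = _ := by ring
    linarith

theorem SmallAt.prodMk {F : 𝒟 → V → W} {G : 𝒟 → V → W'} (hF : SmallAt size x₀ F)
    (hG : SmallAt size x₀ G) : SmallAt size x₀ fun D x => (F D x, G D x) := by
  have h := (hF.clm (ContinuousLinearMap.inl ℝ W W')).add (hG.clm (ContinuousLinearMap.inr ℝ W W'))
  simpa using h

variable {E F : Type} [NormedAddCommGroup E] [NormedSpace ℝ E] [FiniteDimensional ℝ E]
  [NormedAddCommGroup F] [NormedSpace ℝ F] [CompleteSpace F] {k : ℕ} {α : ℝ} [HolderExponent α]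

/-- The value needs k + 1 derivatives of the superposed function. Its derivative is a superposition
of `fderiv`, which needs one more, and `exists_norm_nem_le` bounds both linearly. -/
theorem smallAt_nem {G : 𝒟 → E → F} (hG : ∀ D, DerivBound (k + 2) Set.univ (G D) (size D))
    (Ψ : V →L[ℝ] CH E k α) :
    SmallAt size x₀ fun D x => nem (G D) ((hG D).1.of_le (by norm_cast; omega)) (Ψ x) := by
  obtain ⟨C, hC⟩ := exists_norm_nem_le (E := E) (α := α) k (‖Ψ‖ * (‖x₀‖ + 1)) F
  obtain ⟨C', hC'⟩ := exists_norm_nem_le (E := E) (α := α) k (‖Ψ‖ * (‖x₀‖ + 1)) (E →L[ℝ] F)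
  have : CompleteSpace E := FiniteDimensional.complete ℝ E
  set B : ℝ := ‖(app : CH (E →L[ℝ] F) k α →L[ℝ] CH E k α →L[ℝ] CH F k α)‖ with hB
  have hs : ∀ D, 0 ≤ size D := fun D =>
    (norm_nonneg _).trans ((hG D).2 0 (by omega) 0 (Set.mem_univ _))
  refine ⟨fun D => (contDiff_nem (hG D).1).comp Ψ.contDiff, |C| + B * |C'| * ‖Ψ‖, by positivity, ?_⟩
  have h1 : ∀ᶠ x in 𝓝 x₀, ‖x‖ < ‖x₀‖ + 1 :=
    continuous_norm.continuousAt.eventually_lt continuousAt_const (lt_add_one _)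
  filter_upwards [h1] with x hx D
  have hΨ : ‖Ψ x‖ ≤ ‖Ψ‖ * (‖x₀‖ + 1) := (Ψ.le_opNorm x).trans (by gcongr)
  have e1 := hC (G D) ((hG D).1.of_le (by norm_cast; omega)) Set.univ (size D) convex_univ
    ((hG D).mono (by omega) subset_rfl le_rfl) (Ψ x) (fun _ => Set.mem_univ _) hΨ
  have e2 := hC' (fderiv ℝ (G D)) (contDiff_nat_succ_iff.1 (hG D).1).2 Set.univ (size D) convex_univ
    (derivBound_succ_iff.1 (hG D)).2.2 (Ψ x) (fun _ => Set.mem_univ _) hΨ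
  have e3 : C * size D ≤ |C| * size D := mul_le_mul_of_nonneg_right (le_abs_self C) (hs D)
  have e4 : C' * size D ≤ |C'| * size D := mul_le_mul_of_nonneg_right (le_abs_self C') (hs D)
  have e5 : 0 ≤ B * |C'| * ‖Ψ‖ * size D := mul_nonneg (by positivity) (hs D)
  have e6 : 0 ≤ |C| * size D := mul_nonneg (by positivity) (hs D)
  rw [add_mul]
  refine ⟨by linarith, ?_⟩
  have hd : fderiv ℝ (fun x => nem (G D) ((hG D).1.of_le (by norm_cast; omega)) (Ψ x)) x =
      (app (nem (fderiv ℝ (G D)) (contDiff_nat_succ_iff.1 (hG D).1).2 (Ψ x))).comp Ψ :=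
    ((hasFDerivAt_nem (hG D).1 (Ψ x)).comp x Ψ.hasFDerivAt).fderiv
  rw [hd]
  refine (ContinuousLinearMap.opNorm_comp_le _ _).trans ?_
  have e7 : ‖app (nem (fderiv ℝ (G D)) (contDiff_nat_succ_iff.1 (hG D).1).2 (Ψ x))‖ ≤
      B * (|C'| * size D) :=
    (ContinuousLinearMap.le_opNorm _ _).trans
      (mul_le_mul_of_nonneg_left (e2.trans e4) (norm_nonneg _))
  calc _ ≤ B * (|C'| * size D) * ‖Ψ‖ := by gcongr
    _ = B * |C'| * ‖Ψ‖ * size D := by ring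
    _ ≤ _ := by linarith

end Small

end KStat

end

set_option linter.unusedSectionVars false

noncomputable section

namespace KStat

/-! ## The equations of stationary discs -/

open Filter Topology ComplexConjugate CH

section Equations

variable {k : ℕ} {α : ℝ} [HolderExponent α]

namespace CH

/-- The pointwise power. -/
def pw (u : CH ℂ k α) : ℕ → CH ℂ k α
  | 0 => const 1
  | n + 1 => mul (pw u n) u

@[simp] theorem pw_apply (u : CH ℂ k α) (n : ℕ) (ζ : Circle) : pw u n ζ = u ζ ^ n := by
  induction n with
  | zero => rw [pow_zero]; rfl
  | succ n ih => rw [pow_succ, ← ih]; rfl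

@[simp] theorem add_apply' (u v : CH ℂ k α) (ζ : Circle) : (u + v) ζ = u ζ + v ζ := rfl
@[simp] theorem sub_apply' (u v : CH ℂ k α) (ζ : Circle) : (u - v) ζ = u ζ - v ζ := rfl
@[simp] theorem neg_apply' (u : CH ℂ k α) (ζ : Circle) : (-u) ζ = -u ζ := rfl

theorem sum_apply {ι : Type*} (s : Finset ι) (f : ι → CH ℂ k α) (ζ : Circle) :
    (∑ i ∈ s, f i) ζ = ∑ i ∈ s, f i ζ := map_sum (eval (k := k) (α := α) (F := ℂ) ζ) f s

variable {V : Type*} [NormedAddCommGroup V] [NormedSpace ℝ V]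

theorem contDiff_mul {f g : V → CH ℂ k α} (hf : ContDiff ℝ 1 f) (hg : ContDiff ℝ 1 g) :
    ContDiff ℝ 1 fun x => mul (f x) (g x) := (mul.contDiff.comp hf).clm_apply hg

theorem contDiff_pw {f : V → CH ℂ k α} (hf : ContDiff ℝ 1 f) (n : ℕ) :
    ContDiff ℝ 1 fun x => pw (f x) n := by
  induction n with
  | zero => exact contDiff_const
  | succ n ih => exact contDiff_mul ih hf

end CH

/-- The index set of the terms `z^i z̄^j y^l` of a deformation: the triples `(l, i, j)`, with
`i + j = d + 1` if `l = 0`, and `i + j = d - l` if `1 ≤ l ≤ d - 1`. -/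
def terms (d : ℕ) : Finset (Σ _ : ℕ, ℕ × ℕ) :=
  (Finset.range d).sigma fun l => Finset.HasAntidiagonal.antidiagonal (if l = 0 then d + 1 else d - l)

/-- Along a disc, z, z̄ and y each contribute a factor 1 - ζ. Weight at least d is what permits the
division of θ_z by (1-ζ)^(d-1). -/
theorem le_of_mem_terms {d : ℕ} {m : Σ _ : ℕ, ℕ × ℕ} (hm : m ∈ terms d) :
    d ≤ m.2.1 + m.2.2 + m.1 := by
  rw [terms, Finset.mem_sigma, Finset.mem_range, Finset.HasAntidiagonal.mem_antidiagonal] at hm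
  split_ifs at hm <;> omega

/-- Global coefficients of a deformation, with a bound of their norm. -/
structure Coef (d k : ℕ) where
  /-- the coefficients of `z^i z̄^j y^l` -/
  R : (Σ _ : ℕ, ℕ × ℕ) → ℂ × ℝ → ℂ
  /-- the term depending on `y` only -/
  t : ℝ → ℝ
  /-- the bound -/
  size : ℝ
  bound_R : ∀ m, DerivBound (k + 3) Set.univ (R m) size
  bound_t : DerivBound (k + 3) Set.univ t size
  t_zero : t 0 = 0

/-- The zero deformation. -/
def Coef.zero (d k : ℕ) : Coef d k where
  R _ _ := 0
  t _ := 0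
  size := 0
  bound_R _ := ⟨contDiff_const, fun j _ x _ => by simp⟩
  bound_t := ⟨contDiff_const, fun j _ x _ => by simp⟩
  t_zero := rfl

namespace Coef

variable {d : ℕ}

/-- The function `θ(z, y)` with the given coefficients. -/
def theta (D : Coef d k) (z : ℂ) (y : ℝ) : ℂ :=
  ∑ m ∈ terms d, z ^ m.2.1 * conj z ^ m.2.2 * (y : ℂ) ^ m.1 * D.R m (z, y) + (D.t y : ℂ)

theorem bound_fderiv_R (D : Coef d k) (m) :
    DerivBound (k + 2) Set.univ (fderiv ℝ (D.R m)) D.size :=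
  (derivBound_succ_iff.1 (D.bound_R m)).2.2

theorem bound_fderiv_t (D : Coef d k) : DerivBound (k + 2) Set.univ (fderiv ℝ D.t) D.size :=
  (derivBound_succ_iff.1 D.bound_t).2.2

/-- The function `∫ t'(sy) ds`, as a linear form. -/
def quot (D : Coef d k) (y : ℝ) : ℝ →L[ℝ] ℝ := ∫ s in (0 : ℝ)..1, fderiv ℝ D.t (s • y)

/-- Rescaling the argument by s ∈ [0,1] does not increase derivatives. As t(0) = 0, this function is
t(y)/y in smooth form, at the cost of one derivative; it serves to divide t(Im g) by 1 - ζ. -/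
theorem bound_quot (D : Coef d k) : DerivBound (k + 2) Set.univ D.quot D.size := by
  refine derivBound_integral (k + 2) (g := fun p : ℝ × ℝ => fderiv ℝ D.t (p.1 • p.2))
    (D.bound_fderiv_t.1.comp (contDiff_fst.smul contDiff_snd)) fun s hs j hj x _ => ?_
  have h1 : (fun y : ℝ => fderiv ℝ D.t (s • y)) =
      fderiv ℝ D.t ∘ (s • ContinuousLinearMap.id ℝ ℝ) := rfl
  show ‖iteratedFDeriv ℝ j (fun y : ℝ => fderiv ℝ D.t (s • y)) x‖ ≤ _
  rw [h1, ContinuousLinearMap.iteratedFDeriv_comp_right _ D.bound_fderiv_t.1 x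
    (by exact_mod_cast hj)]
  refine (ContinuousMultilinearMap.norm_compContinuousLinearMap_le _ _).trans ?_
  have h2 : ‖s • ContinuousLinearMap.id ℝ ℝ‖ ≤ 1 := by
    rw [norm_smul, ContinuousLinearMap.norm_id, mul_one, Real.norm_eq_abs, abs_of_nonneg hs.1]
    exact hs.2
  refine (mul_le_of_le_one_right (norm_nonneg _) ?_).trans (D.bound_fderiv_t.2 j hj _ (Set.mem_univ _))
  exact Finset.prod_le_one (fun _ _ => norm_nonneg _) fun _ _ => h2

theorem quot_mul (D : Coef d k) (y : ℝ) : (D.quot y 1 : ℝ) * y = D.t y := by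
  have h1 : D.quot y = hadamard D.t (0, y) := by simp [quot, hadamard]
  have h2 := hadamard_apply (D.bound_t.1.of_le (by norm_cast; omega)) 0 y
  rw [D.t_zero, sub_zero, sub_zero, ← h1] at h2
  rw [← h2]
  conv_rhs => rw [show y = y • (1 : ℝ) by simp, map_smul]
  simp [mul_comm]

end Coef

/-- The space of unknowns `(b, p, u, v)`. -/
abbrev Unk (k : ℕ) (α : ℝ) : Type := ℂ × A k α × A k α × A k α

namespace Unk

/-- The boundary values of `u`. -/
def U : Unk k α →L[ℝ] CH ℂ k α :=
  bd.comp ((ContinuousLinearMap.fst ℝ _ _).comp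
    ((ContinuousLinearMap.snd ℝ _ _).comp (ContinuousLinearMap.snd ℝ _ _)))

/-- The boundary values of `v`. -/
def T : Unk k α →L[ℝ] CH ℂ k α :=
  bd.comp ((ContinuousLinearMap.snd ℝ _ _).comp
    ((ContinuousLinearMap.snd ℝ _ _).comp (ContinuousLinearMap.snd ℝ _ _)))

/-- The function `-ζ̄ ū`, with `h̄ = (1 - ζ) (-ζ̄ ū)`. -/
def S : Unk k α →L[ℝ] CH ℂ k α := -((mul (zp (-1))).comp (cj.comp U))

/-- The function `(v + ζ̄ v̄) / 2i`, with `Im g = (1 - ζ) (v + ζ̄ v̄) / 2i`. -/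
def Yv : Unk k α →L[ℝ] CH ℂ k α := (mul (const (1 / (2 * I)))).comp (T + (mul (zp (-1))).comp (cj.comp T))

/-- The function `-(v - ζ̄ v̄) / 2`, with `-Re g = -(1 - ζ) (v - ζ̄ v̄) / 2`. -/
def X : Unk k α →L[ℝ] CH ℂ k α := (mul (const (-1 / 2))).comp (T - (mul (zp (-1))).comp (cj.comp T))

/-- The linear part `b̄ ζ̄ + b ζ`. -/
def Lb : Unk k α →L[ℝ] CH ℂ k α :=
  let L : Unk k α →L[ℝ] CH ℂ k α :=
    ((mul (zp 1)).comp (const (k := k) (α := α))).comp (ContinuousLinearMap.fst ℝ _ _)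
  cj.comp L + L

/-- The function `2 Re (ζ^{k₀+1} p)`. -/
def Lp (k₀ : ℕ) : Unk k α →L[ℝ] CH ℂ k α :=
  let L : Unk k α →L[ℝ] CH ℂ k α := ((mul (zp (k₀ + 1 : ℕ))).comp bd).comp
    ((ContinuousLinearMap.fst ℝ _ _).comp (ContinuousLinearMap.snd ℝ _ _))
  L + cj.comp L

/-- The function `c = (b̄ ζ̄ + 1 + b ζ)^{k₀} + 2 Re (ζ^{k₀+1} p)`. -/
def dens (k₀ : ℕ) (x : Unk k α) : CH ℂ k α := pw (const 1 + Lb x) k₀ + Lp k₀ x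

/-- The function `1 - ζ`. -/
def W : CH ℂ k α := const 1 - zp 1

/-- The boundary values of `h` and `Im g`. -/
def Φ : Unk k α →L[ℝ] CH (ℂ × ℝ) k α :=
  (lmap (ContinuousLinearMap.inl ℝ ℂ ℝ)).comp ((mul W).comp U) +
  (lmap (ContinuousLinearMap.inr ℝ ℂ ℝ)).comp ((lmap imCLM).comp ((mul W).comp T))

/-- The boundary values of `Im g`. -/
def Ψ : Unk k α →L[ℝ] CH ℝ k α := (lmap imCLM).comp ((mul W).comp T)

variable (x : Unk k α) (ζ : Circle)

@[simp] theorem U_apply : U x ζ = bdVal x.2.2.1 ζ := rfl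
@[simp] theorem S_apply : S x ζ = -((ζ : ℂ) ^ (-1 : ℤ) * conj (bdVal x.2.2.1 ζ)) := rfl
@[simp] theorem Yv_apply : Yv x ζ =
    1 / (2 * I) * (bdVal x.2.2.2 ζ + (ζ : ℂ) ^ (-1 : ℤ) * conj (bdVal x.2.2.2 ζ)) := rfl
@[simp] theorem X_apply : X x ζ =
    -1 / 2 * (bdVal x.2.2.2 ζ - (ζ : ℂ) ^ (-1 : ℤ) * conj (bdVal x.2.2.2 ζ)) := rfl
@[simp] theorem Lb_apply : Lb x ζ =
    conj ((ζ : ℂ) ^ (1 : ℤ) * x.1) + (ζ : ℂ) ^ (1 : ℤ) * x.1 := rfl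
@[simp] theorem Lp_apply (k₀ : ℕ) : Lp k₀ x ζ = (ζ : ℂ) ^ ((k₀ + 1 : ℕ) : ℤ) * bdVal x.2.1 ζ +
    conj ((ζ : ℂ) ^ ((k₀ + 1 : ℕ) : ℤ) * bdVal x.2.1 ζ) := rfl
@[simp] theorem W_apply : (W : CH ℂ k α) ζ = 1 - (ζ : ℂ) ^ (1 : ℤ) := rfl
theorem dens_apply (k₀ : ℕ) : dens k₀ x ζ = (1 + Lb x ζ) ^ k₀ + Lp k₀ x ζ := by
  rw [dens, add_apply', pw_apply]; rfl

theorem Φ_apply : Φ x ζ = (discBd x.2.2.1 ζ, (discBd x.2.2.2 ζ).im) := by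
  have h : Φ x ζ = ((1 - (ζ : ℂ) ^ (1 : ℤ)) * bdVal x.2.2.1 ζ, (0 : ℝ)) +
    ((0 : ℂ), ((1 - (ζ : ℂ) ^ (1 : ℤ)) * bdVal x.2.2.2 ζ).im) := rfl
  rw [h, zpow_one, Prod.mk_add_mk, add_zero, zero_add]
  rfl

theorem Ψ_apply : Ψ x ζ = (discBd x.2.2.2 ζ).im := by
  have h : Ψ x ζ = ((1 - (ζ : ℂ) ^ (1 : ℤ)) * bdVal x.2.2.2 ζ).im := rfl
  rw [h, zpow_one]
  rfl

end Unk

end Equations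

end KStat

end

set_option linter.unusedSectionVars false

noncomputable section

namespace KStat

open Filter Topology ComplexConjugate CH

/-! ### The equations as a model part plus a small perturbation -/

section Equations

variable {k : ℕ} {α : ℝ} [HolderExponent α] {d : ℕ}

namespace Coef

variable (D : Coef d k)

open Unk

/-- The coefficient `r_{ijl}` along the disc. -/
def NR (m : Σ _ : ℕ, ℕ × ℕ) (x : Unk k α) : CH ℂ k α :=
  nem (D.R m) ((D.bound_R m).1.of_le (by norm_cast; omega)) (Φ x)

/-- The differential of `r_{ijl}` along the disc. -/
def NdR (m : Σ _ : ℕ, ℕ × ℕ) (x : Unk k α) : CH (ℂ × ℝ →L[ℝ] ℂ) k α :=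
  nem (fderiv ℝ (D.R m)) ((D.bound_fderiv_R m).1.of_le (by norm_cast; omega)) (Φ x)

/-- The partial derivative with respect to `y`, in terms of the differential. -/
def evy : (ℂ × ℝ →L[ℝ] ℂ) →L[ℝ] ℂ := ContinuousLinearMap.apply ℝ ℂ ((0 : ℂ), (1 : ℝ))

/-- The partial derivative with respect to `z`, in terms of the differential. -/
def evz : (ℂ × ℝ →L[ℝ] ℂ) →L[ℝ] ℂ :=
  (ContinuousLinearMap.mul ℝ ℂ (1 / 2)).comp (ContinuousLinearMap.apply ℝ ℂ ((1 : ℂ), (0 : ℝ)) -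
    (ContinuousLinearMap.mul ℝ ℂ I).comp (ContinuousLinearMap.apply ℝ ℂ (I, (0 : ℝ))))

/-- The value at `1` of a real linear form, as a complex number. -/
def ev1 : (ℝ →L[ℝ] ℝ) →L[ℝ] ℂ := ofRealCLM.comp (ContinuousLinearMap.apply ℝ ℝ (1 : ℝ))

/-- The quotient `t(y) / y` along the disc. -/
def NQ (x : Unk k α) : CH ℂ k α :=
  lmap ev1 (nem D.quot (D.bound_quot.1.of_le (by norm_cast; omega)) (Ψ x))

/-- The derivative `t'(y)` along the disc. -/
def Ndt (x : Unk k α) : CH ℂ k α :=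
  lmap ev1 (nem (fderiv ℝ D.t) (D.bound_fderiv_t.1.of_le (by norm_cast; omega)) (Ψ x))

/-- The contribution `θ / (1 - ζ)` of the deformation to the first equation. -/
def pert₁ (x : Unk k α) : CH ℂ k α :=
  ∑ m ∈ terms d, mul (mul (pw W (m.2.1 + m.2.2 + m.1 - 1))
    (mul (mul (pw (U x) m.2.1) (pw (S x) m.2.2)) (pw (Yv x) m.1))) (D.NR m x) + mul (Yv x) (D.NQ x)

/-- The derivative `θ_y` along the disc. -/
def pert₂ (x : Unk k α) : CH ℂ k α :=
  ∑ m ∈ terms d, (mul (mul (pw W (m.2.1 + m.2.2 + m.1 - 1))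
    (mul (mul (pw (U x) m.2.1) (pw (S x) m.2.2)) (mul (const (m.1 : ℂ)) (pw (Yv x) (m.1 - 1)))))
      (D.NR m x) +
    mul (mul (pw W (m.2.1 + m.2.2 + m.1)) (mul (mul (pw (U x) m.2.1) (pw (S x) m.2.2))
      (pw (Yv x) m.1))) (lmap evy (D.NdR m x))) + D.Ndt x

/-- The contribution `θ_z / (1 - ζ)^{d-1}` of the deformation to the third equation. -/
def pert₃ (x : Unk k α) : CH ℂ k α :=
  ∑ m ∈ terms d, (mul (mul (pw W (m.2.1 + m.2.2 + m.1 - d))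
    (mul (mul (mul (const (m.2.1 : ℂ)) (pw (U x) (m.2.1 - 1))) (pw (S x) m.2.2)) (pw (Yv x) m.1)))
      (D.NR m x) +
    mul (mul (pw W (m.2.1 + m.2.2 + m.1 - d + 1)) (mul (mul (pw (U x) m.2.1) (pw (S x) m.2.2))
      (pw (Yv x) m.1))) (lmap evz (D.NdR m x)))

end Coef

namespace Unk

/-- The contribution `P(h) / (1 - ζ)` of the model to the first equation. -/
def model₁ (d k₀ : ℕ) (a : ℕ → ℂ) (x : Unk k α) : CH ℂ k α :=
  ∑ j ∈ Finset.Icc (d - k₀) k₀, mul (mul (const (a j)) (pw W (d - 1)))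
    (mul (pw (U x) j) (pw (S x) (d - j)))

/-- The contribution `P_z(h) / (1 - ζ)^{d-1}` of the model to the third equation. -/
def model₃ (d k₀ : ℕ) (a : ℕ → ℂ) (x : Unk k α) : CH ℂ k α :=
  ∑ j ∈ Finset.Icc (d - k₀) k₀, mul (const (a j * j)) (mul (pw (U x) (j - 1)) (pw (S x) (d - j)))

end Unk

namespace Coef

open Unk

variable (D : Coef d k) (k₀ : ℕ) (a : ℕ → ℂ)

/-- The function `r(h, g) / (1 - ζ)`. -/
def eq₁ (x : Unk k α) : CH ℂ k α := X x + model₁ d k₀ a x + D.pert₁ x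

/-- The function `ζ^{k₀} c r_w(h, g)`. -/
def eq₂ (x : Unk k α) : CH ℂ k α :=
  mul (mul (zp k₀) (dens k₀ x)) (const (-1 / 2) + mul (const (-I / 2)) (D.pert₂ x))

/-- The function `ζ^{k₀} c r_z(h, g) / (1 - ζ)^{d-1}`. -/
def eq₃ (x : Unk k α) : CH ℂ k α := mul (mul (zp k₀) (dens k₀ x)) (model₃ d k₀ a x + D.pert₃ x)

/-- The equations of the lifts of stationary discs, with additional finite dimensional data. -/
def eqs {n : ℕ} (J : A k α →L[ℝ] (Fin n → ℂ)) (x : Unk k α) :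
    A k α × A k α × A k α × (Fin n → ℂ) :=
  (szego (D.eq₁ k₀ a x), negPart (D.eq₂ k₀ x), negPart (D.eq₃ k₀ a x), J x.2.2.1)

/-- The equations for the undeformed model. -/
def modelEqs (d : ℕ) {n : ℕ} (J : A k α →L[ℝ] (Fin n → ℂ)) (x : Unk k α) :
    A k α × A k α × A k α × (Fin n → ℂ) :=
  (szego (X x + model₁ d k₀ a x), negPart (mul (mul (zp k₀) (dens k₀ x)) (const (-1 / 2))),
    negPart (mul (mul (zp k₀) (dens k₀ x)) (model₃ d k₀ a x)), J x.2.2.1)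

/-- The contribution of the deformation to the equations. -/
def pertEqs (n : ℕ) (x : Unk k α) : A k α × A k α × A k α × (Fin n → ℂ) :=
  (szego (D.pert₁ x), negPart (mul (mul (zp k₀) (dens k₀ x)) (mul (const (-I / 2)) (D.pert₂ x))),
    negPart (mul (mul (zp k₀) (dens k₀ x)) (D.pert₃ x)), 0)

theorem eqs_eq {n : ℕ} (J : A k α →L[ℝ] (Fin n → ℂ)) (x : Unk k α) :
    D.eqs k₀ a J x = modelEqs k₀ a d J x + D.pertEqs k₀ n x := by
  simp only [eqs, modelEqs, pertEqs, eq₁, eq₂, eq₃, Prod.mk_add_mk, map_add, add_zero]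

theorem contDiff_U : ContDiff ℝ 1 (fun x : Unk k α => U x) := U.contDiff
theorem contDiff_S : ContDiff ℝ 1 (fun x : Unk k α => S x) := S.contDiff
theorem contDiff_Yv : ContDiff ℝ 1 (fun x : Unk k α => Yv x) := Yv.contDiff
theorem contDiff_dens : ContDiff ℝ 1 (fun x : Unk k α => dens k₀ x) :=
  (contDiff_pw (contDiff_const.add Lb.contDiff) k₀).add (Lp k₀).contDiff

theorem contDiff_modelEqs {n : ℕ} (J : A k α →L[ℝ] (Fin n → ℂ)) :
    ContDiff ℝ 1 (modelEqs k₀ a d J) := by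
  have hU := contDiff_U (k := k) (α := α)
  have hS := contDiff_S (k := k) (α := α)
  have hd := contDiff_dens (k := k) (α := α) k₀
  refine ContDiff.prodMk (szego.contDiff.comp (X.contDiff.add (ContDiff.sum fun j _ => ?_)))
    (ContDiff.prodMk (negPart.contDiff.comp ?_) (ContDiff.prodMk (negPart.contDiff.comp ?_) ?_))
  · exact contDiff_mul contDiff_const (contDiff_mul (contDiff_pw hU _) (contDiff_pw hS _))
  · exact contDiff_mul (contDiff_mul contDiff_const hd) contDiff_const
  · refine contDiff_mul (contDiff_mul contDiff_const hd) (ContDiff.sum fun j _ => ?_)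
    exact contDiff_mul contDiff_const (contDiff_mul (contDiff_pw hU _) (contDiff_pw hS _))
  · exact J.contDiff.comp (contDiff_fst.comp (contDiff_snd.comp contDiff_snd))

/-- Each term is a polynomial expression in the unknowns, independent of the deformation, times a
superposition of one of the coefficients or of its differential. Class C^{k+3} of the coefficients
leaves k + 2 derivatives for the differential, as `smallAt_nem` requires. -/
theorem smallAt_pertEqs (x₀ : Unk k α) (n : ℕ) :
    SmallAt (fun D : Coef d k => D.size) x₀ fun D => D.pertEqs k₀ n := by
  have hU := contDiff_U (k := k) (α := α)
  have hS := contDiff_S (k := k) (α := α)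
  have hY := contDiff_Yv (k := k) (α := α)
  have hd := contDiff_dens (k := k) (α := α) k₀
  have hzd : ContDiff ℝ 1 fun x : Unk k α => mul (zp k₀) (dens k₀ x) := contDiff_mul contDiff_const hd
  have hNR : ∀ m, SmallAt (fun D : Coef d k => D.size) x₀ fun D (x : Unk k α) => D.NR m x := fun m =>
    smallAt_nem (fun D => (D.bound_R m).mono (by omega) subset_rfl le_rfl) Φ
  have hNdR : ∀ m, SmallAt (fun D : Coef d k => D.size) x₀ fun D (x : Unk k α) => D.NdR m x :=
    fun m => smallAt_nem (fun D => D.bound_fderiv_R m) Φ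
  have hNQ : SmallAt (fun D : Coef d k => D.size) x₀ fun D (x : Unk k α) => D.NQ x :=
    (smallAt_nem (fun D => D.bound_quot) Ψ).clm (lmap ev1)
  have hNdt : SmallAt (fun D : Coef d k => D.size) x₀ fun D (x : Unk k α) => D.Ndt x :=
    (smallAt_nem (fun D => D.bound_fderiv_t) Ψ).clm (lmap ev1)
  have h1 : SmallAt (fun D : Coef d k => D.size) x₀ fun D (x : Unk k α) => D.pert₁ x := by
    refine (SmallAt.sum fun m _ => SmallAt.bilin mul ?_ (hNR m)).add (hNQ.bilin mul hY)
    exact contDiff_mul contDiff_const (contDiff_mul (contDiff_mul (contDiff_pw hU _)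
      (contDiff_pw hS _)) (contDiff_pw hY _))
  have h2 : SmallAt (fun D : Coef d k => D.size) x₀ fun D (x : Unk k α) => D.pert₂ x := by
    refine (SmallAt.sum fun m _ => (SmallAt.bilin mul ?_ (hNR m)).add
      (SmallAt.bilin mul ?_ ((hNdR m).clm (lmap evy)))).add hNdt
    · exact contDiff_mul contDiff_const (contDiff_mul (contDiff_mul (contDiff_pw hU _)
        (contDiff_pw hS _)) (contDiff_mul contDiff_const (contDiff_pw hY _)))
    · exact contDiff_mul contDiff_const (contDiff_mul (contDiff_mul (contDiff_pw hU _)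
        (contDiff_pw hS _)) (contDiff_pw hY _))
  have h3 : SmallAt (fun D : Coef d k => D.size) x₀ fun D (x : Unk k α) => D.pert₃ x := by
    refine SmallAt.sum fun m _ => (SmallAt.bilin mul ?_ (hNR m)).add
      (SmallAt.bilin mul ?_ ((hNdR m).clm (lmap evz)))
    · exact contDiff_mul contDiff_const (contDiff_mul (contDiff_mul (contDiff_mul contDiff_const
        (contDiff_pw hU _)) (contDiff_pw hS _)) (contDiff_pw hY _))
    · exact contDiff_mul contDiff_const (contDiff_mul (contDiff_mul (contDiff_pw hU _)
        (contDiff_pw hS _)) (contDiff_pw hY _))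
  exact (h1.clm szego).prodMk ((((h2.clm (mul (const (-I / 2)))).bilin mul hzd).clm negPart).prodMk
    (((h3.bilin mul hzd).clm negPart).prodMk smallAt_zero))

end Coef

end Equations

end KStat

end

set_option linter.unusedSectionVars false

noncomputable section

namespace KStat

open Filter Topology ComplexConjugate CH

/-! ## The linearized equations -/

section Linearization

variable {k : ℕ} {α : ℝ} [HolderExponent α] {d : ℕ}

/-- ζ̄v̄ has only negative orders. This is why Re g/(1-ζ) projects to v/2. -/
theorem szego_zp_neg_cj (v : A k α) : szego (mul (zp (-1)) (cj (bd v))) = 0 := by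
  refine szego_eq_zero_iff.2 fun n => ?_
  have h1 : (mul (zp (-1)) (cj (bd v))).1 = (cj (mul (zp 1) (bd v))).1 := by
    funext ζ
    simp only [mul_apply, cj_apply, zp_apply, map_mul, zpow_one, zpow_neg_one]
    rw [← Circle.coe_inv_eq_conj, Circle.coe_inv]
  rw [h1, fc_cj_zp_mul, isHol_bd v _ (by omega), map_zero]

theorem negPart_zp_neg_cj (p : A k α) : negPart (mul (zp (-1)) (cj (bd p))) = p := by
  have h1 : cj (mul (zp 1) (mul (zp (-1)) (cj (bd p)))) = bd p := by
    ext ζ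
    simp only [mul_apply, cj_apply, zp_apply, zpow_one, zpow_neg_one]
    rw [mul_inv_cancel_left₀ (Circle.coe_ne_zero ζ), conj_conj]
  rw [negPart_apply, h1, szego_bd]

/-- The derivative is already known to exist, so it is identified by scalar derivatives at each
point of the circle along a line. -/
theorem fderiv_CH_apply {V : Type*} [NormedAddCommGroup V] [NormedSpace ℝ V] {F : V → CH ℂ k α}
    (hF : ContDiff ℝ 1 F) {x x' : V} {w : CH ℂ k α}
    (h : ∀ ζ, HasDerivAt (fun t : ℝ => F (x + t • x') ζ) (w ζ) 0) : fderiv ℝ F x x' = w := by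
  ext ζ
  have h1 : HasDerivAt (fun t : ℝ => x + t • x') x' 0 := by
    simpa using ((hasDerivAt_id (0 : ℝ)).smul_const x').const_add x
  have h2 : HasFDerivAt F (fderiv ℝ F x) (x + (0 : ℝ) • x') := by
    rw [zero_smul, add_zero]
    exact (hF.differentiable one_ne_zero x).hasFDerivAt
  have h3 := (eval ζ).hasFDerivAt.comp_hasDerivAt (0 : ℝ) (h2.comp_hasDerivAt (0 : ℝ) h1)
  exact h3.unique (h ζ)

theorem hasDerivAt_line (a b : ℂ) : HasDerivAt (fun t : ℝ => a + t • b) b 0 := by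
  simpa using ((hasDerivAt_id (0 : ℝ)).smul_const b).const_add a

theorem hasDerivAt_line_pow (a b : ℂ) (n : ℕ) :
    HasDerivAt (fun t : ℝ => (a + t • b) ^ n) (n * a ^ (n - 1) * b) 0 := by
  have h1 := (hasDerivAt_line a b).fun_pow n
  simpa using h1

namespace Unk

/-- The component `u` of the unknowns. -/
def pu : Unk k α →L[ℝ] A k α :=
  (ContinuousLinearMap.fst ℝ (A k α) (A k α)).comp
    ((ContinuousLinearMap.snd ℝ (A k α) (A k α × A k α)).comp
      (ContinuousLinearMap.snd ℝ ℂ (A k α × A k α × A k α)))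

@[simp] theorem pu_apply (x : Unk k α) : pu x = x.2.2.1 := rfl

/-- The derivative of `model₁`. -/
def dmodel₁ (d k₀ : ℕ) (a : ℕ → ℂ) (x x' : Unk k α) : CH ℂ k α :=
  ∑ j ∈ Finset.Icc (d - k₀) k₀, mul (mul (const (a j)) (pw W (d - 1)))
    (mul (mul (mul (const j) (pw (U x) (j - 1))) (U x')) (pw (S x) (d - j)) +
      mul (pw (U x) j) (mul (mul (const (d - j : ℕ)) (pw (S x) (d - j - 1))) (S x')))

/-- The derivative of `model₃`. -/
def dmodel₃ (d k₀ : ℕ) (a : ℕ → ℂ) (x x' : Unk k α) : CH ℂ k α :=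
  ∑ j ∈ Finset.Icc (d - k₀) k₀, mul (const (a j * j))
    (mul (mul (mul (const (j - 1 : ℕ)) (pw (U x) (j - 1 - 1))) (U x')) (pw (S x) (d - j)) +
      mul (pw (U x) (j - 1)) (mul (mul (const (d - j : ℕ)) (pw (S x) (d - j - 1))) (S x')))

theorem line_apply (L : Unk k α →L[ℝ] CH ℂ k α) (x x' : Unk k α) (t : ℝ) (ζ : Circle) :
    L (x + t • x') ζ = L x ζ + t • L x' ζ := by
  rw [map_add, map_smul]; rfl

theorem hasDerivAt_mono (x x' : Unk k α) (i j : ℕ) (ζ : Circle) :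
    HasDerivAt (fun t : ℝ => mul (pw (U (x + t • x')) i) (pw (S (x + t • x')) j) ζ)
      ((mul (mul (mul (const i) (pw (U x) (i - 1))) (U x')) (pw (S x) j) +
      mul (pw (U x) i) (mul (mul (const j) (pw (S x) (j - 1))) (S x'))) ζ) 0 := by
  have h := (hasDerivAt_line_pow (U x ζ) (U x' ζ) i).fun_mul (hasDerivAt_line_pow (S x ζ) (S x' ζ) j)
  refine (h.congr_deriv ?_).congr_of_eventuallyEq (Eventually.of_forall fun t => ?_)
  · simp only [zero_smul, add_zero, add_apply', mul_apply, pw_apply, const_apply]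
  · simp only [mul_apply, pw_apply, line_apply]

variable (k₀ : ℕ) (a : ℕ → ℂ)

theorem contDiff_model₁ : ContDiff ℝ 1 (model₁ (k := k) (α := α) d k₀ a) :=
  ContDiff.sum fun _ _ => contDiff_mul contDiff_const
    (contDiff_mul (contDiff_pw U.contDiff _) (contDiff_pw S.contDiff _))

theorem contDiff_model₃ : ContDiff ℝ 1 (model₃ (k := k) (α := α) d k₀ a) :=
  ContDiff.sum fun _ _ => contDiff_mul contDiff_const
    (contDiff_mul (contDiff_pw U.contDiff _) (contDiff_pw S.contDiff _))

theorem fderiv_model₁ (x x' : Unk k α) :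
    fderiv ℝ (model₁ d k₀ a) x x' = dmodel₁ d k₀ a x x' := by
  refine fderiv_CH_apply (contDiff_model₁ k₀ a) fun ζ => ?_
  simp only [model₁, dmodel₁, CH.sum_apply]
  refine HasDerivAt.fun_sum fun j _ => ?_
  exact (hasDerivAt_mono x x' j (d - j) ζ).const_mul (mul (const (a j)) (pw W (d - 1)) ζ)

theorem fderiv_model₃ (x x' : Unk k α) :
    fderiv ℝ (model₃ d k₀ a) x x' = dmodel₃ d k₀ a x x' := by
  refine fderiv_CH_apply (contDiff_model₃ k₀ a) fun ζ => ?_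
  simp only [model₃, dmodel₃, CH.sum_apply]
  refine HasDerivAt.fun_sum fun j _ => ?_
  exact (hasDerivAt_mono x x' (j - 1) (d - j) ζ).const_mul (a j * j)

/-- The derivative of the density at `b = 0`. -/
def ddens (x' : Unk k α) : CH ℂ k α := mul (const k₀) (Lb x') + Lp k₀ x'

theorem dens_base {x : Unk k α} (hb : x.1 = 0) (hp : x.2.1 = 0) : dens k₀ x = const 1 := by
  ext ζ
  have h0 : bdVal (0 : A k α) ζ = 0 := by
    rw [← bd_apply, map_zero]; rfl
  rw [dens_apply, Lb_apply, Lp_apply, hb, hp, h0]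
  simp

theorem fderiv_dens {x : Unk k α} (hb : x.1 = 0) (x' : Unk k α) :
    fderiv ℝ (dens k₀) x x' = ddens k₀ x' := by
  refine fderiv_CH_apply (Coef.contDiff_dens k₀) fun ζ => ?_
  simp only [dens_apply, line_apply]
  have h0 : bdVal (0 : A k α) ζ = 0 := by
    rw [← bd_apply, map_zero]; rfl
  have hL : Lb x ζ = 0 := by rw [Lb_apply, hb]; simp
  have h1 := (hasDerivAt_line_pow (1 + Lb x ζ) (Lb x' ζ) k₀).add
    (hasDerivAt_line (Lp k₀ x ζ) (Lp k₀ x' ζ))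
  simp only [hL, add_zero, one_pow, mul_one] at h1
  refine (h1.congr_deriv rfl).congr_of_eventuallyEq (Eventually.of_forall fun t => ?_)
  simp only [hL, zero_add, Pi.add_apply]

/-- The derivative of the model equations at a point with `b = 0`, `p = 0`. -/
theorem fderiv_modelEqs {n : ℕ} (J : A k α →L[ℝ] (Fin n → ℂ)) {x : Unk k α} (hb : x.1 = 0)
    (hp : x.2.1 = 0) (x' : Unk k α) :
    fderiv ℝ (Coef.modelEqs k₀ a d J) x x' =
      (szego (X x' + dmodel₁ d k₀ a x x'),
        negPart (mul (mul (zp k₀) (ddens k₀ x')) (const (-1 / 2))),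
        negPart (mul (mul (zp k₀) (ddens k₀ x')) (model₃ d k₀ a x) +
          mul (zp k₀) (dmodel₃ d k₀ a x x')), J x'.2.2.1) := by
  have e1 : HasFDerivAt (fun x : Unk k α => szego (X x + model₁ d k₀ a x))
      (szego.comp (X + fderiv ℝ (model₁ d k₀ a) x)) x :=
    szego.hasFDerivAt.comp x (X.hasFDerivAt.add
      ((contDiff_model₁ k₀ a).differentiable one_ne_zero x).hasFDerivAt)
  have hd := ((Coef.contDiff_dens (k := k) (α := α) k₀).differentiable one_ne_zero x).hasFDerivAt
  have hzd : HasFDerivAt (fun x : Unk k α => mul (zp k₀) (dens k₀ x))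
      ((mul (zp k₀)).comp (fderiv ℝ (dens k₀) x)) x := (mul (zp k₀)).hasFDerivAt.comp x hd
  have e2 : HasFDerivAt (fun x : Unk k α => negPart (mul (mul (zp k₀) (dens k₀ x)) (const (-1 / 2))))
      (negPart.comp ((mul.flip (const (-1 / 2))).comp ((mul (zp k₀)).comp (fderiv ℝ (dens k₀) x)))) x :=
    negPart.hasFDerivAt.comp x ((mul.flip (const (-1 / 2))).hasFDerivAt.comp x hzd)
  have e3 : HasFDerivAt (fun x : Unk k α => mul (mul (zp k₀) (dens k₀ x)) (model₃ d k₀ a x))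
      ((mul (mul (zp k₀) (dens k₀ x))).comp (fderiv ℝ (model₃ d k₀ a) x) +
        (mul.flip (model₃ d k₀ a x)).comp ((mul (zp k₀)).comp (fderiv ℝ (dens k₀) x))) x :=
    mul.hasFDerivAt_of_bilinear hzd
      ((contDiff_model₃ (d := d) k₀ a).differentiable one_ne_zero x).hasFDerivAt
  have e3' : HasFDerivAt (fun x : Unk k α =>
      negPart (mul (mul (zp k₀) (dens k₀ x)) (model₃ d k₀ a x)))
      (negPart.comp ((mul (mul (zp k₀) (dens k₀ x))).comp (fderiv ℝ (model₃ d k₀ a) x) +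
        (mul.flip (model₃ d k₀ a x)).comp ((mul (zp k₀)).comp (fderiv ℝ (dens k₀) x)))) x :=
    negPart.hasFDerivAt.comp x e3
  have e4 : HasFDerivAt (fun x : Unk k α => J x.2.2.1) (J.comp pu) x := (J.comp pu).hasFDerivAt
  have h : HasFDerivAt (Coef.modelEqs k₀ a d J) _ x := e1.prodMk (e2.prodMk (e3'.prodMk e4))
  rw [h.fderiv]
  simp only [ContinuousLinearMap.prod_apply, ContinuousLinearMap.comp_apply,
    _root_.add_apply, ContinuousLinearMap.flip_apply, fderiv_model₁, fderiv_model₃,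
    fderiv_dens k₀ hb, dens_base k₀ hb hp, pu_apply]
  rw [add_comm (mul (mul (zp k₀) (const 1)) (dmodel₃ d k₀ a x x'))]
  have h1 : mul (zp k₀) (const 1) = (zp k₀ : CH ℂ k α) := by
    ext ζ
    simp only [mul_apply, const_apply, mul_one]
  rw [h1]

end Unk

end Linearization

end KStat

end

set_option linter.unusedSectionVars false

noncomputable section

namespace KStat

open Filter Topology ComplexConjugate CH

/-! ## Bijectivity of the linearized equations -/

section Bijectivity

variable {k : ℕ} {α : ℝ} [HolderExponent α] {d : ℕ}

theorem bdVal_const (φ : ℂ) (ζ : Circle) : bdVal (A.const φ : A k α) ζ = φ := re_add_im φ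

theorem negPart_congr {p q r : CH ℂ k α} (hr : IsHol r) (h : p = q + r) :
    negPart p = negPart q := by
  rw [h, map_add, negPart_eq_zero_iff.2 hr, add_zero]

/-- `ζ^{k₀} P_z(h) / (1 - ζ)^{d-1}` for `h = (1 - ζ) φ`. -/
def gradPoly (d k₀ : ℕ) (a : ℕ → ℂ) (φ : ℂ) : Polynomial ℂ :=
  ∑ j ∈ Finset.Icc (d - k₀) k₀,
    Polynomial.C (a j * j * φ ^ (j - 1) * conj φ ^ (d - j) * (-1) ^ (d - j)) *
      Polynomial.X ^ (k₀ + j - d)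

/-- `ζ^{k₀} P_{zz}(h) / (1 - ζ)^{d-2}` for `h = (1 - ζ) φ`. -/
def hessPoly (d k₀ : ℕ) (a : ℕ → ℂ) (φ : ℂ) : Polynomial ℂ :=
  ∑ j ∈ Finset.Icc (d - k₀) k₀,
    Polynomial.C (a j * j * (j - 1 : ℕ) * φ ^ (j - 1 - 1) * conj φ ^ (d - j) * (-1) ^ (d - j)) *
      Polynomial.X ^ (k₀ + j - d)

/-- The coefficients of the model polynomial, rotated. -/
def twist (d : ℕ) (a : ℕ → ℂ) (φ : ℂ) (j : ℕ) : ℂ := a j * φ ^ (j - 1) * conj φ ^ (d - j - 1)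

theorem twist_one (d : ℕ) (a : ℕ → ℂ) : twist d a 1 = a := by
  funext j
  simp [twist]

theorem eval_gradPoly (d k₀ : ℕ) (a : ℕ → ℂ) (φ z : ℂ) : (gradPoly d k₀ a φ).eval z =
    ∑ j ∈ Finset.Icc (d - k₀) k₀,
      a j * j * φ ^ (j - 1) * conj φ ^ (d - j) * (-1) ^ (d - j) * z ^ (k₀ + j - d) := by
  simp only [gradPoly, Polynomial.eval_finsetSum, Polynomial.eval_mul, Polynomial.eval_C,
    Polynomial.eval_pow, Polynomial.eval_X]

theorem eval_hessPoly (d k₀ : ℕ) (a : ℕ → ℂ) (φ z : ℂ) : (hessPoly d k₀ a φ).eval z =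
    ∑ j ∈ Finset.Icc (d - k₀) k₀,
      a j * j * (j - 1 : ℕ) * φ ^ (j - 1 - 1) * conj φ ^ (d - j) * (-1) ^ (d - j) *
        z ^ (k₀ + j - d) := by
  simp only [hessPoly, Polynomial.eval_finsetSum, Polynomial.eval_mul, Polynomial.eval_C,
    Polynomial.eval_pow, Polynomial.eval_X]

theorem eval_derivative_gradPoly (d k₀ : ℕ) (a : ℕ → ℂ) (φ z : ℂ) :
    (gradPoly d k₀ a φ).derivative.eval z =
    ∑ j ∈ Finset.Icc (d - k₀) k₀, a j * j * φ ^ (j - 1) * conj φ ^ (d - j) * (-1) ^ (d - j) *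
      (k₀ + j - d : ℕ) * z ^ (k₀ + j - d - 1) := by
  simp only [gradPoly, Polynomial.derivative_sum, Polynomial.eval_finsetSum,
    Polynomial.derivative_C_mul_X_pow, Polynomial.eval_mul, Polynomial.eval_C, Polynomial.eval_pow,
    Polynomial.eval_X]

namespace Unk

variable (k₀ : ℕ) (a : ℕ → ℂ)

/-- One summand of the linearized third equation, with z = ζ, w = ζ̄, p = φ̄, c = b̄, and L the
variation 2 Re(ζ^(k₀+1)p). In the coefficient of b̄, k₀ is split as (k₀+j-d) + (d-j): the first part
gives the derivative of the gradient polynomial, the second joins the Levi term. This is how b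
enters the Toeplitz operator through u + φbζ. -/
theorem term_identity {k₀ : ℕ} (hd : k₀ < d) {j : ℕ} (hj : j ∈ Finset.Icc (d - k₀) k₀)
    (A φ p z w b c u u' L : ℂ) (hzw : z * w = 1) :
    z ^ k₀ * (k₀ * (w * c + z * b) + L) * (A * j * (φ ^ (j - 1) * (-(w * p)) ^ (d - j))) +
      z ^ k₀ * (A * j * ((j - 1 : ℕ) * φ ^ (j - 1 - 1) * u * (-(w * p)) ^ (d - j) +
        φ ^ (j - 1) * ((d - j : ℕ) * (-(w * p)) ^ (d - j - 1) * (-(w * u'))))) =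
    A * φ ^ (j - 1) * p ^ (d - j - 1) * (j * (d - j : ℕ)) * (-1) ^ (d - j) * z ^ (k₀ + j - d) *
        (u' + p * c * w) +
      A * j * φ ^ (j - 1) * p ^ (d - j) * (-1) ^ (d - j) * z ^ (k₀ + j - d) * L +
      (A * j * (j - 1 : ℕ) * φ ^ (j - 1 - 1) * p ^ (d - j) * (-1) ^ (d - j) * z ^ (k₀ + j - d) * u +
      (k₀ * b * z * (A * j * φ ^ (j - 1) * p ^ (d - j) * (-1) ^ (d - j) * z ^ (k₀ + j - d)) +
      c * (A * j * φ ^ (j - 1) * p ^ (d - j) * (-1) ^ (d - j) * (k₀ + j - d : ℕ) *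
        z ^ (k₀ + j - d - 1)))) := by
  rw [Finset.mem_Icc] at hj
  obtain ⟨m, hm⟩ : ∃ m, d - j = m + 1 := ⟨d - j - 1, by omega⟩
  obtain ⟨n, hn⟩ : ∃ n, k₀ + j - d = n := ⟨_, rfl⟩
  have hk : k₀ = n + (m + 1) := by omega
  have h0 : z ^ m * w ^ m = 1 := by rw [← mul_pow, hzw, one_pow]
  have h1 : z ^ k₀ * (-(w * p)) ^ m = z ^ (n + 1) * ((-1) ^ m * p ^ m) := by
    rw [hk, neg_pow, mul_pow]
    linear_combination z ^ (n + 1) * (-1) ^ m * p ^ m * h0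
  have h2 : (n : ℂ) * z ^ (n - 1) = n * z ^ n * w := by
    rcases n with _ | n
    · simp
    · rw [Nat.add_sub_cancel, pow_succ]
      linear_combination (-((n + 1 : ℕ) : ℂ) * z ^ n) * hzw
  have hk' : (k₀ : ℂ) = n + (m + 1) := by rw [hk]; push_cast; ring
  rw [hm, hn, Nat.add_sub_cancel, pow_succ (-(w * p)) m, pow_succ (-1 : ℂ) m, pow_succ p m, hk']
  push_cast
  rw [pow_succ] at h1
  set e := (-1 : ℂ) ^ m
  set P := p ^ m
  set s := (-(w * p)) ^ m
  set Z := z ^ n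
  set K := z ^ k₀
  set φ₁ := φ ^ (j - 1)
  set φ₂ := φ ^ (j - 1 - 1)
  set q := ((j - 1 : ℕ) : ℂ)
  linear_combination (-(((n + (m + 1)) * (w * c + z * b) + L) * (A * j * φ₁ * (w * p))) -
      A * j * (q * φ₂ * u * (w * p) + φ₁ * ((m + 1) * (w * u')))) * h1 +
    Z * e * P * (-(((n + (m + 1)) * (w * c + z * b) + L) * (A * j * φ₁ * p)) -
      A * j * (q * φ₂ * u * p + φ₁ * ((m + 1) * u'))) * hzw +
    c * (A * j * φ₁ * (P * p) * e) * h2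

/-- The linearization of the third equation, up to holomorphic terms. -/
theorem negPart_linearization (hd : k₀ < d) (φ : ℂ) {x : Unk k α} (hx : x.2.2.1 = A.const φ)
    (x' : Unk k α) :
    negPart (mul (mul (zp k₀) (ddens k₀ x')) (model₃ d k₀ a x) +
      mul (zp k₀) (dmodel₃ d k₀ a x x')) =
    negPart (mul (poly (leviPoly d k₀ (twist d a φ)))
      (cj (bd x'.2.2.1 + mul (const (φ * x'.1)) (zp 1)))) +
    negPart (mul (poly (gradPoly d k₀ a φ)) (Lp k₀ x')) := by
  -- The discarded terms are the second derivative P_{zz} acting on u and the parts of the b and b̄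
  -- terms that are polynomials in ζ.
  have hH : IsHol (mul (poly (hessPoly d k₀ a φ)) (bd x'.2.2.1) +
      (mul (mul (const (k₀ * x'.1)) (zp (1 : ℕ))) (poly (gradPoly d k₀ a φ)) +
        mul (const (conj x'.1)) (poly (gradPoly d k₀ a φ).derivative))) :=
    ((isHol_poly _).mul (isHol_bd _)).add ((((isHol_const _).mul (isHol_zp 1)).mul
      (isHol_poly _)).add ((isHol_const _).mul (isHol_poly _)))
  rw [← map_add]
  refine negPart_congr hH ?_
  ext ζ
  have hz : (ζ : ℂ) ≠ 0 := Circle.coe_ne_zero ζ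
  have hU : U x ζ = φ := by rw [U_apply, hx, bdVal_const]
  have hS : S x ζ = -((ζ : ℂ)⁻¹ * conj φ) := by rw [S_apply, hx, bdVal_const, zpow_neg_one]
  have hcz : conj (ζ : ℂ) = (ζ : ℂ)⁻¹ := by rw [← Circle.coe_inv_eq_conj, Circle.coe_inv]
  simp only [add_apply', mul_apply, ddens, model₃, dmodel₃, CH.sum_apply, pw_apply, const_apply,
    zp_apply, poly_apply, cj_apply, hU, hS, bd_apply, Lb_apply]
  rw [eval_leviPoly, eval_gradPoly, eval_hessPoly, eval_derivative_gradPoly]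
  simp only [Finset.mul_sum, Finset.sum_mul, ← Finset.sum_add_distrib]
  refine Finset.sum_congr rfl fun j hj => ?_
  have := term_identity hd hj (a j) φ (conj φ) ζ (ζ : ℂ)⁻¹ x'.1 (conj x'.1) (bdVal x'.2.2.1 ζ)
    (conj (bdVal x'.2.2.1 ζ)) (Lp k₀ x' ζ) (mul_inv_cancel₀ hz)
  have hU' : U x' ζ = bdVal x'.2.2.1 ζ := rfl
  have hS' : S x' ζ = -((ζ : ℂ)⁻¹ * conj (bdVal x'.2.2.1 ζ)) := by rw [S_apply, zpow_neg_one]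
  rw [hU', hS', twist]
  simp only [zpow_natCast, zpow_one, map_add, map_mul, hcz, Nat.cast_one]
  linear_combination this

/-- The linearization of the second equation. -/
theorem negPart_mul_ddens (hk₀ : 0 < k₀) (x' : Unk k α) :
    negPart (mul (mul (zp k₀) (ddens k₀ x')) (const (-1 / 2))) = (-1 / 2 : ℝ) • x'.2.1 := by
  -- After multiplication by ζ^k₀, every term of the varied density is holomorphic except ζ^k₀
  -- conj(ζ^(k₀+1)p) = ζ̄p̄.
  have hH : IsHol (mul (const (-1 / 2)) (mul (const (k₀ * conj x'.1)) (zp (k₀ - 1 : ℕ)) +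
      (mul (const (k₀ * x'.1)) (zp (k₀ + 1 : ℕ)) + mul (zp (2 * k₀ + 1 : ℕ)) (bd x'.2.1)))) :=
    (isHol_const _).mul (((isHol_const _).mul (isHol_zp _)).add
      (((isHol_const _).mul (isHol_zp _)).add ((isHol_zp _).mul (isHol_bd _))))
  rw [← negPart_zp_neg_cj ((-1 / 2 : ℝ) • x'.2.1)]
  refine negPart_congr hH ?_
  ext ζ
  have hz : (ζ : ℂ) ≠ 0 := Circle.coe_ne_zero ζ
  have hcz : conj (ζ : ℂ) = (ζ : ℂ)⁻¹ := by rw [← Circle.coe_inv_eq_conj, Circle.coe_inv]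
  have h1 : bd ((-1 / 2 : ℝ) • x'.2.1) ζ = (-1 / 2 : ℝ) • bdVal x'.2.1 ζ := by
    rw [map_smul]; rfl
  obtain ⟨n, rfl⟩ : ∃ n, k₀ = n + 1 := ⟨k₀ - 1, by omega⟩
  simp only [add_apply', mul_apply, ddens, const_apply, zp_apply, cj_apply, h1, bd_apply, Lb_apply,
    Lp_apply, Nat.add_sub_cancel]
  simp only [zpow_natCast, zpow_one, map_mul, map_pow, hcz, zpow_neg, real_smul, conj_ofReal]
  have hzw : (ζ : ℂ) * (ζ : ℂ)⁻¹ = 1 := mul_inv_cancel₀ hz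
  have hzn : (ζ : ℂ) ^ (n + 1) * (ζ : ℂ)⁻¹ ^ (n + 1) = 1 := by rw [← mul_pow, hzw, one_pow]
  generalize (ζ : ℂ)⁻¹ = w at hzw hzn ⊢
  push_cast
  linear_combination (-1 / 2) * ((n : ℂ) + 1) * conj x'.1 * (ζ : ℂ) ^ n * hzw +
    (-1 / 2) * conj (bdVal x'.2.1 ζ) * w * hzn

/-- The linearization of the first equation. -/
theorem szego_X (x' : Unk k α) : szego (X x') = (-1 / 2 : ℝ) • x'.2.2.2 := by
  have h1 : X x' = (-1 / 2 : ℝ) • (bd x'.2.2.2 - mul (zp (-1)) (cj (bd x'.2.2.2))) := by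
    ext ζ
    refine (X_apply x' ζ).trans ?_
    show _ = (-1 / 2 : ℝ) • (bdVal x'.2.2.2 ζ - (ζ : ℂ) ^ (-1 : ℤ) * conj (bdVal x'.2.2.2 ζ))
    rw [real_smul]
    push_cast
    ring
  rw [h1, map_smul, map_sub, szego_bd, szego_zp_neg_cj, sub_zero]

theorem dmodel₁_congr (x : Unk k α) {x' x'' : Unk k α} (h : x'.2.2.1 = x''.2.2.1) :
    dmodel₁ d k₀ a x x' = dmodel₁ d k₀ a x x'' := by
  have hU : U x' = U x'' := by ext ζ; rw [U_apply, U_apply, h]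
  have hS : S x' = S x'' := by ext ζ; rw [S_apply, S_apply, h]
  rw [dmodel₁, hU, hS, dmodel₁]

theorem Lp_congr {x' x'' : Unk k α} (h : x'.2.1 = x''.2.1) : Lp k₀ x' = Lp k₀ x'' := by
  ext ζ
  rw [Lp_apply, Lp_apply, h]

/-- The linearized equations at `h = (1 - ζ) φ`. -/
theorem fderiv_modelEqs_const (hk₀ : 0 < k₀) (hd : k₀ < d) {n : ℕ} (J : A k α →L[ℝ] (Fin n → ℂ))
    (φ : ℂ) (v : A k α) (x' : Unk k α) :
    fderiv ℝ (Coef.modelEqs k₀ a d J) (0, 0, A.const φ, v) x' =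
      ((-1 / 2 : ℝ) • x'.2.2.2 + szego (dmodel₁ d k₀ a (0, 0, A.const φ, v) x'),
        (-1 / 2 : ℝ) • x'.2.1,
        negPart (mul (poly (leviPoly d k₀ (twist d a φ)))
          (cj (bd x'.2.2.1 + mul (const (φ * x'.1)) (zp 1)))) +
        negPart (mul (poly (gradPoly d k₀ a φ)) (Lp k₀ x')), J x'.2.2.1) := by
  rw [fderiv_modelEqs k₀ a J rfl rfl, negPart_mul_ddens k₀ hk₀,
    negPart_linearization k₀ a hd φ rfl, map_add, szego_X]

/-- The linearized equations are uniquely solvable. -/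
theorem bijective_fderiv_modelEqs (ha : IsModel d k₀ a)
    (J : A k α →L[ℝ] (Fin (k₀ - d / 2 + 2) → ℂ))
    (hJ : ∀ (Q : Polynomial ℂ), (∀ z : ℂ, ‖z‖ ≤ 1 → Q.eval z ≠ 0) → ∀ (u : A k α) (s : Polynomial ℂ),
      s.degree < (k₀ - d / 2 + 2 : ℕ) → mul (poly Q) (bd u) = poly s → J u = 0 → s = 0)
    (v : A k α) :
    Function.Bijective (fderiv ℝ (Coef.modelEqs k₀ a d J) (0, 0, A.const 1, v)) := by
  obtain ⟨κ, hκ, Q, hQn, hQ, hB⟩ := exists_factor (k₀ - d / 2) (leviPoly d k₀ a)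
    ha.natDegree_leviPoly ha.reflect_leviPoly ha.leviPoly_coeff_zero_ne fun z => ha.leviPoly_eval_ne
  obtain ⟨h1, h2⟩ := toeplitz_bijective hκ hQ hQn hB J (hJ Q hQ)
  have hT := fderiv_modelEqs_const k₀ a ha.k₀_pos ha.lt J 1 v
  simp only [twist_one, one_mul] at hT
  have hhalf : (-1 / 2 : ℝ) ≠ 0 := by norm_num
  -- The system is triangular: p is determined by the second component, then (b,u) by the third and
  -- fourth through the Toeplitz problem, then v by the first.
  constructor
  · refine (injective_iff_map_eq_zero _).2 fun x' hx' => ?_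
    rw [hT x'] at hx'
    obtain ⟨b, p, u, w⟩ := x'
    simp only [Prod.mk_eq_zero] at hx' ⊢
    obtain ⟨e1, e2, e3, e4⟩ := hx'
    have hp : p = 0 := (smul_eq_zero.1 e2).resolve_left hhalf
    have hLp : Lp k₀ (b, p, u, w) = 0 := by
      rw [Lp_congr k₀ (x'' := 0) (by exact hp), map_zero]
    rw [hLp, map_zero, map_zero, add_zero] at e3
    obtain ⟨hb, hu⟩ := h1 b u e3 e4
    refine ⟨hb, hp, hu, ?_⟩
    have h0 : dmodel₁ d k₀ a (0, 0, A.const 1, v) (0 : Unk k α) = 0 := by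
      rw [← fderiv_model₁, map_zero]
    rw [dmodel₁_congr k₀ a (0, 0, A.const 1, v) (x'' := 0) (by exact hu), h0, map_zero,
      add_zero] at e1
    exact (smul_eq_zero.1 e1).resolve_left hhalf
  · rintro ⟨q₁, q₂, q₃, y⟩
    obtain ⟨b, u, e3, e4⟩ := h2 (q₃ - negPart (mul (poly (gradPoly d k₀ a 1))
      (Lp k₀ ((0 : ℂ), (-1 / 2 : ℝ)⁻¹ • q₂, (0 : A k α), (0 : A k α))))) y
    refine ⟨(b, (-1 / 2 : ℝ)⁻¹ • q₂, u, (-1 / 2 : ℝ)⁻¹ • (q₁ - szego (dmodel₁ d k₀ a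
      (0, 0, A.const 1, v) (0, 0, u, 0)))), ?_⟩
    rw [hT]
    refine Prod.ext ?_ (Prod.ext ?_ (Prod.ext ?_ e4))
    · dsimp only
      rw [smul_inv_smul₀ hhalf]
      exact (congrArg (fun t => _ + szego t) (dmodel₁_congr k₀ a (0, 0, A.const 1, v)
        (x'' := (0, 0, u, 0)) rfl)).trans (sub_add_cancel _ _)
    · dsimp only
      rw [smul_inv_smul₀ hhalf]
    · dsimp only
      rw [e3]
      exact (congrArg (fun t => _ + negPart (mul _ t)) (Lp_congr k₀
        (x'' := ((0 : ℂ), (-1 / 2 : ℝ)⁻¹ • q₂, (0 : A k α), (0 : A k α))) rfl)).trans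
        (sub_add_cancel _ _)

end Unk

end Bijectivity

end KStat

end

set_option linter.unusedSectionVars false

noncomputable section

namespace KStat

open Filter Topology

/-! ## Uniform inverse function theorem and parametrization of solution sets -/

section Inverse

open scoped NNReal

variable {V W 𝒟 : Type*} [NormedAddCommGroup V] [NormedSpace ℝ V] [CompleteSpace V]
  [NormedAddCommGroup W] [NormedSpace ℝ W] [CompleteSpace W]

/-- On a ball independent of the parameter, f₀ + G D stays C^1-close to the isomorphism T = f₀'(x₀),
within a constant c < 1/‖T^{-1}‖. Half of c comes from the continuity of f₀', the other half from
the smallness of G D. Such a map is a homeomorphism of the ball onto an open set. -/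
theorem exists_local_inverse {f₀ : V → W} (hf₀ : ContDiff ℝ 1 f₀) {x₀ : V}
    (hT : Function.Bijective (fderiv ℝ f₀ x₀)) {size : 𝒟 → ℝ} {G : 𝒟 → V → W}
    (hG : SmallAt size x₀ G) :
    ∃ κ : ℝ, 0 < κ ∧ ∃ ε : ℝ, 0 < ε ∧ ∀ D, size D < ε → ∃ e : OpenPartialHomeomorph V W,
      e.source = ball x₀ κ ∧ (∀ x, e x = f₀ x + G D x) ∧ ContDiffOn ℝ 1 e.symm e.target := by
  let T : V ≃L[ℝ] W := ContinuousLinearEquiv.ofBijective (fderiv ℝ f₀ x₀)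
    (LinearMap.ker_eq_bot.2 hT.1) (LinearMap.range_eq_top.2 hT.2)
  have hTc : (T : V →L[ℝ] W) = fderiv ℝ f₀ x₀ := rfl
  obtain ⟨c, hc0, hc⟩ : ∃ c : ℝ≥0, 0 < c ∧ (Subsingleton V ∨ c < ‖(T.symm : W →L[ℝ] V)‖₊⁻¹) := by
    rcases subsingleton_or_nontrivial V with h | h
    · exact ⟨1, one_pos, Or.inl h⟩
    · have : 0 < ‖(T.symm : W →L[ℝ] V)‖₊⁻¹ := inv_pos.2 T.nnnorm_symm_pos
      obtain ⟨c, h1, h2⟩ := exists_between this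
      exact ⟨c, h1, Or.inr h2⟩
  obtain ⟨hG1, C, hC0, hC⟩ := hG
  have hcont : Continuous (fderiv ℝ f₀) := hf₀.continuous_fderiv one_ne_zero
  have h1 : ∀ᶠ x in 𝓝 x₀, ‖fderiv ℝ f₀ x - fderiv ℝ f₀ x₀‖ < c / 2 := by
    simpa only [dist_eq_norm] using! Metric.tendsto_nhds.1 (hcont.tendsto x₀) (c / 2) (by positivity)
  obtain ⟨κ, hκ, hball⟩ := Metric.eventually_nhds_iff_ball.1 (h1.and hC)
  refine ⟨κ, hκ, c / (2 * (C + 1)), by positivity, fun D hD => ?_⟩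
  have hf : ContDiff ℝ 1 fun x => f₀ x + G D x := hf₀.add (hG1 D)
  have hder : ∀ x ∈ ball x₀ κ, ‖fderiv ℝ (fun x => f₀ x + G D x) x - (T : V →L[ℝ] W)‖ ≤ c := by
    intro x hx
    obtain ⟨h2, h3⟩ := hball x hx
    rw [fderiv_fun_add (hf₀.differentiable one_ne_zero x) ((hG1 D).differentiable one_ne_zero x),
      hTc, add_sub_right_comm]
    refine (norm_add_le _ _).trans ?_
    have h4 : C * size D ≤ c / 2 := by
      have h5 : C * size D ≤ C * (c / (2 * (C + 1))) := mul_le_mul_of_nonneg_left hD.le hC0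
      refine h5.trans ?_
      rw [mul_div_assoc', div_le_div_iff₀ (by positivity) two_pos]
      have : (0 : ℝ) ≤ c := c.2
      nlinarith
    have := (h3 D).2
    linarith
  have happ : ApproximatesLinearOn (fun x => f₀ x + G D x) (T : V →L[ℝ] W) (ball x₀ κ) c :=
    fun x hx y hy => (convex_ball x₀ κ).norm_image_sub_le_of_norm_fderiv_le'
      (fun z _ => hf.differentiable one_ne_zero z) hder hy hx
  let e := happ.toOpenPartialHomeomorph _ _ hc isOpen_ball
  refine ⟨e, rfl, fun x => rfl, fun y hy => ?_⟩
  have hx : e.symm y ∈ ball x₀ κ := e.map_target hy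
  set L := fderiv ℝ (fun x => f₀ x + G D x) (e.symm y) with hL
  -- The derivative at any point of the ball is itself within c of T, hence bijective; this gives
  -- the C^1 regularity of the inverse on the whole target.
  have happL : ApproximatesLinearOn L (T : V →L[ℝ] W) Set.univ c := fun x _ z _ => by
    rw [← map_sub, ← _root_.sub_apply]
    exact ((L - (T : V →L[ℝ] W)).le_opNorm _).trans
      (mul_le_mul_of_nonneg_right (hder _ hx) (norm_nonneg _))
  have hLb : Function.Bijective L :=
    ⟨Set.injOn_univ.1 (happL.injOn hc), happL.surjective hc⟩
  let L' : V ≃L[ℝ] W := ContinuousLinearEquiv.ofBijective L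
    (LinearMap.ker_eq_bot.2 hLb.1) (LinearMap.range_eq_top.2 hLb.2)
  have hL' : HasFDerivAt e (L' : V →L[ℝ] W) (e.symm y) :=
    (hf.differentiable one_ne_zero (e.symm y)).hasFDerivAt
  exact (e.contDiffAt_symm hy hL' hf.contDiffAt).contDiffWithinAt

/-- The derivative of the inverse of a local homeomorphism. -/
theorem fderiv_symm_apply {e : OpenPartialHomeomorph V W} (he : ContDiffOn ℝ 1 e.symm e.target)
    {x : V} (hx : x ∈ e.source) (hd : DifferentiableAt ℝ e x) (x' : V) :
    fderiv ℝ e.symm (e x) (fderiv ℝ e x x') = x' := by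
  have h1 : HasFDerivAt e.symm (fderiv ℝ e.symm (e x)) (e x) :=
    ((he.contDiffAt (e.open_target.mem_nhds (e.map_source hx))).differentiableAt
      one_ne_zero).hasFDerivAt
  have h2 := h1.comp x hd.hasFDerivAt
  have h3 : HasFDerivAt (e.symm ∘ e) (ContinuousLinearMap.id ℝ V) x :=
    (hasFDerivAt_id x).congr_of_eventuallyEq (by
      filter_upwards [e.open_source.mem_nhds hx] with z hz
      exact e.left_inv hz)
  exact congrArg (fun L : V →L[ℝ] V => L x') (h2.unique h3)

variable {A' : Type*} [NormedAddCommGroup A'] [NormedSpace ℝ A'] {m : ℕ}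

/-- The set of the parameters of the solutions in `𝒰`. -/
def solDomain (e : OpenPartialHomeomorph V W) (ι : (Fin m → ℝ) →L[ℝ] W) (𝒰 : Set V) :
    Set (Fin m → ℝ) := ι ⁻¹' (e.target ∩ e.symm ⁻¹' 𝒰)

/-- The set of the projections of the solutions in `𝒰`. -/
def solSet (e : OpenPartialHomeomorph V W) (ι : (Fin m → ℝ) →L[ℝ] W) (𝒰 : Set V)
    (π : V →L[ℝ] A') : Set A' := π '' {x ∈ 𝒰 | ∃ t, e x = ι t}

theorem isOpen_solDomain {e : OpenPartialHomeomorph V W} {ι : (Fin m → ℝ) →L[ℝ] W} {𝒰 : Set V}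
    (h𝒰 : IsOpen 𝒰) : IsOpen (solDomain e ι 𝒰) :=
  (e.symm.isOpen_inter_preimage h𝒰).preimage ι.continuous

/-- The solutions are parametrized by `e.symm ∘ ι`, if the parameter is a continuous linear function
of the projection of the solution. -/
theorem isParam_solSet {e : OpenPartialHomeomorph V W} (he : ContDiffOn ℝ 1 e.symm e.target)
    {ι : (Fin m → ℝ) →L[ℝ] W} {𝒰 : Set V} (h𝒰 : IsOpen 𝒰) (hs : 𝒰 ⊆ e.source) {π : V →L[ℝ] A'}
    {J : A' → Fin m → ℝ} (hJc : ContDiff ℝ 1 J) (hJ : ∀ x ∈ 𝒰, ∀ t, e x = ι t → J (π x) = t) :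
    IsParam m (solSet e ι 𝒰 π) (solDomain e ι 𝒰) (fun t => π (e.symm (ι t))) ∧
      solSet e ι 𝒰 π = (fun t => π (e.symm (ι t))) '' solDomain e ι 𝒰 := by
  have hJσ : ∀ t ∈ solDomain e ι 𝒰, J (π (e.symm (ι t))) = t := fun t ht =>
    hJ _ ht.2 t (e.right_inv ht.1)
  have hmem : ∀ t ∈ solDomain e ι 𝒰, π (e.symm (ι t)) ∈ solSet e ι 𝒰 π := fun t ht =>
    ⟨_, ⟨ht.2, t, e.right_inv ht.1⟩, rfl⟩
  have hsol : ∀ x ∈ 𝒰, ∀ t, e x = ι t → t ∈ solDomain e ι 𝒰 ∧ e.symm (ι t) = x := by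
    intro x hx t hxt
    have h1 : e.symm (ι t) = x := by rw [← hxt, e.left_inv (hs hx)]
    refine ⟨⟨?_, ?_⟩, h1⟩
    · rw [← hxt]; exact e.map_source (hs hx)
    · rw [Set.mem_preimage, h1]; exact hx
  have hopen : IsOpen (solDomain e ι 𝒰) := isOpen_solDomain h𝒰
  have hcd : ContDiffOn ℝ 1 (fun t => π (e.symm (ι t))) (solDomain e ι 𝒰) :=
    π.contDiff.comp_contDiffOn (he.comp ι.contDiff.contDiffOn fun t ht => ht.1)
  refine ⟨⟨hopen, hcd, fun t ht => ?_, fun t ht t' ht' h => ?_, fun Ω' hΩ' hΩo => ?_⟩, ?_⟩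
  -- J is a globally defined C^1 left inverse of the parametrization. It yields immersion by the
  -- chain rule, injectivity, and relative openness of images, with J⁻¹(Ω') as open set.
  · have h1 : HasFDerivAt (fun t => π (e.symm (ι t))) _ t :=
      ((hcd.contDiffAt (hopen.mem_nhds ht)).differentiableAt one_ne_zero).hasFDerivAt
    have h2 := ((hJc.differentiable one_ne_zero _).hasFDerivAt).comp t h1
    have h3 : HasFDerivAt (J ∘ fun t => π (e.symm (ι t)))
        (ContinuousLinearMap.id ℝ (Fin m → ℝ)) t :=
      (hasFDerivAt_id t).congr_of_eventuallyEq (by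
        filter_upwards [hopen.mem_nhds ht] with z hz
        exact hJσ z hz)
    have h4 := h2.unique h3
    intro s s' hss
    have h5 := congrArg (fun L : (Fin m → ℝ) →L[ℝ] (Fin m → ℝ) => L s) h4
    have h6 := congrArg (fun L : (Fin m → ℝ) →L[ℝ] (Fin m → ℝ) => L s') h4
    simp only [ContinuousLinearMap.comp_apply, ContinuousLinearMap.id_apply] at h5 h6
    rw [← h5, ← h6, hss]
  · have h1 := congrArg J h
    rwa [hJσ t ht, hJσ t' ht'] at h1
  · refine ⟨J ⁻¹' Ω', hΩo.preimage hJc.continuous, ?_⟩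
    ext y
    constructor
    · rintro ⟨t, ht, rfl⟩
      refine ⟨hmem t (hΩ' ht), ?_⟩
      show J (π (e.symm (ι t))) ∈ Ω'
      rw [hJσ t (hΩ' ht)]
      exact ht
    · rintro ⟨⟨x, ⟨hx, t, hxt⟩, rfl⟩, hy⟩
      refine ⟨t, ?_, congrArg π (hsol x hx t hxt).2⟩
      rw [Set.mem_preimage, hJ x hx t hxt] at hy
      exact hy
  · ext y
    constructor
    · rintro ⟨x, ⟨hx, t, hxt⟩, rfl⟩
      exact ⟨t, (hsol x hx t hxt).1, congrArg π (hsol x hx t hxt).2⟩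
    · rintro ⟨t, ht, rfl⟩
      exact hmem t ht

/-- If `φ ∘ σ` is a linear isomorphism, then `φ` is a diffeomorphism of the image of `σ`. -/
theorem diffeoOntoImage_of_comp_eq {n : ℕ} {N : Set A'} {Ω : Set (Fin m → ℝ)}
    {σ : (Fin m → ℝ) → A'} (hσ : IsParam m N Ω σ) (hN : N = σ '' Ω) {φ : A' → Fin n → ℂ}
    (L : (Fin m → ℝ) ≃L[ℝ] (Fin n → ℂ)) (hφ : ∀ t ∈ Ω, φ (σ t) = L t) : DiffeoOntoImage m N φ := by
  have hinj : Set.InjOn φ N := by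
    rw [hN]
    rintro _ ⟨t, ht, rfl⟩ _ ⟨t', ht', rfl⟩ h
    rw [hφ t ht, hφ t' ht'] at h
    rw [L.injective h]
  refine ⟨hinj, fun x hx => ⟨Ω, σ, hσ, by rwa [← hN], hσ.isOpen, ?_, fun t ht => ?_, ?_, ?_⟩⟩
  · exact L.contDiff.contDiffOn.congr hφ
  · have h1 : φ ∘ σ =ᶠ[𝓝 t] L := by
      filter_upwards [hσ.isOpen.mem_nhds ht] with z hz
      exact hφ z hz
    rw [h1.fderiv_eq, L.fderiv]
    exact L.injective
  · intro t ht t' ht' h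
    rw [Function.comp_apply, Function.comp_apply, hφ t ht, hφ t' ht'] at h
    exact L.injective h
  · intro Ω' hΩ' hΩo
    have h1 : (φ ∘ σ) '' Ω' = L '' Ω' := Set.image_congr fun t ht => hφ t (hΩ' ht)
    refine ⟨L '' Ω', L.toHomeomorph.isOpenMap _ hΩo, ?_⟩
    rw [h1, Set.right_eq_inter]
    rintro _ ⟨t, ht, rfl⟩
    exact ⟨σ t, by rw [hN]; exact ⟨t, hΩ' ht, rfl⟩, hφ t (hΩ' ht)⟩

end Inverse

end KStat

end

set_option linter.unusedSectionVars false

noncomputable section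

namespace KStat

open Filter Topology ComplexConjugate CH

/-! ## Derivatives of a deformed defining function -/

section Derivatives

theorem wirt_of_clm (L : ℂ →L[ℝ] ℂ) : L = wirt ((L 1 - I * L I) / 2) ((L 1 + I * L I) / 2) := by
  refine ContinuousLinearMap.ext fun v => ?_
  have h1 : L v = v.re * L 1 + v.im * L I := by
    have h2 : v = v.re • (1 : ℂ) + v.im • I := by
      rw [real_smul, real_smul, mul_one, re_add_im]
    conv_lhs => rw [h2, map_add, map_smul, map_smul, real_smul, real_smul]
  rw [h1, wirt_apply, ← re_add_im v]
  simp only [map_add, map_mul, conj_ofReal, conj_I, add_re, ofReal_re, mul_re, I_re, mul_zero, ofReal_im,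
    I_im, mul_one, sub_self, add_zero, add_im, mul_im, zero_add]
  linear_combination ((v.im : ℂ) * L I) * I_sq

theorem hasFDerivAt_mul_wirt {f g : ℂ → ℂ} {a b a' b' z : ℂ} (hf : HasFDerivAt f (wirt a b) z)
    (hg : HasFDerivAt g (wirt a' b') z) :
    HasFDerivAt (fun z => f z * g z) (wirt (a * g z + f z * a') (b * g z + f z * b')) z := by
  refine (hf.mul hg).congr_fderiv (ContinuousLinearMap.ext fun v => ?_)
  simp
  ring

theorem hasFDerivAt_add_wirt {f g : ℂ → ℂ} {a b a' b' z : ℂ} (hf : HasFDerivAt f (wirt a b) z)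
    (hg : HasFDerivAt g (wirt a' b') z) :
    HasFDerivAt (fun z => f z + g z) (wirt (a + a') (b + b')) z := by
  refine (hf.add hg).congr_fderiv (ContinuousLinearMap.ext fun v => ?_)
  simp
  ring

theorem hasFDerivAt_const_wirt (c z : ℂ) : HasFDerivAt (fun _ : ℂ => c) (wirt 0 0) z := by
  refine (hasFDerivAt_const c z).congr_fderiv (ContinuousLinearMap.ext fun v => ?_)
  simp

variable {d k : ℕ}

namespace Coef

variable (D : Coef d k)

/-- The derivative `θ_z`. -/
def thetaZ (z : ℂ) (y : ℝ) : ℂ :=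
  ∑ m ∈ terms d, (m.2.1 * z ^ (m.2.1 - 1) * conj z ^ m.2.2 * (y : ℂ) ^ m.1 * D.R m (z, y) +
    z ^ m.2.1 * conj z ^ m.2.2 * (y : ℂ) ^ m.1 * evz (fderiv ℝ (D.R m) (z, y)))

/-- The derivative `θ_y`. -/
def thetaY (z : ℂ) (y : ℝ) : ℂ :=
  ∑ m ∈ terms d, (z ^ m.2.1 * conj z ^ m.2.2 * (m.1 * (y : ℂ) ^ (m.1 - 1)) * D.R m (z, y) +
    z ^ m.2.1 * conj z ^ m.2.2 * (y : ℂ) ^ m.1 * evy (fderiv ℝ (D.R m) (z, y))) + ev1 (fderiv ℝ D.t y)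

theorem differentiableAt_R (m) (p : ℂ × ℝ) : DifferentiableAt ℝ (D.R m) p :=
  (D.bound_R m).1.differentiable (by norm_cast) p

theorem hasFDerivAt_theta (z : ℂ) (y : ℝ) :
    ∃ b, HasFDerivAt (fun z => D.theta z y) (wirt (D.thetaZ z y) b) z := by
  have hR : ∀ m, ∃ b, HasFDerivAt (fun z => D.R m (z, y))
      (wirt (evz (fderiv ℝ (D.R m) (z, y))) b) z := fun m => by
    have h1 : HasFDerivAt (fun z : ℂ => (z, y)) (ContinuousLinearMap.inl ℝ ℂ ℝ) z :=
      hasFDerivAt_prodMk_left z y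
    have h2 := (D.differentiableAt_R m (z, y)).hasFDerivAt.comp z h1
    rw [wirt_of_clm ((fderiv ℝ (D.R m) (z, y)).comp (ContinuousLinearMap.inl ℝ ℂ ℝ))] at h2
    have h3 : evz (fderiv ℝ (D.R m) (z, y)) =
        ((fderiv ℝ (D.R m) (z, y)).comp (ContinuousLinearMap.inl ℝ ℂ ℝ) 1 -
          I * (fderiv ℝ (D.R m) (z, y)).comp (ContinuousLinearMap.inl ℝ ℂ ℝ) I) / 2 := by
      show 1 / 2 * (fderiv ℝ (D.R m) (z, y) (1, 0) - I * fderiv ℝ (D.R m) (z, y) (I, 0)) =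
        (fderiv ℝ (D.R m) (z, y) (1, 0) - I * fderiv ℝ (D.R m) (z, y) (I, 0)) / 2
      ring
    rw [h3]
    exact ⟨_, h2⟩
  choose b hb using hR
  have h1 := HasFDerivAt.sum_wirt (s := terms d) fun m _ =>
    hasFDerivAt_mul_wirt (hasFDerivAt_monomial ((y : ℂ) ^ m.1) m.2.1 m.2.2 z) (hb m)
  have h2 := hasFDerivAt_add_wirt h1 (hasFDerivAt_const_wirt (D.t y : ℂ) z)
  have h3 : D.thetaZ z y = ∑ m ∈ terms d, ((y : ℂ) ^ m.1 * (m.2.1 * z ^ (m.2.1 - 1)) *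
      conj z ^ m.2.2 * D.R m (z, y) + (y : ℂ) ^ m.1 * z ^ m.2.1 * conj z ^ m.2.2 *
      evz (fderiv ℝ (D.R m) (z, y))) + 0 := by
    rw [add_zero, thetaZ]
    exact Finset.sum_congr rfl fun m _ => by ring
  rw [h3]
  refine ⟨_, h2.congr_of_eventuallyEq (Eventually.of_forall fun z => ?_)⟩
  simp only [theta]
  congr 1
  exact Finset.sum_congr rfl fun m _ => by ring

theorem hasDerivAt_theta (z : ℂ) (y : ℝ) : HasDerivAt (fun y => D.theta z y) (D.thetaY z y) y := by
  have hR : ∀ m, HasDerivAt (fun y => D.R m (z, y)) (evy (fderiv ℝ (D.R m) (z, y))) y := fun m => by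
    have h1 : HasDerivAt (fun y : ℝ => (z, y)) ((0 : ℂ), (1 : ℝ)) y :=
      (hasDerivAt_const y z).prodMk (hasDerivAt_id y)
    exact (D.differentiableAt_R m (z, y)).hasFDerivAt.comp_hasDerivAt y h1
  have ht : HasDerivAt (fun y => (D.t y : ℂ)) (ev1 (fderiv ℝ D.t y)) y := by
    have h1 : HasDerivAt D.t (fderiv ℝ D.t y 1) y :=
      (D.bound_t.1.differentiable (by norm_cast) y).hasFDerivAt.hasDerivAt
    exact h1.ofReal_comp
  have hy : ∀ n : ℕ, HasDerivAt (fun y : ℝ => (y : ℂ) ^ n) (n * (y : ℂ) ^ (n - 1)) y := fun n =>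
    (hasDerivAt_pow n (y : ℂ)).comp_ofReal
  exact (HasDerivAt.fun_sum fun m _ => ((hy m.1).const_mul (z ^ m.2.1 * conj z ^ m.2.2)).fun_mul
    (hR m)).add ht

end Coef

theorem hasFDerivAt_comp_re {g : ℝ → ℂ} {g' : ℂ} {w : ℂ} (h : HasDerivAt g g' w.re) :
    HasFDerivAt (fun w : ℂ => g w.re) (wirt (g' / 2) (g' / 2)) w := by
  refine (h.hasFDerivAt.comp w reCLM.hasFDerivAt).congr_fderiv (ContinuousLinearMap.ext fun v => ?_)
  have : (v.re : ℂ) = (v + conj v) / 2 := by rw [add_conj]; push_cast; ring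
  simp [this]
  ring

theorem hasFDerivAt_comp_im {g : ℝ → ℂ} {g' : ℂ} {w : ℂ} (h : HasDerivAt g g' w.im) :
    HasFDerivAt (fun w : ℂ => g w.im) (wirt (-I / 2 * g') (I / 2 * g')) w := by
  refine (h.hasFDerivAt.comp w imCLM.hasFDerivAt).congr_fderiv (ContinuousLinearMap.ext fun v => ?_)
  have : (v.im : ℂ) = -I / 2 * v + I / 2 * conj v := by
    have h1 := sub_conj v
    push_cast at h1
    linear_combination (I / 2) * h1 + (v.im : ℂ) * I_sq
  simp [this]
  ring

variable {k₀ : ℕ} {a : ℕ → ℂ}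

/-- The function `r` is the deformation of `ρ` given by `D` in the bidisc of radius `δ`. -/
structure IsDeformed (D : Coef d k) (k₀ : ℕ) (a : ℕ → ℂ) (δ : ℝ) (r : ℂ × ℂ → ℝ) : Prop where
  eq : ∀ z w : ℂ, ‖z‖ < δ → ‖w‖ < δ → (r (z, w) : ℂ) = -w.re + modelPoly d k₀ a z + D.theta z w.im

variable {D : Coef d k} {δ : ℝ} {r : ℂ × ℂ → ℝ} {z w : ℂ}

theorem IsDeformed.dz_left (h : IsDeformed D k₀ a δ r) (hz : ‖z‖ < δ) (hw : ‖w‖ < δ) :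
    dz (fun z => (r (z, w) : ℂ)) z = modelDz d k₀ a z + D.thetaZ z w.im := by
  obtain ⟨b, hb⟩ := D.hasFDerivAt_theta z w.im
  have h1 := hasFDerivAt_add_wirt (hasFDerivAt_add_wirt (hasFDerivAt_const_wirt (-w.re : ℂ) z)
    (hasFDerivAt_modelPoly d k₀ a z)) hb
  rw [zero_add] at h1
  refine dz_eq (h1.congr_of_eventuallyEq ?_)
  filter_upwards [(isOpen_lt continuous_norm continuous_const).mem_nhds hz] with z' hz'
  exact h.eq z' w hz' hw

theorem IsDeformed.dz_right (h : IsDeformed D k₀ a δ r) (hz : ‖z‖ < δ) (hw : ‖w‖ < δ) :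
    dz (fun w => (r (z, w) : ℂ)) w = -1 / 2 + -I / 2 * D.thetaY z w.im := by
  have hre : HasDerivAt (fun y : ℝ => (-y : ℂ)) (-1) w.re := (hasDerivAt_id w.re).ofReal_comp.neg
  have h1 := hasFDerivAt_add_wirt (hasFDerivAt_add_wirt (hasFDerivAt_comp_re hre)
    (hasFDerivAt_const_wirt (modelPoly d k₀ a z) w))
    (hasFDerivAt_comp_im (D.hasDerivAt_theta z w.im))
  rw [add_zero] at h1
  refine dz_eq (h1.congr_of_eventuallyEq ?_)
  filter_upwards [(isOpen_lt continuous_norm continuous_const).mem_nhds hw] with w' hw'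
  exact h.eq z w' hz hw'

end Derivatives

end KStat

end

set_option linter.unusedSectionVars false

noncomputable section

namespace KStat

open Filter Topology ComplexConjugate CH

/-! ## The equations along a disc -/

section Identities

variable {k : ℕ} {α : ℝ} [HolderExponent α] {d : ℕ}

theorem Circle.conj_eq_inv (ζ : Circle) : conj (ζ : ℂ) = (ζ : ℂ)⁻¹ := by
  rw [← Circle.coe_inv_eq_conj, Circle.coe_inv]

namespace Unk

variable (x : Unk k α) (ζ : Circle)

theorem one_sub_mul_U : (1 - (ζ : ℂ)) * U x ζ = discBd x.2.2.1 ζ := rfl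

/-- This is 1 - ζ̄ = -ζ̄(1 - ζ) on the circle, the source of the divisibility by 1 - ζ of
expressions involving conjugates. -/
theorem one_sub_mul_S : (1 - (ζ : ℂ)) * S x ζ = conj (discBd x.2.2.1 ζ) := by
  have hz : (ζ : ℂ) * (ζ : ℂ)⁻¹ = 1 := mul_inv_cancel₀ (Circle.coe_ne_zero ζ)
  rw [S_apply, discBd, map_mul, map_sub, map_one, Circle.conj_eq_inv, zpow_neg_one]
  linear_combination conj (bdVal x.2.2.1 ζ) * hz

theorem conj_discBd (v : A k α) : conj (discBd v ζ) = -((1 - (ζ : ℂ)) * (ζ : ℂ)⁻¹) * conj (bdVal v ζ) := by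
  have hz : (ζ : ℂ) * (ζ : ℂ)⁻¹ = 1 := mul_inv_cancel₀ (Circle.coe_ne_zero ζ)
  rw [discBd, map_mul, map_sub, map_one, Circle.conj_eq_inv]
  linear_combination -conj (bdVal v ζ) * hz

theorem one_sub_mul_Yv : (1 - (ζ : ℂ)) * Yv x ζ = ((discBd x.2.2.2 ζ).im : ℂ) := by
  rw [im_eq_sub_conj, conj_discBd, Yv_apply, zpow_neg_one, discBd]
  ring

theorem one_sub_mul_X : (1 - (ζ : ℂ)) * X x ζ = -((discBd x.2.2.2 ζ).re : ℂ) := by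
  rw [re_eq_add_conj, conj_discBd, X_apply, zpow_neg_one, discBd]
  ring

theorem one_sub_mul_model₁ (k₀ : ℕ) (a : ℕ → ℂ) (hd : k₀ < d) :
    (1 - (ζ : ℂ)) * model₁ d k₀ a x ζ = modelPoly d k₀ a (discBd x.2.2.1 ζ) := by
  simp only [model₁, modelPoly, CH.sum_apply, Finset.mul_sum]
  rw [← one_sub_mul_S, ← one_sub_mul_U]
  refine Finset.sum_congr rfl fun j hj => ?_
  rw [Finset.mem_Icc] at hj
  simp only [mul_apply, const_apply, pw_apply, W_apply, zpow_one]
  rw [mul_pow, mul_pow]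
  have h1 : (1 - (ζ : ℂ)) * (1 - (ζ : ℂ)) ^ (d - 1) = (1 - (ζ : ℂ)) ^ j * (1 - (ζ : ℂ)) ^ (d - j) := by
    rw [← pow_succ', ← pow_add]; congr 1; omega
  linear_combination a j * U x ζ ^ j * S x ζ ^ (d - j) * h1

theorem one_sub_pow_mul_model₃ (k₀ : ℕ) (a : ℕ → ℂ) (hd : k₀ < d) :
    (1 - (ζ : ℂ)) ^ (d - 1) * model₃ d k₀ a x ζ = modelDz d k₀ a (discBd x.2.2.1 ζ) := by
  simp only [model₃, modelDz, CH.sum_apply, Finset.mul_sum]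
  rw [← one_sub_mul_S, ← one_sub_mul_U]
  refine Finset.sum_congr rfl fun j hj => ?_
  rw [Finset.mem_Icc] at hj
  simp only [mul_apply, const_apply, pw_apply]
  rw [mul_pow, mul_pow]
  have h1 : (1 - (ζ : ℂ)) ^ (d - 1) = (1 - (ζ : ℂ)) ^ (j - 1) * (1 - (ζ : ℂ)) ^ (d - j) := by
    rw [← pow_add]; congr 1; omega
  rw [h1]
  ring

end Unk

namespace Coef

open Unk

variable (D : Coef d k) (x : Unk k α) (ζ : Circle)

theorem NR_apply (m) : D.NR m x ζ = D.R m (discBd x.2.2.1 ζ, (discBd x.2.2.2 ζ).im) := by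
  rw [← Φ_apply]; rfl

theorem NdR_apply (m) : D.NdR m x ζ = fderiv ℝ (D.R m) (discBd x.2.2.1 ζ, (discBd x.2.2.2 ζ).im) := by
  rw [← Φ_apply]; rfl

theorem NQ_apply : D.NQ x ζ = ev1 (D.quot (discBd x.2.2.2 ζ).im) := by
  rw [← Ψ_apply]; rfl

theorem Ndt_apply : D.Ndt x ζ = ev1 (fderiv ℝ D.t (discBd x.2.2.2 ζ).im) := by
  rw [← Ψ_apply]; rfl

theorem one_sub_mul_pert₁ (hd : 0 < d) :
    (1 - (ζ : ℂ)) * D.pert₁ x ζ = D.theta (discBd x.2.2.1 ζ) (discBd x.2.2.2 ζ).im := by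
  have hY := one_sub_mul_Yv x ζ
  have hq : (ev1 (D.quot (discBd x.2.2.2 ζ).im) : ℂ) * ((discBd x.2.2.2 ζ).im : ℂ) =
      (D.t (discBd x.2.2.2 ζ).im : ℂ) := by
    rw [← D.quot_mul, ofReal_mul]; rfl
  simp only [pert₁, theta, add_apply', CH.sum_apply, mul_add, Finset.mul_sum]
  congr 1
  · refine Finset.sum_congr rfl fun m hm => ?_
    have hm' := le_of_mem_terms hm
    simp only [mul_apply, pw_apply, W_apply, zpow_one, NR_apply]
    rw [← hY, ← one_sub_mul_S, ← one_sub_mul_U, mul_pow, mul_pow, mul_pow]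
    have h1 : (1 - (ζ : ℂ)) * (1 - (ζ : ℂ)) ^ (m.2.1 + m.2.2 + m.1 - 1) =
        (1 - (ζ : ℂ)) ^ m.2.1 * (1 - (ζ : ℂ)) ^ m.2.2 * (1 - (ζ : ℂ)) ^ m.1 := by
      rw [← pow_succ', ← pow_add, ← pow_add]; congr 1; omega
    generalize D.R m _ = R
    linear_combination U x ζ ^ m.2.1 * S x ζ ^ m.2.2 * Yv x ζ ^ m.1 * R * h1
  · rw [← hq, ← hY, mul_apply, NQ_apply]
    ring

theorem pert₂_apply (hd : 0 < d) :
    D.pert₂ x ζ = D.thetaY (discBd x.2.2.1 ζ) (discBd x.2.2.2 ζ).im := by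
  have hY := one_sub_mul_Yv x ζ
  simp only [pert₂, thetaY, add_apply', CH.sum_apply]
  congr 1
  · refine Finset.sum_congr rfl fun m hm => ?_
    have hm' := le_of_mem_terms hm
    simp only [mul_apply, pw_apply, W_apply, zpow_one, NR_apply, const_apply, lmap_apply, NdR_apply]
    rw [← hY, ← one_sub_mul_S, ← one_sub_mul_U]
    generalize D.R m _ = R
    generalize evy _ = E
    simp only [mul_pow]
    have h1 : (1 - (ζ : ℂ)) ^ (m.2.1 + m.2.2 + m.1) =
        (1 - (ζ : ℂ)) ^ m.2.1 * (1 - (ζ : ℂ)) ^ m.2.2 * (1 - (ζ : ℂ)) ^ m.1 := by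
      rw [← pow_add, ← pow_add]
    -- The factor `m.1` is kept on both sides: for `m.1 = 0` the truncated exponents disagree, but
    -- the term is zero.
    have h2 : (1 - (ζ : ℂ)) ^ (m.2.1 + m.2.2 + m.1 - 1) * (m.1 : ℂ) =
        (1 - (ζ : ℂ)) ^ m.2.1 * (1 - (ζ : ℂ)) ^ m.2.2 * (1 - (ζ : ℂ)) ^ (m.1 - 1) * m.1 := by
      rcases Nat.eq_zero_or_pos m.1 with h | h
      · simp [h]
      · rw [← pow_add, ← pow_add]; congr 2; omega
    linear_combination U x ζ ^ m.2.1 * S x ζ ^ m.2.2 * Yv x ζ ^ m.1 * E * h1 +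
      U x ζ ^ m.2.1 * S x ζ ^ m.2.2 * Yv x ζ ^ (m.1 - 1) * R * h2
  · exact D.Ndt_apply x ζ

theorem one_sub_pow_mul_pert₃ (hd : 0 < d) :
    (1 - (ζ : ℂ)) ^ (d - 1) * D.pert₃ x ζ = D.thetaZ (discBd x.2.2.1 ζ) (discBd x.2.2.2 ζ).im := by
  have hY := one_sub_mul_Yv x ζ
  simp only [pert₃, thetaZ, CH.sum_apply, Finset.mul_sum]
  refine Finset.sum_congr rfl fun m hm => ?_
  have hm' := le_of_mem_terms hm
  simp only [add_apply', mul_apply, pw_apply, W_apply, zpow_one, NR_apply, const_apply, lmap_apply,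
    NdR_apply]
  rw [← hY, ← one_sub_mul_S, ← one_sub_mul_U]
  generalize D.R m _ = R
  generalize evz _ = E
  simp only [mul_pow]
  have h1 : (1 - (ζ : ℂ)) ^ (d - 1) * (1 - (ζ : ℂ)) ^ (m.2.1 + m.2.2 + m.1 - d + 1) =
      (1 - (ζ : ℂ)) ^ m.2.1 * (1 - (ζ : ℂ)) ^ m.2.2 * (1 - (ζ : ℂ)) ^ m.1 := by
    rw [← pow_add, ← pow_add, ← pow_add]; congr 1; omega
  have h2 : (1 - (ζ : ℂ)) ^ (d - 1) * (1 - (ζ : ℂ)) ^ (m.2.1 + m.2.2 + m.1 - d) * (m.2.1 : ℂ) =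
      (1 - (ζ : ℂ)) ^ (m.2.1 - 1) * (1 - (ζ : ℂ)) ^ m.2.2 * (1 - (ζ : ℂ)) ^ m.1 * m.2.1 := by
    rcases Nat.eq_zero_or_pos m.2.1 with h | h
    · simp [h]
    · rw [← pow_add, ← pow_add, ← pow_add]; congr 2; omega
  linear_combination U x ζ ^ m.2.1 * S x ζ ^ m.2.2 * Yv x ζ ^ m.1 * E * h1 +
    U x ζ ^ (m.2.1 - 1) * S x ζ ^ m.2.2 * Yv x ζ ^ m.1 * R * h2

variable {k₀ : ℕ} {a : ℕ → ℂ} {δ : ℝ} {r : ℂ × ℂ → ℝ} {D x}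

theorem one_sub_mul_eq₁ (hd : k₀ < d) (hr : IsDeformed D k₀ a δ r) (hu : ‖discBd x.2.2.1 ζ‖ < δ)
    (hv : ‖discBd x.2.2.2 ζ‖ < δ) : (1 - (ζ : ℂ)) * D.eq₁ k₀ a x ζ =
      (r (discBd x.2.2.1 ζ, discBd x.2.2.2 ζ) : ℂ) := by
  rw [hr.eq _ _ hu hv, ← one_sub_mul_X, ← one_sub_mul_model₁ x ζ k₀ a hd,
    ← one_sub_mul_pert₁ D x ζ (by omega), eq₁]
  simp only [add_apply']
  ring

theorem eq₂_apply (hd : k₀ < d) (hr : IsDeformed D k₀ a δ r) (hu : ‖discBd x.2.2.1 ζ‖ < δ)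
    (hv : ‖discBd x.2.2.2 ζ‖ < δ) : D.eq₂ k₀ x ζ = (ζ : ℂ) ^ k₀ * dens k₀ x ζ *
      dz (fun w => (r (discBd x.2.2.1 ζ, w) : ℂ)) (discBd x.2.2.2 ζ) := by
  rw [hr.dz_right hu hv, ← pert₂_apply D x ζ (by omega), eq₂]
  simp only [add_apply', mul_apply, const_apply, zp_apply, zpow_natCast]

theorem one_sub_pow_mul_eq₃ (hd : k₀ < d) (hr : IsDeformed D k₀ a δ r) (hu : ‖discBd x.2.2.1 ζ‖ < δ)
    (hv : ‖discBd x.2.2.2 ζ‖ < δ) : (1 - (ζ : ℂ)) ^ (d - 1) * D.eq₃ k₀ a x ζ =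
      (ζ : ℂ) ^ k₀ * dens k₀ x ζ *
      dz (fun z => (r (z, discBd x.2.2.2 ζ) : ℂ)) (discBd x.2.2.1 ζ) := by
  rw [hr.dz_left hu hv, ← one_sub_pow_mul_model₃ x ζ k₀ a hd,
    ← one_sub_pow_mul_pert₃ D x ζ (by omega), eq₃]
  simp only [add_apply', mul_apply, zp_apply, zpow_natCast]
  ring

end Coef

/-! ## The lifts of stationary discs as solutions of the equations -/

theorem isHol_of_one_sub_pow_mul {q w : CH ℂ k α} {n : ℕ} (hw : IsHol w)
    (h : ∀ ζ : Circle, w ζ = (1 - (ζ : ℂ)) ^ n * q ζ) : IsHol q := by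
  induction n generalizing w with
  | zero =>
    have : w = q := by ext ζ; rw [h, pow_zero, one_mul]
    exact this ▸ hw
  | succ n ih =>
    refine ih (w := mul (pw Unk.W n) q) (isHol_of_one_sub_mul hw fun ζ => ?_) fun ζ => ?_
    · simp only [h, mul_apply, pw_apply, Unk.W_apply, zpow_one]
      ring
    · simp only [mul_apply, pw_apply, Unk.W_apply, zpow_one]

theorem isHol_pw {q : CH ℂ k α} (h : IsHol q) (n : ℕ) : IsHol (pw q n) := by
  induction n with
  | zero => exact isHol_const 1
  | succ n ih => exact ih.mul h

theorem isHol_W : IsHol (Unk.W : CH ℂ k α) := by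
  have h := (isHol_const (k := k) (α := α) 1).add (isHol_zp (k := k) (α := α) 1).neg
  have h' : (Unk.W : CH ℂ k α) = const 1 + -zp (1 : ℕ) := by
    ext ζ
    simp only [Unk.W_apply, add_apply', neg_apply', const_apply, zp_apply, Nat.cast_one]
    ring
  exact h' ▸ h

/-- A function `q` such that `(1 - ζ) q` is real vanishes if its Fourier coefficients of
nonnegative order vanish. -/
theorem szego_eq_zero_iff_of_real {q : CH ℂ k α} {w : Circle → ℝ}
    (h : ∀ ζ : Circle, (1 - (ζ : ℂ)) * q ζ = w ζ) : szego q = 0 ↔ ∀ ζ, w ζ = 0 := by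
  have hfc := fc_one_sub_mul (w := fun ζ : Circle => (w ζ : ℂ)) q fun ζ => (h ζ).symm
  constructor
  · intro h0
    have h1 := szego_eq_zero_iff.1 h0
    have h2 : ∀ n : ℤ, 0 < n → fc (fun ζ : Circle => (w ζ : ℂ)) n = 0 := fun n hn => by
      obtain ⟨m, rfl⟩ : ∃ m : ℕ, n = m + 1 := ⟨(n - 1).toNat, by omega⟩
      rw [hfc, add_sub_cancel_right, h1 m]
      have := h1 (m + 1)
      push_cast at this
      rw [this, sub_zero]
    have h3 : ∀ n : ℤ, n ≠ 0 → fc (fun ζ : Circle => (w ζ : ℂ)) n = 0 := fun n hn => by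
      rcases lt_or_gt_of_ne hn with hn | hn
      · have h4 := fc_conj (fun ζ : Circle => (w ζ : ℂ)) n
        simp only [conj_ofReal] at h4
        rw [h4, h2 (-n) (by omega), map_zero]
      · exact h2 n hn
    -- Vanishing of the coefficients of positive order forces, by reality, vanishing of those of
    -- negative order. So (1-ζ)q is constant, and it is zero at ζ = 1.
    have h4 : mul Unk.W q = const (fc (fun ζ : Circle => (w ζ : ℂ)) 0) := by
      refine CH.ext_fc fun n => ?_
      have h5 : (mul Unk.W q).1 = fun ζ : Circle => (w ζ : ℂ) := by
        funext ζ
        rw [← h ζ]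
        show (1 - (ζ : ℂ) ^ (1 : ℤ)) * q ζ = _
        rw [zpow_one]
      have h6 : (const (fc (fun ζ : Circle => (w ζ : ℂ)) 0) : CH ℂ k α).1 =
          fun ζ : Circle => fc (fun ζ : Circle => (w ζ : ℂ)) 0 * (ζ : ℂ) ^ (0 : ℤ) := by
        funext ζ
        rw [zpow_zero, mul_one]; rfl
      rw [h5, h6, fc_const_mul, fc_zpow]
      split_ifs with hn
      · rw [hn, mul_one]
      · rw [h3 n hn, mul_zero]
    have h7 : ∀ ζ, (w ζ : ℂ) = fc (fun ζ : Circle => (w ζ : ℂ)) 0 := fun ζ => by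
      have := congrArg (fun q : CH ℂ k α => q ζ) h4
      simp only [mul_apply, Unk.W_apply, zpow_one, const_apply] at this
      rw [← h ζ, this]
    have h8 : fc (fun ζ : Circle => (w ζ : ℂ)) 0 = 0 := by
      rw [← h7 1, ← h 1]
      simp
    intro ζ
    have := h7 ζ
    rw [h8] at this
    exact_mod_cast this
  · intro h0
    have h00 : IsHol (0 : CH ℂ k α) := by
      have := isHol_bd (0 : A k α)
      rwa [map_zero] at this
    have h1 : IsHol q := isHol_of_one_sub_mul h00 fun ζ => by
      rw [h ζ, h0 ζ, ofReal_zero]; rfl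
    have h2 : ∀ n : ℕ, fc q.1 n = fc q.1 (n - 1) := fun n => by
      have h3 := hfc n
      have h4 : (fun ζ : Circle => (w ζ : ℂ)) = fun ζ : Circle => 0 * (ζ : ℂ) ^ (0 : ℤ) := by
        funext ζ; rw [h0 ζ]; simp
      rw [h4, fc_const_mul, zero_mul] at h3
      exact (sub_eq_zero.1 h3.symm)
    refine szego_eq_zero_iff.2 fun n => ?_
    induction n with
    | zero => rw [h2]; exact h1 _ (by norm_num)
    | succ n ih => rw [h2]; push_cast; rw [add_sub_cancel_right]; exact ih

end Identities

end KStat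

end

set_option linter.unusedSectionVars false

noncomputable section

namespace KStat

open Filter Topology ComplexConjugate CH

/-! ### Lifts in terms of the unknowns, and the parametrization of the densities -/

section Lifts

variable {k : ℕ} {α : ℝ} [HolderExponent α] {d : ℕ}

namespace Unk

/-- The point of `Y` given by the unknowns. -/
def toY (k₀ : ℕ) (x : Unk k α) : Y k α := ((ofCH (dens k₀ x)).1, x.2.2.1, x.2.2.2)

theorem conj_dens (k₀ : ℕ) (x : Unk k α) (ζ : Circle) : conj (dens k₀ x ζ) = dens k₀ x ζ := by
  rw [dens_apply, Lb_apply, Lp_apply]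
  simp only [map_add, map_pow, map_one, conj_conj]
  ring

theorem toY_fst_apply (k₀ : ℕ) (x : Unk k α) (ζ : Circle) :
    (((toY k₀ x).1 ζ : ℝ) : ℂ) = dens k₀ x ζ := conj_eq_iff_re.1 (conj_dens k₀ x ζ)

theorem continuous_toY (k₀ : ℕ) : Continuous (toY k₀ : Unk k α → Y k α) := by
  have h1 : Continuous fun x : Unk k α => (ofCH (dens k₀ x)).1 :=
    continuous_fst.comp (ofCH.continuous.comp (Coef.contDiff_dens k₀).continuous)
  exact h1.prodMk (continuous_snd.comp continuous_snd)

variable {D : Coef d k} {k₀ : ℕ} {a : ℕ → ℂ} {δ δ' : ℝ} {r : ℂ × ℂ → ℝ} {x : Unk k α}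

/-- The lifts of stationary discs are the solutions of the equations. -/
theorem toY_mem_stationaryLifts_iff (hd : k₀ < d) (hr : IsDeformed D k₀ a δ' r) (hδ : δ' ≤ δ)
    (hx : ∀ ζ : Circle, (toY k₀ x).1 ζ ≠ 0 ∧ ‖discBd x.2.2.1 ζ‖ < δ' ∧ ‖discBd x.2.2.2 ζ‖ < δ') :
    toY k₀ x ∈ stationaryLifts k α k₀ δ r ↔
      szego (D.eq₁ k₀ a x) = 0 ∧ negPart (D.eq₂ k₀ x) = 0 ∧ negPart (D.eq₃ k₀ a x) = 0 := by
  have e1 : szego (D.eq₁ k₀ a x) = 0 ↔ ∀ ζ : Circle, r (discBd x.2.2.1 ζ, discBd x.2.2.2 ζ) = 0 :=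
    szego_eq_zero_iff_of_real fun ζ => Coef.one_sub_mul_eq₁ ζ hd hr (hx ζ).2.1 (hx ζ).2.2
  have e2 : negPart (D.eq₂ k₀ x) = 0 ↔ ∃ u : A k α, ∀ ζ : Circle, bdVal u ζ =
      (ζ : ℂ) ^ k₀ * ((toY k₀ x).1 ζ : ℂ) *
        dz (fun w => (r (discBd x.2.2.1 ζ, w) : ℂ)) (discBd x.2.2.2 ζ) := by
    refine negPart_eq_zero_iff.trans (isHol_iff_exists.trans (exists_congr fun u => ?_))
    refine ⟨fun h ζ => ?_, fun h => CH.ext fun ζ => ?_⟩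
    · rw [toY_fst_apply, ← Coef.eq₂_apply ζ hd hr (hx ζ).2.1 (hx ζ).2.2, ← h]; rfl
    · rw [Coef.eq₂_apply ζ hd hr (hx ζ).2.1 (hx ζ).2.2, ← toY_fst_apply]; exact h ζ
  have e3 : negPart (D.eq₃ k₀ a x) = 0 ↔ ∃ u : A k α, ∀ ζ : Circle, bdVal u ζ =
      (ζ : ℂ) ^ k₀ * ((toY k₀ x).1 ζ : ℂ) *
        dz (fun z => (r (z, discBd x.2.2.2 ζ) : ℂ)) (discBd x.2.2.1 ζ) := by
    -- Multiplication by (1-ζ)^(d-1) obviously preserves holomorphy; for the converse, division by 1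
    -- - ζ does too when the quotient is known to be of class C^{k,α}.
    refine negPart_eq_zero_iff.trans ⟨fun h => ?_, ?_⟩
    · obtain ⟨u, hu⟩ := isHol_iff_exists.1 ((isHol_pw isHol_W (d - 1)).mul h)
      refine ⟨u, fun ζ => ?_⟩
      have h1 := congrArg (fun q : CH ℂ k α => q ζ) hu
      simp only [mul_apply, pw_apply, W_apply, zpow_one, bd_apply] at h1
      rw [h1, Coef.one_sub_pow_mul_eq₃ ζ hd hr (hx ζ).2.1 (hx ζ).2.2, toY_fst_apply]
    · rintro ⟨u, hu⟩
      refine isHol_of_one_sub_pow_mul (n := d - 1) (isHol_bd u) fun ζ => ?_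
      rw [Coef.one_sub_pow_mul_eq₃ ζ hd hr (hx ζ).2.1 (hx ζ).2.2, ← toY_fst_apply]
      exact hu ζ
  rw [e1, e2, e3]
  constructor
  · rintro ⟨-, h1, h3, h2⟩
    exact ⟨fun ζ => (h1 ζ).2.2, h2, h3⟩
  · rintro ⟨h1, h2, h3⟩
    exact ⟨fun ζ => (hx ζ).1, fun ζ => ⟨(hx ζ).2.1.trans_le hδ, (hx ζ).2.2.trans_le hδ, h1 ζ⟩, h3, h2⟩

end Unk

/-! ## The normalization of the densities -/

theorem circleCoeff_eq_fc (u : Circle → ℂ) (n : ℕ) : circleCoeff u n = fc u n := by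
  rw [circleCoeff, fc]
  congr 1
  · push_cast
    rw [one_div]
  · congr 1
    funext t
    rw [zpow_neg, zpow_natCast, Circle.coe_exp, ← Complex.exp_nat_mul, ← Complex.exp_neg]
    congr 2
    ring

/-- The function `b̄ ζ̄ + 1 + b ζ`. -/
def gamBase (b : ℂ) : CH ℂ k α := const 1 + Unk.Lb ((b, 0, 0, 0) : Unk k α)

theorem gamBase_apply (b : ℂ) (ζ : Circle) :
    (gamBase b : CH ℂ k α) ζ = conj b * conj (ζ : ℂ) + 1 + b * (ζ : ℂ) := by
  have : (gamBase b : CH ℂ k α) ζ = 1 + (conj ((ζ : ℂ) ^ (1 : ℤ) * b) + (ζ : ℂ) ^ (1 : ℤ) * b) := rfl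
  rw [this, zpow_one, map_mul]
  ring

theorem conj_gamBase (b : ℂ) (ζ : Circle) :
    conj ((gamBase b : CH ℂ k α) ζ) = (gamBase b : CH ℂ k α) ζ := by
  rw [gamBase_apply]
  simp only [map_add, map_mul, conj_conj, map_one]
  ring

theorem dens_eq_pw_gamBase (k₀ : ℕ) (x : Unk k α) :
    Unk.dens k₀ x = pw (gamBase x.1) k₀ + Unk.Lp k₀ x := rfl

theorem fc_neg_of_real {q : Circle → ℂ} (h : ∀ ζ, conj (q ζ) = q ζ) (n : ℤ) :
    fc q (-n) = conj (fc q n) := by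
  have h1 := fc_conj q (-n)
  simp only [h, neg_neg] at h1
  exact h1

theorem fc_gamBase_mul (b : ℂ) (q : CH ℂ k α) (n : ℤ) :
    fc (mul q (gamBase b)).1 n = conj b * fc q.1 (n + 1) + fc q.1 n + b * fc q.1 (n - 1) := by
  have h1 : mul q (gamBase b) = mul (const (conj b)) (mul (zp (-1)) q) + q +
      mul (const b) (mul (zp 1) q) := by
    ext ζ
    simp only [add_apply', mul_apply, const_apply, zp_apply, gamBase_apply, Circle.conj_eq_inv,
      zpow_one, zpow_neg_one]
    ring
  have h2 := map_add (fcL (k := k) (α := α) n) (mul (const (conj b)) (mul (zp (-1)) q) + q)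
    (mul (const b) (mul (zp 1) q))
  rw [← h1, map_add] at h2
  have h3 : ∀ (c : ℂ) (m : ℤ), fcL n (mul (const c) (mul (zp m) q)) = c * fc q.1 (n - m) := fun c m =>
    (fc_const_mul c (fun ζ : Circle => (ζ : ℂ) ^ m * q ζ) n).trans (by rw [fc_zpow_mul])
  rw [h3, h3, sub_neg_eq_add] at h2
  exact h2

/-- The coefficients are b^m times nonnegative reals, since b̄b = |b|² in the three-term recurrence;
at m = 0 the orders 1 and -1 contribute equally, whence the factor 2. The bound s₁ ≥ 1 is what
allows |b| to be controlled by the first Fourier coefficient. -/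
theorem fc_pw_gamBase (b : ℂ) (n : ℕ) : ∃ s : ℕ → ℝ, (∀ m, 0 ≤ s m) ∧ 1 ≤ s 0 ∧ (1 ≤ n → 1 ≤ s 1) ∧
    ∀ m : ℕ, fc (pw (gamBase b : CH ℂ k α) n).1 m = b ^ m * s m := by
  induction n with
  | zero =>
    refine ⟨fun m => if m = 0 then 1 else 0, fun m => by dsimp only; split_ifs <;> norm_num,
      by norm_num, by norm_num, fun m => ?_⟩
    have h1 : (pw (gamBase b : CH ℂ k α) 0).1 = fun ζ : Circle => (ζ : ℂ) ^ (0 : ℤ) := by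
      funext ζ
      rw [zpow_zero]; rfl
    rw [h1, fc_zpow]
    rcases Nat.eq_zero_or_pos m with h | h
    · simp [h]
    · simp [h.ne']
  | succ n ih =>
    obtain ⟨s, hs0, hs1, hs2, hs⟩ := ih
    have hb : (0 : ℝ) ≤ ‖b‖ ^ 2 := by positivity
    refine ⟨fun m => if m = 0 then s 0 + 2 * (‖b‖ ^ 2 * s 1) else ‖b‖ ^ 2 * s (m + 1) + s m + s (m - 1),
      fun m => ?_, ?_, fun _ => ?_, fun m => ?_⟩
    · dsimp only
      split_ifs
      · have := mul_nonneg hb (hs0 1); linarith [hs0 0]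
      · have := mul_nonneg hb (hs0 (m + 1)); linarith [hs0 m, hs0 (m - 1)]
    · dsimp only
      rw [if_pos rfl]
      have := mul_nonneg hb (hs0 1); linarith
    · dsimp only
      rw [if_neg one_ne_zero]
      have := mul_nonneg hb (hs0 (1 + 1)); linarith [hs0 1]
    · have hbb : conj b * b = ((‖b‖ ^ 2 : ℝ) : ℂ) := by
        rw [mul_comm, mul_conj, normSq_eq_norm_sq]
      have h1 := fc_gamBase_mul b (pw (gamBase b : CH ℂ k α) n) m
      rw [show pw (gamBase b : CH ℂ k α) (n + 1) = mul (pw (gamBase b) n) (gamBase b) from rfl, h1]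
      have h2 := hs (m + 1)
      push_cast at h2
      rw [h2, hs m]
      dsimp only
      rcases Nat.eq_zero_or_pos m with rfl | hm
      · have hreal : ∀ ζ, conj ((pw (gamBase b : CH ℂ k α) n).1 ζ) = (pw (gamBase b : CH ℂ k α) n).1 ζ := by
          intro ζ
          have h3 : (pw (gamBase b : CH ℂ k α) n).1 ζ = (gamBase b : CH ℂ k α) ζ ^ n := pw_apply _ _ _
          rw [h3, map_pow, conj_gamBase]
        have h4 := fc_neg_of_real hreal 1
        have h5 := hs 1
        push_cast at h5
        rw [h5] at h4
        simp only [map_mul, conj_ofReal, pow_one] at h4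
        rw [show ((0 : ℕ) : ℤ) - 1 = -1 by norm_num, h4, if_pos rfl]
        push_cast at hbb ⊢
        linear_combination (2 * (s 1 : ℂ)) * hbb
      · obtain ⟨m, rfl⟩ : ∃ l, m = l + 1 := ⟨m - 1, by omega⟩
        rw [if_neg (Nat.succ_ne_zero m)]
        have h3 := hs m
        rw [show ((m + 1 : ℕ) : ℤ) - 1 = m by push_cast; ring, h3, Nat.add_sub_cancel]
        push_cast at hbb ⊢
        linear_combination (b ^ (m + 1) * (s (m + 1 + 1) : ℂ)) * hbb

theorem norm_le_norm_fc_pw_gamBase (b : ℂ) {n : ℕ} (hn : 1 ≤ n) :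
    ‖b‖ ≤ ‖fc (pw (gamBase b : CH ℂ k α) n).1 1‖ := by
  obtain ⟨s, -, -, hs1, hs⟩ := fc_pw_gamBase (k := k) (α := α) b n
  have := hs 1
  push_cast at this
  rw [this, pow_one, norm_mul, norm_real, Real.norm_eq_abs]
  exact le_mul_of_one_le_right (norm_nonneg b) ((hs1 hn).trans (le_abs_self _))

theorem fc_Lp (k₀ : ℕ) (x : Unk k α) (n : ℤ) : fc (Unk.Lp k₀ x).1 n =
    fc (bd x.2.1).1 (n - (k₀ + 1)) + conj (fc (bd x.2.1).1 (-n - (k₀ + 1))) := by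
  have h1 : (Unk.Lp k₀ x).1 = fun ζ : Circle => (ζ : ℂ) ^ ((k₀ + 1 : ℕ) : ℤ) * bd x.2.1 ζ +
      conj ((ζ : ℂ) ^ ((k₀ + 1 : ℕ) : ℤ) * bd x.2.1 ζ) := rfl
  rw [h1, fc_add (p := fun ζ : Circle => (ζ : ℂ) ^ ((k₀ + 1 : ℕ) : ℤ) * bd x.2.1 ζ)
    (q := fun ζ : Circle => conj ((ζ : ℂ) ^ ((k₀ + 1 : ℕ) : ℤ) * bd x.2.1 ζ))
    (mul (zp (k₀ + 1 : ℕ)) (bd x.2.1)).continuous (cj (mul (zp (k₀ + 1 : ℕ)) (bd x.2.1))).continuous,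
    fc_zpow_mul, fc_conj, fc_zpow_mul]
  push_cast
  rfl

/-- The first Fourier coefficients of the density are those of `(b̄ ζ̄ + 1 + b ζ)^{k₀}`. -/
theorem coeffVec_dens (k₀ : ℕ) (x : Unk k α) : coeffVec k₀ (fun ζ => Unk.dens k₀ x ζ) =
    coeffVec k₀ fun ζ => (conj x.1 * conj (ζ : ℂ) + 1 + x.1 * (ζ : ℂ)) ^ k₀ := by
  funext n
  have h1 : (fun ζ : Circle => (conj x.1 * conj (ζ : ℂ) + 1 + x.1 * (ζ : ℂ)) ^ k₀) =
      (pw (gamBase x.1 : CH ℂ k α) k₀).1 := by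
    funext ζ
    rw [← gamBase_apply (k := k) (α := α)]
    exact (pw_apply _ _ _).symm
  rw [h1]
  simp only [coeffVec, circleCoeff_eq_fc]
  have h2 := map_add (fcL (k := k) (α := α) (n : ℕ)) (pw (gamBase x.1) k₀) (Unk.Lp k₀ x)
  rw [← dens_eq_pw_gamBase, fcL_apply, fcL_apply, fcL_apply, fc_Lp] at h2
  rw [isHol_bd x.2.1 _ (by omega), isHol_bd x.2.1 _ (by omega), map_zero, add_zero, add_zero] at h2
  exact h2

/-- The component `p` of the unknowns, in terms of `b` and the density. -/
def densPart (k₀ : ℕ) (c : Hol k α) (b : ℂ) : A k α :=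
  szego (mul (zp (-(k₀ + 1) : ℤ)) (toCH (c, 0) - pw (gamBase b) k₀))

theorem toCH_real_apply (c : Hol k α) (ζ : Circle) : toCH (c, (0 : Hol k α)) ζ = (c ζ : ℂ) := by
  have h0 : (0 : Hol k α) ζ = 0 := rfl
  rw [toCH_apply, toComplex, h0]
  simp

/-- The difference c - (b̄ζ̄ + 1 + bζ)^k₀ is real and its coefficients of order |n| ≤ k₀ vanish, so
it equals 2 Re(ζ^(k₀+1)p) with p = `densPart k₀ c b`. The bound on |b| ensures that a density close
to 1 has a small b. -/
theorem exists_of_coeffVec_mem_Gam {k₀ : ℕ} (hk₀ : 1 ≤ k₀) {c : Hol k α}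
    (hc : coeffVec k₀ (fun ζ => (c ζ : ℂ)) ∈ Gam k₀) : ∃ b : ℂ, ‖b‖ < 1 / 2 ∧
      ‖b‖ ≤ ‖fc (fun ζ => (c ζ : ℂ)) 1‖ ∧
      ∀ u v : A k α, Unk.toY k₀ (b, densPart k₀ c b, u, v) = (c, u, v) := by
  obtain ⟨b, hb, hcb⟩ := hc
  have hpw : (fun ζ : Circle => (conj b * conj (ζ : ℂ) + 1 + b * (ζ : ℂ)) ^ k₀) =
      (pw (gamBase b : CH ℂ k α) k₀).1 := by
    funext ζ
    rw [← gamBase_apply (k := k) (α := α)]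
    exact (pw_apply _ _ _).symm
  have hcc : (fun ζ => (c ζ : ℂ)) = (toCH (c, (0 : Hol k α))).1 := by
    funext ζ
    exact (toCH_real_apply c ζ).symm
  rw [hpw, hcc] at hcb
  have hfc : ∀ n : ℕ, n ≤ k₀ → fc (toCH (c, (0 : Hol k α))).1 n = fc (pw (gamBase b : CH ℂ k α) k₀).1 n := by
    intro n hn
    have := congrFun hcb ⟨n, by omega⟩
    simpa only [coeffVec, circleCoeff_eq_fc] using this
  refine ⟨b, hb, ?_, fun u v => ?_⟩
  · rw [hcc]
    have := hfc 1 hk₀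
    push_cast at this
    rw [this]
    exact norm_le_norm_fc_pw_gamBase b hk₀
  · set q : CH ℂ k α := toCH (c, 0) - pw (gamBase b) k₀ with hq
    have hqreal : ∀ ζ, conj (q.1 ζ) = q.1 ζ := fun ζ => by
      have h1 : q.1 ζ = (c ζ : ℂ) - (gamBase b : CH ℂ k α) ζ ^ k₀ := by
        rw [← pw_apply, ← toCH_real_apply]; rfl
      rw [h1, map_sub, map_pow, conj_gamBase, conj_ofReal]
    have hq0 : ∀ n : ℤ, n.natAbs ≤ k₀ → fc q.1 n = 0 := by
      have h1 : ∀ n : ℕ, n ≤ k₀ → fc q.1 n = 0 := fun n hn => by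
        have := map_sub (fcL (k := k) (α := α) n) (toCH (c, 0)) (pw (gamBase b) k₀)
        rw [fcL_apply, fcL_apply, fcL_apply, hfc n hn, sub_self] at this
        exact this
      intro n hn
      rcases Int.natAbs_eq n with h | h
      · rw [h]; exact h1 _ hn
      · rw [h, fc_neg_of_real hqreal, h1 _ hn, map_zero]
    have hp : ∀ n : ℤ, fc (bd (densPart k₀ c b)).1 n = if 0 ≤ n then fc q.1 (n + (k₀ + 1)) else 0 := by
      intro n
      split_ifs with hn
      · obtain ⟨m, rfl⟩ : ∃ m : ℕ, n = m := ⟨n.toNat, by omega⟩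
        refine (fc_szego _ m).trans ?_
        refine (fc_zpow_mul (-(k₀ + 1) : ℤ) q.1 m).trans ?_
        rw [sub_neg_eq_add]
      · exact isHol_bd _ n (by omega)
    have hLp : Unk.Lp k₀ (b, densPart k₀ c b, u, v) = q := by
      refine CH.ext_fc fun n => ?_
      rw [fc_Lp, hp, hp]
      by_cases h0 : n.natAbs ≤ k₀
      · rw [if_neg (by omega), if_neg (by omega), map_zero, add_zero, hq0 n h0]
      · rcases le_or_gt 0 n with hn | hn
        · rw [if_pos (by omega), if_neg (by omega), map_zero, add_zero, sub_add_cancel]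
        · rw [if_neg (by omega), if_pos (by omega), zero_add, sub_add_cancel,
            fc_neg_of_real hqreal, conj_conj]
    have hdens : Unk.dens k₀ (b, densPart k₀ c b, u, v) = toCH (c, (0 : Hol k α)) := by
      rw [dens_eq_pw_gamBase, hLp, hq, add_sub_cancel]
    refine Prod.ext (Subtype.ext (funext fun ζ => ?_)) rfl
    have h1 := Unk.toY_fst_apply k₀ (b, densPart k₀ c b, u, v) ζ
    rw [hdens, toCH_real_apply] at h1
    exact_mod_cast h1

end Lifts

end KStat

end

set_option linter.unusedSectionVars false

noncomputable section

namespace KStat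

open Filter Topology ComplexConjugate CH

/-! ## The sets of lifts as solution sets -/

section SolutionSets

variable {k : ℕ} {α : ℝ} [HolderExponent α] {d : ℕ}

theorem norm_A_le_cnorm (u : A k α) : ‖u‖ ≤ cnorm u :=
  max_le (le_add_of_nonneg_right (norm_nonneg u.1.2)) (le_add_of_nonneg_left (norm_nonneg u.1.1))

theorem norm_le_normY (p : Y k α) : ‖p‖ ≤ normY p := by
  have h1 := norm_A_le_cnorm p.2.1
  have h2 := norm_A_le_cnorm p.2.2
  have h3 := norm_nonneg p.1
  have h4 := norm_nonneg p.2.1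
  have h5 := norm_nonneg p.2.2
  refine max_le ?_ (max_le ?_ ?_) <;> rw [normY] <;> linarith

theorem continuous_cnorm : Continuous (cnorm : A k α → ℝ) :=
  ((continuous_fst.comp continuous_subtype_val).norm).add
    (continuous_snd.comp continuous_subtype_val).norm

theorem continuous_normY : Continuous (normY : Y k α → ℝ) :=
  (continuous_fst.norm.add (continuous_cnorm.comp (continuous_fst.comp continuous_snd))).add
    (continuous_cnorm.comp (continuous_snd.comp continuous_snd))

theorem exists_normY_lt {p₀ : Y k α} {s : Set (Y k α)} (hs : s ∈ 𝓝 p₀) :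
    ∃ η > 0, ∀ p, normY (p - p₀) < η → p ∈ s := by
  obtain ⟨η, hη, h⟩ := Metric.mem_nhds_iff.1 hs
  exact ⟨η, hη, fun p hp => h (by rw [mem_ball, dist_eq_norm]; exact (norm_le_normY _).trans_lt hp)⟩

/-- The unknowns of the base disc. -/
def basePt (g₀ : A k α) : Unk k α := (0, 0, A.const 1, g₀)

theorem toY_eq_of_base {x : Unk k α} (k₀ : ℕ) (hb : x.1 = 0) (hp : x.2.1 = 0) :
    Unk.toY k₀ x = (Hol.const 1, x.2.2.1, x.2.2.2) := by
  refine Prod.ext (Subtype.ext (funext fun ζ => ?_)) rfl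
  have h := Unk.toY_fst_apply k₀ x ζ
  rw [Unk.dens_base k₀ hb hp, const_apply] at h
  exact_mod_cast h

theorem toY_basePt (k₀ : ℕ) (g₀ : A k α) : Unk.toY k₀ (basePt g₀) = baseLift g₀ :=
  toY_eq_of_base k₀ rfl rfl

/-- The neighbourhood of the base point in the space of unknowns. -/
def nearSet (k₀ : ℕ) (g₀ : A k α) (κ η : ℝ) : Set (Unk k α) :=
  {x | x ∈ ball (basePt g₀) κ ∧ ‖x.1‖ < 1 / 2 ∧ normY (Unk.toY k₀ x - baseLift g₀) < η}

theorem isOpen_nearSet (k₀ : ℕ) (g₀ : A k α) (κ η : ℝ) : IsOpen (nearSet k₀ g₀ κ η) :=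
  isOpen_ball.inter ((isOpen_lt continuous_fst.norm continuous_const).inter
    (isOpen_lt (continuous_normY.comp ((Unk.continuous_toY k₀).sub continuous_const))
      continuous_const))

theorem basePt_mem_nearSet (k₀ : ℕ) (g₀ : A k α) {κ η : ℝ} (hκ : 0 < κ) (hη : 0 < η) :
    basePt g₀ ∈ nearSet k₀ g₀ κ η := by
  refine ⟨mem_ball_self hκ, by simp [basePt], ?_⟩
  rw [toY_basePt, sub_self]
  simpa [normY, cnorm] using hη

theorem bdVal_sub (u v : A k α) (ζ : Circle) : bdVal (u - v) ζ = bdVal u ζ - bdVal v ζ := by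
  rw [← bd_apply, map_sub]; rfl

theorem norm_discBd_sub_le (u v : A k α) (ζ : Circle) :
    ‖discBd u ζ - discBd v ζ‖ ≤ 2 * ‖bd (u - v)‖ := by
  rw [discBd, discBd, ← mul_sub, ← bdVal_sub, norm_mul]
  refine mul_le_mul ?_ ((bd (u - v)).norm_apply_le ζ) (norm_nonneg _) zero_le_two
  refine (norm_sub_le _ _).trans ?_
  rw [Circle.norm_coe, norm_one]
  norm_num

theorem continuous_discBd (u : A k α) : Continuous (discBd u) :=
  (continuous_const.sub continuous_subtype_val).mul (bd u).continuous

/-- The base disc lies in a smaller bidisc. -/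
theorem exists_radius {u v : A k α} {δ : ℝ} (h : ∀ ζ : Circle, ‖discBd u ζ‖ < δ ∧ ‖discBd v ζ‖ < δ) :
    ∃ δ', 0 < δ' ∧ δ' < δ ∧ ∀ ζ : Circle, ‖discBd u ζ‖ < δ' ∧ ‖discBd v ζ‖ < δ' := by
  obtain ⟨ζ₀, -, hζ₀⟩ := isCompact_univ.exists_isMaxOn Set.univ_nonempty
    ((continuous_discBd u).norm.max (continuous_discBd v).norm).continuousOn
  obtain ⟨δ', h1, h2⟩ := exists_between (max_lt (h ζ₀).1 (h ζ₀).2)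
  refine ⟨δ', (norm_nonneg _).trans_lt ((le_max_left _ _).trans_lt h1), h2, fun ζ => ?_⟩
  have h3 := (hζ₀ (Set.mem_univ ζ)).trans_lt h1
  exact max_lt_iff.1 h3

theorem continuous_densPart (k₀ : ℕ) :
    Continuous fun q : Y k α × ℂ => ((q.2, densPart k₀ q.1.1 q.2, q.1.2) : Unk k α) := by
  have h1 : ContDiff ℝ 1 fun q : Y k α × ℂ => (gamBase q.2 : CH ℂ k α) :=
    contDiff_const.add (Unk.Lb.contDiff.comp (contDiff_snd.prodMk contDiff_const))
  have h2 : Continuous fun q : Y k α × ℂ => (toCH (q.1.1, (0 : Hol k α)) : CH ℂ k α) :=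
    toCH.continuous.comp ((continuous_fst.comp continuous_fst).prodMk continuous_const)
  have h3 : Continuous fun q : Y k α × ℂ => densPart k₀ q.1.1 q.2 :=
    szego.continuous.comp ((mul (zp (-(k₀ + 1) : ℤ))).continuous.comp
      (h2.sub (contDiff_pw h1 k₀).continuous))
  exact continuous_snd.prodMk (h3.prodMk (continuous_snd.comp continuous_fst))

theorem densPart_base (k₀ : ℕ) : densPart k₀ (Hol.const 1 : Hol k α) 0 = 0 := by
  have h1 : toCH (Hol.const 1, (0 : Hol k α)) - pw (gamBase 0) k₀ = (0 : CH ℂ k α) := by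
    ext ζ
    rw [sub_apply', toCH_real_apply, pw_apply, gamBase_apply]
    have : (Hol.const 1 : Hol k α) ζ = 1 := rfl
    rw [this]
    simp
  rw [densPart, h1, map_zero, map_zero]

/-- The lifts close to the base lift give unknowns close to the base point. -/
theorem exists_radius_lifts (k₀ : ℕ) {g₀ : A k α} {δ' κ : ℝ} (hκ : 0 < κ)
    (hδ : ∀ ζ : Circle, ‖discBd (A.const 1 : A k α) ζ‖ < δ' ∧ ‖discBd g₀ ζ‖ < δ') :
    ∃ η₁ > 0, ∀ p : Y k α, normY (p - baseLift g₀) < η₁ →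
      (∀ ζ : Circle, p.1 ζ ≠ 0 ∧ ‖discBd p.2.1 ζ‖ < δ' ∧ ‖discBd p.2.2 ζ‖ < δ') ∧
      ∀ b : ℂ, ‖b‖ ≤ ‖fc (fun ζ => (p.1 ζ : ℂ)) 1‖ →
        (b, densPart k₀ p.1 b, p.2) ∈ ball (basePt g₀) κ := by
  refine exists_normY_lt (s := {p | _ ∧ _}) ?_
  refine Filter.inter_mem ?_ ?_
  · obtain ⟨δ₁, -, h1, h2⟩ := exists_radius hδ
    have e1 : ∀ᶠ p : Y k α in 𝓝 (baseLift g₀), ‖toCH (p.1 - Hol.const 1, (0 : Hol k α))‖ < 1 := by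
      have hc : Continuous fun p : Y k α => ‖toCH (p.1 - Hol.const 1, (0 : Hol k α))‖ :=
        (toCH.continuous.comp ((continuous_fst.sub continuous_const).prodMk continuous_const)).norm
      have h0 : ‖toCH ((baseLift g₀).1 - Hol.const 1, (0 : Hol k α))‖ = 0 := by
        have : (baseLift g₀).1 - Hol.const 1 = (0 : Hol k α) := sub_self _
        rw [this, ← Prod.zero_eq_mk, map_zero, norm_zero]
      exact (isOpen_lt hc continuous_const).mem_nhds (h0.trans_lt one_pos)
    have e2 : ∀ᶠ p : Y k α in 𝓝 (baseLift g₀), 2 * ‖bd (p.2.1 - A.const 1)‖ < δ' - δ₁ := by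
      have hc : Continuous fun p : Y k α => 2 * ‖bd (p.2.1 - A.const 1)‖ :=
        continuous_const.mul (bd.continuous.comp
          ((continuous_fst.comp continuous_snd).sub continuous_const)).norm
      have h0 : 2 * ‖bd ((baseLift g₀).2.1 - A.const 1)‖ = 0 := by
        have : (baseLift g₀).2.1 - A.const 1 = (0 : A k α) := sub_self _
        rw [this, map_zero, norm_zero, mul_zero]
      exact (isOpen_lt hc continuous_const).mem_nhds (h0.trans_lt (sub_pos.2 h1))
    have e3 : ∀ᶠ p : Y k α in 𝓝 (baseLift g₀), 2 * ‖bd (p.2.2 - g₀)‖ < δ' - δ₁ := by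
      have hc : Continuous fun p : Y k α => 2 * ‖bd (p.2.2 - g₀)‖ :=
        continuous_const.mul (bd.continuous.comp
          ((continuous_snd.comp continuous_snd).sub continuous_const)).norm
      have h0 : 2 * ‖bd ((baseLift g₀).2.2 - g₀)‖ = 0 := by
        have : (baseLift g₀).2.2 - g₀ = (0 : A k α) := sub_self _
        rw [this, map_zero, norm_zero, mul_zero]
      exact (isOpen_lt hc continuous_const).mem_nhds (h0.trans_lt (sub_pos.2 h1))
    filter_upwards [e1, e2, e3] with p hp1 hp2 hp3 ζ
    refine ⟨fun h0 => ?_, ?_, ?_⟩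
    · have h3 := (toCH (p.1 - Hol.const 1, (0 : Hol k α))).norm_apply_le ζ
      rw [toCH_real_apply] at h3
      have h4 : (p.1 - Hol.const 1 : Hol k α) ζ = p.1 ζ - 1 := rfl
      rw [h4, h0] at h3
      norm_num at h3
      linarith
    · have h3 := norm_discBd_sub_le p.2.1 (A.const 1) ζ
      have h4 := norm_sub_norm_le (discBd p.2.1 ζ) (discBd (A.const 1 : A k α) ζ)
      have h5 := (h2 ζ).1
      linarith
    · have h3 := norm_discBd_sub_le p.2.2 g₀ ζ
      have h4 := norm_sub_norm_le (discBd p.2.2 ζ) (discBd g₀ ζ)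
      have h5 := (h2 ζ).2
      linarith
  -- The unknowns depend continuously on the lift and on b jointly, and b is small because the first
  -- Fourier coefficient of c is: it vanishes for c = 1.
  · have h1 := (continuous_densPart (k := k) (α := α) k₀).tendsto (baseLift g₀, 0)
    have h2 : ((0 : ℂ), densPart k₀ (baseLift g₀).1 0, (baseLift g₀).2) = basePt g₀ := by
      rw [show (baseLift g₀).1 = Hol.const 1 from rfl, densPart_base]; rfl
    dsimp only at h1
    rw [h2, nhds_prod_eq] at h1
    obtain ⟨pa, ha, pb, hb, hab⟩ := eventually_prod_iff.1 (h1.eventually (ball_mem_nhds _ hκ))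
    obtain ⟨s, hs, hsb⟩ := Metric.eventually_nhds_iff.1 hb
    have e1 : ∀ᶠ p : Y k α in 𝓝 (baseLift g₀), ‖fc (fun ζ => (p.1 ζ : ℂ)) 1‖ < s := by
      have hc : Continuous fun p : Y k α => ‖fcL 1 (toCH (p.1, (0 : Hol k α)))‖ :=
        ((fcL 1).continuous.comp (toCH.continuous.comp (continuous_fst.prodMk continuous_const))).norm
      have hcc : ∀ c : Hol k α, fcL 1 (toCH (c, (0 : Hol k α))) = fc (fun ζ => (c ζ : ℂ)) 1 := fun c => by
        rw [fcL_apply]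
        congr 1
        funext ζ
        exact toCH_real_apply c ζ
      simp only [hcc] at hc
      have h0 : fc (fun ζ => (((baseLift g₀).1 ζ : ℝ) : ℂ)) 1 = 0 := by
        have : (fun ζ => (((baseLift g₀).1 ζ : ℝ) : ℂ)) = fun ζ : Circle => (ζ : ℂ) ^ (0 : ℤ) := by
          funext ζ
          rw [show (baseLift g₀).1 ζ = 1 from rfl]; simp
        rw [this, fc_zpow, if_neg one_ne_zero]
      exact (isOpen_lt hc continuous_const).mem_nhds
        ((congrArg norm h0).trans_lt (norm_zero.trans_lt hs))
    filter_upwards [ha, e1] with p hp1 hp2 b hb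
    exact hab hp1 (hsb (by rw [dist_zero_right]; exact hb.trans_lt hp2))

/-- The parameters, as values of the equations. -/
def paramMap {n m : ℕ} (L : (Fin m → ℝ) ≃L[ℝ] (Fin n → ℂ)) :
    (Fin m → ℝ) →L[ℝ] A k α × A k α × A k α × (Fin n → ℂ) :=
  (ContinuousLinearMap.inr ℝ (A k α) (A k α × A k α × (Fin n → ℂ))).comp
    ((ContinuousLinearMap.inr ℝ (A k α) (A k α × (Fin n → ℂ))).comp
      ((ContinuousLinearMap.inr ℝ (A k α) (Fin n → ℂ)).comp L.toContinuousLinearMap))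

theorem paramMap_apply {n m : ℕ} (L : (Fin m → ℝ) ≃L[ℝ] (Fin n → ℂ)) (t : Fin m → ℝ) :
    paramMap (k := k) (α := α) L t = (0, 0, 0, L t) := rfl

variable {D : Coef d k} {k₀ : ℕ} {a : ℕ → ℂ} {δ δ' κ η₁ η : ℝ} {r : ℂ × ℂ → ℝ} {g₀ : A k α}
  {n m : ℕ} {J : A k α →L[ℝ] (Fin n → ℂ)} {L : (Fin m → ℝ) ≃L[ℝ] (Fin n → ℂ)}
  {e : OpenPartialHomeomorph (Unk k α) (A k α × A k α × A k α × (Fin n → ℂ))}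

theorem exists_eqs_eq_iff {x : Unk k α} : (∃ t, D.eqs k₀ a J x = paramMap L t) ↔
    szego (D.eq₁ k₀ a x) = 0 ∧ negPart (D.eq₂ k₀ x) = 0 ∧ negPart (D.eq₃ k₀ a x) = 0 := by
  constructor
  · rintro ⟨t, ht⟩
    rw [paramMap_apply, Coef.eqs, Prod.mk.injEq, Prod.mk.injEq, Prod.mk.injEq] at ht
    exact ⟨ht.1, ht.2.1, ht.2.2.1⟩
  · rintro ⟨h1, h2, h3⟩
    refine ⟨L.symm (J x.2.2.1), ?_⟩
    rw [paramMap_apply, Coef.eqs, h1, h2, h3, L.apply_symm_apply]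

/-- The lifts of stationary discs are the solutions of the equations. -/
theorem M_eq_image (hk₀ : 1 ≤ k₀) (hd : k₀ < d) (hr : IsDeformed D k₀ a δ' r) (hδ : δ' ≤ δ)
    (hη₁ : ∀ p : Y k α, normY (p - baseLift g₀) < η₁ →
      (∀ ζ : Circle, p.1 ζ ≠ 0 ∧ ‖discBd p.2.1 ζ‖ < δ' ∧ ‖discBd p.2.2 ζ‖ < δ') ∧
      ∀ b : ℂ, ‖b‖ ≤ ‖fc (fun ζ => (p.1 ζ : ℂ)) 1‖ →
        (b, densPart k₀ p.1 b, p.2) ∈ ball (basePt g₀) κ) (hη : η ≤ η₁)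
    (he : ∀ x, e x = D.eqs k₀ a J x) :
    M k₀ δ r (baseLift g₀) η =
      Unk.toY k₀ '' {x ∈ nearSet k₀ g₀ κ η | ∃ t, e x = paramMap L t} := by
  ext p
  constructor
  · rintro ⟨hp, hpη, hpΓ⟩
    obtain ⟨c, u, v⟩ := p
    obtain ⟨b, hb, hbc, hY⟩ := exists_of_coeffVec_mem_Gam hk₀ hpΓ
    obtain ⟨h1, h2⟩ := hη₁ _ (hpη.trans_le hη)
    refine ⟨(b, densPart k₀ c b, u, v), ⟨⟨h2 b hbc, hb, ?_⟩, ?_⟩, hY u v⟩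
    · rw [hY]; exact hpη
    · simp only [he]
      refine exists_eqs_eq_iff.2 ((Unk.toY_mem_stationaryLifts_iff hd hr hδ ?_).1 ?_)
      · rw [hY]; exact h1
      · rw [hY]; exact hp
  · rintro ⟨x, ⟨⟨hx1, hx2, hx3⟩, hx4⟩, rfl⟩
    simp only [he] at hx4
    obtain ⟨h1, -⟩ := hη₁ _ (hx3.trans_le hη)
    refine ⟨(Unk.toY_mem_stationaryLifts_iff hd hr hδ h1).2 (exists_eqs_eq_iff.1 hx4), hx3, x.1, hx2, ?_⟩
    simp only [Unk.toY_fst_apply]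
    exact coeffVec_dens k₀ x

theorem projH_image_M (hM : M k₀ δ r (baseLift g₀) η =
      Unk.toY k₀ '' {x ∈ nearSet k₀ g₀ κ η | ∃ t, e x = paramMap L t}) :
    projH '' M k₀ δ r (baseLift g₀) η = solSet e (paramMap L) (nearSet k₀ g₀ κ η) Unk.pu := by
  rw [hM, Set.image_image, solSet]
  rfl

end SolutionSets

end KStat

end

set_option linter.unusedSectionVars false

noncomputable section

namespace KStat

open Filter Topology ComplexConjugate

/-! ## Extension of the coefficients of a deformation by cutoff functions -/

section Cutoff

variable {E F : Type} [NormedAddCommGroup E] [NormedSpace ℝ E] [NormedAddCommGroup F]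
  [NormedSpace ℝ F]

theorem cmNorm_nonneg (m : ℕ) (K : Set E) (f : E → F) : 0 ≤ cmNorm m K f :=
  Finset.sum_nonneg fun _ _ => Real.iSup_nonneg fun _ => norm_nonneg _

theorem norm_iteratedFDerivWithin_le_cmNorm {m : ℕ} {K : Set E} (hK : IsCompact K)
    (hu : UniqueDiffOn ℝ K) {f : E → F} (hf : ContDiffOn ℝ m f K) {j : ℕ} (hj : j ≤ m) {x : E}
    (hx : x ∈ K) : ‖iteratedFDerivWithin ℝ j f K x‖ ≤ cmNorm m K f := by
  have h1 : BddAbove (Set.range fun x : K => ‖iteratedFDerivWithin ℝ j f K x‖) := by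
    have h2 := (hf.continuousOn_iteratedFDerivWithin (m := j) (by exact_mod_cast hj) hu).norm
    obtain ⟨B, hB⟩ := (hK.image_of_continuousOn h2).bddAbove
    refine ⟨B, ?_⟩
    rintro _ ⟨y, rfl⟩
    exact hB ⟨y, y.2, rfl⟩
  refine (le_ciSup h1 ⟨x, hx⟩).trans ?_
  exact Finset.single_le_sum
    (f := fun j => ⨆ x : K, ‖iteratedFDerivWithin ℝ j f K x‖)
    (fun _ _ => Real.iSup_nonneg fun _ => norm_nonneg _) (Finset.mem_range.2 (by omega))

/-- The Leibniz formula is used within K, where the cutoff is supported, and 2^m bounds the sum of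
the binomial coefficients. Outside the support all derivatives vanish. -/
theorem derivBound_cutoff {m : ℕ} {K : Set E} (hK : IsCompact K) (hu : UniqueDiffOn ℝ K)
    {χ : E → ℝ} (hχ : ContDiff ℝ m χ) (hs : tsupport χ ⊆ interior K) {f : E → F}
    (hf : ContDiffOn ℝ m f K) :
    DerivBound m Set.univ (fun x => χ x • f x) (2 ^ m * cmNorm m K χ * cmNorm m K f) := by
  have hzero : ∀ x ∉ tsupport χ, (fun x => χ x • f x) =ᶠ[𝓝 x] fun _ => 0 := fun x hx => by
    filter_upwards [notMem_tsupport_iff_eventuallyEq.1 hx] with y hy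
    rw [hy, Pi.zero_apply, zero_smul]
  constructor
  · refine contDiff_iff_contDiffAt.2 fun x => ?_
    by_cases hx : x ∈ tsupport χ
    · exact hχ.contDiffAt.smul (hf.contDiffAt (mem_interior_iff_mem_nhds.1 (hs hx)))
    · exact contDiffAt_const.congr_of_eventuallyEq (hzero x hx)
  · intro j hj x _
    have hB := cmNorm_nonneg m K χ
    have hN := cmNorm_nonneg m K f
    by_cases hx : x ∈ tsupport χ
    · have hxK : K ∈ 𝓝 x := mem_interior_iff_mem_nhds.1 (hs hx)
      have h1 : iteratedFDeriv ℝ j (fun x => χ x • f x) x =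
          iteratedFDerivWithin ℝ j (fun x => χ x • f x) K x := by
        rw [← iteratedFDerivWithin_univ]
        exact iteratedFDerivWithin_congr_set (eventuallyEq_univ.2 hxK).symm j
      rw [h1]
      refine (norm_iteratedFDerivWithin_smul_le hχ.contDiffOn hf hu (mem_of_mem_nhds hxK)
        (by exact_mod_cast hj)).trans ?_
      have h2 : ∀ i ∈ Finset.range (j + 1), (j.choose i : ℝ) * ‖iteratedFDerivWithin ℝ i χ K x‖ *
          ‖iteratedFDerivWithin ℝ (j - i) f K x‖ ≤ (j.choose i : ℝ) * (cmNorm m K χ * cmNorm m K f) := by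
        intro i hi
        rw [Finset.mem_range] at hi
        rw [mul_assoc]
        refine mul_le_mul_of_nonneg_left ?_ (Nat.cast_nonneg _)
        exact mul_le_mul (norm_iteratedFDerivWithin_le_cmNorm hK hu hχ.contDiffOn (by omega)
          (mem_of_mem_nhds hxK)) (norm_iteratedFDerivWithin_le_cmNorm hK hu hf (by omega)
          (mem_of_mem_nhds hxK)) (norm_nonneg _) hB
      refine (Finset.sum_le_sum h2).trans ?_
      rw [← Finset.sum_mul, mul_assoc]
      refine mul_le_mul_of_nonneg_right ?_ (mul_nonneg hB hN)
      have h3 := Nat.sum_range_choose j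
      calc (∑ i ∈ Finset.range (j + 1), (j.choose i : ℝ)) = 2 ^ j := by exact_mod_cast h3
        _ ≤ 2 ^ m := pow_le_pow_right₀ one_le_two hj
    · rw [((hzero x hx).iteratedFDeriv ℝ j).eq_of_nhds]
      have : iteratedFDeriv ℝ j (fun _ : E => (0 : F)) x = 0 := by
        rw [iteratedFDeriv_fun_zero]; rfl
      rw [this, norm_zero]
      positivity

theorem exists_cutoff (E : Type*) [NormedAddCommGroup E] [NormedSpace ℝ E] [FiniteDimensional ℝ E]
    {δ' δ : ℝ} (h0 : 0 < δ') (h : δ' < δ) : ∃ χ : E → ℝ, (∀ n : ℕ, ContDiff ℝ n χ) ∧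
      (∀ x, ‖x‖ < δ' → χ x = 1) ∧ tsupport χ ⊆ ball 0 δ := by
  obtain ⟨s, h1, h2⟩ := exists_between h
  let χ : ContDiffBump (0 : E) := ⟨δ', s, h0, h1⟩
  refine ⟨χ, fun n => χ.contDiff, fun x hx => χ.one_of_mem_closedBall (by simpa using hx.le), ?_⟩
  rw [χ.tsupport_eq]
  exact closedBall_subset_ball h2

theorem derivBound_comp_fst {E' : Type} [NormedAddCommGroup E'] [NormedSpace ℝ E'] {m : ℕ}
    {f : E → F} {ε : ℝ} (h : DerivBound m Set.univ f ε) :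
    DerivBound m Set.univ (fun p : E × E' => f p.1) ε := by
  refine ⟨h.1.comp contDiff_fst, fun j hj x _ => ?_⟩
  have h1 : (fun p : E × E' => f p.1) = f ∘ (ContinuousLinearMap.fst ℝ E E') := rfl
  rw [h1, ContinuousLinearMap.iteratedFDeriv_comp_right _ h.1 x (by exact_mod_cast hj)]
  refine (ContinuousMultilinearMap.norm_compContinuousLinearMap_le _ _).trans ?_
  refine (mul_le_of_le_one_right (norm_nonneg _) ?_).trans (h.2 j hj _ (Set.mem_univ _))
  exact Finset.prod_le_one (fun _ _ => norm_nonneg _) fun _ _ => ContinuousLinearMap.norm_fst_le ℝ E E'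

end Cutoff

section Deformations

variable {d k : ℕ} {δ : ℝ}

theorem thetaFun_eq_sum_terms (hd : 0 < d) (r₀ : ℕ → ℕ → ℂ → ℂ) (r : ℕ → ℕ → ℕ → ℂ × ℝ → ℂ)
    (θ₁ : ℝ → ℝ) (z : ℂ) (y : ℝ) : thetaFun d r₀ r θ₁ z y =
      ∑ m ∈ terms d, z ^ m.2.1 * conj z ^ m.2.2 * (y : ℂ) ^ m.1 *
        (if m.1 = 0 then r₀ m.2.1 m.2.2 z else r m.2.1 m.2.2 m.1 (z, y)) + (θ₁ y : ℂ) := by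
  rw [thetaFun, terms, Finset.sum_sigma, Finset.range_eq_Ico, Finset.sum_eq_sum_Ico_succ_bot hd]
  congr 2
  · rw [if_pos rfl]
    exact Finset.sum_congr rfl fun p _ => by simp
  · refine Finset.sum_congr (by
      ext l
      rw [Finset.mem_Icc, Finset.mem_Ico]
      omega) fun l hl => ?_
    rw [Finset.mem_Ico] at hl
    rw [if_neg (by omega)]
    exact Finset.sum_congr rfl fun p _ => by
      rw [if_neg (show ¬l = 0 by omega)]

namespace Deformation

theorem cmNorm_θ₁_le (D : Deformation d k δ) : cmNorm (k + 3) (Set.Icc (-δ) δ) D.θ₁ ≤ D.norm :=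
  le_add_of_nonneg_left (le_max_of_le_left (Real.iSup_nonneg fun _ => cmNorm_nonneg _ _ _))

theorem cmNorm_r₀_le (D : Deformation d k δ) {i j : ℕ} (h : i + j = d + 1) :
    cmNorm (k + 3) (closedBall 0 δ) (D.r₀ i j) ≤ D.norm := by
  refine le_add_of_le_of_nonneg (le_max_of_le_left ?_) (cmNorm_nonneg _ _ _)
  exact le_ciSup (f := fun p : Finset.HasAntidiagonal.antidiagonal (d + 1) =>
    cmNorm (k + 3) (closedBall 0 δ) (D.r₀ p.1.1 p.1.2)) (Set.finite_range _).bddAbove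
    ⟨(i, j), Finset.HasAntidiagonal.mem_antidiagonal.2 h⟩

theorem cmNorm_r_le (D : Deformation d k δ) {i j l : ℕ} (hl : 1 ≤ l) (hl' : l ≤ d - 1)
    (h : i + j = d - l) :
    cmNorm (k + 3) (closedBall 0 δ ×ˢ Set.Icc (-δ) δ) (D.r i j l) ≤ D.norm := by
  refine le_add_of_le_of_nonneg (le_max_of_le_right ?_) (cmNorm_nonneg _ _ _)
  refine le_trans ?_ (le_ciSup (f := fun l : Finset.Icc 1 (d - 1) =>
    ⨆ p : Finset.HasAntidiagonal.antidiagonal (d - l.1),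
      cmNorm (k + 3) (closedBall 0 δ ×ˢ Set.Icc (-δ) δ) (D.r p.1.1 p.1.2 l.1))
    (Set.finite_range _).bddAbove ⟨l, Finset.mem_Icc.2 ⟨hl, hl'⟩⟩)
  exact le_ciSup (f := fun p : Finset.HasAntidiagonal.antidiagonal (d - l) =>
    cmNorm (k + 3) (closedBall 0 δ ×ˢ Set.Icc (-δ) δ) (D.r p.1.1 p.1.2 l)) (Set.finite_range _).bddAbove
    ⟨(i, j), Finset.HasAntidiagonal.mem_antidiagonal.2 h⟩

theorem norm_nonneg (D : Deformation d k δ) : 0 ≤ D.norm :=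
  (cmNorm_nonneg _ _ _).trans D.cmNorm_θ₁_le

end Deformation

variable {k₀ : ℕ} {a : ℕ → ℂ}

/-- The coefficients of a deformation extend, after shrinking the bidisc, with bounds of the norm. -/
theorem exists_coef (ha : IsModel d k₀ a) {δ' : ℝ} (h0 : 0 < δ') (hδ : δ' < δ) :
    ∃ C : ℝ, 0 ≤ C ∧ ∀ D : Deformation d k δ, ∃ D' : Coef d k, D'.size = C * D.norm ∧
      IsDeformed D' k₀ a δ' (D.fn k₀ a) := by
  have hδ0 : 0 < δ := h0.trans hδ
  obtain ⟨χ₁, hχ₁, hχ₁1, hχ₁s⟩ := exists_cutoff ℂ h0 hδ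
  obtain ⟨χ₂, hχ₂, hχ₂1, hχ₂s⟩ := exists_cutoff (ℂ × ℝ) h0 hδ
  obtain ⟨χ₃, hχ₃, hχ₃1, hχ₃s⟩ := exists_cutoff ℝ h0 hδ
  have hK₁ : IsCompact (closedBall (0 : ℂ) δ) := isCompact_closedBall _ _
  have hK₃ : IsCompact (Set.Icc (-δ) δ) := isCompact_Icc
  have hu₁ : UniqueDiffOn ℝ (closedBall (0 : ℂ) δ) :=
    uniqueDiffOn_convex (convex_closedBall _ _) (by
      rw [interior_closedBall _ hδ0.ne']; exact nonempty_ball.2 hδ0)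
  have hu₃ : UniqueDiffOn ℝ (Set.Icc (-δ) δ) := uniqueDiffOn_Icc (by linarith)
  have hs₁ : tsupport χ₁ ⊆ interior (closedBall (0 : ℂ) δ) :=
    hχ₁s.trans ball_subset_interior_closedBall
  have hs₂ : tsupport χ₂ ⊆ interior (closedBall (0 : ℂ) δ ×ˢ Set.Icc (-δ) δ) := by
    refine hχ₂s.trans (interior_maximal (fun p hp => ?_) isOpen_ball)
    rw [mem_ball_zero_iff, Prod.norm_def, max_lt_iff, Real.norm_eq_abs, abs_lt] at hp
    exact ⟨mem_closedBall_zero_iff.2 hp.1.le, hp.2.1.le, hp.2.2.le⟩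
  have hs₃ : tsupport χ₃ ⊆ interior (Set.Icc (-δ) δ) := by
    refine hχ₃s.trans (interior_maximal (fun p hp => ?_) isOpen_ball)
    rw [mem_ball_zero_iff, Real.norm_eq_abs, abs_lt] at hp
    exact ⟨hp.1.le, hp.2.le⟩
  set C₁ := 2 ^ (k + 3) * cmNorm (k + 3) (closedBall (0 : ℂ) δ) χ₁ with hC₁
  set C₂ := 2 ^ (k + 3) * cmNorm (k + 3) (closedBall (0 : ℂ) δ ×ˢ Set.Icc (-δ) δ) χ₂ with hC₂
  set C₃ := 2 ^ (k + 3) * cmNorm (k + 3) (Set.Icc (-δ) δ) χ₃ with hC₃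
  have hC₁0 : 0 ≤ C₁ := mul_nonneg (by positivity) (cmNorm_nonneg _ _ _)
  have hC₂0 : 0 ≤ C₂ := mul_nonneg (by positivity) (cmNorm_nonneg _ _ _)
  have hC₃0 : 0 ≤ C₃ := mul_nonneg (by positivity) (cmNorm_nonneg _ _ _)
  refine ⟨C₁ + C₂ + C₃, by positivity, fun D => ?_⟩
  have hN := D.norm_nonneg
  -- `Coef` asks for bounds for every index, so the coefficients are set to zero outside `terms d`.
  let R : (Σ _ : ℕ, ℕ × ℕ) → ℂ × ℝ → ℂ := fun m p => if m ∈ terms d then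
    (if m.1 = 0 then χ₁ p.1 • D.r₀ m.2.1 m.2.2 p.1 else χ₂ p • D.r m.2.1 m.2.2 m.1 p) else 0
  have hR : ∀ m, DerivBound (k + 3) Set.univ (R m) ((C₁ + C₂ + C₃) * D.norm) := fun m => by
    by_cases hm : m ∈ terms d
    · have hm' := hm
      rw [terms, Finset.mem_sigma, Finset.mem_range, Finset.HasAntidiagonal.mem_antidiagonal] at hm'
      by_cases h : m.1 = 0
      · rw [if_pos h] at hm'
        have h1 : R m = fun p => χ₁ p.1 • D.r₀ m.2.1 m.2.2 p.1 := by
          funext p; simp only [R]; rw [if_pos hm, if_pos h]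
        rw [h1]
        have h2 := derivBound_comp_fst (E' := ℝ) (derivBound_cutoff hK₁ hu₁ (hχ₁ _) hs₁
          (D.contDiffOn_r₀ m.2.1 m.2.2 hm'.2))
        refine h2.mono le_rfl subset_rfl ?_
        have h3 := mul_le_mul_of_nonneg_left (D.cmNorm_r₀_le hm'.2) hC₁0
        nlinarith
      · rw [if_neg h] at hm'
        have h1 : R m = fun p => χ₂ p • D.r m.2.1 m.2.2 m.1 p := by
          funext p; simp only [R]; rw [if_pos hm, if_neg h]
        rw [h1]
        have h2 := derivBound_cutoff (hK₁.prod hK₃) (hu₁.prod hu₃) (hχ₂ _) hs₂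
          (D.contDiffOn_r m.2.1 m.2.2 m.1 (by omega) (by omega) hm'.2)
        refine h2.mono le_rfl subset_rfl ?_
        have h3 := mul_le_mul_of_nonneg_left
          (D.cmNorm_r_le (i := m.2.1) (j := m.2.2) (l := m.1) (by omega) (by omega) hm'.2) hC₂0
        nlinarith
    · have h1 : R m = fun _ => 0 := by
        funext p; simp only [R]; rw [if_neg hm]
      rw [h1]
      refine ⟨contDiff_const, fun j _ x _ => ?_⟩
      have : iteratedFDeriv ℝ j (fun _ : ℂ × ℝ => (0 : ℂ)) x = 0 := by
        rw [iteratedFDeriv_fun_zero]; rfl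
      rw [this, norm_zero]
      positivity
  have ht : DerivBound (k + 3) Set.univ (fun y => χ₃ y • D.θ₁ y) ((C₁ + C₂ + C₃) * D.norm) := by
    refine (derivBound_cutoff hK₃ hu₃ (hχ₃ _) hs₃ D.contDiffOn_θ₁).mono le_rfl subset_rfl ?_
    have h3 := mul_le_mul_of_nonneg_left D.cmNorm_θ₁_le hC₃0
    nlinarith
  -- From θ₁(y) = O(y²) only the value at 0 is retained; it makes t(y)/y smooth.
  have ht0 : χ₃ 0 • D.θ₁ 0 = 0 := by
    obtain ⟨B, hB⟩ := D.θ₁_isBigO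
    have h1 := hB 0 ⟨by linarith, hδ0.le⟩
    have h2 : D.θ₁ 0 = 0 := by
      rw [← abs_nonpos_iff]
      refine h1.trans (by simp)
    rw [h2, smul_zero]
  refine ⟨⟨R, fun y => χ₃ y • D.θ₁ y, _, hR, ht, ht0⟩, rfl, ⟨fun z w hz hw => ?_⟩⟩
  have hwi : |w.im| < δ' := (abs_im_le_norm w).trans_lt hw
  have hθ : Coef.theta (d := d) ⟨R, fun y => χ₃ y • D.θ₁ y, _, hR, ht, ht0⟩ z w.im =
      thetaFun d D.r₀ D.r D.θ₁ z w.im := by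
    rw [thetaFun_eq_sum_terms ha.d_pos]
    simp only [Coef.theta, R]
    rw [hχ₃1 _ hwi, one_smul]
    congr 1
    refine Finset.sum_congr rfl fun m hm => ?_
    rw [if_pos hm, hχ₁1 _ hz, hχ₂1 (z, w.im) (max_lt hz hwi), one_smul, one_smul]
  have him : (thetaFun d D.r₀ D.r D.θ₁ z w.im).im = 0 :=
    D.real z (mem_closedBall_zero_iff.2 (hz.le.trans hδ.le)) _
      ⟨by linarith [(abs_lt.1 hwi).1], by linarith [(abs_lt.1 hwi).2]⟩
  have h1 : ((modelPoly d k₀ a z).re : ℂ) = modelPoly d k₀ a z :=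
    Complex.ext (by simp) (by simp [ha.modelPoly_im z])
  have h2 : ((thetaFun d D.r₀ D.r D.θ₁ z w.im).re : ℂ) = thetaFun d D.r₀ D.r D.θ₁ z w.im :=
    Complex.ext (by simp) (by simp [him])
  rw [hθ, Deformation.fn, rho]
  push_cast
  rw [h1, h2]

theorem isDeformed_rho (ha : IsModel d k₀ a) (δ : ℝ) :
    IsDeformed (Coef.zero d k) k₀ a δ (rho d k₀ a) := by
  refine ⟨fun z w _ _ => ?_⟩
  have h1 : ((modelPoly d k₀ a z).re : ℂ) = modelPoly d k₀ a z :=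
    Complex.ext (by simp) (by simp [ha.modelPoly_im z])
  rw [rho]
  push_cast
  rw [h1]
  simp [Coef.theta, Coef.zero]

end Deformations

end KStat

end

set_option linter.unusedSectionVars false

noncomputable section

namespace KStat

open Filter Topology ComplexConjugate

/-! ## A trigonometric polynomial -/

section Trigonometric

variable {d k₀ : ℕ}

/-- The function `∑ x_j φ^j φ̄^{d-j}`. -/
def trig (d k₀ : ℕ) (x : ℕ → ℂ) (φ : ℂ) : ℂ :=
  ∑ j ∈ Finset.Icc (d - k₀) k₀, x j * φ ^ j * conj φ ^ (d - j)

open Polynomial in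
-- For |φ| = 1, multiplication by φ^(2k₀-d) turns both the trigonometric sum and its conjugate into
-- polynomials in φ² of degree at most 2k₀ - d. The top coefficient of their product involves only
-- the two extreme coefficients of the sum.
theorem exists_trigPoly (h1 : d ≤ 2 * k₀) (h2 : k₀ ≤ d) (x : ℕ → ℂ) :
    ∃ p : ℂ[X], p.coeff (2 * k₀ - d + (2 * k₀ - d)) = x k₀ * conj (x (d - k₀)) ∧
      ∀ φ : ℂ, ‖φ‖ = 1 → p.eval (φ ^ 2) = (φ ^ (2 * k₀ - d)) ^ 2 * (‖trig d k₀ x φ‖ ^ 2 : ℝ) := by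
  set p : ℂ[X] := ∑ j ∈ Finset.Icc (d - k₀) k₀, C (x j) * X ^ (j - (d - k₀)) with hp
  set q : ℂ[X] := ∑ j ∈ Finset.Icc (d - k₀) k₀, C (conj (x j)) * X ^ (k₀ - j) with hq
  have hpd : p.natDegree ≤ 2 * k₀ - d := natDegree_sum_le_of_forall_le _ _ fun j hj =>
    (natDegree_C_mul_X_pow_le _ _).trans (by rw [Finset.mem_Icc] at hj; omega)
  have hqd : q.natDegree ≤ 2 * k₀ - d := natDegree_sum_le_of_forall_le _ _ fun j hj =>
    (natDegree_C_mul_X_pow_le _ _).trans (by rw [Finset.mem_Icc] at hj; omega)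
  refine ⟨p * q, ?_, fun φ hφ => ?_⟩
  · rw [coeff_mul_add_eq_of_natDegree_le hpd hqd]
    congr 1
    · simp only [hp, finsetSum_coeff, coeff_C_mul_X_pow]
      rw [Finset.sum_eq_single k₀, if_pos (by omega)]
      · intro j hj hne
        rw [Finset.mem_Icc] at hj
        rw [if_neg (by omega)]
      · intro h
        exact absurd (Finset.mem_Icc.2 ⟨by omega, le_rfl⟩) h
    · simp only [hq, finsetSum_coeff, coeff_C_mul_X_pow]
      rw [Finset.sum_eq_single (d - k₀), if_pos (by omega)]
      · intro j hj hne
        rw [Finset.mem_Icc] at hj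
        rw [if_neg (by omega)]
      · intro h
        exact absurd (Finset.mem_Icc.2 ⟨le_rfl, by omega⟩) h
  · have hφφ : φ * conj φ = 1 := by
      rw [mul_conj, normSq_eq_norm_sq, hφ]; norm_num
    have hφn : ∀ n, φ ^ n * conj φ ^ n = 1 := fun n => by rw [← mul_pow, hφφ, one_pow]
    have e1 : p.eval (φ ^ 2) = φ ^ (2 * k₀ - d) * trig d k₀ x φ := by
      simp only [hp, trig, eval_finsetSum, eval_mul, eval_C, eval_pow, eval_X, Finset.mul_sum]
      refine Finset.sum_congr rfl fun j hj => ?_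
      rw [Finset.mem_Icc] at hj
      have h3 : φ ^ (2 * k₀ - d) * φ ^ j = (φ ^ 2) ^ (j - (d - k₀)) * φ ^ (d - j) := by
        rw [← pow_mul, ← pow_add, ← pow_add]; congr 1; omega
      linear_combination (-x j * conj φ ^ (d - j)) * h3 - x j * (φ ^ 2) ^ (j - (d - k₀)) * hφn (d - j)
    have e2 : q.eval (φ ^ 2) = φ ^ (2 * k₀ - d) * conj (trig d k₀ x φ) := by
      simp only [hq, trig, eval_finsetSum, eval_mul, eval_C, eval_pow, eval_X, Finset.mul_sum, map_sum,
        map_mul, map_pow, conj_conj]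
      refine Finset.sum_congr rfl fun j hj => ?_
      rw [Finset.mem_Icc] at hj
      have h3 : φ ^ (2 * k₀ - d) * φ ^ (d - j) = (φ ^ 2) ^ (k₀ - j) * φ ^ j := by
        rw [← pow_mul, ← pow_add, ← pow_add]; congr 1; omega
      linear_combination (-conj (x j) * conj φ ^ j) * h3 - conj (x j) * (φ ^ 2) ^ (k₀ - j) * hφn j
    rw [eval_mul, e1, e2]
    have h4 := mul_conj (trig d k₀ x φ)
    rw [normSq_eq_norm_sq] at h4
    linear_combination (φ ^ (2 * k₀ - d)) ^ 2 * h4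

/-- If the two moduli agreed for all small angles, a nonzero polynomial, the difference of the two
from `exists_trigPoly`, would vanish at infinitely many points e^{2iθ}. -/
theorem exists_norm_trig_ne (h1 : d ≤ 2 * k₀) (h2 : k₀ ≤ d) {x y : ℕ → ℂ}
    (h : x k₀ * conj (x (d - k₀)) ≠ y k₀ * conj (y (d - k₀))) {ε : ℝ} (hε : 0 < ε) :
    ∃ θ : ℝ, |θ| < ε ∧ ‖trig d k₀ x (exp (θ * I))‖ ≠ ‖trig d k₀ y (exp (θ * I))‖ := by
  obtain ⟨p, hp0, hp⟩ := exists_trigPoly h1 h2 x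
  obtain ⟨q, hq0, hq⟩ := exists_trigPoly h1 h2 y
  have hpq : p - q ≠ 0 := fun h0 => h <| by
    rw [← hp0, ← hq0, sub_eq_zero.1 h0]
  by_contra! hcon
  -- The period of e^{2iθ} is π, so angles in an interval of length at most 1 give distinct points.
  have hinj : Set.InjOn (fun θ : ℝ => exp (θ * I) ^ 2) (Set.Ioo 0 (min ε 1)) := by
    intro s hs t ht hst
    simp only [← Complex.exp_nat_mul] at hst
    obtain ⟨n, hn⟩ := Complex.exp_eq_exp_iff_exists_int.1 hst
    have h3 : s - t = n * Real.pi := by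
      have h4 : ((s - t : ℝ) : ℂ) * (2 * I) = ((n * Real.pi : ℝ) : ℂ) * (2 * I) := by
        push_cast at hn ⊢
        linear_combination hn
      exact_mod_cast mul_right_cancel₀ (mul_ne_zero two_ne_zero I_ne_zero) h4
    have hs1 := hs.2.trans_le (min_le_right _ _)
    have ht1 := ht.2.trans_le (min_le_right _ _)
    have hpi := Real.pi_gt_three
    have h5 : |s - t| < 1 := by rw [abs_lt]; constructor <;> linarith [hs.1, ht.1]
    have h6 : n = 0 := by
      by_contra hn0
      have : (1 : ℝ) ≤ |(n : ℝ)| := by exact_mod_cast Int.one_le_abs hn0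
      rw [h3, abs_mul, abs_of_pos Real.pi_pos] at h5
      nlinarith
    rw [h6, Int.cast_zero, zero_mul] at h3
    linarith
  refine (((Set.Ioo_infinite (lt_min hε one_pos)).image hinj).mono ?_) (p - q).roots.toFinset.finite_toSet
  rintro _ ⟨θ, hθ, rfl⟩
  have h3 : |θ| < ε := by rw [abs_of_pos hθ.1]; exact hθ.2.trans_le (min_le_left _ _)
  have hn := norm_exp_ofReal_mul_I θ
  rw [Finset.mem_coe, Multiset.mem_toFinset, Polynomial.mem_roots hpq, Polynomial.IsRoot.def,
    Polynomial.eval_sub, hp _ hn, hq _ hn, hcon θ h3, sub_self]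

/-- As k + q = m + 1, the right-hand side is C(m,k)C(m,q) by symmetry of the binomials. The
left-hand side is this product times (k-1)(q-1)/((k+1)(q+1)), a ratio less than 1. -/
theorem choose_mul_choose_lt {m q k : ℕ} (h : k + q = m + 1) (hq : 1 ≤ q) (hk : 1 ≤ k) :
    m.choose (q + 1) * m.choose (k + 1) < m.choose (q - 1) * m.choose (k - 1) := by
  rw [← Nat.choose_symm_of_eq_add (show m = k + (q - 1) by omega),
    ← Nat.choose_symm_of_eq_add (show m = q + (k - 1) by omega)]
  have h1 := Nat.choose_succ_right_eq m q
  have h2 := Nat.choose_succ_right_eq m k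
  rw [show m - q = k - 1 by omega] at h1
  rw [show m - k = q - 1 by omega] at h2
  have h3 : 0 < m.choose q := Nat.choose_pos (by omega)
  have h4 : 0 < m.choose k := Nat.choose_pos (by omega)
  refine lt_of_mul_lt_mul_right (a := (q + 1) * (k + 1)) ?_ (Nat.zero_le _)
  calc m.choose (q + 1) * m.choose (k + 1) * ((q + 1) * (k + 1))
      = m.choose q * m.choose k * ((k - 1) * (q - 1)) := by
        linear_combination (m.choose (k + 1) * (k + 1)) * h1 + m.choose q * (k - 1) * h2
    _ < m.choose q * m.choose k * ((q + 1) * (k + 1)) := by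
        refine Nat.mul_lt_mul_of_pos_left ?_ (Nat.mul_pos h3 h4)
        rw [mul_comm (q + 1)]
        exact Nat.mul_lt_mul_of_lt_of_le (by omega) (by omega) (by omega)
    _ = m.choose k * m.choose q * ((q + 1) * (k + 1)) := by ring

/-- The coefficients of `b` in the derivative of the centre. -/
def cenCoeff (d : ℕ) (a : ℕ → ℂ) (j : ℕ) : ℂ := j * a j * ((d - 1).choose (d - j - 1) : ℕ)

/-- The coefficients of `b̄` in the derivative of the centre. -/
def cenCoeff' (d : ℕ) (a : ℕ → ℂ) (j : ℕ) : ℂ := (d - j : ℕ) * a j * ((d - 1).choose (d - j + 1) : ℕ)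

/-- Both sides are k₀(d-k₀)a_{k₀}² times a product of two binomial coefficients; the products differ
by `choose_mul_choose_lt`. -/
theorem IsModel.cenCoeff_ne {a : ℕ → ℂ} (ha : IsModel d k₀ a) :
    cenCoeff d a k₀ * conj (cenCoeff d a (d - k₀)) ≠
      cenCoeff' d a k₀ * conj (cenCoeff' d a (d - k₀)) := by
  have h0 := ha.lt
  have h1 := ha.k₀_pos
  have h2 := ha.half_le
  have h3 : conj (a (d - k₀)) = a k₀ := ha.conj_coeff (Finset.mem_Icc.2 ⟨by omega, le_rfl⟩)
  have h4 : d - (d - k₀) = k₀ := by omega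
  have h5 := choose_mul_choose_lt (m := d - 1) (q := d - k₀) (k := k₀) (by omega) (by omega) h1
  simp only [cenCoeff, cenCoeff', map_mul, h3, h4, map_natCast]
  intro h6
  have h7 : (k₀ * (d - k₀ : ℕ) * a k₀ ^ 2 : ℂ) ≠ 0 := by
    refine mul_ne_zero (mul_ne_zero ?_ ?_) (pow_ne_zero _ ha.lead)
    · exact_mod_cast h1.ne'
    · exact_mod_cast (by omega : d - k₀ ≠ 0)
  have h8 : (((d - 1).choose (d - k₀ - 1) * (d - 1).choose (k₀ - 1) : ℕ) : ℂ) =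
      (((d - 1).choose (d - k₀ + 1) * (d - 1).choose (k₀ + 1) : ℕ) : ℂ) := by
    refine mul_left_cancel₀ h7 ?_
    push_cast
    linear_combination h6
  exact absurd (by exact_mod_cast h8) h5.ne'

/-- The real linear map b ↦ bX + b̄Y has determinant |X|² - |Y|²; the witness is Cramer's rule. -/
theorem exists_mul_add_mul_conj {X Y : ℂ} (h : ‖X‖ ≠ ‖Y‖) (w : ℂ) : ∃ b : ℂ, b * X + conj b * Y = w := by
  have h1 : X * conj X - Y * conj Y ≠ 0 := by
    rw [mul_conj, mul_conj, normSq_eq_norm_sq, normSq_eq_norm_sq, sub_ne_zero]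
    intro h2
    have h3 : ‖X‖ ^ 2 = ‖Y‖ ^ 2 := by exact_mod_cast h2
    exact h ((sq_eq_sq₀ (norm_nonneg _) (norm_nonneg _)).1 h3)
  refine ⟨(conj X * w - Y * conj w) / (X * conj X - Y * conj Y), ?_⟩
  have h2 : conj X * X - conj Y * Y = X * conj X - Y * conj Y := by ring
  simp only [map_div₀, map_sub, map_mul, conj_conj]
  rw [h2, div_mul_eq_mul_div, div_mul_eq_mul_div, ← add_div, div_eq_iff h1]
  ring

end Trigonometric

end KStat

end

set_option linter.unusedSectionVars false

noncomputable section

namespace KStat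

open Filter Topology ComplexConjugate CH

/-! ## The rotated discs and the derivative of the centre -/

section Rotated

variable {k : ℕ} {α : ℝ} [HolderExponent α] {d : ℕ}

theorem coeff_one_sub_X_pow (m n : ℕ) :
    ((1 - Polynomial.X : Polynomial ℂ) ^ m).coeff n = (-1) ^ n * (m.choose n : ℕ) := by
  have h : (1 - Polynomial.X : Polynomial ℂ) ^ m =
      ((1 + Polynomial.X) ^ m).comp (Polynomial.C (-1) * Polynomial.X) := by
    rw [Polynomial.pow_comp, Polynomial.add_comp, Polynomial.one_comp, Polynomial.X_comp,
      Polynomial.C_neg, Polynomial.C_1, neg_one_mul, sub_eq_add_neg]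
  rw [h, Polynomial.comp_C_mul_X_coeff, Polynomial.coeff_one_add_X_pow, mul_comm]

theorem continuous_const_A : Continuous fun φ : ℂ => (A.const φ : A k α) := by
  have h2 : (fun φ : ℂ => (A.const φ : A k α)) = fun φ => szego (const φ : CH ℂ k α) := by
    funext φ
    refine A_ext (k := k) (α := α) fun n => ?_
    rw [fc_szego]
    congr 1
    funext ζ
    exact bdVal_const (k := k) (α := α) φ ζ
  rw [h2]
  exact szego.continuous.comp (const (k := k) (α := α)).continuous

/-- The function `ζ^{-m} (1 - ζ)^n`. -/
def shiftPow (n m : ℕ) : CH ℂ k α := mul (zp (-(m : ℤ))) (poly ((1 - Polynomial.X) ^ n))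

theorem shiftPow_apply (n m : ℕ) (ζ : Circle) :
    (shiftPow n m : CH ℂ k α) ζ = ((ζ : ℂ)⁻¹) ^ m * (1 - (ζ : ℂ)) ^ n := by
  have h : (shiftPow n m : CH ℂ k α) ζ =
    (ζ : ℂ) ^ (-(m : ℤ)) * ((1 - Polynomial.X : Polynomial ℂ) ^ n).eval (ζ : ℂ) := rfl
  rw [h, zpow_neg, zpow_natCast, inv_pow]
  simp

theorem fc_const_mul_shiftPow (c : ℂ) (n m : ℕ) :
    fcL 0 (mul (const c) (shiftPow n m : CH ℂ k α)) = c * ((-1) ^ m * (n.choose m : ℕ)) := by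
  rw [fcL_apply]
  refine (fc_const_mul c (shiftPow n m : CH ℂ k α).1 0).trans ?_
  refine congrArg (c * ·) ((fc_zpow_mul (-(m : ℤ)) _ 0).trans ?_)
  rw [zero_sub, neg_neg, fc_poly, coeff_one_sub_X_pow]

namespace Unk

variable (k₀ : ℕ) (a : ℕ → ℂ)

/-- The unknowns of the disc with `h = (1 - ζ) φ`. -/
def rotPt (d k₀ : ℕ) (a : ℕ → ℂ) (φ : ℂ) : Unk k α :=
  (0, 0, A.const φ, (2 : ℝ) • szego (model₁ d k₀ a (0, 0, A.const φ, 0)))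

theorem model₁_congr {x x' : Unk k α} (h : x.2.2.1 = x'.2.2.1) :
    model₁ d k₀ a x = model₁ d k₀ a x' := by
  have hU : U x = U x' := by ext ζ; rw [U_apply, U_apply, h]
  have hS : S x = S x' := by ext ζ; rw [S_apply, S_apply, h]
  rw [model₁, hU, hS, model₁]

theorem continuous_rotPt : Continuous fun φ : ℂ => (rotPt d k₀ a φ : Unk k α) := by
  have h0 := continuous_const_A (k := k) (α := α)
  have h1 : Continuous fun φ : ℂ => ((0, 0, A.const φ, 0) : Unk k α) :=
    continuous_const.prodMk (continuous_const.prodMk (h0.prodMk continuous_const))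
  have h2 : Continuous fun φ : ℂ => szego (model₁ d k₀ a ((0, 0, A.const φ, 0) : Unk k α)) :=
    szego.continuous.comp ((contDiff_model₁ k₀ a).continuous.comp h1)
  exact continuous_const.prodMk (continuous_const.prodMk (h0.prodMk (h2.const_smul (2 : ℝ))))

theorem model₃_const (hd : k₀ < d) (φ : ℂ) {x : Unk k α} (hx : x.2.2.1 = A.const φ) :
    mul (zp k₀) (model₃ d k₀ a x) = poly (gradPoly d k₀ a φ) := by
  ext ζ
  have hzz : (ζ : ℂ) * (ζ : ℂ)⁻¹ = 1 := mul_inv_cancel₀ (Circle.coe_ne_zero ζ)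
  have hU : U x ζ = φ := by rw [U_apply, hx, bdVal_const]
  have hS : S x ζ = -((ζ : ℂ)⁻¹ * conj φ) := by rw [S_apply, hx, bdVal_const, zpow_neg_one]
  simp only [mul_apply, model₃, CH.sum_apply, pw_apply, const_apply, zp_apply, poly_apply, hU, hS,
    zpow_natCast]
  rw [eval_gradPoly, Finset.mul_sum]
  refine Finset.sum_congr rfl fun j hj => ?_
  rw [Finset.mem_Icc] at hj
  have h1 : (ζ : ℂ) ^ k₀ * (ζ : ℂ)⁻¹ ^ (d - j) = (ζ : ℂ) ^ (k₀ + j - d) := by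
    rw [show k₀ = (k₀ + j - d) + (d - j) by omega, pow_add, mul_assoc, ← mul_pow, hzz, one_pow,
      mul_one]
    congr 1
    omega
  rw [neg_pow, mul_pow]
  linear_combination a j * j * φ ^ (j - 1) * (-1) ^ (d - j) * conj φ ^ (d - j) * h1

theorem modelEqs_const (hd : k₀ < d) {n : ℕ} (J : A k α →L[ℝ] (Fin n → ℂ)) (φ : ℂ) (v : A k α) :
    Coef.modelEqs k₀ a d J (0, 0, A.const φ, v) =
      ((-1 / 2 : ℝ) • v + szego (model₁ d k₀ a (0, 0, A.const φ, 0)), 0, 0, J (A.const φ)) := by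
  have h1 : mul (zp k₀) (const 1) = (zp k₀ : CH ℂ k α) := by
    ext ζ
    simp only [mul_apply, const_apply, mul_one]
  rw [Coef.modelEqs, dens_base k₀ rfl rfl, h1, model₃_const k₀ a hd φ rfl, map_add, szego_X,
    negPart_eq_zero_iff.2 (isHol_poly _), negPart_eq_zero_iff.2 ((isHol_zp k₀).mul (isHol_const _))]
  exact congrArg (fun q => ((-1 / 2 : ℝ) • v + szego q, (0 : A k α), (0 : A k α), J (A.const φ)))
    (model₁_congr k₀ a rfl)

theorem modelEqs_rotPt (hd : k₀ < d) {n : ℕ} (J : A k α →L[ℝ] (Fin n → ℂ)) (φ : ℂ) :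
    Coef.modelEqs k₀ a d J (rotPt d k₀ a φ) = (0, 0, 0, J (A.const φ)) := by
  rw [rotPt, modelEqs_const k₀ a hd J, smul_smul]
  norm_num

/-- A disc with `h = (1 - ζ) φ` is determined by the equations. -/
theorem eq_rotPt (hd : k₀ < d) {n : ℕ} (J : A k α →L[ℝ] (Fin n → ℂ)) (φ : ℂ) (v : A k α) {y}
    (h : Coef.modelEqs k₀ a d J (0, 0, A.const φ, v) = (0, y)) :
    ((0, 0, A.const φ, v) : Unk k α) = rotPt d k₀ a φ := by
  rw [modelEqs_const k₀ a hd J] at h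
  have h1 := congrArg Prod.fst h
  dsimp only at h1
  have h2 : v = (2 : ℝ) • szego (model₁ d k₀ a (0, 0, A.const φ, 0)) := by
    rw [add_eq_zero_iff_neg_eq] at h1
    rw [← h1, smul_neg, smul_smul]
    norm_num
  rw [rotPt, ← h2]

/-- The tangent vectors at `h = (1 - ζ) φ` along which only the parameters move. -/
def tanVec (d k₀ : ℕ) (a : ℕ → ℂ) (φ l b : ℂ) : Unk k α :=
  let u : A k α := ofBd (poly (Polynomial.C (φ * l) - Polynomial.C (φ * b) * Polynomial.X)) (isHol_poly _)
  (b, 0, u, (2 : ℝ) • szego (dmodel₁ d k₀ a (rotPt d k₀ a φ) (0, 0, u, 0)))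

theorem bdVal_tanVec (φ l b : ℂ) (ζ : Circle) :
    bdVal (tanVec d k₀ a φ l b : Unk k α).2.2.1 ζ = φ * (l - b * ζ) := by
  have h : bd (tanVec d k₀ a φ l b : Unk k α).2.2.1 =
      poly (Polynomial.C (φ * l) - Polynomial.C (φ * b) * Polynomial.X) := bd_ofBd _ (isHol_poly _)
  rw [← bd_apply, h, poly_apply]
  simp only [Polynomial.eval_sub, Polynomial.eval_mul, Polynomial.eval_C, Polynomial.eval_X]
  ring

/-- For u = φ(l - bζ) the function u + φbζ is the constant φl, so the Toeplitz term is a polynomial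
times a constant and has no negative part. The last component of the vector is chosen to solve the
first linearized equation. -/
theorem fderiv_modelEqs_tanVec (hk₀ : 0 < k₀) (hd : k₀ < d) {n : ℕ}
    (J : A k α →L[ℝ] (Fin n → ℂ)) (φ l b : ℂ) :
    fderiv ℝ (Coef.modelEqs k₀ a d J) (rotPt d k₀ a φ) (tanVec d k₀ a φ l b) =
      (0, 0, 0, J (tanVec d k₀ a φ l b).2.2.1) := by
  have h := fderiv_modelEqs_const k₀ a hk₀ hd J φ
    (rotPt d k₀ a φ : Unk k α).2.2.2 (tanVec d k₀ a φ l b)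
  refine h.trans ?_
  have h1 : bd (tanVec d k₀ a φ l b : Unk k α).2.2.1 +
      mul (const (φ * (tanVec d k₀ a φ l b : Unk k α).1)) (zp 1) = const (φ * l) := by
    ext ζ
    have hb : (tanVec d k₀ a φ l b : Unk k α).1 = b := rfl
    simp only [add_apply', mul_apply, const_apply, zp_apply, bd_apply, bdVal_tanVec, zpow_one, hb]
    ring
  have h2 : Lp k₀ (tanVec d k₀ a φ l b : Unk k α) = 0 := by
    rw [Lp_congr k₀ (x'' := 0) (by rfl), map_zero]
  have h3 : cj (const (φ * l)) = (const (conj (φ * l)) : CH ℂ k α) := by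
    ext ζ
    simp only [cj_apply, const_apply]
  rw [h1, h2, h3, map_zero, map_zero, add_zero,
    negPart_eq_zero_iff.2 ((isHol_poly _).mul (isHol_const _))]
  refine Prod.ext ?_ (Prod.ext ?_ rfl)
  · have h4 : dmodel₁ d k₀ a (rotPt d k₀ a φ : Unk k α) (tanVec d k₀ a φ l b) =
      dmodel₁ d k₀ a (rotPt d k₀ a φ) (0, 0, (tanVec d k₀ a φ l b : Unk k α).2.2.1, 0) :=
      dmodel₁_congr k₀ a _ rfl
    have h5 : (tanVec d k₀ a φ l b : Unk k α).2.2.2 = (2 : ℝ) • szego (dmodel₁ d k₀ a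
      (rotPt d k₀ a φ) (0, 0, (tanVec d k₀ a φ l b : Unk k α).2.2.1, 0)) := rfl
    have h6 : ∀ w : A k α, (-1 / 2 : ℝ) • (2 : ℝ) • w + w = 0 := fun w => by
      rw [smul_smul]; norm_num
    show (-1 / 2 : ℝ) • (tanVec d k₀ a φ l b : Unk k α).2.2.2 + szego (dmodel₁ d k₀ a
      (rotPt d k₀ a φ) (tanVec d k₀ a φ l b)) = 0
    rw [h4, h5, h6]
  · exact smul_zero _

/-- The values of `h` and `g` at the centre. -/
def cen : Unk k α →L[ℝ] ℂ × ℂ := ((fcL 0).comp U).prod ((fcL 0).comp T)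

theorem cen_eq (x : Unk k α) : cen x = centre (toY k₀ x) := by
  have h : ∀ u : A k α, disc u 0 = fcL 0 (bd u) := fun u => by
    rw [disc, sub_zero, one_mul, ext_zero, fcL_apply]
  rw [centre, h, h]
  rfl

/-- The constant l leaves the power ζ^(-(d-j)) in place; -bζ in u raises it by one, and its
conjugate lowers it by one. Each piece is a shifted power of 1 - ζ, whose mean is a signed binomial
coefficient; this is the origin of `cenCoeff` and `cenCoeff'`. -/
theorem dmodel₁_tanVec (hd : k₀ < d) (φ l b : ℂ) :
    dmodel₁ d k₀ a (rotPt d k₀ a φ : Unk k α) (tanVec d k₀ a φ l b) =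
    ∑ j ∈ Finset.Icc (d - k₀) k₀,
      (mul (const (a j * φ ^ j * conj φ ^ (d - j) * (-1) ^ (d - j) * (j * l + (d - j : ℕ) * conj l)))
          (shiftPow (d - 1) (d - j)) +
        (mul (const (-(a j * φ ^ j * conj φ ^ (d - j) * (-1) ^ (d - j) * j * b)))
          (shiftPow (d - 1) (d - j - 1)) +
        mul (const (-(a j * φ ^ j * conj φ ^ (d - j) * (-1) ^ (d - j) * (d - j : ℕ) * conj b)))
          (shiftPow (d - 1) (d - j + 1)))) := by
  ext ζ
  have hzz : (ζ : ℂ) * (ζ : ℂ)⁻¹ = 1 := mul_inv_cancel₀ (Circle.coe_ne_zero ζ)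
  have hcz : conj (ζ : ℂ) = (ζ : ℂ)⁻¹ := Circle.conj_eq_inv ζ
  have hx : (rotPt d k₀ a φ : Unk k α).2.2.1 = A.const φ := rfl
  have hU : U (rotPt d k₀ a φ : Unk k α) ζ = φ := by rw [U_apply, hx, bdVal_const]
  have hS : S (rotPt d k₀ a φ : Unk k α) ζ = -((ζ : ℂ)⁻¹ * conj φ) := by
    rw [S_apply, hx, bdVal_const, zpow_neg_one]
  have hU' : U (tanVec d k₀ a φ l b : Unk k α) ζ = φ * (l - b * ζ) := by rw [U_apply, bdVal_tanVec]
  have hS' : S (tanVec d k₀ a φ l b : Unk k α) ζ =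
      -((ζ : ℂ)⁻¹ * (conj φ * (conj l - conj b * (ζ : ℂ)⁻¹))) := by
    rw [S_apply, bdVal_tanVec, zpow_neg_one, map_mul, map_sub, map_mul, hcz]
  simp only [dmodel₁, CH.sum_apply, add_apply', mul_apply, pw_apply, const_apply, hU, hS, hU', hS',
    shiftPow_apply, W_apply, zpow_one]
  refine Finset.sum_congr rfl fun j hj => ?_
  rw [Finset.mem_Icc] at hj
  obtain ⟨n, hn⟩ : ∃ n, d - j = n + 1 := ⟨d - j - 1, by omega⟩
  obtain ⟨i, rfl⟩ : ∃ i, j = i + 1 := ⟨j - 1, by omega⟩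
  rw [hn]
  simp only [Nat.add_sub_cancel]
  generalize (ζ : ℂ)⁻¹ = w at hzz ⊢
  generalize conj φ = p
  rw [neg_pow, mul_pow, neg_pow (w * p) n, mul_pow w p n]
  push_cast
  linear_combination (-(a (i + 1) * φ ^ (i + 1) * p ^ (n + 1) * (-1) ^ (n + 1) * (i + 1) * b) * w ^ n *
    (1 - (ζ : ℂ)) ^ (d - 1)) * hzz

theorem cen_tanVec (hd : k₀ < d) (φ l b : ℂ) :
    cen (tanVec d k₀ a φ l b : Unk k α) = (φ * l,
      2 * (∑ j ∈ Finset.Icc (d - k₀) k₀, a j * φ ^ j * conj φ ^ (d - j) *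
          (j * l + (d - j : ℕ) * conj l) * ((d - 1).choose (d - j) : ℕ) +
        (b * trig d k₀ (cenCoeff d a) φ + conj b * trig d k₀ (cenCoeff' d a) φ))) := by
  refine Prod.ext ?_ ?_
  · show fcL 0 (bd (ofBd (poly (Polynomial.C (φ * l) - Polynomial.C (φ * b) * Polynomial.X))
      (isHol_poly _))) = _
    rw [bd_ofBd, fcL_apply]
    refine (fc_poly _ 0).trans ?_
    simp
  · have h4 : dmodel₁ d k₀ a (rotPt d k₀ a φ : Unk k α) (tanVec d k₀ a φ l b) =
      dmodel₁ d k₀ a (rotPt d k₀ a φ) (0, 0, (tanVec d k₀ a φ l b : Unk k α).2.2.1, 0) :=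
      dmodel₁_congr k₀ a _ rfl
    have h5 : (tanVec d k₀ a φ l b : Unk k α).2.2.2 = (2 : ℝ) • szego (dmodel₁ d k₀ a
      (rotPt d k₀ a φ) (0, 0, (tanVec d k₀ a φ l b : Unk k α).2.2.1, 0)) := rfl
    show fcL 0 (bd (tanVec d k₀ a φ l b : Unk k α).2.2.2) = _
    have h6 : ∀ q : CH ℂ k α, fcL 0 (bd (szego q)) = fcL 0 q := fun q => by
      rw [fcL_apply, fcL_apply]; exact fc_szego q 0
    rw [h5, ← h4, map_smul, map_smul, h6, dmodel₁_tanVec k₀ a hd, map_sum, real_smul, ofReal_ofNat]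
    simp only [map_add, fc_const_mul_shiftPow, trig, Finset.mul_sum, ← Finset.sum_add_distrib]
    refine Finset.sum_congr rfl fun j hj => ?_
    rw [Finset.mem_Icc] at hj
    obtain ⟨n, hn⟩ : ∃ n, d - j = n + 1 := ⟨d - j - 1, by omega⟩
    have he : (-1 : ℂ) ^ n * (-1) ^ n = 1 := by rw [← mul_pow]; norm_num
    rw [cenCoeff, cenCoeff', hn, Nat.add_sub_cancel, pow_succ (-1 : ℂ) (n + 1), pow_succ (-1 : ℂ) n]
    linear_combination (2 * (a j * φ ^ j * conj φ ^ (n + 1)) * ((j * l + (n + 1 : ℕ) * conj l) *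
      ((d - 1).choose (n + 1) : ℕ) + j * b * ((d - 1).choose n : ℕ) + (n + 1 : ℕ) * conj b *
        ((d - 1).choose (n + 1 + 1) : ℕ))) * he

/-- The tangent vectors move the centre in all directions. -/
theorem exists_cen_tanVec (hd : k₀ < d) {φ : ℂ} (hφ : φ ≠ 0)
    (h : ‖trig d k₀ (cenCoeff d a) φ‖ ≠ ‖trig d k₀ (cenCoeff' d a) φ‖) (w : ℂ × ℂ) :
    ∃ l b, cen (tanVec d k₀ a φ l b : Unk k α) = w := by
  obtain ⟨b, hb⟩ := exists_mul_add_mul_conj h (w.2 / 2 -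
    ∑ j ∈ Finset.Icc (d - k₀) k₀, a j * φ ^ j * conj φ ^ (d - j) *
      (j * (w.1 / φ) + (d - j : ℕ) * conj (w.1 / φ)) * ((d - 1).choose (d - j) : ℕ))
  refine ⟨w.1 / φ, b, ?_⟩
  rw [cen_tanVec k₀ a hd, hb]
  refine Prod.ext (mul_div_cancel₀ _ hφ) ?_
  ring

end Unk

end Rotated

end KStat

end

set_option linter.unusedSectionVars false

noncomputable section

namespace KStat

open Filter Topology ComplexConjugate CH

/-! ## Parametrization of the lifts -/

section Parametrization

variable {k : ℕ} {α : ℝ} [HolderExponent α] {d k₀ : ℕ} {a : ℕ → ℂ}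

theorem nonempty_paramEquiv (l : ℕ) :
    Nonempty ((Fin (2 * l + 4) → ℝ) ≃L[ℝ] (Fin (l + 2) → ℂ)) := by
  refine ⟨ContinuousLinearEquiv.ofFinrankEq ?_⟩
  rw [Module.finrank_fin_fun, Module.finrank_pi_fintype]
  simp only [Complex.finrank_real_complex, Finset.sum_const, Finset.card_univ, Fintype.card_fin,
    smul_eq_mul]
  ring

theorem exists_solver (ha : IsModel d k₀ a) (J : A k α →L[ℝ] (Fin (k₀ - d / 2 + 2) → ℂ))
    (hJ : ∀ (Q : Polynomial ℂ), (∀ z : ℂ, ‖z‖ ≤ 1 → Q.eval z ≠ 0) → ∀ (u : A k α) (s : Polynomial ℂ),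
      s.degree < (k₀ - d / 2 + 2 : ℕ) → mul (poly Q) (bd u) = poly s → J u = 0 → s = 0)
    (g₀ : A k α) : ∃ κ : ℝ, 0 < κ ∧ ∃ ε : ℝ, 0 < ε ∧ ∀ D : Coef d k, D.size < ε →
      ∃ e : OpenPartialHomeomorph (Unk k α) (A k α × A k α × A k α × (Fin (k₀ - d / 2 + 2) → ℂ)),
        e.source = ball (basePt g₀) κ ∧ (∀ x, e x = D.eqs k₀ a J x) ∧
          ContDiffOn ℝ 1 e.symm e.target := by
  simp only [Coef.eqs_eq]
  exact exists_local_inverse (Coef.contDiff_modelEqs k₀ a J)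
    (Unk.bijective_fderiv_modelEqs k₀ a ha J hJ g₀) (Coef.smallAt_pertEqs k₀ (basePt g₀) _)

variable {D : Coef d k} {δ δ' κ η₁ η : ℝ} {r : ℂ × ℂ → ℝ} {g₀ : A k α}
  {n m : ℕ} {J : A k α →L[ℝ] (Fin n → ℂ)} {L : (Fin m → ℝ) ≃L[ℝ] (Fin n → ℂ)}
  {e : OpenPartialHomeomorph (Unk k α) (A k α × A k α × A k α × (Fin n → ℂ))}

theorem apply_pu_of_eq (he : ∀ x, e x = D.eqs k₀ a J x) {x : Unk k α} {t : Fin m → ℝ}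
    (h : e x = paramMap L t) : J (Unk.pu x) = L t := by
  rw [he, paramMap_apply, Coef.eqs, Prod.mk.injEq, Prod.mk.injEq, Prod.mk.injEq] at h
  exact h.2.2.2

/-- The parametrization of the projections of the lifts. -/
def lift (e : OpenPartialHomeomorph (Unk k α) (A k α × A k α × A k α × (Fin n → ℂ)))
    (L : (Fin m → ℝ) ≃L[ℝ] (Fin n → ℂ)) (t : Fin m → ℝ) : A k α := Unk.pu (e.symm (paramMap L t))

theorem isParam_lift (he : ∀ x, e x = D.eqs k₀ a J x) (hs : e.source = ball (basePt g₀) κ)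
    (hC : ContDiffOn ℝ 1 e.symm e.target)
    (hM : M k₀ δ r (baseLift g₀) η =
      Unk.toY k₀ '' {x ∈ nearSet k₀ g₀ κ η | ∃ t, e x = paramMap L t}) :
    IsParam m (projH '' M k₀ δ r (baseLift g₀) η) (solDomain e (paramMap L) (nearSet k₀ g₀ κ η))
        (lift e L) ∧
      projH '' M k₀ δ r (baseLift g₀) η =
        lift e L '' solDomain e (paramMap L) (nearSet k₀ g₀ κ η) := by
  rw [projH_image_M hM]
  refine isParam_solSet hC (isOpen_nearSet k₀ g₀ κ η) ?_ (J := fun u => L.symm (J u))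
    (L.symm.contDiff.comp J.contDiff) fun x _ t ht => ?_
  · rw [hs]
    exact fun x hx => hx.1
  · rw [apply_pu_of_eq he ht, L.symm_apply_apply]

theorem apply_lift (he : ∀ x, e x = D.eqs k₀ a J x) {𝒰 : Set (Unk k α)} {t : Fin m → ℝ}
    (ht : t ∈ solDomain e (paramMap L) 𝒰) : J (lift e L t) = L t :=
  apply_pu_of_eq he (e.right_inv ht.1)

/-- The zero deformation has size zero, so the smallness estimate itself forces its contribution to
vanish. -/
theorem Coef.pertEqs_zero (x : Unk k α) : (Coef.zero d k).pertEqs k₀ n x = 0 := by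
  obtain ⟨-, C, -, h⟩ := Coef.smallAt_pertEqs (d := d) k₀ x n
  have h1 : ‖(Coef.zero d k).pertEqs k₀ n x‖ ≤ C * (Coef.zero d k).size :=
    (h.self_of_nhds (Coef.zero d k)).1
  have h2 : (Coef.zero d k).size = 0 := rfl
  rw [h2, mul_zero] at h1
  exact norm_le_zero_iff.1 h1

theorem Coef.eqs_zero : (Coef.zero d k).eqs k₀ a J = Coef.modelEqs k₀ a d J := by
  funext x
  rw [Coef.eqs_eq, Coef.pertEqs_zero, add_zero]

theorem basePt_eq_rotPt (hd : k₀ < d) (h : ∃ t, Coef.modelEqs k₀ a d J (basePt g₀) = paramMap L t) :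
    basePt g₀ = Unk.rotPt d k₀ a 1 := by
  obtain ⟨t, ht⟩ := h
  exact Unk.eq_rotPt k₀ a hd J 1 g₀ (ht.trans (paramMap_apply L t))

/-- There are discs close to the base disc with a nondegenerate map to the centre. -/
theorem exists_angle (ha : IsModel d k₀ a) (h : basePt g₀ = Unk.rotPt d k₀ a 1) {𝒰 : Set (Unk k α)}
    (h𝒰 : 𝒰 ∈ 𝓝 (basePt g₀)) {ε : ℝ} (hε : 0 < ε) :
    ∃ θ : ℝ, |θ| < ε ∧ Unk.rotPt d k₀ a (exp (θ * I)) ∈ 𝒰 ∧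
      ‖trig d k₀ (cenCoeff d a) (exp (θ * I))‖ ≠ ‖trig d k₀ (cenCoeff' d a) (exp (θ * I))‖ := by
  have hc : Continuous fun θ : ℝ => (Unk.rotPt d k₀ a (exp (θ * I)) : Unk k α) :=
    (Unk.continuous_rotPt k₀ a).comp (by fun_prop)
  have h0 : (Unk.rotPt d k₀ a (exp ((0 : ℝ) * I)) : Unk k α) = basePt g₀ := by
    rw [h, ofReal_zero, zero_mul, exp_zero]
  have h1 : (fun θ : ℝ => (Unk.rotPt d k₀ a (exp (θ * I)) : Unk k α)) ⁻¹' 𝒰 ∈ 𝓝 (0 : ℝ) :=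
    hc.continuousAt.preimage_mem_nhds (by rw [h0]; exact h𝒰)
  obtain ⟨ε', hε', hball⟩ := Metric.mem_nhds_iff.1 h1
  obtain ⟨θ, hθ, hne⟩ := exists_norm_trig_ne ha.half_le ha.lt.le ha.cenCoeff_ne (lt_min hε hε')
  refine ⟨θ, hθ.trans_le (min_le_left _ _), hball ?_, hne⟩
  rw [mem_ball, Real.dist_0_eq_abs]
  exact hθ.trans_le (min_le_right _ _)

/-- The centre as a function of the parameters. -/
def cenParam (e : OpenPartialHomeomorph (Unk k α) (A k α × A k α × A k α × (Fin n → ℂ)))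
    (L : (Fin m → ℝ) ≃L[ℝ] (Fin n → ℂ)) (t : Fin m → ℝ) : ℂ × ℂ :=
  Unk.cen (e.symm (paramMap L t))

theorem contDiffOn_cenParam (hC : ContDiffOn ℝ 1 e.symm e.target) {𝒰 : Set (Unk k α)} :
    ContDiffOn ℝ 1 (cenParam e L) (solDomain e (paramMap L) 𝒰) :=
  Unk.cen.contDiff.comp_contDiffOn
    (hC.comp (paramMap (k := k) (α := α) L).contDiff.contDiffOn fun _ ht => ht.1)

/-- The derivative of `e` sends the vectors `tanVec` into the parameter directions, so the
derivative of the inverse recovers them from parameters. Their centres fill ℂ² by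
`Unk.exists_cen_tanVec`. -/
theorem surjective_fderiv_cenParam (ha : IsModel d k₀ a)
    (he : ∀ x, e x = Coef.modelEqs k₀ a d J x) (hC : ContDiffOn ℝ 1 e.symm e.target) {φ : ℂ}
    (hφ : φ ≠ 0) (hne : ‖trig d k₀ (cenCoeff d a) φ‖ ≠ ‖trig d k₀ (cenCoeff' d a) φ‖)
    (hx : Unk.rotPt d k₀ a φ ∈ e.source) {t : Fin m → ℝ}
    (ht : e (Unk.rotPt d k₀ a φ) = paramMap L t) :
    Function.Surjective (fderiv ℝ (cenParam e L) t) := by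
  intro w
  obtain ⟨l, b, hw⟩ := Unk.exists_cen_tanVec (k := k) (α := α) k₀ a ha.lt hφ hne w
  have hfun : (e : Unk k α → _) = Coef.modelEqs k₀ a d J := funext he
  have hd : DifferentiableAt ℝ e (Unk.rotPt d k₀ a φ) := by
    rw [hfun]
    exact (Coef.contDiff_modelEqs k₀ a J).differentiable one_ne_zero _
  have h1 := fderiv_symm_apply hC hx hd (Unk.tanVec d k₀ a φ l b)
  have h2 : fderiv ℝ e (Unk.rotPt d k₀ a φ) (Unk.tanVec d k₀ a φ l b) =
      paramMap L (L.symm (J (Unk.tanVec d k₀ a φ l b : Unk k α).2.2.1)) := by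
    rw [hfun, Unk.fderiv_modelEqs_tanVec k₀ a ha.k₀_pos ha.lt J, paramMap_apply, L.apply_symm_apply]
  rw [h2, ht] at h1
  refine ⟨L.symm (J (Unk.tanVec d k₀ a φ l b : Unk k α).2.2.1), ?_⟩
  have h3 : HasFDerivAt e.symm (fderiv ℝ e.symm (paramMap L t)) (paramMap L t) := by
    rw [← ht]
    exact ((hC.contDiffAt (e.open_target.mem_nhds (e.map_source hx))).differentiableAt
      one_ne_zero).hasFDerivAt
  have h4 : HasFDerivAt (cenParam e L) _ t :=
    Unk.cen.hasFDerivAt.comp t (h3.comp t (paramMap (k := k) (α := α) L).hasFDerivAt)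
  rw [h4.fderiv]
  refine Eq.trans ?_ hw
  exact congrArg Unk.cen h1

end Parametrization

end KStat

end

set_option linter.unusedSectionVars false

noncomputable section

namespace KStat

open Filter Topology ComplexConjugate CH

/-! ## The evaluation map and the jet map -/

section Main

variable {k : ℕ} {α : ℝ} [HolderExponent α] {d k₀ : ℕ} {a : ℕ → ℂ}

/-- The discs attached to the model: manifold structure and evaluation at the centre. -/
theorem exists_centre_model (ha : IsModel d k₀ a) {δ δ' : ℝ} {g₀ : A k α} (hδ : δ' ≤ δ)
    (hg₀ : ∀ ζ : Circle, ‖discBd (A.const 1 : A k α) ζ‖ < δ' ∧ ‖discBd g₀ ζ‖ < δ')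
    (hf₀ : baseLift g₀ ∈ stationaryLifts k α k₀ δ (rho d k₀ a)) :
    ∃ η₁ : ℝ, 0 < η₁ ∧ ∀ η : ℝ, 0 < η → η ≤ η₁ →
        IsC1Submanifold (2 * (k₀ - d / 2) + 4)
          (projH '' M k₀ δ (rho d k₀ a) (baseLift g₀) η) ∧
        (∃ φ : A k α → ℂ × ℂ,
          (∀ p ∈ M k₀ δ (rho d k₀ a) (baseLift g₀) η, φ (projH p) = centre p) ∧
          ∀ ε : ℝ, 0 < ε → ∃ θ : ℝ, |θ| < ε ∧
            A.const (exp (θ * I)) ∈ projH '' M k₀ δ (rho d k₀ a) (baseLift g₀) η ∧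
            SurjectiveDerivAt (2 * (k₀ - d / 2) + 4)
              (projH '' M k₀ δ (rho d k₀ a) (baseLift g₀) η) φ (A.const (exp (θ * I)))) ∧
        (∃ O : Set (ℂ × ℂ), IsOpen O ∧ O.Nonempty ∧
          O ⊆ centre '' M k₀ δ (rho d k₀ a) (baseLift g₀) η) := by
  obtain ⟨L⟩ := nonempty_paramEquiv (k₀ - d / 2)
  set J : A k α →L[ℝ] (Fin (k₀ - d / 2 + 2) → ℂ) := taylor (k₀ - d / 2 + 2)
  obtain ⟨κ, hκ, ε₁, hε₁, hsol⟩ := exists_solver ha J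
    (fun Q _ u s hs hu hJ => eq_zero_of_taylor hs hu hJ) g₀
  obtain ⟨e, hs, he, hC⟩ := hsol (Coef.zero d k) hε₁
  obtain ⟨η₁, hη₁, hrad⟩ := exists_radius_lifts k₀ hκ hg₀
  have hr := isDeformed_rho (k := k) ha δ'
  refine ⟨η₁, hη₁, fun η hη0 hη => ?_⟩
  have hM := M_eq_image (L := L) ha.k₀_pos ha.lt hr hδ hrad hη he
  obtain ⟨hpar, himg⟩ := isParam_lift he hs hC hM
  have hem : ∀ x, e x = Coef.modelEqs k₀ a d J x := fun x => by rw [he, Coef.eqs_zero]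
  have hbase : basePt g₀ = Unk.rotPt d k₀ a 1 := by
    -- The hypothesis that (1, f₀) is a lift enters here: the first equation determines g₀ from h =
    -- 1 - ζ, so the base point is the rotated point with φ = 1.
    refine basePt_eq_rotPt (J := J) (L := L) ha.lt ?_
    rw [← Coef.eqs_zero]
    refine exists_eqs_eq_iff.2 ((Unk.toY_mem_stationaryLifts_iff ha.lt hr hδ ?_).1 ?_)
    · rw [toY_basePt]
      exact (hrad _ (by rw [sub_self]; simpa [normY, cnorm] using hη₁)).1
    · rw [toY_basePt]
      exact hf₀
  have hpt : ∀ φ : ℂ, Unk.rotPt d k₀ a φ ∈ nearSet k₀ g₀ κ η → ∃ t ∈ solDomain e (paramMap L)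
      (nearSet k₀ g₀ κ η), e (Unk.rotPt d k₀ a φ) = paramMap L t ∧ lift e L t = A.const φ := by
    intro φ hφ
    have hsrc : Unk.rotPt d k₀ a φ ∈ e.source := by rw [hs]; exact hφ.1
    have h1 : e (Unk.rotPt d k₀ a φ) = paramMap L (L.symm (J (A.const φ))) := by
      rw [hem, Unk.modelEqs_rotPt k₀ a ha.lt J, paramMap_apply, L.apply_symm_apply]
    have h2 : e.symm (paramMap L (L.symm (J (A.const φ)))) = Unk.rotPt d k₀ a φ := by
      rw [← h1, e.left_inv hsrc]
    refine ⟨L.symm (J (A.const φ)), ⟨?_, ?_⟩, h1, ?_⟩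
    · rw [← h1]
      exact e.map_source hsrc
    · rw [Set.mem_preimage, h2]
      exact hφ
    · rw [lift, h2]
      rfl
  have hnhds : nearSet k₀ g₀ κ η ∈ 𝓝 (basePt g₀) :=
    (isOpen_nearSet k₀ g₀ κ η).mem_nhds (basePt_mem_nearSet k₀ g₀ hκ hη0)
  -- The evaluation map is defined on all of `A k α` by reading the parameter J(u) and taking the
  -- centre of the solution with that parameter. On lifts it returns their centre, which gives the
  -- well-definedness as a function of h.
  refine ⟨fun x hx => ⟨_, _, hpar, by rwa [← himg]⟩,
    ⟨fun u => cenParam e L (L.symm (J u)), fun p hp => ?_, fun ε hε => ?_⟩, ?_⟩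
  · rw [hM] at hp
    obtain ⟨x, ⟨hx, t, ht⟩, rfl⟩ := hp
    have h1 : L.symm (J (projH (Unk.toY k₀ x))) = t := by
      rw [L.symm_apply_eq]
      exact apply_pu_of_eq he ht
    have h2 : x ∈ e.source := by rw [hs]; exact hx.1
    dsimp only
    rw [h1, cenParam, ← ht, e.left_inv h2, Unk.cen_eq k₀]
  · obtain ⟨θ, hθ, hmem, hne⟩ := exists_angle ha hbase hnhds hε
    obtain ⟨t, ht, het, hlt⟩ := hpt _ hmem
    have hcong : Set.EqOn ((fun u => cenParam e L (L.symm (J u))) ∘ lift e L) (cenParam e L)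
        (solDomain e (paramMap L) (nearSet k₀ g₀ κ η)) := fun s hs' => by
      rw [Function.comp_apply, apply_lift he hs', L.symm_apply_apply]
    refine ⟨θ, hθ, ?_, _, _, hpar, (contDiffOn_cenParam hC).congr hcong, t, ht, hlt, ?_⟩
    · rw [himg]
      exact ⟨t, ht, hlt⟩
    · rw [(hcong.eventuallyEq_of_mem (hpar.isOpen.mem_nhds ht)).fderiv_eq]
      exact surjective_fderiv_cenParam ha hem hC (exp_ne_zero _) hne (by rw [hs]; exact hmem.1) het
  · obtain ⟨θ, -, hmem, hne⟩ := exists_angle ha hbase hnhds one_pos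
    obtain ⟨t, ht, het, -⟩ := hpt _ hmem
    have hsurj := surjective_fderiv_cenParam ha hem hC (exp_ne_zero _) hne
      (by rw [hs]; exact hmem.1) het
    have hΩ := hpar.isOpen.mem_nhds ht
    have hstrict : HasStrictFDerivAt (cenParam e L) (fderiv ℝ (cenParam e L) t) t :=
      ((contDiffOn_cenParam hC).contDiffAt hΩ).hasStrictFDerivAt one_ne_zero
    -- A C^1 map with surjective derivative is open at the point, so the set of centres contains a
    -- neighbourhood of one of them.
    have hmap := hstrict.map_nhds_eq_of_surj (LinearMap.range_eq_top.2 hsurj)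
    have h1 : cenParam e L '' solDomain e (paramMap L) (nearSet k₀ g₀ κ η) ∈ 𝓝 (cenParam e L t) := by
      rw [← hmap]
      exact Filter.image_mem_map hΩ
    refine ⟨_, isOpen_interior, ⟨_, mem_interior_iff_mem_nhds.2 h1⟩, interior_subset.trans ?_⟩
    rintro _ ⟨s, hs', rfl⟩
    refine ⟨Unk.toY k₀ (e.symm (paramMap L s)), ?_, (Unk.cen_eq k₀ _).symm⟩
    rw [hM]
    exact ⟨_, ⟨hs'.2, s, e.right_inv hs'.1⟩, rfl⟩

/-- The discs attached to the deformed hypersurfaces are determined by their jets. -/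
theorem exists_jet_deformation (ha : IsModel d k₀ a) (hk : k₀ - d / 2 + 2 ≤ k) {δ δ' : ℝ}
    {g₀ : A k α} (hδ0 : 0 < δ') (hδ : δ' < δ)
    (hg₀ : ∀ ζ : Circle, ‖discBd (A.const 1 : A k α) ζ‖ < δ' ∧ ‖discBd g₀ ζ‖ < δ') :
    ∃ η₁ : ℝ, 0 < η₁ ∧ ∃ ε : ℝ, 0 < ε ∧ ∀ D : Deformation d k δ, D.norm < ε →
      ∀ η : ℝ, 0 < η → η ≤ η₁ →
        DiffeoOntoImage (2 * (k₀ - d / 2) + 4)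
          (projH '' M k₀ δ (D.fn k₀ a) (baseLift g₀) η) (jetAtOne (k₀ - d / 2 + 2)) := by
  obtain ⟨L⟩ := nonempty_paramEquiv (k₀ - d / 2)
  obtain ⟨J, hJ⟩ := exists_jetAtOne_eq (k := k) (α := α) hk
  obtain ⟨κ, hκ, ε₁, hε₁, hsol⟩ := exists_solver ha J
    (fun Q hQ u s hs hu h0 => eq_zero_of_jetAtOne hQ hs hu ((hJ u).trans h0)) g₀
  obtain ⟨η₁, hη₁, hrad⟩ := exists_radius_lifts k₀ hκ hg₀
  obtain ⟨C, hC0, hcoef⟩ := exists_coef (k := k) ha hδ0 hδ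
  -- The extended coefficients have size C times the norm of the deformation, which has to stay
  -- below the threshold ε₁ of the inverse function theorem; neither C nor η₁ depends on the
  -- deformation.
  refine ⟨η₁, hη₁, ε₁ / (C + 1), by positivity, fun D hD η _ hη => ?_⟩
  obtain ⟨D', hsize, hr⟩ := hcoef D
  have hsmall : D'.size < ε₁ := by
    rw [lt_div_iff₀ (by positivity)] at hD
    rw [hsize]
    nlinarith [D.norm_nonneg]
  obtain ⟨e, hs, he, hC⟩ := hsol D' hsmall
  have hM := M_eq_image (L := L) ha.k₀_pos ha.lt hr hδ.le hrad hη he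
  obtain ⟨hpar, himg⟩ := isParam_lift he hs hC hM
  -- J is the jet map itself, so along the parametrization the jet is the linear isomorphism `L`.
  exact diffeoOntoImage_of_comp_eq hpar himg L fun t ht => (hJ _).trans (apply_lift he ht)

end Main

end KStat

end

theorem proposition4p4 (d k₀ : ℕ) (a : ℕ → ℂ) (ha : IsModel d k₀ a) (k : ℕ) (hk : 1 ≤ k)
    (α : ℝ) (hα0 : 0 < α) (hα1 : α < 1) (δ : ℝ) (g₀ : A k α)
    (hf₀ : baseLift g₀ ∈ stationaryLifts k α k₀ δ (rho d k₀ a)) :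
    ∃ η₀ : ℝ, 0 < η₀ ∧
      -- the evaluation map at the centre
      (∀ η : ℝ, 0 < η → η ≤ η₀ →
        IsC1Submanifold (2 * (k₀ - d / 2) + 4)
          (projH '' M k₀ δ (rho d k₀ a) (baseLift g₀) η) ∧
        (∃ φ : A k α → ℂ × ℂ,
          (∀ p ∈ M k₀ δ (rho d k₀ a) (baseLift g₀) η,
            φ (projH p) = centre p) ∧
          ∀ ε : ℝ, 0 < ε → ∃ θ : ℝ, |θ| < ε ∧
            A.const (exp (θ * I)) ∈
              projH '' M k₀ δ (rho d k₀ a) (baseLift g₀) η ∧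
            SurjectiveDerivAt (2 * (k₀ - d / 2) + 4)
              (projH '' M k₀ δ (rho d k₀ a) (baseLift g₀) η) φ
              (A.const (exp (θ * I)))) ∧
        (∃ O : Set (ℂ × ℂ), IsOpen O ∧ O.Nonempty ∧
          O ⊆ centre '' M k₀ δ (rho d k₀ a) (baseLift g₀) η)) ∧
      -- the jet map at the boundary point `1`
      (k₀ - d / 2 + 2 ≤ k →
        ∃ ε : ℝ, 0 < ε ∧ ∀ D : Deformation d k δ, D.norm < ε → ∀ η : ℝ, 0 < η → η ≤ η₀ →
          DiffeoOntoImage (2 * (k₀ - d / 2) + 4)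
            (projH '' M k₀ δ (D.fn k₀ a) (baseLift g₀) η)
            (jetAtOne (k₀ - d / 2 + 2))) := by
  have : HolderExponent α := ⟨hα0, hα1⟩
  obtain ⟨δ', hδ0, hδ, hg₀⟩ := exists_radius (u := A.const 1) (v := g₀) fun ζ =>
    ⟨(hf₀.2.1 ζ).1, (hf₀.2.1 ζ).2.1⟩
  obtain ⟨η₁, hη₁, h1⟩ := exists_centre_model ha hδ.le hg₀ hf₀
  by_cases hkl : k₀ - d / 2 + 2 ≤ k
  · obtain ⟨η₂, hη₂, ε, hε, h2⟩ := exists_jet_deformation ha hkl hδ0 hδ hg₀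
    exact ⟨min η₁ η₂, lt_min hη₁ hη₂, fun η h0 hη => h1 η h0 (hη.trans (min_le_left _ _)),
      fun _ => ⟨ε, hε, fun D hD η h0 hη => h2 D hD η h0 (hη.trans (min_le_right _ _))⟩⟩
  · exact ⟨η₁, hη₁, h1, fun h => absurd h hkl⟩
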